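/- **Setting.** Let $\Gamma\subset\mathbb R^2$ be a positively oriented $C^\infty$ Jordan curve of length $L$, parametrized by arc length by an $L$-periodic map $\gamma$, with normal $n(s)=(\gamma_2'(s),-\gamma_1'(s))$ and curvature $\kappa$ ($\gamma''=-\kappa n$), let $\mathcal E$ be the exterior (unbounded) region, and let $r_0>0$, $r_0\sup|\kappa|<1$, be such that $\theta(r,s)=\gamma(s)+r\,n(s)$ is injective on $(-r_0,r_0)\times\mathbb R/L\mathbb Z$, with image $U_\Gamma$. On $U_\Gamma$ put $N\circ\theta=n(s)$, $T\circ\theta=(1+r\kappa(s))\gamma'(s)$, $\mathfrak d_{\rm tan}=T\cdot\nabla$ and $\mathfrak d_\parallel^\alpha=\partial_t^{\alpha_0}\mathfrak d_{\rm tan}^{\alpha_1}$ for $\alpha=(\alpha_0,\alpha_1)\in\mathbb N^2$. For $T>0$ consider $$\partial_tu+A_1(t,x)\partial_1u+A_2(t,x)\partial_2u+B(t,x)u=f(t,x)\quad\text{in }(0,T)\times\mathcal E,$$ with $u,f$ valued in $\mathbb R^n$ and $A_j,B$ valued in the real $n\times n$ matrices. **Norms.** $|||v(t)|||_{k,p}=\sum_{j=0}^k\|\partial_t^jv(t)\|_{W^{k-j,p}(\mathcal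 E)}$, $|||\cdot|||_k=|||\cdot|||_{k,2}$, $\mathbb W^{k,p}_T=\bigcap_{j=0}^kC^j([0,T];W^{k-j,p}(\mathcal E))$ with norm $\sup_{[0,T]}|||v(t)|||_{k,p}$, and $\mathbb W^k_T=\mathbb W^{k,2}_T$ (no condition if $k=-1$). For $\lambda>0$, $$I_{\lambda,t}(\varphi)=\sup_{t'\in[0,t]}e^{-\lambda t'}|\varphi(t')|+\sqrt\lambda\Big(\int_0^te^{-2\lambda t'}|\varphi(t')|^2dt'\Big)^{1/2},\qquad S^*_{\lambda,t}(g)=\sup_{I_{\lambda,t}(\varphi)\le1}\Big|\int_0^te^{-2\lambda t'}g(t')\varphi(t')\,dt'\Big|.$$ **Assumptions.** Let $m\ge0$ be an integer, $p\in(2,\infty)$, $0<K_0\le K$, and $\alpha_0,\beta_0>0$, $\beta_1\in\mathbb R$. 1. There is a symmetric matrix $S(t,x)$ such that $SA_1$, $SA_2$ are symmetric, $\alpha_0|v|^2\le v\cdot Sv\le\beta_0|v|^2$ and $v\cdot(\partial_tS+\partial_1(SA_1)+\partial_2(SA_2)-2SB)v\le\beta_1|v|^2$ for all $v\in\mathbb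 R^n$, in $(0,T)\times\mathcal E$. ($A_j$ and $S$ are $C^1$ in $(0,T)\times\mathcal E$ and continuous up to the boundary; $B$ is continuous in $(0,T)\times\mathcal E$.) 2. $\|A_j\|_{L^\infty}\le K_0$, $\|B\|_{L^\infty}\le K$, and for $\partial\in\{\partial_t,\partial_1,\partial_2\}$ (weak derivatives) the norms of $\partial A_j$ in $\mathbb W^{m-1}_T$ and in $\mathbb W^{1,p}_T$, and of $\partial B$ in $\mathbb W^{m-1}_T$ and in $\mathbb W^1_T$, are at most $K$. 3. (Non-characteristic boundary.) $A_{\rm nor}=N_1A_1+N_2A_2$ is invertible with $|A_{\rm nor}^{-1}|\le K_0$ in $(0,T)\times(\mathcal E\cap U_\Gamma)$. 4. $\beta_0/\alpha_0\le K_0$ and $\beta_1/\alpha_0\le K$. **Weak dissipativity of order $m$.** The boundary term of $u$ is weakly dissipative of order $m$ if there is $\lambda_1>0$ and, for each $|\alpha|\le m$, there are functions $E_{{\rm bdry},\alpha}\ge0$ of $t\in[0,T]$, $S_{{\rm data},\alpha}\ge0$ non-decreasing in $t\in[0,T]$ (both may depend on $\lambda$), and a continuous $\nu_\alpha:[0,\infty)\to[0,\infty)$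 with $\nu_\alpha(0)=0$, such that for all $\lambda\ge\lambda_1$ and $t\in[0,T]$ $$\int_0^te^{-2\lambda t'}\Big(\int_\Gamma SA_{\rm nor}\,\mathfrak d_\parallel^\alpha u\cdot\mathfrak d_\parallel^\alpha u\Big)dt'\le-E_{{\rm bdry},\alpha}(t)+S_{{\rm data},\alpha}(t)+\tfrac{\alpha_0}8I_{\lambda,t}\big(\|\mathfrak d_\parallel^\alpha u\|_{L^2(\mathcal E\cap U_\Gamma)}\big)^2+\alpha_0\nu_\alpha(\lambda^{-1})I_{\lambda,t}(|||u|||_m)^2.$$ Put $E^m_{\rm bdry}=\sum_{|\alpha|\le m}E_{{\rm bdry},\alpha}$, $S^m_{\rm data}=\sum_{|\alpha|\le m}S_{{\rm data},\alpha}$, $\nu=\sum_{|\alpha|\le m}\nu_\alpha$. **Theorem.** For given $\Gamma$, $r_0$, $n$, $m$ there are a constant $C(K_0)$ depending only on $K_0$ and a threshold $\lambda_0$ depending only on $p$, $K$ and $\nu$ such that, under assumptions 1–4, every regular solution $u$ of the system (the restriction of a $C^{m+1}$ function, with $u\in\mathbb W^{m+1}_T$ and $f\in\mathbb W^m_T$)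 whose boundary term is weakly dissipative of order $m$ satisfies $$I_{\lambda,t}(|||u(\cdot)|||_m)^2+\tfrac1{\alpha_0}E^m_{\rm bdry}(t)\le C(K_0)\Big(|||u(0)|||_m^2+S^*_{\lambda,t}(|||f(\cdot)|||_m)^2+\tfrac1{\alpha_0}S^m_{\rm data}(t)\Big)$$ for all $\lambda\ge\max(\lambda_0,\lambda_1)$ and all $t\in[0,T]$. -/

import Mathlib

open MeasureTheory Set Filter Topology
open scoped ContDiff

noncomputable section

/-- The plane `ℝ²`, with its Euclidean norm. -/
abbrev Plane : Type := EuclideanSpace ℝ (Fin 2)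

/-- Space-time points `(t, x)`. -/
abbrev SpaceTime : Type := ℝ × Plane

/-- `ℝⁿ`, with its Euclidean norm. -/
abbrev Vec (n : ℕ) : Type := EuclideanSpace ℝ (Fin n)

/-- Real `n × n` matrices, seen as linear operators of `ℝⁿ`, with the operator norm. -/
abbrev Mat (n : ℕ) : Type := Vec n →L[ℝ] Vec n

/-! ### The curve, the exterior domain, normal-tangential coordinates -/

/-- The unit vector `n(s) = (γ₂'(s), -γ₁'(s))` normal to the curve. -/
def unitNormal (γ : ℝ → Plane) (s : ℝ) : Plane := !₂[deriv γ s 1, -(deriv γ s 0)]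

/-- The scalar curvature `κ`, for which `γ'' = κ (γ')^⊥` with `v^⊥ = (-v₂, v₁)`. -/
def curvature (γ : ℝ → Plane) (s : ℝ) : ℝ :=
  deriv γ s 0 * deriv (deriv γ) s 1 - deriv γ s 1 * deriv (deriv γ) s 0

/-- The map `θ(r, s) = γ(s) + r n(s)`. -/
def thetaMap (γ : ℝ → Plane) (q : ℝ × ℝ) : Plane := γ q.2 + q.1 • unitNormal γ q.2

/-- The outer region: the points off the curve whose connected component in the complement of
the curve is unbounded. -/
def outerRegion (γ : ℝ → Plane) : Set Plane :=
  {x | x ∉ range γ ∧ ¬ Bornology.IsBounded (connectedComponentIn (range γ)ᶜ x)}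

/-- The enclosed region: the points off the curve whose connected component in the complement of
the curve is bounded. -/
def innerRegion (γ : ℝ → Plane) : Set Plane :=
  {x | x ∉ range γ ∧ Bornology.IsBounded (connectedComponentIn (range γ)ᶜ x)}

/-- A positively oriented smooth Jordan curve `Γ` of length `L`, parametrized by arc length, with
a width `r₀` such that `(r, s) ↦ γ(s) + r n(s)` is a diffeomorphism from `(-r₀, r₀) × ℝ/Lℤ` onto
its image. Positive orientation means that the enclosed region lies on the left of the curve and
the outer region on its right. -/
structure BoundaryCurve where
  /-- the arc length parametrization -/
  γ : ℝ → Plane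
  /-- the length -/
  L : ℝ
  /-- the half-width of the tubular neighborhood -/
  r₀ : ℝ
  L_pos : 0 < L
  smooth : ContDiff ℝ ∞ γ
  periodic : Function.Periodic γ L
  unit_speed : ∀ s, ‖deriv γ s‖ = 1
  simple : InjOn γ (Ico 0 L)
  right_outer : ∀ s, ∀ᶠ r in 𝓝[>] (0 : ℝ), thetaMap γ (r, s) ∈ outerRegion γ
  left_inner : ∀ s, ∀ᶠ r in 𝓝[>] (0 : ℝ), thetaMap γ (-r, s) ∈ innerRegion γ
  r₀_pos : 0 < r₀
  r₀_curvature : ∀ s, r₀ * |curvature γ s| < 1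
  tube_injective : InjOn (thetaMap γ) (Ioo (-r₀) r₀ ×ˢ Ico 0 L)

namespace BoundaryCurve

variable (Γ : BoundaryCurve)

/-- The exterior domain `ℰ`. -/
def ext : Set Plane := outerRegion Γ.γ

/-- The parameter set `(-r₀, r₀) × [0, L)`. -/
def params : Set (ℝ × ℝ) := Ioo (-Γ.r₀) Γ.r₀ ×ˢ Ico 0 Γ.L

/-- The tubular neighborhood `U_Γ`. -/
def tube : Set Plane := thetaMap Γ.γ '' Γ.params

/-- The normal-tangential coordinates `(r, s)` of a point of `U_Γ`. -/
def coords (x : Plane) : ℝ × ℝ := Function.invFunOn (thetaMap Γ.γ) Γ.params x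

/-- The vector field `N` on `U_Γ`: `N ∘ θ = n(s)`. -/
def normalField (x : Plane) : Plane := unitNormal Γ.γ (Γ.coords x).2

/-- The vector field `T` on `U_Γ`: `T ∘ θ = (1 + r κ(s)) γ'(s)`. -/
def tangentField (x : Plane) : Plane :=
  (1 + (Γ.coords x).1 * curvature Γ.γ (Γ.coords x).2) • deriv Γ.γ (Γ.coords x).2

/-- The space-time domain `(0, T) × ℰ`. -/
def cyl (T : ℝ) : Set SpaceTime := Ioo 0 T ×ˢ Γ.ext

end BoundaryCurve

/-! ### Derivatives -/

section Derivatives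

variable {V : Type*} [NormedAddCommGroup V] [NormedSpace ℝ V]

/-- The coordinate directions of space-time: `0` for `t`, `1` for `x₁`, `2` for `x₂`. -/
def stDir : Fin 3 → SpaceTime :=
  ![(1, 0), (0, EuclideanSpace.single 0 1), (0, EuclideanSpace.single 1 1)]

/-- The partial derivatives `∂_t`, `∂₁`, `∂₂` (for `i = 0, 1, 2`). -/
def pd (i : Fin 3) (u : SpaceTime → V) : SpaceTime → V := fun z => fderiv ℝ u z (stDir i)

/-- Multi-indices `β = (β₀, β₁, β₂)` for `∂_t^β₀ ∂₁^β₁ ∂₂^β₂`. -/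
abbrev MultiIdx : Type := ℕ × ℕ × ℕ

/-- The length `|β|`. -/
def MultiIdx.len (β : MultiIdx) : ℕ := β.1 + β.2.1 + β.2.2

/-- The multi-index of the single derivative in direction `i`. -/
def unitIdx : Fin 3 → MultiIdx := ![(1, 0, 0), (0, 1, 0), (0, 0, 1)]

/-- The classical derivative `∂^β u`. -/
def pdIter (β : MultiIdx) (u : SpaceTime → V) : SpaceTime → V :=
  (pd 0)^[β.1] ((pd 1)^[β.2.1] ((pd 2)^[β.2.2] u))

/-- The tangential derivative `𝔡_tan = T · ∇` (meaningful in `U_Γ`). -/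
def dTan (Γ : BoundaryCurve) (u : SpaceTime → V) : SpaceTime → V :=
  fun z => fderiv ℝ u z (0, Γ.tangentField z.2)

/-- `𝔡_∥^α = ∂_t^α₀ 𝔡_tan^α₁` (meaningful in `U_Γ`). -/
def dPar (Γ : BoundaryCurve) (α : ℕ × ℕ) (u : SpaceTime → V) : SpaceTime → V :=
  (pd 0)^[α.1] ((dTan Γ)^[α.2] u)

/-- `h` is the weak derivative `∂^β g` in the open set `Ω` of space-time. -/
def IsWeakDeriv (Ω : Set SpaceTime) (β : MultiIdx) (g h : SpaceTime → V) : Prop :=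
  LocallyIntegrableOn g Ω ∧ LocallyIntegrableOn h Ω ∧
  ∀ φ : SpaceTime → ℝ, ContDiff ℝ ∞ φ → HasCompactSupport φ → tsupport φ ⊆ Ω →
    ∫ z in Ω, pdIter β φ z • g z = (-1 : ℝ) ^ β.len • ∫ z in Ω, φ z • h z

/-! ### Norms -/

/-- The `L^p(D)` norm of a function of `x`. -/
def lpNormOn (D : Set Plane) (p : ℝ) (h : Plane → V) : ℝ :=
  (eLpNorm h (ENNReal.ofReal p) (volume.restrict D)).toReal

/-- `g ∈ C([0, T]; L^p(D))`. -/
def ContInLp (D : Set Plane) (T p : ℝ) (g : SpaceTime → V) : Prop :=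
  ∀ t ∈ Icc 0 T,
    MemLp (fun x => g (t, x)) (ENNReal.ofReal p) (volume.restrict D) ∧
    Tendsto (fun τ => eLpNorm (fun x => g (τ, x) - g (t, x)) (ENNReal.ofReal p)
      (volume.restrict D)) (𝓝[Icc 0 T] t) (𝓝 0)

/-- The pairs `(a, b)` of natural numbers with `a + b ≤ m`. -/
def pairsUpTo (m : ℕ) : Finset (ℕ × ℕ) :=
  (Finset.range (m + 1) ×ˢ Finset.range (m + 1)).filter (fun α => α.1 + α.2 ≤ m)

/-- The norm `|||u(t)|||_{m,p} = ∑_{j ≤ m} ‖∂_t^j u(t)‖_{W^{m-j,p}(D)}` of a function whose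
derivatives `∂^β u` are the functions `J β`. -/
def jetNorm (D : Set Plane) (m : ℕ) (p : ℝ) (J : MultiIdx → SpaceTime → V) (t : ℝ) : ℝ :=
  ∑ j ∈ Finset.range (m + 1),
    (∑ b ∈ pairsUpTo (m - j), lpNormOn D p (fun x => J (j, b) (t, x)) ^ p) ^ (1 / p)

/-- `g ∈ 𝕎^{k,p}_T = ⋂_j C^j([0, T]; W^{k-j,p}(ℰ))`, the functions `J β` being its derivatives:
all weak space-time derivatives of order at most `k` are in `C([0, T]; L^p(ℰ))`. -/
def IsWJet (Γ : BoundaryCurve) (T : ℝ) (k : ℕ) (p : ℝ) (g : SpaceTime → V)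
    (J : MultiIdx → SpaceTime → V) : Prop :=
  ∀ β : MultiIdx, β.len ≤ k → IsWeakDeriv (Γ.cyl T) β g (J β) ∧ ContInLp Γ.ext T p (J β)

/-- `g ∈ 𝕎^{k,p}_T` with `‖g‖_{𝕎^{k,p}_T} ≤ K`. -/
def WBound (Γ : BoundaryCurve) (T : ℝ) (k : ℕ) (p : ℝ) (g : SpaceTime → V) (K : ℝ) : Prop :=
  ∃ J : MultiIdx → SpaceTime → V, IsWJet Γ T k p g J ∧
    ∀ t ∈ Icc 0 T, jetNorm Γ.ext k p J t ≤ K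

/-- The norm `|||u(t)|||_m` of a function that is classically differentiable. -/
def normW (Γ : BoundaryCurve) (m : ℕ) (u : SpaceTime → V) (t : ℝ) : ℝ :=
  jetNorm Γ.ext m 2 (fun β => pdIter β u) t

/-- Functions regular enough for `m` differentiations of the system: `u` is `C^{m+1}` up to the
boundary (it is the restriction to `[0, T] × closure ℰ` of a function of class `C^{m+1}`), and it
belongs to `𝕎^{m+1}_T`. -/
def IsRegularUpTo (Γ : BoundaryCurve) (T : ℝ) (m : ℕ) (u : SpaceTime → V) : Prop :=
  ContDiff ℝ ((m + 1 : ℕ) : ℕ∞) u ∧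
  ∀ β : MultiIdx, β.len ≤ m + 1 → ContInLp Γ.ext T 2 (pdIter β u)

end Derivatives

/-- `I_{λ,t}(φ) = sup_{[0,t]} e^{-λ t'} |φ(t')| + √λ ‖φ‖_{L²_λ(0,t)}`. -/
def weightedI (lam t : ℝ) (φ : ℝ → ℝ) : ℝ :=
  sSup ((fun τ => Real.exp (-lam * τ) * |φ τ|) '' Icc 0 t) +
    √lam * √(∫ τ in (0)..t, Real.exp (-2 * lam * τ) * φ τ ^ 2)

/-- The dual norm `S*_{λ,t}`; the test functions are the (bounded, measurable) `φ` with
`I_{λ,t}(φ) ≤ 1`. -/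
def dualS (lam t : ℝ) (g : ℝ → ℝ) : ℝ :=
  sSup {y | ∃ φ : ℝ → ℝ, Measurable φ ∧
    BddAbove ((fun τ => Real.exp (-lam * τ) * |φ τ|) '' Icc 0 t) ∧ weightedI lam t φ ≤ 1 ∧
    y = |∫ τ in (0)..t, Real.exp (-2 * lam * τ) * g τ * φ τ|}

/-! ### The system and the assumptions -/

/-- The coefficients `A₁ = A 0`, `A₂ = A 1`, `B` of the system and the symmetrizer `S`. -/
structure Coeffs (n : ℕ) where
  A : Fin 2 → SpaceTime → Mat n
  B : SpaceTime → Mat n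
  S : SpaceTime → Mat n

namespace Coeffs

variable {n : ℕ} (c : Coeffs n)

/-- `u` solves `∂_t u + A₁ ∂₁ u + A₂ ∂₂ u + B u = f` in `(0, T) × ℰ`. -/
def Solves (Γ : BoundaryCurve) (T : ℝ) (u f : SpaceTime → Vec n) : Prop :=
  ∀ z ∈ Γ.cyl T,
    pd 0 u z + c.A 0 z (pd 1 u z) + c.A 1 z (pd 2 u z) + c.B z (u z) = f z

/-- The boundary matrix `A_nor = N_j A_j`. -/
def Anor (Γ : BoundaryCurve) (z : SpaceTime) : Mat n :=
  Γ.normalField z.2 0 • c.A 0 z + Γ.normalField z.2 1 • c.A 1 z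

/-- The matrices `A_j` and `S` are of class `C¹` in `(0, T) × ℰ` and continuous up to the
boundary (so that they have values on `Γ`), `B` is continuous in `(0, T) × ℰ`. -/
structure IsSmooth (Γ : BoundaryCurve) (T : ℝ) : Prop where
  A_diff : ∀ j, ContDiffOn ℝ 1 (c.A j) (Γ.cyl T)
  A_cont : ∀ j, ContinuousOn (c.A j) (Icc 0 T ×ˢ closure Γ.ext)
  S_diff : ContDiffOn ℝ 1 c.S (Γ.cyl T)
  S_cont : ContinuousOn c.S (Icc 0 T ×ˢ closure Γ.ext)
  B_cont : ContinuousOn c.B (Γ.cyl T)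

/-- `S` is a Friedrichs symmetrizer with constants `α₀, β₀, β₁`. -/
structure IsFriedrichs (Γ : BoundaryCurve) (T α₀ β₀ β₁ : ℝ) : Prop where
  α₀_pos : 0 < α₀
  β₀_pos : 0 < β₀
  S_symm : ∀ z ∈ Γ.cyl T, IsSelfAdjoint (c.S z)
  SA_symm : ∀ j, ∀ z ∈ Γ.cyl T, IsSelfAdjoint (c.S z ∘L c.A j z)
  lower : ∀ z ∈ Γ.cyl T, ∀ v : Vec n, α₀ * ‖v‖ ^ 2 ≤ inner ℝ v (c.S z v)
  upper : ∀ z ∈ Γ.cyl T, ∀ v : Vec n, inner ℝ v (c.S z v) ≤ β₀ * ‖v‖ ^ 2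
  energy : ∀ z ∈ Γ.cyl T, ∀ v : Vec n,
    inner ℝ v ((pd 0 c.S z + pd 1 (fun y => c.S y ∘L c.A 0 y) z
      + pd 2 (fun y => c.S y ∘L c.A 1 y) z - (2 : ℝ) • (c.S z ∘L c.B z)) v) ≤ β₁ * ‖v‖ ^ 2

/-- The bounds on the coefficients:
`‖A_j‖_{L^∞} ≤ K₀`, `‖∂A_j‖_{𝕎^{m-1} ∩ 𝕎^{1,p}} ≤ K`, `‖B‖_{L^∞} ≤ K`,
`‖∂B‖_{𝕎^{m-1} ∩ 𝕎^1} ≤ K`, where `∂` stands for `∂_t, ∂₁, ∂₂` and the conditions in `𝕎^{m-1}`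
are void for `m = 0`. -/
structure IsBounded (Γ : BoundaryCurve) (T : ℝ) (m : ℕ) (p K₀ K : ℝ) : Prop where
  A_bound : ∀ j, ∀ z ∈ Γ.cyl T, ‖c.A j z‖ ≤ K₀
  A_deriv : ∀ j i, ∃ G : SpaceTime → Mat n, IsWeakDeriv (Γ.cyl T) (unitIdx i) (c.A j) G ∧
    (1 ≤ m → WBound Γ T (m - 1) 2 G K) ∧ WBound Γ T 1 p G K
  B_bound : ∀ z ∈ Γ.cyl T, ‖c.B z‖ ≤ K
  B_deriv : ∀ i, ∃ G : SpaceTime → Mat n, IsWeakDeriv (Γ.cyl T) (unitIdx i) c.B G ∧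
    (1 ≤ m → WBound Γ T (m - 1) 2 G K) ∧ WBound Γ T 1 2 G K

/-- The system is non-characteristic: `A_nor` is invertible in `(0, T) × (ℰ ∩ U_Γ)`, with
`|A_nor⁻¹| ≤ K₀`. -/
def IsNonChar (Γ : BoundaryCurve) (T K₀ : ℝ) : Prop :=
  ∀ z ∈ Ioo 0 T ×ˢ (Γ.ext ∩ Γ.tube),
    IsUnit (c.Anor Γ z) ∧ ‖Ring.inverse (c.Anor Γ z)‖ ≤ K₀

/-- The boundary integral `∫_Γ 𝔅[w(t)]`, where `𝔅[w] = S A_nor w · w`. -/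
def bdryTerm (Γ : BoundaryCurve) (w : SpaceTime → Vec n) (t : ℝ) : ℝ :=
  ∫ s in (0)..Γ.L,
    inner ℝ (c.S (t, Γ.γ s) (c.Anor Γ (t, Γ.γ s) (w (t, Γ.γ s)))) (w (t, Γ.γ s))

/-- The boundary term of `u` is weakly dissipative of order `m`, for `λ ≥ lamd`, with boundary
energies `Eb α`, data functions `Sd α` (functions of `λ` and `t`) and moduli `ν α`. The functions
`𝔡_∥^α u` live in the part of `ℰ` where the normal-tangential coordinates are defined; their
`L²` norm is taken there. -/
structure IsWeaklyDissipative (Γ : BoundaryCurve) (T : ℝ) (m : ℕ) (α₀ lamd : ℝ)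
    (Eb Sd : ℕ × ℕ → ℝ → ℝ → ℝ) (ν : ℕ × ℕ → ℝ → ℝ) (u : SpaceTime → Vec n) : Prop where
  lamd_pos : 0 < lamd
  ν_cont : ∀ α ∈ pairsUpTo m, ContinuousOn (ν α) (Ici 0)
  ν_nonneg : ∀ α ∈ pairsUpTo m, ∀ r, 0 ≤ r → 0 ≤ ν α r
  ν_zero : ∀ α ∈ pairsUpTo m, ν α 0 = 0
  Eb_nonneg : ∀ α ∈ pairsUpTo m, ∀ lam, lamd ≤ lam → ∀ t ∈ Icc 0 T, 0 ≤ Eb α lam t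
  Sd_nonneg : ∀ α ∈ pairsUpTo m, ∀ lam, lamd ≤ lam → ∀ t ∈ Icc 0 T, 0 ≤ Sd α lam t
  Sd_mono : ∀ α ∈ pairsUpTo m, ∀ lam, lamd ≤ lam → MonotoneOn (Sd α lam) (Icc 0 T)
  dissip : ∀ α ∈ pairsUpTo m, ∀ lam, lamd ≤ lam → ∀ t ∈ Icc 0 T,
    ∫ τ in (0)..t, Real.exp (-2 * lam * τ) * c.bdryTerm Γ (dPar Γ α u) τ ≤
      -Eb α lam t + Sd α lam t
        + α₀ / 8 * weightedI lam t
            (fun τ => lpNormOn (Γ.ext ∩ Γ.tube) 2 (fun x => dPar Γ α u (τ, x))) ^ 2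
        + α₀ * ν α lam⁻¹ * weightedI lam t (normW Γ m u) ^ 2

end Coeffs

end

open ENNReal (ofReal ofReal_mul rpow_mul ofReal_ofNat rpow_natCast ofReal_ne_top mul_ne_top ofReal_le_ofReal rpow_le_rpow ofReal_add ofReal_toReal pow_le_pow_left mul_rpow_of_nonneg toReal_mono)
open EuclideanSpace (single proj equiv)
open MultiIdx (len)
open Real (exp smoothTransition norm_of_nonneg norm_eq_abs exp_pos rpow_nonneg)
open Metric (ball isOpen_ball mem_ball cthickening closedBall)
open Finset (sum_nonneg mul_sum sum_le_sum sum_congr single_le_sum mem_filter sum_add_distrib sum_le_card_nsmul mem_product aemeasurable_fun_sum sum_mul)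
open intervalIntegral (integral_of_le integral_congr integral_mono_on)
open ContinuousLinearMap (comp_apply le_opNorm inr le_opENorm integral_apply star_eq_adjoint adjoint_inner_left)
open Function (Periodic iterate_succ_apply' iterate_succ_apply uncurry)
open Fin (sum_univ_two)
open Nat (le_succ)

variable {V : Type*} [NormedAddCommGroup V] [NormedSpace ℝ V] {n m k : ℕ} {Γ : BoundaryCurve}
  {c : Coeffs n} {T p t τ lam α₀ β₀ β₁ K₀ K ε h M : ℝ} {q : ℝ × ℝ} {x : Plane} {z : SpaceTime}
  {α β : MultiIdx} {g : Plane → ℝ} {u a v : SpaceTime → V} {f w : SpaceTime → Vec n}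
  {F : MultiIdx → SpaceTime → Vec n}

namespace BoundaryCurve

variable (Γ : BoundaryCurve)

lemma contDiff_deriv : ContDiff ℝ ∞ (deriv Γ.γ) := (contDiff_infty_iff_deriv.1 Γ.smooth).2

lemma contDiff_deriv_deriv : ContDiff ℝ ∞ (deriv (deriv Γ.γ)) :=
  (contDiff_infty_iff_deriv.1 Γ.contDiff_deriv).2

lemma contDiff_deriv_apply (i : Fin 2) : ContDiff ℝ ∞ (fun s => deriv Γ.γ s i) :=
  contDiff_euclidean.1 Γ.contDiff_deriv i

lemma contDiff_deriv_deriv_apply (i : Fin 2) : ContDiff ℝ ∞ (fun s => deriv (deriv Γ.γ) s i) :=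
  contDiff_euclidean.1 Γ.contDiff_deriv_deriv i

lemma contDiff_unitNormal : ContDiff ℝ ∞ (unitNormal Γ.γ) := by
  rw [contDiff_euclidean]
  intro i
  fin_cases i
  · simpa [unitNormal] using Γ.contDiff_deriv_apply 1
  · simpa [unitNormal] using (Γ.contDiff_deriv_apply 0).neg

lemma contDiff_curvature : ContDiff ℝ ∞ (curvature Γ.γ) :=
  ((Γ.contDiff_deriv_apply 0).mul (Γ.contDiff_deriv_deriv_apply 1)).sub
    ((Γ.contDiff_deriv_apply 1).mul (Γ.contDiff_deriv_deriv_apply 0))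

lemma contDiff_thetaMap : ContDiff ℝ ∞ (thetaMap Γ.γ) :=
  (Γ.smooth.comp contDiff_snd).add (contDiff_fst.smul (Γ.contDiff_unitNormal.comp contDiff_snd))

lemma periodic_deriv : Periodic (deriv Γ.γ) Γ.L := fun s => by
  rw [← deriv_comp_add_const]; congr 1; funext x; exact Γ.periodic x

lemma periodic_deriv_deriv : Periodic (deriv (deriv Γ.γ)) Γ.L := fun s => by
  rw [← deriv_comp_add_const]; congr 1; funext x; exact Γ.periodic_deriv x

lemma periodic_unitNormal : Periodic (unitNormal Γ.γ) Γ.L := fun s => by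
  simp only [unitNormal, Γ.periodic_deriv s]

lemma periodic_curvature : Periodic (curvature Γ.γ) Γ.L := fun s => by
  simp only [curvature, Γ.periodic_deriv s, Γ.periodic_deriv_deriv s]

lemma thetaMap_add_period (r s : ℝ) : thetaMap Γ.γ (r, s + Γ.L) = thetaMap Γ.γ (r, s) := by
  simp only [thetaMap, Γ.periodic s, Γ.periodic_unitNormal s]

lemma sq_add_sq_deriv (s : ℝ) : deriv Γ.γ s 0 ^ 2 + deriv Γ.γ s 1 ^ 2 = 1 := by
  have h := Γ.unit_speed s
  have h2 : ‖deriv Γ.γ s‖ ^ 2 = 1 := by rw [h]; norm_num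
  rw [EuclideanSpace.norm_sq_eq] at h2
  simpa [sum_univ_two] using h2

lemma hasDerivAt_deriv_apply (i : Fin 2) (s : ℝ) :
    HasDerivAt (fun s => deriv Γ.γ s i) (deriv (deriv Γ.γ) s i) s := by
  have h : HasDerivAt (deriv Γ.γ) (deriv (deriv Γ.γ) s) s :=
    (Γ.contDiff_deriv.differentiable (by simp) s).hasDerivAt
  exact (hasDerivAt_pi.1 ((equiv (Fin 2) ℝ).toContinuousLinearMap.hasFDerivAt.comp_hasDerivAt s h)) i

lemma deriv_mul_deriv_deriv (s : ℝ) :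
    deriv Γ.γ s 0 * deriv (deriv Γ.γ) s 0 + deriv Γ.γ s 1 * deriv (deriv Γ.γ) s 1 = 0 := by
  have h1 := ((Γ.hasDerivAt_deriv_apply 0 s).pow 2).add ((Γ.hasDerivAt_deriv_apply 1 s).pow 2)
  have h2 : HasDerivAt (fun s => deriv Γ.γ s 0 ^ 2 + deriv Γ.γ s 1 ^ 2) 0 s := by
    simp_rw [Γ.sq_add_sq_deriv]; exact hasDerivAt_const _ _
  have := h1.unique h2
  simp at this
  linarith

lemma hasDerivAt_unitNormal (s : ℝ) :
    HasDerivAt (unitNormal Γ.γ) (curvature Γ.γ s • deriv Γ.γ s) s := by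
  have e := Γ.deriv_mul_deriv_deriv s
  have e1 := Γ.sq_add_sq_deriv s
  have hd : HasDerivAt (unitNormal Γ.γ) (deriv (unitNormal Γ.γ) s) s :=
    (Γ.contDiff_unitNormal.differentiable (by simp) s).hasDerivAt
  have hc := fun i => (hasDerivAt_pi.1 ((equiv (Fin 2) ℝ).toContinuousLinearMap.hasFDerivAt.comp_hasDerivAt s hd)) i
  have h0 : deriv (unitNormal Γ.γ) s 0 = deriv (deriv Γ.γ) s 1 :=
    HasDerivAt.unique (hc 0) (Γ.hasDerivAt_deriv_apply 1 s)
  have h1 : deriv (unitNormal Γ.γ) s 1 = -deriv (deriv Γ.γ) s 0 :=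
    HasDerivAt.unique (hc 1) (Γ.hasDerivAt_deriv_apply 0 s).neg
  convert hd using 1
  ext i
  fin_cases i
  · simp only [Fin.zero_eta, PiLp.smul_apply, smul_eq_mul, h0, curvature]
    linear_combination (deriv (deriv Γ.γ) s 1) * e1 - deriv Γ.γ s 1 * e
  · simp only [Fin.mk_one, PiLp.smul_apply, smul_eq_mul, h1, curvature]
    linear_combination -(deriv (deriv Γ.γ) s 0) * e1 + deriv Γ.γ s 0 * e

/-- The derivative of `θ` at `(r, s)`: `(a, b) ↦ a n(s) + b (1 + r κ(s)) γ'(s)`. -/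
noncomputable def dTheta (q : ℝ × ℝ) : ℝ × ℝ →L[ℝ] Plane :=
  (ContinuousLinearMap.fst ℝ ℝ ℝ).smulRight (unitNormal Γ.γ q.2) +
    (ContinuousLinearMap.snd ℝ ℝ ℝ).smulRight ((1 + q.1 * curvature Γ.γ q.2) • deriv Γ.γ q.2)

lemma hasFDerivAt_thetaMap (q : ℝ × ℝ) : HasFDerivAt (thetaMap Γ.γ) (Γ.dTheta q) q := by
  have h1 : HasFDerivAt (fun q : ℝ × ℝ => Γ.γ q.2) _ q :=
    ((Γ.smooth.differentiable (by simp) q.2).hasDerivAt.hasFDerivAt).comp q hasFDerivAt_snd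
  have h2 : HasFDerivAt (fun q : ℝ × ℝ => unitNormal Γ.γ q.2) _ q :=
    ((Γ.hasDerivAt_unitNormal q.2).hasFDerivAt).comp q hasFDerivAt_snd
  have h3 := h1.add ((hasFDerivAt_fst (𝕜 := ℝ) (p := q)).smul h2)
  refine h3.congr_fderiv ?_
  ext <;> simp [dTheta, mul_assoc, add_mul]

lemma normal_inner (s : ℝ) (x : Plane) :
    inner ℝ (unitNormal Γ.γ s) x = deriv Γ.γ s 1 * x 0 - deriv Γ.γ s 0 * x 1 := by
  simp [PiLp.inner_apply, sum_univ_two, unitNormal]; ring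

lemma deriv_inner (s : ℝ) (x : Plane) :
    inner ℝ (deriv Γ.γ s) x = deriv Γ.γ s 0 * x 0 + deriv Γ.γ s 1 * x 1 := by
  simp [PiLp.inner_apply, sum_univ_two]; ring

lemma frame_expand (s : ℝ) (x : Plane) : (inner ℝ (unitNormal Γ.γ s) x : ℝ) • unitNormal Γ.γ s
      + (inner ℝ (deriv Γ.γ s) x : ℝ) • deriv Γ.γ s = x := by
  have e1 := Γ.sq_add_sq_deriv s
  rw [normal_inner, deriv_inner]
  ext i
  fin_cases i
  · simp [unitNormal]; linear_combination x 0 * e1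
  · simp [unitNormal]; linear_combination x 1 * e1

lemma norm_unitNormal (s : ℝ) : ‖unitNormal Γ.γ s‖ = 1 := by
  have e1 := Γ.sq_add_sq_deriv s
  rw [EuclideanSpace.norm_eq]
  simp [unitNormal, sum_univ_two]; linarith

lemma normal_inner_deriv (s : ℝ) : inner ℝ (unitNormal Γ.γ s) (deriv Γ.γ s) = (0 : ℝ) := by
  rw [normal_inner]; ring

/-- The region of parameters where `θ` is a local diffeomorphism. -/
def regular : Set (ℝ × ℝ) := {q | 0 < 1 + q.1 * curvature Γ.γ q.2}

lemma isOpen_regular : IsOpen Γ.regular := isOpen_lt continuous_const (continuous_const.add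
    (continuous_fst.mul (Γ.contDiff_curvature.continuous.comp continuous_snd)))

lemma mem_regular (h : |q.1| ≤ Γ.r₀) : q ∈ Γ.regular := by
  have h1 := Γ.r₀_curvature q.2
  have h2 : |q.1 * curvature Γ.γ q.2| < 1 := by
    rw [abs_mul]; exact (mul_le_mul_of_nonneg_right h (abs_nonneg _)).trans_lt h1
  have := (abs_lt.1 h2).1
  simp only [regular, Set.mem_ofPred_eq]; linarith

/-- The inverse of the derivative of `θ`. -/
noncomputable def dThetaInv (q : ℝ × ℝ) : Plane →L[ℝ] ℝ × ℝ := (innerSL ℝ (unitNormal Γ.γ q.2)).prod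
    ((1 + q.1 * curvature Γ.γ q.2)⁻¹ • innerSL ℝ (deriv Γ.γ q.2))

/-- The derivative of `θ` as a linear isomorphism. -/
noncomputable def dThetaEquiv (hq : q ∈ Γ.regular) : (ℝ × ℝ) ≃L[ℝ] Plane :=
  ContinuousLinearEquiv.equivOfInverse (Γ.dTheta q) (Γ.dThetaInv q)
    (by
      intro p
      have h : (1 + q.1 * curvature Γ.γ q.2) ≠ 0 := ne_of_gt hq
      have e : inner ℝ (deriv Γ.γ q.2) (unitNormal Γ.γ q.2) = (0 : ℝ) := by
        rw [real_inner_comm, normal_inner_deriv]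
      have e2 := Γ.unit_speed q.2
      simp [dTheta, dThetaInv, inner_add_right, inner_smul_right, e, e2, norm_unitNormal,
        normal_inner_deriv]
      ext
      · rfl
      · simp; field_simp)
    (by
      intro x
      have h : (1 + q.1 * curvature Γ.γ q.2) ≠ 0 := ne_of_gt hq
      have e := Γ.frame_expand q.2 x
      simp only [dTheta, dThetaInv, ContinuousLinearMap.prod_apply, add_apply,
        ContinuousLinearMap.smulRight_apply, ContinuousLinearMap.coe_fst',
        ContinuousLinearMap.coe_snd', smul_apply, innerSL_apply_apply,
        smul_eq_mul, smul_smul]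
      rw [mul_comm (_)⁻¹, mul_assoc, inv_mul_cancel₀ h, mul_one]
      exact e)

/-- The parameters of the tubular neighborhood, on the universal cover. -/
def band : Set (ℝ × ℝ) := Ioo (-Γ.r₀) Γ.r₀ ×ˢ univ

lemma isOpen_band : IsOpen Γ.band := isOpen_Ioo.prod isOpen_univ

lemma band_subset_regular : Γ.band ⊆ Γ.regular := fun _ hq =>
  Γ.mem_regular (abs_le.2 ⟨hq.1.1.le, hq.1.2.le⟩)

lemma thetaMap_toIcoMod (r s : ℝ) :
    thetaMap Γ.γ (r, toIcoMod Γ.L_pos 0 s) = thetaMap Γ.γ (r, s) := by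
  have h : Periodic (fun s => thetaMap Γ.γ (r, s)) Γ.L := Γ.thetaMap_add_period r
  simp only [toIcoMod]
  exact h.sub_zsmul_eq _

lemma toIcoMod_mem_params (hq : q ∈ Γ.band) : (q.1, toIcoMod Γ.L_pos 0 q.2) ∈ Γ.params :=
  ⟨hq.1, by simpa using toIcoMod_mem_Ico Γ.L_pos 0 q.2⟩

lemma tube_eq_image_band : Γ.tube = thetaMap Γ.γ '' Γ.band := by
  apply Subset.antisymm
  · rintro _ ⟨q, hq, rfl⟩; exact ⟨q, ⟨hq.1, mem_univ _⟩, rfl⟩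
  · rintro _ ⟨q, hq, rfl⟩
    exact ⟨_, Γ.toIcoMod_mem_params hq, Γ.thetaMap_toIcoMod q.1 q.2⟩

lemma coords_thetaMap (hq : q ∈ Γ.band) :
    Γ.coords (thetaMap Γ.γ q) = (q.1, toIcoMod Γ.L_pos 0 q.2) := by
  have hm := Γ.toIcoMod_mem_params hq
  have h := Γ.tube_injective.leftInvOn_invFunOn hm
  rw [← h, thetaMap_toIcoMod]; rfl

lemma coords_mem (hx : x ∈ Γ.tube) : Γ.coords x ∈ Γ.params := Function.invFunOn_mem hx

lemma coords_mem_band (hx : x ∈ Γ.tube) : Γ.coords x ∈ Γ.band := ⟨(Γ.coords_mem hx).1, mem_univ _⟩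

lemma thetaMap_coords (hx : x ∈ Γ.tube) : thetaMap Γ.γ (Γ.coords x) = x := Function.invFunOn_eq hx

lemma thetaMap_mem_tube (hq : q ∈ Γ.band) : thetaMap Γ.γ q ∈ Γ.tube := by
  rw [tube_eq_image_band]; exact mem_image_of_mem _ hq

lemma isOpen_image_thetaMap {O : Set (ℝ × ℝ)} (hO : IsOpen O) (hsub : O ⊆ Γ.regular) :
    IsOpen (thetaMap Γ.γ '' O) := by
  rw [isOpen_iff_mem_nhds]
  rintro _ ⟨q, hq, rfl⟩
  have h1 : HasStrictFDerivAt (thetaMap Γ.γ) ((Γ.dThetaEquiv (hsub hq) : ℝ × ℝ →L[ℝ] Plane)) q :=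
    (Γ.contDiff_thetaMap.contDiffAt).hasStrictFDerivAt' (Γ.hasFDerivAt_thetaMap q) (by simp)
  rw [← h1.map_nhds_eq_of_equiv]
  exact image_mem_map (hO.mem_nhds hq)

lemma isOpen_tube : IsOpen Γ.tube := by
  rw [tube_eq_image_band]; exact Γ.isOpen_image_thetaMap Γ.isOpen_band Γ.band_subset_regular

/-- A smooth local inverse of `θ`. -/
lemma exists_local_inverse (hq : q ∈ Γ.regular) :
    ∃ σ : Plane → ℝ × ℝ, ContDiffAt ℝ ∞ σ (thetaMap Γ.γ q) ∧ σ (thetaMap Γ.γ q) = q ∧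
      HasFDerivAt σ (Γ.dThetaInv q) (thetaMap Γ.γ q) ∧
      ∀ᶠ x in 𝓝 (thetaMap Γ.γ q), thetaMap Γ.γ (σ x) = x := by
  have hf : HasFDerivAt (thetaMap Γ.γ) ((Γ.dThetaEquiv hq : ℝ × ℝ →L[ℝ] Plane)) q :=
    Γ.hasFDerivAt_thetaMap q
  have hc : ContDiffAt ℝ ∞ (thetaMap Γ.γ) q := Γ.contDiff_thetaMap.contDiffAt
  have h1 : HasStrictFDerivAt (thetaMap Γ.γ) ((Γ.dThetaEquiv hq : ℝ × ℝ →L[ℝ] Plane)) q :=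
    hc.hasStrictFDerivAt' hf (by simp)
  refine ⟨hc.localInverse hf (by simp), hc.to_localInverse hf (by simp),
    hc.localInverse_apply_image hf (by simp), ?_, ?_⟩
  · exact h1.to_localInverse.hasFDerivAt
  · exact h1.eventually_right_inverse

end BoundaryCurve

/-- The Lebesgue measure of the exterior domain. -/
notation "vol[" Γ "]" => Measure.restrict volume (BoundaryCurve.ext Γ)

/-- The Lebesgue measure of the time interval. -/
notation "time[" T "]" => Measure.restrict volume (Ioo (0 : ℝ) T)

/-- The jet of iterated partial derivatives of `w`. -/
notation "jet[" w "]" => fun β => pdIter β w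

/-- The spatial `L²` norm of `w` as a function of time. -/
notation "extNorm[" Γ "," w "]" => fun τ => lpNormOn (BoundaryCurve.ext Γ) 2 fun x => w (τ, x)

/-- A family of functions indexed by the iterated partial derivatives. -/
abbrev Jet (V : Type*) := MultiIdx → SpaceTime → V

namespace BoundaryCurve

variable (Γ : BoundaryCurve)

lemma thetaMap_injective {q' : ℝ × ℝ} (hq : q ∈ Γ.band) (hq' : q' ∈ Γ.band)
    (h : thetaMap Γ.γ q = thetaMap Γ.γ q') : q.1 = q'.1 := by
  have h1 := Γ.coords_thetaMap hq
  rw [h, Γ.coords_thetaMap hq'] at h1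
  exact (congrArg Prod.fst h1).symm

lemma thetaMap_zero (s : ℝ) : thetaMap Γ.γ (0, s) = Γ.γ s := by simp [thetaMap]

lemma zero_mem_band (s : ℝ) : ((0 : ℝ), s) ∈ Γ.band :=
  ⟨⟨by simpa using Γ.r₀_pos, Γ.r₀_pos⟩, mem_univ _⟩

lemma curve_mem_tube (s : ℝ) : Γ.γ s ∈ Γ.tube := by
  rw [← Γ.thetaMap_zero]; exact Γ.thetaMap_mem_tube (Γ.zero_mem_band s)

/-- Functions on the tubular neighborhood that are smooth functions of the normal-tangential
coordinates, up to the boundary of the neighborhood. -/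
def IsTubeSmooth (g : Plane → ℝ) : Prop :=
  ∃ C : ℝ × ℝ → ℝ, ContDiffOn ℝ ∞ C Γ.regular ∧ (∀ r s, C (r, s + Γ.L) = C (r, s)) ∧
    ∀ q ∈ Γ.band, g (thetaMap Γ.γ q) = C q

variable {Γ}

lemma eventuallyEq_comp_local_inverse {C : ℝ × ℝ → ℝ} {σ : Plane → ℝ × ℝ}
    (hg : ∀ q ∈ Γ.band, g (thetaMap Γ.γ q) = C q) (hq : q ∈ Γ.band)
    (hσ : ContinuousAt σ (thetaMap Γ.γ q)) (hσq : σ (thetaMap Γ.γ q) = q)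
    (hinv : ∀ᶠ x in 𝓝 (thetaMap Γ.γ q), thetaMap Γ.γ (σ x) = x) :
    g =ᶠ[𝓝 (thetaMap Γ.γ q)] C ∘ σ := by
  have h1 : ∀ᶠ x in 𝓝 (thetaMap Γ.γ q), σ x ∈ Γ.band :=
    hσ.eventually_mem (by rw [hσq]; exact Γ.isOpen_band.mem_nhds hq)
  filter_upwards [h1, hinv] with x hx hx2
  rw [Function.comp, ← hg _ hx, hx2]

lemma hasFDerivAt_of_coords {C : ℝ × ℝ → ℝ} (hC : ContDiffOn ℝ ∞ C Γ.regular)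
    (hg : ∀ q ∈ Γ.band, g (thetaMap Γ.γ q) = C q) (hq : q ∈ Γ.band) :
    HasFDerivAt g ((fderiv ℝ C q).comp (Γ.dThetaInv q)) (thetaMap Γ.γ q) := by
  obtain ⟨σ, h1, h2, h3, h4⟩ := Γ.exists_local_inverse (Γ.band_subset_regular hq)
  have h5 := eventuallyEq_comp_local_inverse hg hq h1.continuousAt h2 h4
  have h6 : HasFDerivAt C (fderiv ℝ C (σ (thetaMap Γ.γ q))) (σ (thetaMap Γ.γ q)) := by
    rw [h2]
    exact ((hC.contDiffAt (Γ.isOpen_regular.mem_nhds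
      (Γ.band_subset_regular hq))).differentiableAt (by simp)).hasFDerivAt
  have h7 := (h6.comp _ h3).congr_of_eventuallyEq h5
  rwa [h2] at h7

namespace IsTubeSmooth

lemma contDiffOn (h : Γ.IsTubeSmooth g) : ContDiffOn ℝ ∞ g Γ.tube := by
  obtain ⟨C, hC, -, hg⟩ := h
  rw [tube_eq_image_band]
  rintro _ ⟨q, hq, rfl⟩
  obtain ⟨σ, h1, h2, -, h4⟩ := Γ.exists_local_inverse (Γ.band_subset_regular hq)
  have h5 := eventuallyEq_comp_local_inverse hg hq h1.continuousAt h2 h4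
  refine ContDiffAt.contDiffWithinAt (ContDiffAt.congr_of_eventuallyEq ?_ h5)
  refine ContDiffAt.comp _ ?_ h1
  rw [h2]
  exact hC.contDiffAt (Γ.isOpen_regular.mem_nhds (Γ.band_subset_regular hq))

lemma contDiffAt (h : Γ.IsTubeSmooth g) (hx : x ∈ Γ.tube) :
    ContDiffAt ℝ ∞ g x := h.contDiffOn.contDiffAt (Γ.isOpen_tube.mem_nhds hx)

lemma differentiableAt (h : Γ.IsTubeSmooth g) (hx : x ∈ Γ.tube) :
    DifferentiableAt ℝ g x := (h.contDiffAt hx).differentiableAt (by simp)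

lemma exists_bound (h : Γ.IsTubeSmooth g) : ∃ M, 0 ≤ M ∧ ∀ x ∈ Γ.tube, |g x| ≤ M := by
  obtain ⟨C, hC, -, hg⟩ := h
  have hK : IsCompact (Icc (-Γ.r₀) Γ.r₀ ×ˢ Icc 0 Γ.L) := isCompact_Icc.prod isCompact_Icc
  have hsub : Icc (-Γ.r₀) Γ.r₀ ×ˢ Icc 0 Γ.L ⊆ Γ.regular := fun q hq => Γ.mem_regular (abs_le.2 hq.1)
  obtain ⟨M, hM⟩ := hK.exists_bound_of_continuousOn (hC.continuousOn.mono hsub)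
  refine ⟨max M 0, le_max_right _ _, fun x hx => ?_⟩
  have h1 := Γ.coords_mem hx
  rw [← Γ.thetaMap_coords hx, hg _ (Γ.coords_mem_band hx)]
  exact (hM _ ⟨Ioo_subset_Icc_self h1.1, Ico_subset_Icc_self h1.2⟩).trans (le_max_left _ _)

lemma const (a : ℝ) : Γ.IsTubeSmooth fun _ => a :=
  ⟨fun _ => a, contDiffOn_const, fun _ _ => rfl, fun _ _ => rfl⟩

lemma add {f : Plane → ℝ} (hf : Γ.IsTubeSmooth f) (hg : Γ.IsTubeSmooth g) :
    Γ.IsTubeSmooth fun x => f x + g x := by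
  obtain ⟨C, hC, hp, hf⟩ := hf
  obtain ⟨C', hC', hp', hg⟩ := hg
  exact ⟨fun q => C q + C' q, hC.add hC', fun r s => by simp only [hp, hp'],
    fun q hq => by simp only [hf q hq, hg q hq]⟩

lemma mul {f : Plane → ℝ} (hf : Γ.IsTubeSmooth f) (hg : Γ.IsTubeSmooth g) :
    Γ.IsTubeSmooth fun x => f x * g x := by
  obtain ⟨C, hC, hp, hf⟩ := hf
  obtain ⟨C', hC', hp', hg⟩ := hg
  exact ⟨fun q => C q * C' q, hC.mul hC', fun r s => by simp only [hp, hp'],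
    fun q hq => by simp only [hf q hq, hg q hq]⟩

lemma fderiv_apply (hg : Γ.IsTubeSmooth g) (e : Plane) :
    Γ.IsTubeSmooth fun x => fderiv ℝ g x e := by
  obtain ⟨C, hC, hp, hg⟩ := hg
  refine ⟨fun q => fderiv ℝ C q (Γ.dThetaInv q e), ?_, ?_, ?_⟩
  · have h1 : ContDiffOn ℝ ∞ (fun q => fderiv ℝ C q) Γ.regular :=
      hC.fderiv_of_isOpen Γ.isOpen_regular (by simp)
    refine h1.clm_apply ?_
    simp only [dThetaInv, ContinuousLinearMap.prod_apply]
    refine ContDiffOn.prodMk ?_ ?_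
    · exact (((innerSL ℝ).contDiff.comp (Γ.contDiff_unitNormal.comp contDiff_snd)).clm_apply
        contDiff_const).contDiffOn
    · refine ContDiffOn.mul ?_ ?_
      · refine ContDiffOn.inv ?_ (fun q hq => ne_of_gt hq)
        exact (contDiff_const.add (contDiff_fst.mul
          (Γ.contDiff_curvature.comp contDiff_snd))).contDiffOn
      · exact (((innerSL ℝ).contDiff.comp (Γ.contDiff_deriv.comp contDiff_snd)).clm_apply
          contDiff_const).contDiffOn
  · intro r s
    have h1 : fderiv ℝ C (r, s + Γ.L) = fderiv ℝ C (r, s) := by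
      have h2 : (fun q : ℝ × ℝ => C (q + (0, Γ.L))) = C := by
        funext q; obtain ⟨a, b⟩ := q; simp [hp]
      have h3 := fderiv_comp_add_right (𝕜 := ℝ) (f := C) (x := (r, s)) ((0, Γ.L) : ℝ × ℝ)
      rw [h2] at h3
      rw [h3]; simp
    simp only [h1, dThetaInv, Γ.periodic_unitNormal s, Γ.periodic_curvature s, Γ.periodic_deriv s]
  · intro q hq
    simp only [(hasFDerivAt_of_coords hC hg hq).fderiv, comp_apply]

end IsTubeSmooth

/-- Periodicity removes the reduction of the tangential coordinate to `[0, L)`. -/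
lemma isTubeSmooth_of_periodic {C : ℝ × ℝ → ℝ} (hC : ContDiffOn ℝ ∞ C Γ.regular)
    (hp : ∀ r s, C (r, s + Γ.L) = C (r, s)) : Γ.IsTubeSmooth fun x => C (Γ.coords x) := by
  refine ⟨C, hC, hp, fun q hq => ?_⟩
  simp only [Γ.coords_thetaMap hq, toIcoMod]
  exact (show Periodic (fun s => C (q.1, s)) Γ.L from hp q.1).sub_zsmul_eq _

variable (Γ)

lemma isTubeSmooth_coords_fst : Γ.IsTubeSmooth fun x => (Γ.coords x).1 :=
  isTubeSmooth_of_periodic (C := fun q => q.1) contDiff_fst.contDiffOn fun _ _ => rfl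

lemma isTubeSmooth_normalField (i : Fin 2) : Γ.IsTubeSmooth fun x => Γ.normalField x i :=
  isTubeSmooth_of_periodic (C := fun q => unitNormal Γ.γ q.2 i)
    ((contDiff_euclidean.1 Γ.contDiff_unitNormal i).comp contDiff_snd).contDiffOn
    fun _ s => by simp only [Γ.periodic_unitNormal s]

lemma isTubeSmooth_tangentField (i : Fin 2) : Γ.IsTubeSmooth fun x => Γ.tangentField x i :=
  isTubeSmooth_of_periodic
    (C := fun q => ((1 + q.1 * curvature Γ.γ q.2) • deriv Γ.γ q.2) i)
    (by
      simp only [PiLp.smul_apply]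
      exact ((contDiff_const.add (contDiff_fst.mul (Γ.contDiff_curvature.comp contDiff_snd))).smul
        ((Γ.contDiff_deriv_apply i).comp contDiff_snd)).contDiffOn)
    fun _ s => by simp only [Γ.periodic_curvature s, Γ.periodic_deriv s]

/-- The vector field dual to `T`. -/
noncomputable def tangentDual (x : Plane) : Plane :=
  (1 + (Γ.coords x).1 * curvature Γ.γ (Γ.coords x).2)⁻¹ • deriv Γ.γ (Γ.coords x).2

lemma isTubeSmooth_tangentDual (i : Fin 2) : Γ.IsTubeSmooth fun x => Γ.tangentDual x i :=
  isTubeSmooth_of_periodic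
    (C := fun q => ((1 + q.1 * curvature Γ.γ q.2)⁻¹ • deriv Γ.γ q.2) i)
    (by
      simp only [PiLp.smul_apply]
      refine ContDiffOn.smul (ContDiffOn.inv ?_ (fun (q : ℝ × ℝ) (hq : q ∈ Γ.regular) =>
        ne_of_gt (show 0 < 1 + q.1 * curvature Γ.γ q.2 from hq))) ?_
      · exact (contDiff_const.add (contDiff_fst.mul
          (Γ.contDiff_curvature.comp contDiff_snd))).contDiffOn
      · exact ((Γ.contDiff_deriv_apply i).comp contDiff_snd).contDiffOn)
    fun _ s => by simp only [Γ.periodic_curvature s, Γ.periodic_deriv s]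

lemma frame_expand_tube (hx : x ∈ Γ.tube) (e : Plane) :
    (inner ℝ (Γ.normalField x) e : ℝ) • Γ.normalField x
      + (inner ℝ (Γ.tangentDual x) e : ℝ) • Γ.tangentField x = e := by
  have h : (1 + (Γ.coords x).1 * curvature Γ.γ (Γ.coords x).2) ≠ 0 :=
    ne_of_gt (Γ.band_subset_regular (Γ.coords_mem_band hx))
  have h2 := Γ.frame_expand (Γ.coords x).2 e
  simp only [tangentDual, tangentField, normalField, inner_smul_left, smul_smul]
  convert h2 using 3
  simp
  field_simp

lemma hasFDerivAt_coords_fst (hx : x ∈ Γ.tube) :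
    HasFDerivAt (fun x => (Γ.coords x).1) (innerSL ℝ (Γ.normalField x)) x := by
  have h := hasFDerivAt_of_coords (Γ := Γ) (g := fun x => (Γ.coords x).1) (C := fun q => q.1)
    contDiff_fst.contDiffOn (fun q hq => by simp only [Γ.coords_thetaMap hq])
    (Γ.coords_mem_band hx)
  rw [Γ.thetaMap_coords hx] at h
  refine h.congr_fderiv ?_
  rw [show (fun q : ℝ × ℝ => q.1) = Prod.fst from rfl, fderiv_fst]
  rfl

lemma norm_normalField (x : Plane) : ‖Γ.normalField x‖ = 1 := Γ.norm_unitNormal _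

lemma continuousOn_normalField : ContinuousOn Γ.normalField Γ.tube := by
  have h : ∀ i, ContinuousOn (fun x => Γ.normalField x i) Γ.tube := fun i =>
    (Γ.isTubeSmooth_normalField i).contDiffOn.continuousOn
  exact (equiv (Fin 2) ℝ).symm.continuous.comp_continuousOn (continuousOn_pi.2 h)

/-! ### The exterior domain -/

lemma isCompact_range : IsCompact (range Γ.γ) := by
  rw [← Γ.periodic.image_Icc Γ.L_pos 0]
  exact isCompact_Icc.image Γ.smooth.continuous

lemma isClosed_range : IsClosed (range Γ.γ) := Γ.isCompact_range.isClosed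

lemma mem_ext_iff_of_preconnected {P : Set Plane} (hP : IsPreconnected P) (hsub : P ⊆ (range Γ.γ)ᶜ)
    {y : Plane} (hx : x ∈ P) (hy : y ∈ P) (hxE : x ∈ Γ.ext) : y ∈ Γ.ext := by
  refine ⟨hsub hy, ?_⟩
  have h1 : y ∈ connectedComponentIn (range Γ.γ)ᶜ x := hP.subset_connectedComponentIn hx hsub hy
  rw [← connectedComponentIn_eq h1]
  exact hxE.2

lemma isOpen_ext : IsOpen Γ.ext := by
  rw [Metric.isOpen_iff]
  intro x hx
  obtain ⟨ε, hε, hb⟩ := Metric.isOpen_iff.1 Γ.isClosed_range.isOpen_compl x hx.1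
  exact ⟨ε, hε, fun y hy => Γ.mem_ext_iff_of_preconnected
    (convex_ball x ε).isPreconnected hb (Metric.mem_ball_self hε) hy hx⟩

lemma measurableSet_ext : MeasurableSet Γ.ext := Γ.isOpen_ext.measurableSet

lemma closure_ext_subset : closure Γ.ext ⊆ Γ.ext ∪ range Γ.γ := by
  intro x hx
  by_contra hcon
  simp only [mem_union, not_or] at hcon
  obtain ⟨ε, hε, hb⟩ := Metric.isOpen_iff.1 Γ.isClosed_range.isOpen_compl x hcon.2
  obtain ⟨y, hy, hyx⟩ := Metric.mem_closure_iff.1 hx ε hε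
  exact hcon.1 (Γ.mem_ext_iff_of_preconnected (convex_ball x ε).isPreconnected hb
    (by rwa [mem_ball, dist_comm]) (Metric.mem_ball_self hε) hy)

lemma thetaMap_notMem_range (hq : q ∈ Γ.band) (h : q.1 ≠ 0) : thetaMap Γ.γ q ∉ range Γ.γ := by
  rintro ⟨s, hs⟩
  rw [← Γ.thetaMap_zero] at hs
  exact h (Γ.thetaMap_injective (Γ.zero_mem_band s) hq hs).symm

lemma thetaMap_mem_ext (h0 : 0 < q.1) (h1 : q.1 < Γ.r₀) : thetaMap Γ.γ q ∈ Γ.ext := by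
  have hsub : Ioo 0 Γ.r₀ ×ˢ univ ⊆ Γ.band := fun q hq =>
    ⟨⟨by linarith [hq.1.1, Γ.r₀_pos], hq.1.2⟩, mem_univ _⟩
  have hP : IsPreconnected (thetaMap Γ.γ '' (Ioo 0 Γ.r₀ ×ˢ univ)) :=
    (isPreconnected_Ioo.prod isPreconnected_univ).image _ Γ.contDiff_thetaMap.continuous.continuousOn
  have hc : thetaMap Γ.γ '' (Ioo 0 Γ.r₀ ×ˢ univ) ⊆ (range Γ.γ)ᶜ := by
    rintro _ ⟨q, hq, rfl⟩; exact Γ.thetaMap_notMem_range (hsub hq) hq.1.1.ne'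
  obtain ⟨r, hr, hr2⟩ := ((Γ.right_outer 0).and (Ioo_mem_nhdsGT Γ.r₀_pos)).exists
  exact Γ.mem_ext_iff_of_preconnected hP hc ⟨(r, 0), ⟨hr2, mem_univ _⟩, rfl⟩
    ⟨q, ⟨⟨h0, h1⟩, mem_univ _⟩, rfl⟩ hr

lemma thetaMap_notMem_ext (h0 : q.1 < 0) (h1 : -Γ.r₀ < q.1) : thetaMap Γ.γ q ∉ Γ.ext := by
  intro hE
  have hsub : Ioo (-Γ.r₀) 0 ×ˢ univ ⊆ Γ.band := fun q hq =>
    ⟨⟨hq.1.1, by linarith [hq.1.2, Γ.r₀_pos]⟩, mem_univ _⟩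
  have hP : IsPreconnected (thetaMap Γ.γ '' (Ioo (-Γ.r₀) 0 ×ˢ univ)) :=
    (isPreconnected_Ioo.prod isPreconnected_univ).image _ Γ.contDiff_thetaMap.continuous.continuousOn
  have hc : thetaMap Γ.γ '' (Ioo (-Γ.r₀) 0 ×ˢ univ) ⊆ (range Γ.γ)ᶜ := by
    rintro _ ⟨q, hq, rfl⟩; exact Γ.thetaMap_notMem_range (hsub hq) hq.1.2.ne
  obtain ⟨r, hr, hr2⟩ := ((Γ.left_inner 0).and (Ioo_mem_nhdsGT Γ.r₀_pos)).exists
  have := Γ.mem_ext_iff_of_preconnected hP hc ⟨q, ⟨⟨h1, h0⟩, mem_univ _⟩, rfl⟩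
    ⟨(-r, 0), ⟨⟨by linarith [hr2.2], by linarith [hr2.1]⟩, mem_univ _⟩, rfl⟩ hE
  exact this.2 hr.2

lemma mem_ext_iff (hx : x ∈ Γ.tube) : x ∈ Γ.ext ↔ 0 < (Γ.coords x).1 := by
  have hb := Γ.coords_mem_band hx
  constructor
  · intro hE
    by_contra hcon
    rcases lt_or_eq_of_le (not_lt.1 hcon) with h | h
    · exact Γ.thetaMap_notMem_ext h hb.1.1 (by rwa [Γ.thetaMap_coords hx])
    · apply hE.1
      refine ⟨(Γ.coords x).2, ?_⟩
      rw [← Γ.thetaMap_zero, ← h]; exact Γ.thetaMap_coords hx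
  · intro h
    rw [← Γ.thetaMap_coords hx]; exact Γ.thetaMap_mem_ext h hb.1.2

lemma curve_mem_closure (s : ℝ) : Γ.γ s ∈ closure Γ.ext := by
  have h1 : Tendsto (fun r : ℝ => thetaMap Γ.γ (r, s)) (𝓝[>] 0) (𝓝 (Γ.γ s)) := by
    have : Continuous (fun r : ℝ => thetaMap Γ.γ (r, s)) :=
      Γ.contDiff_thetaMap.continuous.comp (by fun_prop)
    have h2 := this.tendsto 0
    rw [Γ.thetaMap_zero] at h2
    exact h2.mono_left nhdsWithin_le_nhds
  exact mem_closure_of_tendsto h1 (Γ.right_outer s)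

/-- The exterior domain satisfies a uniform interior cone condition. -/
lemma exists_cone : ∃ h : ℝ, 0 < h ∧ ∀ x ∈ Γ.ext, ∃ ν : Plane, ‖ν‖ = 1 ∧
    ∀ d : Plane, ‖d‖ ≤ h → ‖d‖ / 2 ≤ inner ℝ ν d → x + d ∈ Γ.ext := by
  have hr := Γ.r₀_pos
  set K : Set Plane := thetaMap Γ.γ '' (Icc 0 (Γ.r₀ / 2) ×ˢ Icc 0 Γ.L) with hKdef
  have hK : IsCompact K := (isCompact_Icc.prod isCompact_Icc).image Γ.contDiff_thetaMap.continuous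
  have hKt : K ⊆ Γ.tube := by
    rintro _ ⟨q, hq, rfl⟩
    exact Γ.thetaMap_mem_tube ⟨⟨by linarith [hq.1.1], by linarith [hq.1.2]⟩, mem_univ _⟩
  obtain ⟨δ, hδ, hδt⟩ := hK.exists_cthickening_subset_open Γ.isOpen_tube hKt
  have hKδ : IsCompact (cthickening δ K) := hK.cthickening
  have huc := hKδ.uniformContinuousOn_of_continuous (Γ.continuousOn_normalField.mono hδt)
  obtain ⟨η, hη, hN⟩ := Metric.uniformContinuousOn_iff.1 huc (1 / 2) (by norm_num)
  have hO : IsOpen (thetaMap Γ.γ '' (Ioo (-(Γ.r₀ / 2)) (Γ.r₀ / 2) ×ˢ univ)) :=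
    Γ.isOpen_image_thetaMap (isOpen_Ioo.prod isOpen_univ) fun q hq =>
      Γ.mem_regular (abs_le.2 ⟨by linarith [hq.1.1], by linarith [hq.1.2]⟩)
  obtain ⟨δ', hδ', hδO⟩ := Γ.isCompact_range.exists_thickening_subset_open hO (by
    rintro _ ⟨s, rfl⟩
    exact ⟨(0, s), ⟨⟨by simp; linarith, by simp; linarith⟩, mem_univ _⟩, Γ.thetaMap_zero s⟩)
  refine ⟨min (δ' / 2) (min (δ / 2) (η / 2)), by positivity, fun x hx => ?_⟩
  by_cases hxd : x ∈ Metric.thickening δ' (range Γ.γ)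
  · obtain ⟨q, hq, rfl⟩ := hδO hxd
    have hqb : q ∈ Γ.band := ⟨⟨by linarith [hq.1.1], by linarith [hq.1.2]⟩, mem_univ _⟩
    have hxt := Γ.thetaMap_mem_tube hqb
    have hq0 : 0 < q.1 := by
      have := (Γ.mem_ext_iff hxt).1 hx
      rwa [Γ.coords_thetaMap hqb] at this
    have hxK : thetaMap Γ.γ q ∈ K := ⟨(q.1, toIcoMod Γ.L_pos 0 q.2),
      ⟨⟨hq0.le, hq.1.2.le⟩, Ico_subset_Icc_self (Γ.toIcoMod_mem_params hqb).2⟩,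
      Γ.thetaMap_toIcoMod _ _⟩
    set x := thetaMap Γ.γ q
    refine ⟨Γ.normalField x, Γ.norm_normalField x, fun d hd hdN => ?_⟩
    have hd1 : ‖d‖ < δ := by
      have := hd.trans ((min_le_right _ _).trans (min_le_left _ _)); linarith
    have hd2 : ‖d‖ < η := by
      have := hd.trans ((min_le_right _ _).trans (min_le_right _ _)); linarith
    have hmem : ∀ σ ∈ Icc (0 : ℝ) 1, x + σ • d ∈ cthickening δ K := fun σ hσ => by
      refine Metric.mem_cthickening_of_dist_le _ x _ _ hxK ?_
      rw [dist_eq_norm, add_sub_cancel_left, norm_smul, norm_of_nonneg hσ.1]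
      nlinarith [norm_nonneg d, hσ.2]
    have hder : ∀ σ ∈ Icc (0 : ℝ) 1, HasDerivAt (fun σ : ℝ => (Γ.coords (x + σ • d)).1)
        (inner ℝ (Γ.normalField (x + σ • d)) d) σ := fun σ hσ => by
      have h1 := Γ.hasFDerivAt_coords_fst (hδt (hmem σ hσ))
      have h2 : HasDerivAt (fun σ : ℝ => x + σ • d) d σ := by
        simpa using ((hasDerivAt_id σ).smul_const d).const_add x
      exact h1.comp_hasDerivAt σ h2
    have hmono : MonotoneOn (fun σ : ℝ => (Γ.coords (x + σ • d)).1) (Icc 0 1) := by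
      refine monotoneOn_of_deriv_nonneg (convex_Icc 0 1)
        (fun σ hσ => (hder σ hσ).continuousAt.continuousWithinAt)
        (fun σ hσ => (hder σ (interior_subset hσ)).differentiableAt.differentiableWithinAt)
        (fun σ hσ => ?_)
      have hσ' := interior_subset hσ
      rw [(hder σ hσ').deriv]
      have h3 := hN _ (hmem σ hσ') _ (Metric.self_subset_cthickening K hxK) (by
        rw [dist_eq_norm, add_sub_cancel_left, norm_smul, norm_of_nonneg hσ'.1]
        nlinarith [norm_nonneg d, hσ'.2])
      rw [dist_eq_norm] at h3
      have h4 : |inner ℝ (Γ.normalField (x + σ • d) - Γ.normalField x) d| ≤ 1 / 2 * ‖d‖ :=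
        (abs_real_inner_le_norm _ _).trans (mul_le_mul_of_nonneg_right h3.le (norm_nonneg _))
      rw [inner_sub_left] at h4
      linarith [(abs_le.1 h4).1]
    have h5 := hmono (left_mem_Icc.2 zero_le_one) (right_mem_Icc.2 zero_le_one) zero_le_one
    have h6 := hmem 1 (right_mem_Icc.2 zero_le_one)
    simp only [zero_smul, add_zero, one_smul] at h5 h6
    exact (Γ.mem_ext_iff (hδt h6)).2 (((Γ.mem_ext_iff hxt).1 hx).trans_le h5)
  · have hball : ball x δ' ⊆ (range Γ.γ)ᶜ := fun y hy hyr => hxd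
      (Metric.mem_thickening_iff.2 ⟨y, hyr, by rwa [dist_comm]⟩)
    refine ⟨single 0 1, by simp, fun d hd _ => ?_⟩
    have hd1 : ‖d‖ < δ' := by have := hd.trans (min_le_left _ _); linarith
    exact Γ.mem_ext_iff_of_preconnected (convex_ball x δ').isPreconnected hball
      (Metric.mem_ball_self hδ') (by simpa [mem_ball, dist_eq_norm] using hd1) hx

end BoundaryCurve

namespace BoundaryCurve

variable (Γ : BoundaryCurve)

/-- Reading off the two coordinates of a point of the plane. -/
noncomputable def planeEquiv : Plane ≃ᵐ ℝ × ℝ :=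
  (MeasurableEquiv.toLp 2 (Fin 2 → ℝ)).symm.trans MeasurableEquiv.finTwoArrow

lemma measurePreserving_planeEquiv : MeasurePreserving planeEquiv :=
  (volume_preserving_finTwoArrow ℝ).comp (PiLp.volume_preserving_ofLp (Fin 2))

lemma measurableSet_params : MeasurableSet Γ.params := measurableSet_Ioo.prod measurableSet_Ico

/-- Integration in normal-tangential coordinates. -/
lemma integral_tube (f : Plane → ℝ) : ∫ x in Γ.tube, f x =
      ∫ q in Γ.params, (1 + q.1 * curvature Γ.γ q.2) * f (thetaMap Γ.γ q) := by
  set eL : Plane →L[ℝ] ℝ × ℝ := (proj 0).prod (proj 1)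
  set Θ : ℝ × ℝ → ℝ × ℝ := fun q => planeEquiv (thetaMap Γ.γ q)
  have hder : ∀ q ∈ Γ.params, HasFDerivWithinAt Θ (eL.comp (Γ.dTheta q)) Γ.params q := fun q _ =>
    (eL.hasFDerivAt.comp q (Γ.hasFDerivAt_thetaMap q)).hasFDerivWithinAt
  have hdet : ∀ q, (eL.comp (Γ.dTheta q)).det = 1 + q.1 * curvature Γ.γ q.2 := by
    intro q
    have h1 : eL.comp (Γ.dTheta q) = (Matrix.toLin (.finTwoProd ℝ) (.finTwoProd ℝ)
        !![deriv Γ.γ q.2 1, (1 + q.1 * curvature Γ.γ q.2) * deriv Γ.γ q.2 0;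
          -deriv Γ.γ q.2 0, (1 + q.1 * curvature Γ.γ q.2) *
            deriv Γ.γ q.2 1]).toContinuousLinearMap := by
      rw [Matrix.toLin_finTwoProd_toContinuousLinearMap]
      ext <;> simp [eL, dTheta, unitNormal]
    rw [h1, LinearMap.det_toContinuousLinearMap, LinearMap.det_toLin, Matrix.det_fin_two_of]
    linear_combination (1 + q.1 * curvature Γ.γ q.2) * Γ.sq_add_sq_deriv q.2
  have hinj : InjOn Θ Γ.params := fun q hq q' hq' h =>
    Γ.tube_injective hq hq' (planeEquiv.injective h)
  have h2 := integral_image_eq_integral_abs_det_fderiv_smul volume Γ.measurableSet_params hder hinj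
    (fun y => f (planeEquiv.symm y))
  have h3 := measurePreserving_planeEquiv.setIntegral_preimage_emb
    planeEquiv.measurableEmbedding (fun y => f (planeEquiv.symm y)) (Θ '' Γ.params)
  have h4 : planeEquiv ⁻¹' (Θ '' Γ.params) = Γ.tube := by
    rw [show Θ '' Γ.params = planeEquiv '' Γ.tube by rw [tube, image_image],
      preimage_image_eq _ planeEquiv.injective]
  rw [h4] at h3
  simp only [MeasurableEquiv.symm_apply_apply] at h3
  rw [h3, h2]
  refine setIntegral_congr_fun Γ.measurableSet_params fun q hq => ?_
  have hpos : 0 < 1 + q.1 * curvature Γ.γ q.2 := Γ.band_subset_regular ⟨hq.1, mem_univ _⟩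
  simp [hdet, Θ, abs_of_pos hpos]

/-! ### Cutting off a neighborhood of the boundary -/

open Classical in
/-- A smooth function that vanishes outside `ℰ` and near `Γ`, and is `1` in `ℰ` at distance more
than `2 ε` from `Γ`. -/
noncomputable def innerCut (ε : ℝ) (x : Plane) : ℝ :=
  if x ∈ Γ.ext then (if x ∈ Γ.tube then smoothTransition ((Γ.coords x).1 / ε - 1) else 1)
  else 0

variable {Γ}

lemma innerCut_of_mem_tube (hε : 0 < ε) (hx : x ∈ Γ.tube) :
    Γ.innerCut ε x = smoothTransition ((Γ.coords x).1 / ε - 1) := by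
  unfold innerCut
  split_ifs with h
  · rfl
  · rw [Γ.mem_ext_iff hx, not_lt] at h
    rw [smoothTransition.zero_of_nonpos]
    have := div_nonpos_of_nonpos_of_nonneg h hε.le
    linarith

lemma innerCut_of_notMem_ext (hx : x ∉ Γ.ext) : Γ.innerCut ε x = 0 := if_neg hx

lemma innerCut_nonneg (ε : ℝ) (x : Plane) : 0 ≤ Γ.innerCut ε x := by
  unfold innerCut; split_ifs <;> simp [smoothTransition.nonneg]

lemma innerCut_le_one (ε : ℝ) (x : Plane) : Γ.innerCut ε x ≤ 1 := by
  unfold innerCut; split_ifs <;> simp [smoothTransition.le_one]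

lemma eventually_innerCut_eq_one (hε : 0 < ε) (hε' : 4 * ε ≤ Γ.r₀) (hx : x ∈ Γ.ext)
    (hxt : x ∉ Γ.tube) : ∀ᶠ y in 𝓝 x, Γ.innerCut ε y = 1 := by
  have hr := Γ.r₀_pos
  have hK : IsCompact (thetaMap Γ.γ '' (Icc 0 (Γ.r₀ / 2) ×ˢ Icc 0 Γ.L)) :=
    (isCompact_Icc.prod isCompact_Icc).image Γ.contDiff_thetaMap.continuous
  have hxK : x ∉ thetaMap Γ.γ '' (Icc 0 (Γ.r₀ / 2) ×ˢ Icc 0 Γ.L) := by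
    rintro ⟨q, hq, rfl⟩
    exact hxt (Γ.thetaMap_mem_tube ⟨⟨by linarith [hq.1.1], by linarith [hq.1.2]⟩, mem_univ _⟩)
  filter_upwards [Γ.isOpen_ext.mem_nhds hx, hK.isClosed.isOpen_compl.mem_nhds hxK] with y hy hyK
  unfold innerCut
  rw [if_pos hy]
  split_ifs with hyt
  · refine smoothTransition.one_of_one_le ?_
    have h1 := (Γ.mem_ext_iff hyt).1 hy
    have h2 : Γ.r₀ / 2 < (Γ.coords y).1 := by
      by_contra hcon
      exact hyK ⟨Γ.coords y, ⟨⟨h1.le, not_lt.1 hcon⟩,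
        Ico_subset_Icc_self (Γ.coords_mem hyt).2⟩, Γ.thetaMap_coords hyt⟩
    have h3 : 2 ≤ (Γ.coords y).1 / ε := by rw [le_div_iff₀ hε]; linarith
    linarith
  · rfl

lemma eventually_innerCut_eq_zero (hε : 0 < ε) (hx : x ∉ Γ.ext) :
    ∀ᶠ y in 𝓝 x, Γ.innerCut ε y = 0 := by
  by_cases hxt : x ∈ Γ.tube
  · have h1 : (Γ.coords x).1 ≤ 0 := not_lt.1 fun h => hx ((Γ.mem_ext_iff hxt).2 h)
    have h2 : ∀ᶠ y in 𝓝 x, (Γ.coords y).1 < ε :=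
      (Γ.hasFDerivAt_coords_fst hxt).continuousAt.eventually_lt continuousAt_const (h1.trans_lt hε)
    filter_upwards [h2, Γ.isOpen_tube.mem_nhds hxt] with y hy hyt
    rw [innerCut_of_mem_tube hε hyt, smoothTransition.zero_of_nonpos]
    have := (div_lt_one hε).2 hy
    linarith
  · have h1 : x ∉ closure Γ.ext := fun h => by
      rcases Γ.closure_ext_subset h with h | ⟨s, rfl⟩
      · exact hx h
      · exact hxt (Γ.curve_mem_tube s)
    filter_upwards [isClosed_closure.isOpen_compl.mem_nhds h1] with y hy
    exact innerCut_of_notMem_ext fun h => hy (subset_closure h)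

lemma innerCut_eventuallyEq (hε : 0 < ε) (hxt : x ∈ Γ.tube) :
    Γ.innerCut ε =ᶠ[𝓝 x] fun y => smoothTransition ((Γ.coords y).1 / ε - 1) := by
  filter_upwards [Γ.isOpen_tube.mem_nhds hxt] with y hyt
  exact innerCut_of_mem_tube hε hyt

lemma contDiff_innerCut (hε : 0 < ε) (hε' : 4 * ε ≤ Γ.r₀) : ContDiff ℝ ∞ (Γ.innerCut ε) := by
  rw [contDiff_iff_contDiffAt]
  intro x
  by_cases hxt : x ∈ Γ.tube
  · refine ContDiffAt.congr_of_eventuallyEq ?_ (innerCut_eventuallyEq hε hxt)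
    exact smoothTransition.contDiffAt.comp x
      (((Γ.isTubeSmooth_coords_fst.contDiffAt hxt).div_const ε).sub contDiffAt_const)
  · by_cases hx : x ∈ Γ.ext
    · exact contDiffAt_const.congr_of_eventuallyEq (eventually_innerCut_eq_one hε hε' hx hxt)
    · exact contDiffAt_const.congr_of_eventuallyEq (eventually_innerCut_eq_zero hε hx)

lemma fderiv_innerCut_of_mem_tube (hε : 0 < ε) (hxt : x ∈ Γ.tube) (e : Plane) :
    fderiv ℝ (Γ.innerCut ε) x e =
      deriv smoothTransition ((Γ.coords x).1 / ε - 1) / ε * inner ℝ (Γ.normalField x) e := by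
  rw [(innerCut_eventuallyEq hε hxt).fderiv_eq]
  have h1 : HasFDerivAt (fun y => (Γ.coords y).1 / ε - 1) (ε⁻¹ • innerSL ℝ (Γ.normalField x)) x := by
    simp_rw [div_eq_inv_mul]
    exact ((Γ.hasFDerivAt_coords_fst hxt).const_mul ε⁻¹).sub_const 1
  have h2 : HasDerivAt smoothTransition
      (deriv smoothTransition ((Γ.coords x).1 / ε - 1)) ((Γ.coords x).1 / ε - 1) :=
    ((smoothTransition.contDiff (n := 1)).differentiable (by simp) _).hasDerivAt
  have h3 := h2.comp_hasFDerivAt x h1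
  have h4 : fderiv ℝ (fun y => smoothTransition ((Γ.coords y).1 / ε - 1)) x = _ := h3.fderiv
  rw [h4]
  simp; ring

lemma fderiv_innerCut_of_notMem_tube (hε : 0 < ε) (hε' : 4 * ε ≤ Γ.r₀) (hxt : x ∉ Γ.tube) :
    fderiv ℝ (Γ.innerCut ε) x = 0 := by
  have : ∃ a : ℝ, Γ.innerCut ε =ᶠ[𝓝 x] fun _ => a := by
    by_cases hx : x ∈ Γ.ext
    · exact ⟨1, eventually_innerCut_eq_one hε hε' hx hxt⟩
    · exact ⟨0, eventually_innerCut_eq_zero hε hx⟩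
  obtain ⟨a, ha⟩ := this
  rw [ha.fderiv_eq]; simp

lemma tsupport_innerCut_subset (hε : 0 < ε) : tsupport (Γ.innerCut ε) ⊆ Γ.ext := by
  intro x hx
  by_contra hcon
  exact (notMem_tsupport_iff_eventuallyEq.2 (eventually_innerCut_eq_zero hε hcon)) hx

lemma deriv_smoothTransition_nonneg (x : ℝ) : 0 ≤ deriv smoothTransition x :=
  smoothTransition.monotone.deriv_nonneg

lemma continuous_deriv_smoothTransition : Continuous (deriv smoothTransition) :=
  (smoothTransition.contDiff (n := 1)).continuous_deriv (by simp)

lemma deriv_smoothTransition_of_neg {x : ℝ} (hx : x < 0) : deriv smoothTransition x = 0 := by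
  have h : smoothTransition =ᶠ[𝓝 x] fun _ => (0 : ℝ) := by
    filter_upwards [Iio_mem_nhds hx] with y hy
    exact smoothTransition.zero_of_nonpos (le_of_lt hy)
  rw [h.deriv_eq]; simp

lemma deriv_smoothTransition_of_one_lt {x : ℝ} (hx : 1 < x) : deriv smoothTransition x = 0 := by
  have h : smoothTransition =ᶠ[𝓝 x] fun _ => (1 : ℝ) := by
    filter_upwards [Ioi_mem_nhds hx] with y hy
    exact smoothTransition.one_of_one_le (le_of_lt hy)
  rw [h.deriv_eq]; simp

/-- The density that concentrates at `r = 0` as `ε → 0`. -/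
noncomputable def rho (ε r : ℝ) : ℝ := deriv smoothTransition (r / ε - 1) / ε

lemma rho_nonneg (hε : 0 < ε) (r : ℝ) : 0 ≤ rho ε r :=
  div_nonneg (deriv_smoothTransition_nonneg _) hε.le

lemma continuous_rho (ε : ℝ) : Continuous (rho ε) :=
  (continuous_deriv_smoothTransition.comp (by fun_prop)).div_const _

lemma rho_eq_zero {r : ℝ} (hε : 0 < ε) (h : r ∉ Icc ε (2 * ε)) : rho ε r = 0 := by
  unfold rho
  rcases lt_or_ge r ε with h1 | h1
  · rw [deriv_smoothTransition_of_neg, zero_div]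
    have := (div_lt_one hε).2 h1
    linarith
  · have h2 : 2 * ε < r := by
      by_contra hcon; exact h ⟨h1, not_lt.1 hcon⟩
    rw [deriv_smoothTransition_of_one_lt, zero_div]
    have := (lt_div_iff₀ hε).2 h2
    linarith

lemma integral_rho (hε : 0 < ε) (hε' : 4 * ε ≤ Γ.r₀) : ∫ r in Ioo (-Γ.r₀) Γ.r₀, rho ε r = 1 := by
  have hr := Γ.r₀_pos
  have h1 : ∀ r, HasDerivAt (fun r => smoothTransition (r / ε - 1)) (rho ε r) r := by
    intro r
    have h2 : HasDerivAt smoothTransition (deriv smoothTransition (r / ε - 1)) (r / ε - 1) :=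
      ((smoothTransition.contDiff (n := 1)).differentiable (by simp) _).hasDerivAt
    have h3 : HasDerivAt (fun r : ℝ => r / ε - 1) (1 / ε) r :=
      ((hasDerivAt_id r).div_const ε).sub_const 1
    have := h2.comp r h3
    simpa [rho, Function.comp_def, div_eq_mul_inv] using this
  rw [← integral_Ioc_eq_integral_Ioo, ← integral_of_le (by linarith),
    intervalIntegral.integral_eq_sub_of_hasDerivAt (fun r _ => h1 r)
      ((continuous_rho ε).intervalIntegrable _ _)]
  rw [smoothTransition.one_of_one_le, smoothTransition.zero_of_nonpos]
  · simp
  · have : -Γ.r₀ / ε ≤ 0 := div_nonpos_of_nonpos_of_nonneg (by linarith) hε.le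
    linarith
  · have : 2 ≤ Γ.r₀ / ε := by rw [le_div_iff₀ hε]; linarith
    linarith

end BoundaryCurve

namespace BoundaryCurve

variable (Γ : BoundaryCurve)

lemma thetaMap_mem_closure (h0 : 0 ≤ q.1) (h1 : q.1 < Γ.r₀) : thetaMap Γ.γ q ∈ closure Γ.ext := by
  rcases h0.eq_or_lt with h | h
  · have : q = (0, q.2) := by ext <;> simp [← h]
    rw [this, Γ.thetaMap_zero]; exact Γ.curve_mem_closure _
  · exact subset_closure (Γ.thetaMap_mem_ext h h1)

lemma isBounded_tube : Bornology.IsBounded Γ.tube :=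
  (((isCompact_Icc (a := -Γ.r₀) (b := Γ.r₀)).prod (isCompact_Icc (a := 0) (b := Γ.L))).image
    Γ.contDiff_thetaMap.continuous).isBounded.subset
    (image_mono (prod_mono Ioo_subset_Icc_self Ico_subset_Icc_self))

lemma fderiv_innerCut_thetaMap (hε : 0 < ε) (hq : q ∈ Γ.band) (j : Fin 2) :
    fderiv ℝ (Γ.innerCut ε) (thetaMap Γ.γ q) (single j 1) = rho ε q.1 * unitNormal Γ.γ q.2 j := by
  rw [fderiv_innerCut_of_mem_tube hε (Γ.thetaMap_mem_tube hq), Γ.coords_thetaMap hq]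
  have : Γ.normalField (thetaMap Γ.γ q) = unitNormal Γ.γ q.2 := by
    rw [normalField, Γ.coords_thetaMap hq, toIcoMod]
    exact Γ.periodic_unitNormal.sub_zsmul_eq _
  rw [this, EuclideanSpace.inner_single_right]
  simp [rho]

lemma normalField_curve (s : ℝ) : Γ.normalField (Γ.γ s) = unitNormal Γ.γ s := by
  rw [← Γ.thetaMap_zero, normalField, Γ.coords_thetaMap (Γ.zero_mem_band s), toIcoMod]
  exact Γ.periodic_unitNormal.sub_zsmul_eq _

/-- The flux density in normal-tangential coordinates. -/
noncomputable def flux (F : Fin 2 → SpaceTime → ℝ) (p : ℝ × ℝ × ℝ) : ℝ :=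
  (1 + p.2.1 * curvature Γ.γ p.2.2) * ∑ j, F j (p.1, thetaMap Γ.γ p.2) * unitNormal Γ.γ p.2.2 j

lemma continuousOn_flux {F : Fin 2 → SpaceTime → ℝ}
    (hF : ∀ j, ContinuousOn (F j) (Icc 0 T ×ˢ closure Γ.ext)) :
    ContinuousOn (Γ.flux F) (Icc 0 T ×ˢ (Icc 0 (Γ.r₀ / 2) ×ˢ univ)) := by
  have hr := Γ.r₀_pos
  unfold flux
  refine ContinuousOn.mul ?_ (continuousOn_finsetSum _ fun j _ => ContinuousOn.mul ?_ ?_)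
  · have := Γ.contDiff_curvature.continuous
    fun_prop
  · refine (hF j).comp (f := fun p : ℝ × ℝ × ℝ => (p.1, thetaMap Γ.γ p.2)) ?_ ?_
    · have := Γ.contDiff_thetaMap.continuous
      fun_prop
    · intro p hp
      exact ⟨hp.1, Γ.thetaMap_mem_closure hp.2.1.1 (by linarith [hp.2.1.2])⟩
  · have := (contDiff_euclidean.1 Γ.contDiff_unitNormal j).continuous
    exact (this.comp (continuous_snd.comp continuous_snd)).continuousOn

lemma integrableOn_rho_mul (hε : 0 < ε) (hε' : 4 * ε ≤ Γ.r₀) {g : ℝ × ℝ → ℝ}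
    (hg : ContinuousOn g (Icc 0 (Γ.r₀ / 2) ×ˢ univ)) :
    IntegrableOn (fun q => rho ε q.1 * g q) Γ.params := by
  have hK : IsCompact (Icc ε (2 * ε) ×ˢ Icc 0 Γ.L) := isCompact_Icc.prod isCompact_Icc
  have h1 : IntegrableOn (fun q : ℝ × ℝ => rho ε q.1 * g q) (Icc ε (2 * ε) ×ˢ Icc 0 Γ.L) := by
    refine ContinuousOn.integrableOn_compact hK (ContinuousOn.mul ?_ (hg.mono ?_))
    · exact ((continuous_rho ε).comp continuous_fst).continuousOn
    · exact prod_mono (fun r hr => ⟨by linarith [hr.1], by linarith [hr.2]⟩) (subset_univ _)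
  refine h1.of_forall_sdiff_eq_zero Γ.measurableSet_params fun q hq => ?_
  rw [rho_eq_zero hε, zero_mul]
  exact fun h => hq.2 ⟨h, Ico_subset_Icc_self hq.1.2⟩

lemma integral_flux_innerCut (hε : 0 < ε) (hε' : 4 * ε ≤ Γ.r₀) (F : Fin 2 → SpaceTime → ℝ) (t : ℝ) :
    ∫ x, ∑ j, F j (t, x) * fderiv ℝ (Γ.innerCut ε) x (single j 1) =
      ∫ q in Γ.params, rho ε q.1 * Γ.flux F (t, q) := by
  rw [← setIntegral_eq_integral_of_forall_compl_eq_zero (s := Γ.tube), Γ.integral_tube]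
  · refine setIntegral_congr_fun Γ.measurableSet_params fun q hq => ?_
    have hb : q ∈ Γ.band := ⟨hq.1, mem_univ _⟩
    simp only [flux, Γ.fderiv_innerCut_thetaMap hε hb, sum_univ_two]
    ring
  · intro x hx
    simp [fderiv_innerCut_of_notMem_tube hε hε' hx]

lemma integral_rho_mul (hε : 0 < ε) (hε' : 4 * ε ≤ Γ.r₀) (g : ℝ → ℝ) :
    ∫ q in Γ.params, rho ε q.1 * g q.2 = ∫ s in (0)..Γ.L, g s := by
  rw [params, Measure.volume_eq_prod, setIntegral_prod_mul, integral_rho hε hε', one_mul,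
    integral_of_le Γ.L_pos.le, integral_Ico_eq_integral_Ioc]

/-- As the cut-off region shrinks to `Γ`, the flux through it tends to the boundary flux,
uniformly in time. -/
lemma exists_flux_close {F : Fin 2 → SpaceTime → ℝ}
    (hF : ∀ j, ContinuousOn (F j) (Icc 0 T ×ˢ closure Γ.ext)) {η : ℝ} (hη : 0 < η) :
    ∃ ε₀ > 0, 4 * ε₀ ≤ Γ.r₀ ∧ ∀ ε, 0 < ε → ε ≤ ε₀ → ∀ t ∈ Icc 0 T,
      |(∫ x, ∑ j, F j (t, x) * fderiv ℝ (Γ.innerCut ε) x (single j 1)) -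
        ∫ s in (0)..Γ.L, ∑ j, F j (t, Γ.γ s) * unitNormal Γ.γ s j| ≤ η := by
  have hr := Γ.r₀_pos
  have hL := Γ.L_pos
  have hcont := Γ.continuousOn_flux hF
  have hK : IsCompact (Icc 0 T ×ˢ (Icc 0 (Γ.r₀ / 2) ×ˢ Icc 0 Γ.L)) :=
    isCompact_Icc.prod (isCompact_Icc.prod isCompact_Icc)
  have huc := hK.uniformContinuousOn_of_continuous
    (hcont.mono (prod_mono_right (prod_mono_right (subset_univ _))))
  obtain ⟨δ, hδ, hd⟩ := Metric.uniformContinuousOn_iff.1 huc (η / Γ.L) (by positivity)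
  refine ⟨min (Γ.r₀ / 4) (δ / 4), by positivity, ?_, fun ε hε hε0 t ht => ?_⟩
  · linarith [min_le_left (Γ.r₀ / 4) (δ / 4)]
  have hε' : 4 * ε ≤ Γ.r₀ := by linarith [min_le_left (Γ.r₀ / 4) (δ / 4)]
  have hεδ : 2 * ε < δ := by linarith [min_le_right (Γ.r₀ / 4) (δ / 4)]
  have h0 : ∫ s in (0)..Γ.L, ∑ j, F j (t, Γ.γ s) * unitNormal Γ.γ s j =
      ∫ q in Γ.params, rho ε q.1 * Γ.flux F (t, 0, q.2) := by
    rw [Γ.integral_rho_mul hε hε' fun s => Γ.flux F (t, 0, s)]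
    simp [flux, Γ.thetaMap_zero]
  rw [Γ.integral_flux_innerCut hε hε', h0, ← integral_sub]
  · have hb : ∫ q in Γ.params, rho ε q.1 * (η / Γ.L) = η := by
      rw [Γ.integral_rho_mul hε hε' fun _ => η / Γ.L]
      simp; field_simp
    rw [← norm_eq_abs]
    conv_rhs => rw [← hb]
    refine norm_integral_le_of_norm_le
      (Γ.integrableOn_rho_mul hε hε' (g := fun _ => η / Γ.L) continuousOn_const) ?_
    refine (ae_restrict_iff' Γ.measurableSet_params).2 (.of_forall fun q hq => ?_)
    rw [← mul_sub, norm_mul, norm_of_nonneg (rho_nonneg hε _)]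
    by_cases hqε : q.1 ∈ Icc ε (2 * ε)
    · refine mul_le_mul_of_nonneg_left ?_ (rho_nonneg hε _)
      have h1 := hd (t, q) ⟨ht, ⟨by linarith [hqε.1], by linarith [hqε.2]⟩,
        Ico_subset_Icc_self hq.2⟩ (t, 0, q.2) ⟨ht, ⟨le_rfl, by linarith⟩,
        Ico_subset_Icc_self hq.2⟩ (by
          rw [Prod.dist_eq, Prod.dist_eq]
          simp [abs_lt]
          exact ⟨by linarith [hqε.1], by linarith [hqε.2]⟩)
      rw [← dist_eq_norm]; exact h1.le
    · simp [rho_eq_zero hε hqε]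
  · exact Γ.integrableOn_rho_mul hε hε' (hcont.comp (by fun_prop) fun q hq => ⟨ht, hq⟩)
  · exact Γ.integrableOn_rho_mul hε hε' (g := fun q => Γ.flux F (t, 0, q.2))
      (hcont.comp (by fun_prop) fun q hq => ⟨ht, ⟨le_rfl, by simp; linarith⟩, mem_univ _⟩)

/-- A smooth function that is `1` on the ball of radius `R` and has support of radius `2 R`. -/
noncomputable def outerCut (R : ℝ) (x : Plane) : ℝ :=
  (⟨1, 2, by norm_num, by norm_num⟩ : ContDiffBump (0 : Plane)) (R⁻¹ • x)

lemma contDiff_outerCut (R : ℝ) : ContDiff ℝ ∞ (outerCut R) :=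
  (ContDiffBump.contDiff _).comp (contDiff_id.const_smul R⁻¹)

lemma outerCut_nonneg (R : ℝ) (x : Plane) : 0 ≤ outerCut R x := ContDiffBump.nonneg _

lemma outerCut_le_one (R : ℝ) (x : Plane) : outerCut R x ≤ 1 := ContDiffBump.le_one _

lemma outerCut_eq_one {R : ℝ} (hR : 0 < R) (hx : ‖x‖ ≤ R) : outerCut R x = 1 := by
  refine ContDiffBump.one_of_mem_closedBall _ ?_
  simp only [mem_closedBall_zero_iff, norm_smul, norm_inv, norm_of_nonneg hR.le]
  rwa [inv_mul_le_one₀ hR]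

lemma hasCompactSupport_outerCut {R : ℝ} (hR : 0 < R) : HasCompactSupport (outerCut R) :=
  (ContDiffBump.hasCompactSupport _).comp_homeomorph (Homeomorph.smulOfNeZero R⁻¹ (by positivity))

lemma exists_fderiv_outerCut_le : ∃ C, 0 ≤ C ∧ ∀ R, 0 < R → ∀ x e : Plane,
    |fderiv ℝ (outerCut R) x e| ≤ C / R * ‖e‖ := by
  set f : ContDiffBump (0 : Plane) := ⟨1, 2, by norm_num, by norm_num⟩
  have hf : ContDiff ℝ 1 f := f.contDiff
  obtain ⟨C, hC⟩ := (f.hasCompactSupport.fderiv ℝ).exists_bound_of_continuous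
    (hf.continuous_fderiv (by simp))
  refine ⟨C, (norm_nonneg _).trans (hC 0), fun R hR x e => ?_⟩
  have h1 : HasFDerivAt (outerCut R) ((fderiv ℝ f (R⁻¹ • x)).comp
      (R⁻¹ • ContinuousLinearMap.id ℝ Plane)) x :=
    (hf.differentiable (by simp) _).hasFDerivAt.comp x ((hasFDerivAt_id x).const_smul R⁻¹)
  rw [h1.fderiv]
  simp only [comp_apply, smul_apply, ContinuousLinearMap.id_apply, map_smul,
    smul_eq_mul, abs_mul, abs_inv, abs_of_pos hR]
  have h2 := (fderiv ℝ f (R⁻¹ • x)).le_of_opNorm_le (hC _) e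
  rw [norm_eq_abs] at h2
  calc R⁻¹ * |fderiv ℝ f (R⁻¹ • x) e| ≤ R⁻¹ * (C * ‖e‖) := by gcongr
    _ = _ := by ring

/-- Cut-off functions that exhaust `ℰ` and whose gradients concentrate on `Γ`. -/
lemma exists_cutoff : ∃ χ : ℕ → Plane → ℝ, (∀ k, ContDiff ℝ ∞ (χ k)) ∧
    (∀ k, HasCompactSupport (χ k)) ∧ (∀ k, tsupport (χ k) ⊆ Γ.ext) ∧
    (∀ k x, 0 ≤ χ k x) ∧ (∀ k x, χ k x ≤ 1) ∧ (∀ x ∈ Γ.ext, ∀ᶠ k in atTop, χ k x = 1) ∧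
    ∀ (T M : ℝ) (F : Fin 2 → SpaceTime → ℝ), (∀ j, ContinuousOn (F j) (Icc 0 T ×ˢ closure Γ.ext)) →
      (∀ t ∈ Icc 0 T, ∀ j, IntegrableOn (fun x => F j (t, x)) Γ.ext ∧
        ∫ x in Γ.ext, |F j (t, x)| ≤ M) →
      ∀ η > 0, ∀ᶠ k in atTop, ∀ t ∈ Icc 0 T,
        |(∫ x, ∑ j, F j (t, x) * fderiv ℝ (χ k) x (single j 1)) -
          ∫ s in (0)..Γ.L, ∑ j, F j (t, Γ.γ s) * unitNormal Γ.γ s j| ≤ η := by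
  have hr := Γ.r₀_pos
  set ε : ℕ → ℝ := fun k => Γ.r₀ / 4 * ((k : ℝ) + 1)⁻¹ with hε
  have hεpos : ∀ k, 0 < ε k := fun k => by positivity
  have hεr : ∀ k, 4 * ε k ≤ Γ.r₀ := fun k => by
    have : ((k : ℝ) + 1)⁻¹ ≤ 1 := inv_le_one_of_one_le₀ (by linarith [k.cast_nonneg (α := ℝ)])
    simp only [hε]; nlinarith
  have hεlim : Tendsto ε atTop (𝓝 0) := by
    have h1 : Tendsto (fun k : ℕ => ((k : ℝ) + 1)⁻¹) atTop (𝓝 0) := by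
      simpa [one_div] using tendsto_one_div_add_atTop_nhds_zero_nat (𝕜 := ℝ)
    simpa using h1.const_mul (Γ.r₀ / 4)
  have hRpos : ∀ k : ℕ, (0 : ℝ) < (k : ℝ) + 1 := fun k => by positivity
  have hRlim : Tendsto (fun k : ℕ => (k : ℝ) + 1) atTop atTop :=
    tendsto_atTop_add_const_right _ _ tendsto_natCast_atTop_atTop
  have hχ : ∀ k : ℕ, tsupport (fun x => Γ.innerCut (ε k) x * outerCut ((k : ℝ) + 1) x) ⊆ Γ.ext :=
    fun k => (tsupport_mul_subset_left).trans (tsupport_innerCut_subset (hεpos k))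
  refine ⟨fun k x => Γ.innerCut (ε k) x * outerCut ((k : ℝ) + 1) x, fun k =>
    (contDiff_innerCut (hεpos k) (hεr k)).mul (contDiff_outerCut _), fun k =>
    (hasCompactSupport_outerCut (hRpos k)).mul_left, hχ, fun k x =>
    mul_nonneg (innerCut_nonneg _ _) (outerCut_nonneg _ _), fun k x =>
    mul_le_one₀ (innerCut_le_one _ _) (outerCut_nonneg _ _) (outerCut_le_one _ _), ?_, ?_⟩
  · intro x hx
    have h1 : ∀ᶠ k in atTop, Γ.innerCut (ε k) x = 1 := by
      by_cases hxt : x ∈ Γ.tube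
      · have h2 := (Γ.mem_ext_iff hxt).1 hx
        filter_upwards [hεlim.eventually_lt_const (half_pos h2)] with k hk
        rw [innerCut_of_mem_tube (hεpos k) hxt]
        refine smoothTransition.one_of_one_le ?_
        have h3 : 2 ≤ (Γ.coords x).1 / ε k := by rw [le_div_iff₀ (hεpos k)]; linarith
        linarith
      · exact Eventually.of_forall fun k => by simp [innerCut, hx, hxt]
    filter_upwards [h1, hRlim.eventually_ge_atTop ‖x‖] with k hk hk2
    rw [hk, outerCut_eq_one (hRpos k) hk2, mul_one]
  · intro T M F hF hM η hη
    obtain ⟨ε₀, hε₀, hε₀r, hclose⟩ := Γ.exists_flux_close hF (half_pos hη)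
    obtain ⟨C, hC0, hC⟩ := exists_fderiv_outerCut_le
    obtain ⟨R₀, hR₀⟩ := Γ.isBounded_tube.exists_norm_le
    have hlim2 : Tendsto (fun k : ℕ => 2 * (C / ((k : ℝ) + 1) * M)) atTop (𝓝 0) := by
      have := ((tendsto_const_nhds (x := C)).div_atTop hRlim).mul_const M
      simpa using this.const_mul 2
    filter_upwards [hεlim.eventually_lt_const hε₀, hRlim.eventually_ge_atTop R₀,
      hlim2.eventually_lt_const (half_pos hη)] with k hk1 hk2 hk3 t ht
    have hc := hclose (ε k) (hεpos k) hk1.le t ht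
    set χ₁ := Γ.innerCut (ε k)
    set χ₂ := outerCut ((k : ℝ) + 1)
    have hd1 : Differentiable ℝ χ₁ := (contDiff_innerCut (hεpos k) (hεr k)).differentiable (by simp)
    have hd2 : Differentiable ℝ χ₂ := (contDiff_outerCut _).differentiable (by simp)
    have hprod : ∀ x (j : Fin 2), fderiv ℝ (fun x => χ₁ x * χ₂ x) x (single j 1) =
        fderiv ℝ χ₁ x (single j 1) + χ₁ x * fderiv ℝ χ₂ x (single j 1) := by
      intro x j
      rw [fderiv_fun_mul (hd1 x) (hd2 x)]
      simp only [add_apply, smul_apply, smul_eq_mul]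
      by_cases hxt : x ∈ Γ.tube
      · rw [show χ₂ x = 1 from outerCut_eq_one (hRpos k) ((hR₀ x hxt).trans hk2)]; ring
      · rw [fderiv_innerCut_of_notMem_tube (hεpos k) (hεr k) hxt]; simp
    have hI1 : ∀ j : Fin 2, Integrable fun x => F j (t, x) * fderiv ℝ χ₁ x (single j 1) := by
      intro j
      set K := thetaMap Γ.γ '' (Icc (ε k) (2 * ε k) ×ˢ Icc 0 Γ.L)
      have hK : IsCompact K :=
        (isCompact_Icc.prod isCompact_Icc).image Γ.contDiff_thetaMap.continuous
      have hKE : K ⊆ Γ.ext := by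
        rintro _ ⟨q, hq, rfl⟩
        exact Γ.thetaMap_mem_ext (by linarith [hq.1.1, hεpos k]) (by linarith [hq.1.2, hεr k])
      have h1 : IntegrableOn (fun x => F j (t, x) * fderiv ℝ χ₁ x (single j 1)) K := by
        refine ContinuousOn.integrableOn_compact hK (ContinuousOn.mul ?_ ?_)
        · exact (hF j).comp (by fun_prop) fun x hx => ⟨ht, subset_closure (hKE hx)⟩
        · exact (((contDiff_innerCut (hεpos k) (hεr k)).continuous_fderiv (by simp)).clm_apply
            continuous_const).continuousOn
      refine h1.integrable_of_forall_notMem_eq_zero fun x hx => ?_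
      by_cases hxt : x ∈ Γ.tube
      · rw [← Γ.thetaMap_coords hxt, Γ.fderiv_innerCut_thetaMap (hεpos k) (Γ.coords_mem_band hxt),
          rho_eq_zero (hεpos k)]
        · simp
        · exact fun h => hx ⟨Γ.coords x, ⟨h, Ico_subset_Icc_self (Γ.coords_mem hxt).2⟩,
            Γ.thetaMap_coords hxt⟩
      · rw [fderiv_innerCut_of_notMem_tube (hεpos k) (hεr k) hxt]; simp
    have hb2 : ∀ (j : Fin 2) x, |χ₁ x * fderiv ℝ χ₂ x (single j 1)| ≤ C / ((k : ℝ) + 1) := by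
      intro j x
      rw [abs_mul, abs_of_nonneg (innerCut_nonneg _ _)]
      have h1 := hC _ (hRpos k) x (single j 1)
      simp only [PiLp.norm_single, norm_one, mul_one] at h1
      calc _ ≤ 1 * |fderiv ℝ χ₂ x (single j 1)| := by
            gcongr; exact innerCut_le_one _ _
        _ ≤ _ := by rw [one_mul]; exact h1
    have hI2' : ∀ j : Fin 2, IntegrableOn (fun x =>
        F j (t, x) * (χ₁ x * fderiv ℝ χ₂ x (single j 1))) Γ.ext := by
      intro j
      refine (hM t ht j).1.mul_bdd (c := C / ((k : ℝ) + 1)) ?_ ?_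
      · exact (hd1.continuous.mul (((contDiff_outerCut _).continuous_fderiv (by simp)).clm_apply
          continuous_const)).aestronglyMeasurable
      · exact Eventually.of_forall fun x => hb2 j x
    have hzero : ∀ (j : Fin 2) x, x ∉ Γ.ext →
        F j (t, x) * (χ₁ x * fderiv ℝ χ₂ x (single j 1)) = 0 := by
      intro j x hx
      simp [χ₁, innerCut_of_notMem_ext hx]
    have hI2 : ∀ j : Fin 2, Integrable fun x =>
        F j (t, x) * (χ₁ x * fderiv ℝ χ₂ x (single j 1)) := fun j =>
      (hI2' j).integrable_of_forall_notMem_eq_zero (hzero j)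
    have hbd : ∀ j : Fin 2,
        |∫ x, F j (t, x) * (χ₁ x * fderiv ℝ χ₂ x (single j 1))| ≤ C / ((k : ℝ) + 1) * M := by
      intro j
      rw [← setIntegral_eq_integral_of_forall_compl_eq_zero (hzero j)]
      have h1 : ∫ x in Γ.ext, |F j (t, x)| * (C / ((k : ℝ) + 1)) ≤ C / ((k : ℝ) + 1) * M := by
        rw [integral_mul_const, mul_comm]
        exact mul_le_mul_of_nonneg_left (hM t ht j).2 (div_nonneg hC0 (hRpos k).le)
      refine le_trans ?_ h1
      rw [← norm_eq_abs]
      refine norm_integral_le_of_norm_le ((hM t ht j).1.abs.mul_const _) (.of_forall fun x => ?_)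
      rw [norm_mul, norm_eq_abs, norm_eq_abs]
      exact mul_le_mul_of_nonneg_left (hb2 j x) (abs_nonneg _)
    have hsplit : ∫ x, ∑ j, F j (t, x) * fderiv ℝ (fun x => χ₁ x * χ₂ x) x (single j 1) =
        (∫ x, ∑ j, F j (t, x) * fderiv ℝ χ₁ x (single j 1)) +
        ∑ j, ∫ x, F j (t, x) * (χ₁ x * fderiv ℝ χ₂ x (single j 1)) := by
      rw [← integral_finsetSum _ fun j _ => hI2 j, ← integral_add
        (integrable_finsetSum _ fun j _ => hI1 j) (integrable_finsetSum _ fun j _ => hI2 j)]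
      refine integral_congr_ae (.of_forall fun x => ?_)
      simp only [hprod, mul_add, sum_add_distrib]
    rw [hsplit]
    have h0 := hbd 0
    have h1 := hbd 1
    rw [sum_univ_two] at *
    rw [abs_le] at *
    constructor <;> linarith [h0.1, h0.2, h1.1, h1.2, hc.1, hc.2]

end BoundaryCurve

section LpNorms

variable {D : Set Plane}

lemma lpNormOn_nonneg (D : Set Plane) (p : ℝ) (h : Plane → V) : 0 ≤ lpNormOn D p h :=
  ENNReal.toReal_nonneg

lemma ofReal_lpNormOn {h : Plane → V} (hh : MemLp h (ofReal p) (volume.restrict D)) :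
    ofReal (lpNormOn D p h) = eLpNorm h (ofReal p) (volume.restrict D) :=
  ofReal_toReal hh.2.ne

lemma lpNormOn_add_le (hp : 1 ≤ p) {f g : Plane → V} (hf : MemLp f (ofReal p) (volume.restrict D))
    (hg : MemLp g (ofReal p) (volume.restrict D)) :
    lpNormOn D p (fun x => f x + g x) ≤ lpNormOn D p f + lpNormOn D p g := by
  unfold lpNormOn
  rw [← ENNReal.toReal_add hf.2.ne hg.2.ne]
  exact toReal_mono (ENNReal.add_ne_top.2 ⟨hf.2.ne, hg.2.ne⟩)
    (eLpNorm_add_le hf.1 hg.1 (by simpa using hp))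

lemma lpNormOn_sub_comm (f g : Plane → V) :
    lpNormOn D p (fun x => f x - g x) = lpNormOn D p (fun x => g x - f x) := by
  unfold lpNormOn
  rw [← eLpNorm_neg]; congr 2; funext x; simp

lemma abs_lpNormOn_sub_le (hp : 1 ≤ p) {f g : Plane → V}
    (hf : MemLp f (ofReal p) (volume.restrict D)) (hg : MemLp g (ofReal p) (volume.restrict D)) :
    |lpNormOn D p f - lpNormOn D p g| ≤ lpNormOn D p (fun x => f x - g x) := by
  have h1 := lpNormOn_add_le hp (hf.sub hg) hg
  have h2 := lpNormOn_add_le hp (hg.sub hf) hf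
  simp only [Pi.sub_apply, sub_add_cancel] at h1 h2
  have h3 : lpNormOn D p (g - f) = lpNormOn D p (f - g) := lpNormOn_sub_comm g f
  rw [abs_le]
  have e : lpNormOn D p (fun x => f x - g x) = lpNormOn D p (f - g) := rfl
  rw [e]
  constructor <;> linarith

lemma memLp_two_iff {h : Plane → V} :
    MemLp h (ofReal 2) (volume.restrict D) ↔ MemLp h 2 (volume.restrict D) := by
  rw [ofReal_ofNat]

lemma lpNormOn_two_sq {h : Plane → V} (hh : MemLp h 2 (volume.restrict D)) :
    lpNormOn D 2 h ^ 2 = ∫ x in D, ‖h x‖ ^ 2 := by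
  have h0 : 0 ≤ ∫ x in D, ‖h x‖ ^ 2 := integral_nonneg fun x => by positivity
  rw [lpNormOn, ofReal_ofNat, hh.eLpNorm_eq_integral_rpow_norm (by simp) (by simp)]
  simp only [ENNReal.toReal_ofNat, Real.rpow_ofNat]
  rw [ENNReal.toReal_ofReal (by positivity), ← Real.rpow_natCast, ← Real.rpow_mul h0]
  simp

lemma integral_norm_mul_le {W : Type*} [NormedAddCommGroup W] [NormedSpace ℝ W] {f : Plane → V} {g : Plane → W}
    (hf : MemLp f 2 (volume.restrict D)) (hg : MemLp g 2 (volume.restrict D)) :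
    ∫ x in D, ‖f x‖ * ‖g x‖ ≤ lpNormOn D 2 f * lpNormOn D 2 g := by
  have h1 := integral_mul_le_Lp_mul_Lq_of_nonneg (μ := volume.restrict D)
    (Real.holderConjugate_iff.2 ⟨one_lt_two, by norm_num⟩ : (2 : ℝ).HolderConjugate 2)
    (f := fun x => ‖f x‖) (g := fun x => ‖g x‖) (.of_forall fun x => norm_nonneg _)
    (.of_forall fun x => norm_nonneg _) (memLp_two_iff.2 hf.norm) (memLp_two_iff.2 hg.norm)
  simp only [Real.rpow_ofNat] at h1
  rw [← lpNormOn_two_sq hf, ← lpNormOn_two_sq hg, ← Real.sqrt_eq_rpow,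
    ← Real.sqrt_eq_rpow, Real.sqrt_sq (lpNormOn_nonneg _ _ _),
    Real.sqrt_sq (lpNormOn_nonneg _ _ _)] at h1
  exact h1

lemma ContInLp.memLp_two {g : SpaceTime → V} (hg : ContInLp D T 2 g) (ht : t ∈ Icc 0 T) :
    MemLp (fun x => g (t, x)) 2 (volume.restrict D) :=
  memLp_two_iff.1 (hg t ht).1

lemma ContInLp.continuousOn_norm (hp : 1 ≤ p) {g : SpaceTime → V} (hg : ContInLp D T p g) :
    ContinuousOn (fun t => lpNormOn D p fun x => g (t, x)) (Icc 0 T) := by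
  intro t ht
  have h1 := (ENNReal.tendsto_toReal ENNReal.zero_ne_top).comp (hg t ht).2
  rw [ContinuousWithinAt, tendsto_iff_dist_tendsto_zero]
  refine squeeze_zero' (.of_forall fun _ => dist_nonneg) ?_ h1
  filter_upwards [self_mem_nhdsWithin] with τ hτ
  rw [Real.dist_eq]
  exact abs_lpNormOn_sub_le hp (hg τ hτ).1 (hg t ht).1

end LpNorms

/-! ### Pointwise computations for the energy balance -/

section Pointwise

lemma pd_inner_symm {M : SpaceTime → Mat n} (i : Fin 3) (hM : DifferentiableAt ℝ M z)
    (hw : DifferentiableAt ℝ w z) (hs : IsSelfAdjoint (M z)) :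
    pd i (fun y => (inner ℝ (w y) (M y (w y)) : ℝ)) z =
      inner ℝ (w z) (pd i M z (w z)) + 2 * inner ℝ (w z) (M z (pd i w z)) := by
  have h1 := hM.hasFDerivAt.clm_apply hw.hasFDerivAt
  have h2 := hw.hasFDerivAt.inner ℝ h1
  have h3 : inner ℝ (pd i w z) (M z (w z)) = inner ℝ (w z) (M z (pd i w z)) := by
    rw [← adjoint_inner_left, ← star_eq_adjoint, hs.star_eq, real_inner_comm]
  simp only [pd] at h3 ⊢
  rw [h2.fderiv]
  simp [fderivInnerCLM_apply, inner_add_right]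
  rw [h3]; ring

lemma inner_symm_le {S : Mat n} {β : ℝ} (hs : IsSelfAdjoint S) (h0 : ∀ v, 0 ≤ inner ℝ v (S v))
    (h1 : ∀ v, inner ℝ v (S v) ≤ β * ‖v‖ ^ 2) (a b : Vec n) :
    inner ℝ a (S b) ≤ β * (‖a‖ * ‖b‖) := by
  have hsym : ∀ a b : Vec n, inner ℝ b (S a) = (inner ℝ a (S b) : ℝ) := fun a b => by
    rw [← adjoint_inner_left, ← star_eq_adjoint, hs.star_eq, real_inner_comm]
  have key : ∀ a b : Vec n, ‖a‖ = 1 → ‖b‖ = 1 → inner ℝ a (S b) ≤ β := by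
    intro a b ha hb
    have hβ : 0 ≤ β := by have := (h0 a).trans (h1 a); rw [ha] at this; linarith
    have e1 := h1 (a + b)
    have e2 := h0 (a - b)
    simp only [map_add, map_sub, inner_add_left, inner_add_right, inner_sub_left,
      inner_sub_right, hsym a b] at e1 e2
    have e3 : ‖a + b‖ ≤ 2 := by have := norm_add_le a b; linarith
    have e4 : ‖a + b‖ ^ 2 ≤ 4 := by nlinarith [norm_nonneg (a + b)]
    nlinarith
  rcases eq_or_ne a 0 with rfl | ha
  · simp
  rcases eq_or_ne b 0 with rfl | hb
  · simp
  have ha' := norm_ne_zero_iff.2 ha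
  have hb' := norm_ne_zero_iff.2 hb
  have := key (‖a‖⁻¹ • a) (‖b‖⁻¹ • b) (by rw [norm_smul]; simp [ha']) (by rw [norm_smul]; simp [hb'])
  simp only [map_smul, inner_smul_left, inner_smul_right] at this
  simp only [conj_trivial] at this
  have hpos : 0 < ‖a‖ * ‖b‖ := by positivity
  calc inner ℝ a (S b) = (‖a‖ * ‖b‖) * (‖a‖⁻¹ * (‖b‖⁻¹ * inner ℝ a (S b))) := by field_simp
    _ ≤ (‖a‖ * ‖b‖) * β := by
      refine mul_le_mul_of_nonneg_left ?_ hpos.le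
      linarith [this]
    _ = _ := by ring

end Pointwise

namespace Coeffs

variable (c : Coeffs n)

/-- The differential operator `∂_t + A₁ ∂₁ + A₂ ∂₂ + B`. -/
noncomputable def op (w : SpaceTime → Vec n) (z : SpaceTime) : Vec n :=
  pd 0 w z + c.A 0 z (pd 1 w z) + c.A 1 z (pd 2 w z) + c.B z (w z)

/-- The energy density. -/
noncomputable def density (w : SpaceTime → Vec n) (z : SpaceTime) : ℝ := inner ℝ (w z) (c.S z (w z))

/-- The energy flux. -/
noncomputable def fluxDensity (w : SpaceTime → Vec n) (j : Fin 2) (z : SpaceTime) : ℝ :=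
  inner ℝ (w z) (c.S z (c.A j z (w z)))

variable {c}

lemma isOpen_cyl (Γ : BoundaryCurve) (T : ℝ) : IsOpen (Γ.cyl T) := isOpen_Ioo.prod Γ.isOpen_ext

lemma closure_cyl (Γ : BoundaryCurve) (hT : 0 < T) :
    closure (Γ.cyl T) = Icc 0 T ×ˢ closure Γ.ext := by
  rw [BoundaryCurve.cyl, closure_prod_eq, closure_Ioo hT.ne]

lemma energy_identity (hs : c.IsSmooth Γ T) (hf : c.IsFriedrichs Γ T α₀ β₀ β₁)
    (hw : ContDiffOn ℝ 1 w (Γ.cyl T)) (hz : z ∈ Γ.cyl T) :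
    pd 0 (c.density w) z + pd 1 (c.fluxDensity w 0) z + pd 2 (c.fluxDensity w 1) z ≤
      β₁ * ‖w z‖ ^ 2 + 2 * β₀ * (‖w z‖ * ‖c.op w z‖) := by
  have hnhds := (isOpen_cyl Γ T).mem_nhds hz
  have hwd : DifferentiableAt ℝ w z := (hw.contDiffAt hnhds).differentiableAt (by simp)
  have hSd : DifferentiableAt ℝ c.S z := (hs.S_diff.contDiffAt hnhds).differentiableAt (by simp)
  have hAd : ∀ j, DifferentiableAt ℝ (c.A j) z := fun j =>
    ((hs.A_diff j).contDiffAt hnhds).differentiableAt (by simp)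
  have h0 := pd_inner_symm 0 hSd hwd (hf.S_symm z hz)
  have h1 := pd_inner_symm (M := fun y => c.S y ∘L c.A 0 y) 1 (hSd.clm_comp (hAd 0)) hwd
    (hf.SA_symm 0 z hz)
  have h2 := pd_inner_symm (M := fun y => c.S y ∘L c.A 1 y) 2 (hSd.clm_comp (hAd 1)) hwd
    (hf.SA_symm 1 z hz)
  have h3 := hf.energy z hz (w z)
  have h4 := inner_symm_le (hf.S_symm z hz)
    (fun v => le_trans (by have := hf.α₀_pos; positivity) (hf.lower z hz v))
    (hf.upper z hz) (w z) (c.op w z)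
  have e0 : pd 0 (c.density w) z = _ := h0
  have e1 : pd 1 (c.fluxDensity w 0) z = _ := h1
  have e2 : pd 2 (c.fluxDensity w 1) z = _ := h2
  rw [e0, e1, e2]
  simp only [op, map_add, inner_add_right, sub_apply, add_apply, smul_apply, inner_sub_right,
    inner_smul_right, comp_apply] at h3 h4 ⊢
  linarith

lemma le_density (hf : c.IsFriedrichs Γ T α₀ β₀ β₁) (w : SpaceTime → Vec n) (hz : z ∈ Γ.cyl T) :
    α₀ * ‖w z‖ ^ 2 ≤ c.density w z := hf.lower z hz _

lemma density_le (hf : c.IsFriedrichs Γ T α₀ β₀ β₁) (w : SpaceTime → Vec n) (hz : z ∈ Γ.cyl T) :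
    c.density w z ≤ β₀ * ‖w z‖ ^ 2 := hf.upper z hz _

lemma continuousOn_fluxDensity (hs : c.IsSmooth Γ T)
    (hw : ContinuousOn w (Icc 0 T ×ˢ closure Γ.ext)) (j : Fin 2) :
    ContinuousOn (c.fluxDensity w j) (Icc 0 T ×ˢ closure Γ.ext) :=
  hw.inner (hs.S_cont.clm_apply ((hs.A_cont j).clm_apply hw))

lemma abs_fluxDensity_le (hT : 0 < T) (hs : c.IsSmooth Γ T) (hf : c.IsFriedrichs Γ T α₀ β₀ β₁)
    (hA : ∀ j, ∀ z ∈ Γ.cyl T, ‖c.A j z‖ ≤ K₀) (hw : ContinuousOn w (Icc 0 T ×ˢ closure Γ.ext))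
    (j : Fin 2) : ∀ z ∈ Icc 0 T ×ˢ closure Γ.ext, |c.fluxDensity w j z| ≤ β₀ * K₀ * ‖w z‖ ^ 2 := by
  rw [← closure_cyl Γ hT]
  refine le_on_closure (fun z hz => ?_) ?_ ?_
  · have h0 : ∀ v, 0 ≤ inner ℝ v (c.S z v) := fun v =>
      le_trans (by have := hf.α₀_pos; positivity) (hf.lower z hz v)
    have h1 := inner_symm_le (hf.S_symm z hz) h0 (hf.upper z hz) (w z) (c.A j z (w z))
    have h2 := inner_symm_le (hf.S_symm z hz) h0 (hf.upper z hz) (w z) (-(c.A j z (w z)))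
    simp only [map_neg, inner_neg_right, norm_neg] at h2
    have h3 : β₀ * (‖w z‖ * ‖c.A j z (w z)‖) ≤ β₀ * K₀ * ‖w z‖ ^ 2 := by
      have := (c.A j z).le_of_opNorm_le (hA j z hz) (w z)
      have hβ := hf.β₀_pos
      calc β₀ * (‖w z‖ * ‖c.A j z (w z)‖) ≤ β₀ * (‖w z‖ * (K₀ * ‖w z‖)) := by gcongr
        _ = _ := by ring
    rw [abs_le, fluxDensity]
    constructor <;> linarith
  · rw [closure_cyl Γ hT]; exact (continuousOn_fluxDensity hs hw j).abs
  · rw [closure_cyl Γ hT]; exact continuousOn_const.mul (hw.norm.pow 2)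

lemma bdryTerm_eq (w : SpaceTime → Vec n) (t : ℝ) : c.bdryTerm Γ w t =
      ∫ s in (0)..Γ.L, ∑ j, c.fluxDensity w j (t, Γ.γ s) * unitNormal Γ.γ s j := by
  unfold bdryTerm
  refine integral_congr fun s _ => ?_
  simp only [Anor, Γ.normalField_curve, fluxDensity, sum_univ_two, add_apply, smul_apply,
    map_add, map_smul, inner_add_left, inner_smul_left]
  simp only [conj_trivial]
  rw [real_inner_comm (w _), real_inner_comm (w _)]
  ring

lemma continuousOn_bdryTerm (hT : 0 < T) (hs : c.IsSmooth Γ T)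
    (hw : ContinuousOn w (Icc 0 T ×ˢ closure Γ.ext)) : ContinuousOn (c.bdryTerm Γ w) (Icc 0 T) := by
  have h1 : Continuous fun q : ℝ × ℝ =>
      ∑ j, c.fluxDensity w j ((projIcc 0 T hT.le q.1 : ℝ), Γ.γ q.2) * unitNormal Γ.γ q.2 j := by
    refine continuous_finsetSum _ fun j _ => Continuous.mul ?_ ?_
    · refine (continuousOn_fluxDensity hs hw j).comp_continuous
        (f := fun q : ℝ × ℝ => ((projIcc 0 T hT.le q.1 : ℝ), Γ.γ q.2)) ?_ ?_
      · have := Γ.smooth.continuous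
        have h2 : Continuous fun q : ℝ × ℝ => (projIcc 0 T hT.le q.1 : ℝ) :=
          continuous_subtype_val.comp (continuous_projIcc.comp continuous_fst)
        fun_prop
      · intro q; exact ⟨(projIcc 0 T hT.le q.1).2, Γ.curve_mem_closure _⟩
    · exact ((contDiff_euclidean.1 Γ.contDiff_unitNormal j).continuous).comp continuous_snd
  have h2 := intervalIntegral.continuous_parametric_intervalIntegral_of_continuous (μ := volume)
    (a₀ := 0) (f := fun t s => ∑ j, c.fluxDensity w j ((projIcc 0 T hT.le t : ℝ), Γ.γ s) *
      unitNormal Γ.γ s j) h1 (s := fun _ => Γ.L) continuous_const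
  refine h2.continuousOn.congr fun t ht => ?_
  simp only [bdryTerm_eq, projIcc_of_mem hT.le ht]

end Coeffs

lemma stDir_succ (j : Fin 2) : stDir j.succ = (0, single j 1) := by
  fin_cases j <;> rfl

namespace BoundaryCurve

variable {χ : Plane → ℝ} {h : SpaceTime → ℝ}

lemma continuousOn_cut_mul (hχ : Continuous χ) (hsupp : tsupport χ ⊆ Γ.ext)
    (hh : ContinuousOn h (Γ.cyl T)) :
    ContinuousOn (fun z : ℝ × Plane => χ z.2 * h z) (Ioo 0 T ×ˢ univ) := by
  rintro z ⟨hz, -⟩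
  by_cases hx : z.2 ∈ Γ.ext
  · have h1 : ContinuousAt h z := hh.continuousAt ((Coeffs.isOpen_cyl Γ T).mem_nhds ⟨hz, hx⟩)
    exact ((hχ.continuousAt.comp continuousAt_snd).mul h1).continuousWithinAt
  · have h1 : χ =ᶠ[𝓝 z.2] 0 := notMem_tsupport_iff_eventuallyEq.1 fun h => hx (hsupp h)
    have h2 : (fun z : ℝ × Plane => χ z.2 * h z) =ᶠ[𝓝 z] fun _ => 0 := by
      filter_upwards [continuousAt_snd.eventually h1] with y hy
      simp [hy]
    exact (continuousAt_const.congr h2.symm).continuousWithinAt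

lemma continuousOn_cut_integral (hχ : Continuous χ) (hc : HasCompactSupport χ)
    (hsupp : tsupport χ ⊆ Γ.ext) (hh : ContinuousOn h (Γ.cyl T)) :
    ContinuousOn (fun t => ∫ x, χ x * h (t, x)) (Ioo 0 T) :=
  continuousOn_integral_of_compact_support hc (continuousOn_cut_mul hχ hsupp hh)
    fun _ x _ hx => by simp [image_eq_zero_of_notMem_tsupport hx]

lemma integrable_cut_mul (hχ : Continuous χ) (hc : HasCompactSupport χ) (hsupp : tsupport χ ⊆ Γ.ext)
    (hh : ContinuousOn h (Γ.cyl T)) (ht : t ∈ Ioo 0 T) : Integrable fun x => χ x * h (t, x) := by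
  refine Continuous.integrable_of_hasCompactSupport ?_ hc.mul_right
  exact (continuousOn_cut_mul hχ hsupp hh).comp_continuous (f := fun x => (t, x)) (by fun_prop)
    fun x => ⟨ht, mem_univ _⟩

lemma continuousOn_pd {h : SpaceTime → V} (hh : ContDiffOn ℝ 1 h (Γ.cyl T)) (i : Fin 3) :
    ContinuousOn (pd i h) (Γ.cyl T) :=
  (hh.continuousOn_fderiv_of_isOpen (Coeffs.isOpen_cyl Γ T) (by simp)).clm_apply continuousOn_const

lemma hasDerivAt_cut_integral (hχ : Continuous χ) (hc : HasCompactSupport χ)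
    (hsupp : tsupport χ ⊆ Γ.ext) (hh : ContDiffOn ℝ 1 h (Γ.cyl T)) (ht : t ∈ Ioo 0 T) :
    HasDerivAt (fun t => ∫ x, χ x * h (t, x)) (∫ x, χ x * pd 0 h (t, x)) t := by
  obtain ⟨δ, hδ, hsub⟩ := Metric.nhds_basis_closedBall.mem_iff.1 (Ioo_mem_nhds ht.1 ht.2)
  have hcont := continuousOn_cut_mul hχ hsupp (continuousOn_pd hh 0)
  have hK : IsCompact (closedBall t δ ×ˢ tsupport χ) := (isCompact_closedBall t δ).prod hc
  obtain ⟨M, hM⟩ := hK.exists_bound_of_continuousOn (hcont.mono (prod_mono hsub (subset_univ _)))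
  have hM0 : 0 ≤ max M 0 := le_max_right _ _
  refine (hasDerivAt_integral_of_dominated_loc_of_deriv_le (F := fun t x => χ x * h (t, x))
    (F' := fun t x => χ x * pd 0 h (t, x)) (bound := (tsupport χ).indicator fun _ => max M 0)
    (Metric.closedBall_mem_nhds t hδ) ?_ ?_ ?_ ?_ ?_ ?_).2
  · filter_upwards [Ioo_mem_nhds ht.1 ht.2] with τ hτ
    exact (integrable_cut_mul hχ hc hsupp hh.continuousOn hτ).1
  · exact integrable_cut_mul hχ hc hsupp hh.continuousOn ht
  · exact (integrable_cut_mul hχ hc hsupp (continuousOn_pd hh 0) ht).1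
  · refine Eventually.of_forall fun x τ hτ => ?_
    by_cases hx : x ∈ tsupport χ
    · rw [indicator_of_mem hx]
      exact (hM (τ, x) ⟨hτ, hx⟩).trans (le_max_left _ _)
    · simp [image_eq_zero_of_notMem_tsupport hx, indicator_of_notMem hx]
  · exact (integrable_indicator_iff (isClosed_tsupport χ).measurableSet).2
      (integrableOn_const (hc.measure_lt_top.ne))
  · refine Eventually.of_forall fun x τ hτ => ?_
    by_cases hx : x ∈ Γ.ext
    · have h1 : HasFDerivAt h (fderiv ℝ h (τ, x)) (τ, x) :=
        ((hh.contDiffAt ((Coeffs.isOpen_cyl Γ T).mem_nhds ⟨hsub hτ, hx⟩)).differentiableAt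
          (by simp)).hasFDerivAt
      have h2 : HasDerivAt (fun τ : ℝ => (τ, x)) ((1 : ℝ), (0 : Plane)) τ :=
        (hasDerivAt_id τ).prodMk (hasDerivAt_const τ x)
      exact (h1.comp_hasDerivAt τ h2).const_mul (χ x)
    · have : χ x = 0 := image_eq_zero_of_notMem_tsupport fun h => hx (hsupp h)
      simp [this, hasDerivAt_const]

lemma integral_cut_mul_pd (hχ : ContDiff ℝ 1 χ) (hc : HasCompactSupport χ)
    (hsupp : tsupport χ ⊆ Γ.ext) (hh : ContDiffOn ℝ 1 h (Γ.cyl T)) (ht : t ∈ Ioo 0 T) (j : Fin 2) :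
    ∫ x, χ x * pd j.succ h (t, x) = - ∫ x, fderiv ℝ χ x (single j 1) * h (t, x) := by
  have hder : ∀ x ∈ Γ.ext, HasFDerivAt (fun x => h (t, x))
      ((fderiv ℝ h (t, x)).comp (inr ℝ ℝ Plane)) x := fun x hx => by
    have h1 : HasFDerivAt h (fderiv ℝ h (t, x)) (t, x) :=
      ((hh.contDiffAt ((Coeffs.isOpen_cyl Γ T).mem_nhds ⟨ht, hx⟩)).differentiableAt
        (by simp)).hasFDerivAt
    exact h1.comp x (hasFDerivAt_prodMk_right t x)
  have heq : ∀ x, χ x * pd j.succ h (t, x) =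
      χ x * fderiv ℝ (fun x => h (t, x)) x (single j 1) := fun x => by
    by_cases hx : x ∈ Γ.ext
    · rw [(hder x hx).fderiv, pd, stDir_succ]; rfl
    · simp [image_eq_zero_of_notMem_tsupport fun h => hx (hsupp h)]
  have hsupp' : tsupport (fun x => fderiv ℝ χ x (single j 1)) ⊆ Γ.ext :=
    (tsupport_fderiv_apply_subset ℝ _).trans hsupp
  have hcont' : Continuous fun x => fderiv ℝ χ x (single j 1) :=
    (hχ.continuous_fderiv (by simp)).clm_apply continuous_const
  simp_rw [heq]
  refine integral_mul_fderiv_eq_neg_fderiv_mul_of_integrable ?_ ?_ ?_ ?_ ?_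
  · exact integrable_cut_mul hcont' (hc.fderiv_apply ℝ _) hsupp' hh.continuousOn ht
  · simp_rw [← heq]
    exact integrable_cut_mul hχ.continuous hc hsupp (continuousOn_pd hh _) ht
  · exact integrable_cut_mul hχ.continuous hc hsupp hh.continuousOn ht
  · exact fun x _ => hχ.differentiable (by simp) x
  · exact fun x hx => (hder x (hsupp hx)).differentiableAt

end BoundaryCurve

namespace Coeffs

open BoundaryCurve

lemma contDiffOn_density (hs : c.IsSmooth Γ T) (hw : ContDiffOn ℝ 1 w (Γ.cyl T)) :
    ContDiffOn ℝ 1 (c.density w) (Γ.cyl T) :=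
  hw.inner ℝ (hs.S_diff.clm_apply hw)

lemma contDiffOn_fluxDensity (hs : c.IsSmooth Γ T) (hw : ContDiffOn ℝ 1 w (Γ.cyl T)) (j : Fin 2) :
    ContDiffOn ℝ 1 (c.fluxDensity w j) (Γ.cyl T) :=
  hw.inner ℝ (hs.S_diff.clm_apply ((hs.A_diff j).clm_apply hw))

lemma continuousOn_op (hs : c.IsSmooth Γ T) (hw : ContDiffOn ℝ 1 w (Γ.cyl T)) :
    ContinuousOn (c.op w) (Γ.cyl T) :=
  (((continuousOn_pd hw 0).add ((hs.A_diff 0).continuousOn.clm_apply (continuousOn_pd hw 1))).add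
    ((hs.A_diff 1).continuousOn.clm_apply (continuousOn_pd hw 2))).add
    (hs.B_cont.clm_apply hw.continuousOn)

/-- The right-hand side of the localized energy balance. -/
noncomputable def cutRate (c : Coeffs n) (w : SpaceTime → Vec n) (χ : Plane → ℝ) (lam α₀ β₀ τ : ℝ) :
    ℝ :=
  (∫ x, ∑ j, c.fluxDensity w j (τ, x) * fderiv ℝ χ x (single j 1))
    - lam * α₀ * (∫ x, χ x * ‖w (τ, x)‖ ^ 2)
    + 2 * β₀ * ∫ x, χ x * (‖w (τ, x)‖ * ‖c.op w (τ, x)‖)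

/-- The energy balance, localized by a cut-off function. -/
lemma cut_energy (hs : c.IsSmooth Γ T) (hf : c.IsFriedrichs Γ T α₀ β₀ β₁) (hβ : β₁ ≤ α₀ * K)
    (hw : ContDiffOn ℝ 1 w (Γ.cyl T)) {χ : Plane → ℝ} (hχ : ContDiff ℝ 1 χ)
    (hc : HasCompactSupport χ) (hsupp : tsupport χ ⊆ Γ.ext) (hχ0 : ∀ x, 0 ≤ χ x) (hlam : K ≤ lam)
    (hl0 : 0 ≤ lam) {t₁ t₂ : ℝ} (h1 : 0 < t₁) (h12 : t₁ ≤ t₂) (h2 : t₂ < T) :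
    ContinuousOn (fun τ => exp (-2 * lam * τ) * c.cutRate w χ lam α₀ β₀ τ) (Icc t₁ t₂) ∧
    α₀ * (exp (-2 * lam * t₂) * ∫ x, χ x * ‖w (t₂, x)‖ ^ 2) ≤
      β₀ * (∫ x, χ x * ‖w (t₁, x)‖ ^ 2) + ∫ τ in t₁..t₂, exp (-2 * lam * τ) *
        c.cutRate w χ lam α₀ β₀ τ := by
  have hα := hf.α₀_pos
  have hβ0 := hf.β₀_pos
  have hχc := hχ.continuous
  have hsub : Icc t₁ t₂ ⊆ Ioo 0 T := fun τ hτ => ⟨h1.trans_le hτ.1, hτ.2.trans_lt h2⟩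
  have hd := contDiffOn_density hs hw
  have hF := contDiffOn_fluxDensity hs hw
  have hw2 : ContinuousOn (fun z => ‖w z‖ ^ 2) (Γ.cyl T) := hw.continuousOn.norm.pow 2
  have hwop : ContinuousOn (fun z => ‖w z‖ * ‖c.op w z‖) (Γ.cyl T) :=
    hw.continuousOn.norm.mul (continuousOn_op hs hw).norm
  have hsupp' : ∀ j : Fin 2, tsupport (fun x => fderiv ℝ χ x (single j 1)) ⊆ Γ.ext := fun j =>
    (tsupport_fderiv_apply_subset ℝ _).trans hsupp
  have hcont' : ∀ j : Fin 2, Continuous fun x => fderiv ℝ χ x (single j 1) :=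
    fun j => (hχ.continuous_fderiv (by simp)).clm_apply continuous_const
  have hb : ∀ τ ∈ Ioo 0 T, ∫ x, ∑ j, c.fluxDensity w j (τ, x) * fderiv ℝ χ x (single j 1) =
      ∑ j, ∫ x, fderiv ℝ χ x (single j 1) * c.fluxDensity w j (τ, x) := by
    intro τ hτ
    rw [← integral_finsetSum]
    · simp_rw [mul_comm]
    · exact fun j _ => integrable_cut_mul (hcont' j) (hc.fderiv_apply ℝ _) (hsupp' j)
        (hF j).continuousOn hτ
  set Y : ℝ → ℝ := fun t => ∫ x, χ x * c.density w (t, x)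
  have hder : ∀ τ ∈ Ioo 0 T, HasDerivAt (fun t => exp (-2 * lam * t) * Y t)
      (exp (-2 * lam * τ) * (-2 * lam) * Y τ +
        exp (-2 * lam * τ) * ∫ x, χ x * pd 0 (c.density w) (τ, x)) τ := by
    intro τ hτ
    have e1 : HasDerivAt (fun t => exp (-2 * lam * t)) (exp (-2 * lam * τ) * (-2 * lam)) τ := by
      simpa using ((hasDerivAt_id τ).const_mul (-2 * lam)).exp
    exact e1.mul (hasDerivAt_cut_integral hχc hc hsupp hd hτ)
  have hYlow : ∀ τ ∈ Ioo 0 T, α₀ * (∫ x, χ x * ‖w (τ, x)‖ ^ 2) ≤ Y τ := by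
    intro τ hτ
    rw [← integral_const_mul]
    refine integral_mono ((integrable_cut_mul hχc hc hsupp hw2 hτ).const_mul _)
      (integrable_cut_mul hχc hc hsupp hd.continuousOn hτ) fun x => ?_
    by_cases hx : x ∈ Γ.ext
    · have := le_density hf w (z := (τ, x)) ⟨hτ, hx⟩
      calc α₀ * (χ x * ‖w (τ, x)‖ ^ 2) = χ x * (α₀ * ‖w (τ, x)‖ ^ 2) := by ring
        _ ≤ _ := mul_le_mul_of_nonneg_left this (hχ0 x)
    · simp [image_eq_zero_of_notMem_tsupport fun h => hx (hsupp h)]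
  have hYup : ∀ τ ∈ Ioo 0 T, Y τ ≤ β₀ * (∫ x, χ x * ‖w (τ, x)‖ ^ 2) := by
    intro τ hτ
    rw [← integral_const_mul]
    refine integral_mono (integrable_cut_mul hχc hc hsupp hd.continuousOn hτ)
      ((integrable_cut_mul hχc hc hsupp hw2 hτ).const_mul _) fun x => ?_
    by_cases hx : x ∈ Γ.ext
    · have := density_le hf w (z := (τ, x)) ⟨hτ, hx⟩
      calc _ ≤ χ x * (β₀ * ‖w (τ, x)‖ ^ 2) := mul_le_mul_of_nonneg_left this (hχ0 x)
        _ = _ := by ring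
    · simp [image_eq_zero_of_notMem_tsupport fun h => hx (hsupp h)]
  have hnn : ∀ τ, 0 ≤ ∫ x, χ x * ‖w (τ, x)‖ ^ 2 := fun τ =>
    integral_nonneg fun x => mul_nonneg (hχ0 x) (by positivity)
  have hle : ∀ τ ∈ Ioo 0 T, ∫ x, χ x * pd 0 (c.density w) (τ, x) ≤
      (∑ j, ∫ x, fderiv ℝ χ x (single j 1) * c.fluxDensity w j (τ, x)) +
        (β₁ * (∫ x, χ x * ‖w (τ, x)‖ ^ 2) +
          2 * β₀ * ∫ x, χ x * (‖w (τ, x)‖ * ‖c.op w (τ, x)‖)) := by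
    intro τ hτ
    have i0 := integrable_cut_mul hχc hc hsupp (continuousOn_pd hd 0) hτ
    have i1 := integrable_cut_mul hχc hc hsupp (continuousOn_pd (hF 0) 1) hτ
    have i2 := integrable_cut_mul hχc hc hsupp (continuousOn_pd (hF 1) 2) hτ
    have i3 := (integrable_cut_mul hχc hc hsupp hw2 hτ).const_mul β₁
    have i4 := (integrable_cut_mul hχc hc hsupp hwop hτ).const_mul (2 * β₀)
    have e1 := integral_cut_mul_pd hχ hc hsupp (hF 0) hτ 0
    have e2 := integral_cut_mul_pd hχ hc hsupp (hF 1) hτ 1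
    have e3 : ∫ x, (χ x * pd 0 (c.density w) (τ, x) + χ x * pd 1 (c.fluxDensity w 0) (τ, x)
        + χ x * pd 2 (c.fluxDensity w 1) (τ, x)) ≤
        ∫ x, (β₁ * (χ x * ‖w (τ, x)‖ ^ 2) + 2 * β₀ * (χ x * (‖w (τ, x)‖ * ‖c.op w (τ, x)‖))) := by
      refine integral_mono ((i0.add i1).add i2) (i3.add i4) fun x => ?_
      by_cases hx : x ∈ Γ.ext
      · have := mul_le_mul_of_nonneg_left
          (energy_identity hs hf hw (z := (τ, x)) ⟨hτ, hx⟩) (hχ0 x)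
        simp only
        linarith
      · simp [image_eq_zero_of_notMem_tsupport fun h => hx (hsupp h)]
    rw [integral_add (by exact i0.add i1) i2, integral_add i0 i1, integral_add i3 i4,
      integral_const_mul, integral_const_mul] at e3
    rw [sum_univ_two]
    simp only [Fin.succ_zero_eq_one, Fin.succ_one_eq_two] at e1 e2
    rw [e1, e2] at e3
    linarith
  have hgc : ContinuousOn (fun t => exp (-2 * lam * t) * Y t) (Icc t₁ t₂) := fun τ hτ =>
    (hder τ (hsub hτ)).continuousAt.continuousWithinAt
  have hφ : ContinuousOn (fun τ => exp (-2 * lam * τ) * c.cutRate w χ lam α₀ β₀ τ) (Icc t₁ t₂) := by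
    unfold cutRate
    refine ContinuousOn.mono ?_ hsub
    refine ContinuousOn.mul (by fun_prop) (((?_ : ContinuousOn _ _).sub (continuousOn_const.mul
      (continuousOn_cut_integral hχc hc hsupp hw2))).add (continuousOn_const.mul
      (continuousOn_cut_integral hχc hc hsupp hwop)))
    refine ContinuousOn.congr ?_ hb
    exact continuousOn_finsetSum _ fun j _ => continuousOn_cut_integral (hcont' j)
      (hc.fderiv_apply ℝ _) (hsupp' j) (hF j).continuousOn
  have hmain := intervalIntegral.sub_le_integral_of_hasDeriv_right_of_le h12 hgc
    (fun τ hτ => (hder τ (hsub (Ioo_subset_Icc_self hτ))).hasDerivWithinAt)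
    (hφ.integrableOn_compact isCompact_Icc) (fun τ hτ => by
      have hτ' := hsub (Ioo_subset_Icc_self hτ)
      have e1 := hle τ hτ'
      have e2 := hYlow τ hτ'
      rw [cutRate, hb τ hτ', mul_assoc, ← mul_add]
      refine mul_le_mul_of_nonneg_left ?_ (exp_pos _).le
      have e3 : β₁ * (∫ x, χ x * ‖w (τ, x)‖ ^ 2) ≤ α₀ * lam * ∫ x, χ x * ‖w (τ, x)‖ ^ 2 :=
        mul_le_mul_of_nonneg_right (hβ.trans (mul_le_mul_of_nonneg_left hlam hα.le)) (hnn τ)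
      have e4 : lam * (α₀ * ∫ x, χ x * ‖w (τ, x)‖ ^ 2) ≤ lam * Y τ :=
        mul_le_mul_of_nonneg_left e2 hl0
      linarith)
  have f1 := hYlow t₂ (hsub (right_mem_Icc.2 h12))
  have f2 := hYup t₁ (hsub (left_mem_Icc.2 h12))
  have f3 : exp (-2 * lam * t₁) * Y t₁ ≤ β₀ * ∫ x, χ x * ‖w (t₁, x)‖ ^ 2 := by
    refine le_trans ?_ f2
    have g1 : 0 ≤ Y t₁ := le_trans (mul_nonneg hα.le (hnn t₁)) (hYlow t₁ (hsub (left_mem_Icc.2 h12)))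
    have g2 : exp (-2 * lam * t₁) ≤ 1 := Real.exp_le_one_iff.2 (by nlinarith)
    nlinarith
  have f4 : α₀ * (exp (-2 * lam * t₂) * ∫ x, χ x * ‖w (t₂, x)‖ ^ 2) ≤
      exp (-2 * lam * t₂) * Y t₂ := by
    calc _ = exp (-2 * lam * t₂) * (α₀ * ∫ x, χ x * ‖w (t₂, x)‖ ^ 2) := by ring
      _ ≤ _ := mul_le_mul_of_nonneg_left f1 (exp_pos _).le
  exact ⟨hφ, by linarith⟩

end Coeffs

namespace Coeffs

open BoundaryCurve

lemma integral_cut_eq {χ : Plane → ℝ} (hsupp : tsupport χ ⊆ Γ.ext) (f : Plane → ℝ) :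
    ∫ x, χ x * f x = ∫ x in Γ.ext, χ x * f x := by
  rw [setIntegral_eq_integral_of_forall_compl_eq_zero]
  intro x hx
  simp [image_eq_zero_of_notMem_tsupport fun h => hx (hsupp h)]

/-- The basic energy estimate. -/
theorem energy_estimate (hT : 0 < T) (hs : c.IsSmooth Γ T) (hf : c.IsFriedrichs Γ T α₀ β₀ β₁)
    (hA : ∀ j, ∀ z ∈ Γ.cyl T, ‖c.A j z‖ ≤ K₀) (hK₀ : 0 ≤ K₀) (hβ : β₁ ≤ α₀ * K)
    (hw : ContDiffOn ℝ 1 w (Γ.cyl T)) (hwc : ContinuousOn w (Icc 0 T ×ˢ closure Γ.ext))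
    (hwL : ContInLp Γ.ext T 2 w) {G : ℝ → ℝ} (hG : ContinuousOn G (Icc 0 T)) (hG0 : ∀ t, 0 ≤ G t)
    (hop : ∀ᵐ t ∂time[T], eLpNorm (fun x => c.op w (t, x)) 2 vol[Γ] ≤ ofReal (G t)) (hlam : K ≤ lam)
    (hl0 : 0 ≤ lam) (ht : t ∈ Icc 0 T) :
    α₀ * (exp (-2 * lam * t) * lpNormOn Γ.ext 2 (fun x => w (t, x)) ^ 2) ≤
      β₀ * lpNormOn Γ.ext 2 (fun x => w (0, x)) ^ 2 +
      ∫ τ in (0)..t, exp (-2 * lam * τ) * (c.bdryTerm Γ w τ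
        - lam * α₀ * lpNormOn Γ.ext 2 (fun x => w (τ, x)) ^ 2
        + 2 * β₀ * (G τ * lpNormOn Γ.ext 2 (fun x => w (τ, x)))) := by
  have hα := hf.α₀_pos
  have hβ0 := hf.β₀_pos
  set N : ℝ → ℝ := fun t => lpNormOn Γ.ext 2 (fun x => w (t, x)) with hN
  have hNc : ContinuousOn N (Icc 0 T) := hwL.continuousOn_norm (by norm_num)
  have hN0 : ∀ t, 0 ≤ N t := fun t => lpNormOn_nonneg _ _ _
  have hNsq : ∀ t ∈ Icc 0 T, N t ^ 2 = ∫ x in Γ.ext, ‖w (t, x)‖ ^ 2 := fun t ht =>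
    lpNormOn_two_sq (hwL.memLp_two ht)
  have hint : ∀ t ∈ Icc 0 T, IntegrableOn (fun x => ‖w (t, x)‖ ^ 2) Γ.ext := fun t ht =>
    (hwL.memLp_two ht).integrable_norm_pow (by norm_num)
  set h : ℝ → ℝ := fun τ => exp (-2 * lam * τ) * (c.bdryTerm Γ w τ
        - lam * α₀ * N τ ^ 2 + 2 * β₀ * (G τ * N τ)) with hh
  have hhc : ContinuousOn h (Icc 0 T) :=
    ContinuousOn.mul (by fun_prop) (((continuousOn_bdryTerm hT hs hwc).sub
      (continuousOn_const.mul (hNc.pow 2))).add (continuousOn_const.mul (hG.mul hNc)))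
  obtain ⟨χ, hχs, hχc, hsupp, hχ0, hχ1, hχlim, hχflux⟩ := Γ.exists_cutoff
  -- the flux term
  obtain ⟨M₁, hM₁⟩ := isCompact_Icc.exists_bound_of_continuousOn (hNc.pow 2)
  have hflux := hχflux T (β₀ * K₀ * M₁) (c.fluxDensity w)
    (fun j => continuousOn_fluxDensity hs hwc j) (by
      intro τ hτ j
      have hb : ∀ x ∈ Γ.ext, |c.fluxDensity w j (τ, x)| ≤ β₀ * K₀ * ‖w (τ, x)‖ ^ 2 := fun x hx =>
        abs_fluxDensity_le hT hs hf hA hwc j (τ, x) ⟨hτ, subset_closure hx⟩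
      have hI : IntegrableOn (fun x => c.fluxDensity w j (τ, x)) Γ.ext := by
        refine Integrable.mono' ((hint τ hτ).const_mul (β₀ * K₀)) ?_
          ((ae_restrict_iff' Γ.measurableSet_ext).2 (.of_forall hb))
        refine ContinuousOn.aestronglyMeasurable ?_ Γ.measurableSet_ext
        exact (continuousOn_fluxDensity hs hwc j).comp (by fun_prop)
          fun x hx => ⟨hτ, subset_closure hx⟩
      refine ⟨hI, ?_⟩
      calc ∫ x in Γ.ext, |c.fluxDensity w j (τ, x)|
          ≤ ∫ x in Γ.ext, β₀ * K₀ * ‖w (τ, x)‖ ^ 2 :=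
            setIntegral_mono_on hI.abs ((hint τ hτ).const_mul _) Γ.measurableSet_ext hb
        _ = β₀ * K₀ * N τ ^ 2 := by rw [integral_const_mul, hNsq τ hτ]
        _ ≤ _ := by
          refine mul_le_mul_of_nonneg_left ?_ (by positivity)
          exact (le_abs_self _).trans (hM₁ τ hτ))
  -- convergence of the localized norms
  have hnlim : ∀ τ ∈ Icc 0 T,
      Tendsto (fun k => ∫ x, χ k x * ‖w (τ, x)‖ ^ 2) atTop (𝓝 (N τ ^ 2)) := by
    intro τ hτ
    simp_rw [fun k => integral_cut_eq (hsupp k) fun x => ‖w (τ, x)‖ ^ 2]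
    rw [hNsq τ hτ]
    refine tendsto_integral_of_dominated_convergence (fun x => ‖w (τ, x)‖ ^ 2) ?_ (hint τ hτ) ?_ ?_
    · exact fun k => (hχs k).continuous.aestronglyMeasurable.mul (hint τ hτ).1
    · refine fun k => Eventually.of_forall fun x => ?_
      rw [norm_mul, norm_of_nonneg (hχ0 k x), norm_of_nonneg (by positivity)]
      exact mul_le_of_le_one_left (by positivity) (hχ1 k x)
    · refine (ae_restrict_iff' Γ.measurableSet_ext).2 (.of_forall fun x hx => ?_)
      refine tendsto_const_nhds.congr' ?_
      filter_upwards [hχlim x hx] with k hk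
      rw [hk, one_mul]
  have hnle : ∀ k, ∀ τ ∈ Icc 0 T, ∫ x, χ k x * ‖w (τ, x)‖ ^ 2 ≤ N τ ^ 2 := by
    intro k τ hτ
    rw [integral_cut_eq (hsupp k), hNsq τ hτ]
    refine integral_mono_of_nonneg (.of_forall fun x =>
      mul_nonneg (hχ0 k x) (by positivity)) (hint τ hτ) (.of_forall fun x => ?_)
    exact mul_le_of_le_one_left (by positivity) (hχ1 k x)
  have hn0 : ∀ k τ, 0 ≤ ∫ x, χ k x * ‖w (τ, x)‖ ^ 2 := fun k τ =>
    integral_nonneg fun x => mul_nonneg (hχ0 k x) (by positivity)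
  have hopm : ∀ τ ∈ Ioo 0 T, AEStronglyMeasurable (fun x => c.op w (τ, x))
      vol[Γ] := fun τ hτ =>
    ((continuousOn_op hs hw).comp (f := fun x : Plane => (τ, x)) (by fun_prop)
      fun x hx => ⟨hτ, hx⟩).aestronglyMeasurable Γ.measurableSet_ext
  have hopw : ∀ᵐ τ ∂time[T], ∀ k, ∫ x, χ k x * (‖w (τ, x)‖ * ‖c.op w (τ, x)‖) ≤ G τ * N τ := by
    filter_upwards [hop, ae_restrict_mem measurableSet_Ioo] with τ hτ hτI k
    have hτ' := Ioo_subset_Icc_self hτI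
    have hm : MemLp (fun x => c.op w (τ, x)) 2 vol[Γ] :=
      ⟨hopm τ hτI, hτ.trans_lt ENNReal.ofReal_lt_top⟩
    rw [integral_cut_eq (hsupp k)]
    have e1 : ∫ x in Γ.ext, χ k x * (‖w (τ, x)‖ * ‖c.op w (τ, x)‖) ≤
        ∫ x in Γ.ext, ‖w (τ, x)‖ * ‖c.op w (τ, x)‖ := by
      refine integral_mono_of_nonneg (.of_forall fun x => mul_nonneg (hχ0 k x) (by positivity))
        ((hwL.memLp_two hτ').norm.integrable_mul hm.norm) (.of_forall fun x => ?_)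
      exact mul_le_of_le_one_left (by positivity) (hχ1 k x)
    have e2 := integral_norm_mul_le (hwL.memLp_two hτ') hm
    have e3 : lpNormOn Γ.ext 2 (fun x => c.op w (τ, x)) ≤ G τ := by
      rw [lpNormOn, ofReal_ofNat]
      exact ENNReal.toReal_le_of_le_ofReal (hG0 τ) hτ
    calc _ ≤ N τ * lpNormOn Γ.ext 2 (fun x => c.op w (τ, x)) := e1.trans e2
      _ ≤ N τ * G τ := mul_le_mul_of_nonneg_left e3 (hN0 τ)
      _ = _ := mul_comm _ _
  have hexp1 : ∀ τ, 0 ≤ τ → exp (-2 * lam * τ) ≤ 1 := fun τ hτ =>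
    Real.exp_le_one_iff.2 (by nlinarith)
  -- the estimate on interior time intervals
  have hP : ∀ t₁ t₂, 0 < t₁ → t₁ ≤ t₂ → t₂ < T →
      α₀ * (exp (-2 * lam * t₂) * N t₂ ^ 2) ≤ β₀ * N t₁ ^ 2 + ∫ τ in t₁..t₂, h τ := by
    intro t₁ t₂ h1 h12 h2
    have hsub : Icc t₁ t₂ ⊆ Ioo 0 T := fun τ hτ => ⟨h1.trans_le hτ.1, hτ.2.trans_lt h2⟩
    have hsub' : Icc t₁ t₂ ⊆ Icc 0 T := hsub.trans Ioo_subset_Icc_self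
    have ht1 := hsub' (left_mem_Icc.2 h12)
    have ht2 := hsub' (right_mem_Icc.2 h12)
    have hnk : ∀ k, ContinuousOn (fun τ => ∫ x, χ k x * ‖w (τ, x)‖ ^ 2) (Icc t₁ t₂) := fun k =>
      (continuousOn_cut_integral (h := fun z => ‖w z‖ ^ 2) (hχs k).continuous (hχc k) (hsupp k)
        (hw.continuousOn.norm.pow 2)).mono hsub
    have hdef : Tendsto (fun k => ∫ τ in t₁..t₂, (N τ ^ 2 - ∫ x, χ k x * ‖w (τ, x)‖ ^ 2)) atTop
        (𝓝 0) := by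
      have := intervalIntegral.tendsto_integral_filter_of_dominated_convergence (μ := volume)
        (a := t₁) (b := t₂) (l := atTop)
        (F := fun k τ => N τ ^ 2 - ∫ x, χ k x * ‖w (τ, x)‖ ^ 2) (f := fun _ => 0)
        (fun τ => N τ ^ 2) (.of_forall fun k => ?_)
        (.of_forall fun k => Eventually.of_forall fun τ hτ => ?_) ?_
        (.of_forall fun τ hτ => ?_)
      · simpa using this
      · rw [uIoc_of_le h12]
        exact ((((hNc.mono hsub').pow 2).sub (hnk k)).mono Ioc_subset_Icc_self).aestronglyMeasurable
          measurableSet_Ioc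
      · rw [uIoc_of_le h12] at hτ
        have hτ' := hsub' (Ioc_subset_Icc_self hτ)
        rw [norm_of_nonneg (by linarith [hnle k τ hτ'])]
        linarith [hn0 k τ]
      · exact (((hNc.mono hsub').pow 2).mono (by rw [uIcc_of_le h12])).intervalIntegrable
      · rw [uIoc_of_le h12] at hτ
        have := (hnlim τ (hsub' (Ioc_subset_Icc_self hτ))).const_sub (N τ ^ 2)
        simpa using this
    have hη : ∀ η > 0, α₀ * (exp (-2 * lam * t₂) * N t₂ ^ 2) ≤
        β₀ * N t₁ ^ 2 + (∫ τ in t₁..t₂, h τ) + η * (t₂ - t₁) := by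
      intro η hη
      have hev : ∀ᶠ k in atTop, α₀ * (exp (-2 * lam * t₂) * ∫ x, χ k x * ‖w (t₂, x)‖ ^ 2) ≤
          β₀ * N t₁ ^ 2 + (∫ τ in t₁..t₂, h τ) + η * (t₂ - t₁) +
            lam * α₀ * ∫ τ in t₁..t₂, (N τ ^ 2 - ∫ x, χ k x * ‖w (τ, x)‖ ^ 2) := by
        filter_upwards [hflux η hη] with k hk
        obtain ⟨hrc, hce⟩ := cut_energy hs hf hβ hw ((hχs k).of_le (by simp)) (hχc k) (hsupp k)
          (hχ0 k) hlam hl0 h1 h12 h2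
        have i1 : IntervalIntegrable h volume t₁ t₂ :=
          ((hhc.mono hsub').mono (by rw [uIcc_of_le h12])).intervalIntegrable
        have i2 : IntervalIntegrable (fun τ => lam * α₀ *
            (N τ ^ 2 - ∫ x, χ k x * ‖w (τ, x)‖ ^ 2)) volume t₁ t₂ :=
          ((continuousOn_const.mul (((hNc.mono hsub').pow 2).sub (hnk k))).mono
            (by rw [uIcc_of_le h12])).intervalIntegrable
        have i3 : IntervalIntegrable (fun _ : ℝ => η) volume t₁ t₂ := intervalIntegrable_const
        have hmono : ∫ τ in t₁..t₂, exp (-2 * lam * τ) * c.cutRate w (χ k) lam α₀ β₀ τ ≤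
            ∫ τ in t₁..t₂, (h τ + η + lam * α₀ * (N τ ^ 2 - ∫ x, χ k x * ‖w (τ, x)‖ ^ 2)) := by
          refine intervalIntegral.integral_mono_ae_restrict h12
            ((hrc.mono (by rw [uIcc_of_le h12])).intervalIntegrable) ((i1.add i3).add i2) ?_
          have hop' := ae_restrict_of_ae_restrict_of_subset hsub hopw
          filter_upwards [hop', ae_restrict_mem measurableSet_Icc] with τ hτ hτI
          have hτ' := hsub' hτI
          have e1 := hk τ hτ'
          rw [← bdryTerm_eq] at e1
          have e2 := (abs_le.1 e1).2
          have e3 := hτ k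
          have e4 := hnle k τ hτ'
          have e5 := hexp1 τ hτ'.1
          have e6 := exp_pos (-2 * lam * τ)
          simp only [hh, cutRate]
          set E := exp (-2 * lam * τ)
          set b := ∫ x, ∑ j, c.fluxDensity w j (τ, x) * fderiv ℝ (χ k) x (single j 1)
          set m := ∫ x, χ k x * ‖w (τ, x)‖ ^ 2
          set o := ∫ x, χ k x * (‖w (τ, x)‖ * ‖c.op w (τ, x)‖)
          have e7 : b - lam * α₀ * m + 2 * β₀ * o ≤ (c.bdryTerm Γ w τ - lam * α₀ * N τ ^ 2 +
              2 * β₀ * (G τ * N τ)) + (η + lam * α₀ * (N τ ^ 2 - m)) := by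
            have := mul_le_mul_of_nonneg_left e3 (by linarith : 0 ≤ 2 * β₀)
            linarith
          have e8 : 0 ≤ η + lam * α₀ * (N τ ^ 2 - m) := by
            have := mul_nonneg (mul_nonneg hl0 hα.le) (sub_nonneg.2 e4)
            linarith
          calc E * (b - lam * α₀ * m + 2 * β₀ * o) ≤ E * ((c.bdryTerm Γ w τ - lam * α₀ * N τ ^ 2 +
              2 * β₀ * (G τ * N τ)) + (η + lam * α₀ * (N τ ^ 2 - m))) :=
                mul_le_mul_of_nonneg_left e7 e6.le
            _ ≤ _ := by nlinarith
        rw [intervalIntegral.integral_add (i1.add i3) i2, intervalIntegral.integral_add i1 i3,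
          intervalIntegral.integral_const_mul, intervalIntegral.integral_const, smul_eq_mul] at hmono
        have := mul_le_mul_of_nonneg_left (hnle k t₁ ht1) hβ0.le
        linarith
      have l1 := ((hnlim t₂ ht2).const_mul (exp (-2 * lam * t₂))).const_mul α₀
      have l2 := (hdef.const_mul (lam * α₀)).const_add
        (β₀ * N t₁ ^ 2 + (∫ τ in t₁..t₂, h τ) + η * (t₂ - t₁))
      rw [mul_zero, add_zero] at l2
      exact le_of_tendsto_of_tendsto l1 l2 hev
    refine le_of_forall_pos_le_add fun δ hδ => ?_
    have h3 : 0 < t₂ - t₁ + 1 := by linarith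
    have := hη (δ / (t₂ - t₁ + 1)) (by positivity)
    have h4 : δ / (t₂ - t₁ + 1) * (t₂ - t₁) ≤ δ := by
      rw [div_mul_eq_mul_div, div_le_iff₀ h3]; nlinarith
    linarith
  -- extension to the closed time interval
  have hprim : ContinuousOn (fun t => ∫ τ in (0)..t, h τ) (Icc 0 T) := by
    have := intervalIntegral.continuousOn_primitive_interval (μ := volume) (a := 0) (b := T)
      (f := h) (by rw [uIcc_of_le hT.le]; exact hhc.integrableOn_compact isCompact_Icc)
    rwa [uIcc_of_le hT.le] at this
  have hii : ∀ a ∈ Icc 0 T, ∀ b ∈ Icc 0 T, IntervalIntegrable h volume a b := fun a ha b hb =>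
    (hhc.mono ((convex_Icc 0 T).ordConnected.uIcc_subset ha hb)).intervalIntegrable
  have h0T : (0 : ℝ) ∈ Icc 0 T := ⟨le_rfl, hT.le⟩
  have hQ : ∀ t₂ ∈ Ioo 0 T, α₀ * (exp (-2 * lam * t₂) * N t₂ ^ 2) ≤
      β₀ * N 0 ^ 2 + ∫ τ in (0)..t₂, h τ := by
    intro t₂ ht₂
    have hsub : Icc 0 t₂ ⊆ Icc 0 T := Icc_subset_Icc le_rfl ht₂.2.le
    have e := le_on_closure (s := Ioo 0 t₂) (f := fun _ => α₀ * (exp (-2 * lam * t₂) * N t₂ ^ 2))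
      (g := fun t₁ => β₀ * N t₁ ^ 2 + ((∫ τ in (0)..t₂, h τ) - ∫ τ in (0)..t₁, h τ))
      (fun t₁ ht₁ => by
        have := hP t₁ t₂ ht₁.1 ht₁.2.le ht₂.2
        rwa [← intervalIntegral.integral_interval_sub_left (hii 0 h0T t₂ (Ioo_subset_Icc_self ht₂))
          (hii 0 h0T t₁ (hsub (Ioo_subset_Icc_self ht₁)))] at this)
      continuousOn_const
      (by
        rw [closure_Ioo ht₂.1.ne]
        exact (continuousOn_const.mul ((hNc.mono hsub).pow 2)).add
          (continuousOn_const.sub (hprim.mono hsub)))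
    have e2 := e (x := 0) (by rw [closure_Ioo ht₂.1.ne]; exact left_mem_Icc.2 ht₂.1.le)
    simpa using e2
  have e := le_on_closure (s := Ioo 0 T) (f := fun t => α₀ * (exp (-2 * lam * t) * N t ^ 2))
    (g := fun t => β₀ * N 0 ^ 2 + ∫ τ in (0)..t, h τ) hQ
    (by rw [closure_Ioo hT.ne]; exact continuousOn_const.mul (ContinuousOn.mul (by fun_prop)
        (hNc.pow 2)))
    (by rw [closure_Ioo hT.ne]; exact continuousOn_const.add hprim)
  exact e (by rwa [closure_Ioo hT.ne])

end Coeffs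

section Kernel

open scoped ENNReal

/-- The truncated singular kernel `|d|^{-s} 1_{|d| ≤ h}`. -/
noncomputable def kern (h s : ℝ) (d : Plane) : ℝ≥0∞ :=
  (closedBall (0 : Plane) h).indicator (fun d => ofReal (‖d‖ ^ (-s))) d

lemma measurable_kern (h s : ℝ) : Measurable (kern h s) :=
  (by fun_prop : Measurable fun d : Plane => ofReal (‖d‖ ^ (-s))).indicator
    Metric.isClosed_closedBall.measurableSet

lemma kern_neg (h s : ℝ) (d : Plane) : kern h s (-d) = kern h s d := by
  simp [kern, indicator]

lemma kern_sub_comm (h s : ℝ) (x y : Plane) : kern h s (x - y) = kern h s (y - x) := by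
  rw [← kern_neg, neg_sub]

lemma lintegral_kern_rpow_lt_top {s r : ℝ} (hr : 0 < r) (hsr : s * r < 2) :
    ∫⁻ d, kern h s d ^ r < (⊤ : ℝ≥0∞) := by
  have h1 : IntegrableOn (fun d : Plane => ‖d‖ ^ (-(s * r))) (ball 0 (h + 1)) := by
    rw [integrableOn_fun_norm_addHaar volume (f := fun y => y ^ (-(s * r)))]
    simp only [finrank_euclideanSpace, Fintype.card_fin]
    have h2 : IntervalIntegrable (fun y : ℝ => y ^ (1 - s * r)) volume 0 (h + 1) :=
      intervalIntegral.intervalIntegrable_rpow' (by linarith)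
    rcases le_or_gt (h + 1) 0 with h0 | h0
    · simp [Ioo_eq_empty (not_lt.2 h0)]
    · rw [intervalIntegrable_iff_integrableOn_Ioo_of_le h0.le] at h2
      refine h2.congr_fun (fun y hy => ?_) measurableSet_Ioo
      simp only [smul_eq_mul]
      rw [← Real.rpow_natCast, ← Real.rpow_add hy.1]
      congr 1; norm_num; ring
  have h3 : ∫⁻ d in ball (0 : Plane) (h + 1), ofReal (‖d‖ ^ (-(s * r))) < (⊤ : ℝ≥0∞) := by
    have := h1.2
    rw [hasFiniteIntegral_iff_ofReal (.of_forall fun d => by positivity)] at this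
    exact this
  refine lt_of_le_of_lt ?_ h3
  rw [← lintegral_indicator isOpen_ball.measurableSet]
  refine lintegral_mono fun d => ?_
  by_cases hd : d ∈ closedBall (0 : Plane) h
  · have hd' : d ∈ ball (0 : Plane) (h + 1) := by
      simp only [Metric.mem_closedBall, mem_ball] at *; linarith
    rw [kern, indicator_of_mem hd, indicator_of_mem hd', ENNReal.ofReal_rpow_of_nonneg
      (by positivity) hr.le, ← Real.rpow_mul (norm_nonneg _)]
    simp
  · simp [kern, indicator_of_notMem hd, hr]

/-- The cone of opening `2π/3` around `ν`, truncated at height `h`. -/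
def cone (h : ℝ) (ν : Plane) : Set Plane := {d | ‖d‖ ≤ h ∧ ‖d‖ / 2 ≤ inner ℝ ν d}

lemma isClosed_cone (h : ℝ) (ν : Plane) : IsClosed (cone h ν) :=
  (isClosed_le (f := fun d : Plane => ‖d‖) (g := fun _ => h) (by fun_prop) (by fun_prop)).inter
    (isClosed_le (f := fun d : Plane => ‖d‖ / 2) (g := fun d => inner ℝ ν d)
      (by fun_prop) (by fun_prop))

lemma measurableSet_cone (h : ℝ) (ν : Plane) : MeasurableSet (cone h ν) :=
  (isClosed_cone h ν).measurableSet

lemma smul_mem_cone {σ : ℝ} {ν d : Plane} (hσ : σ ∈ Icc (0 : ℝ) 1) (hd : d ∈ cone h ν) :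
    σ • d ∈ cone h ν := by
  refine ⟨?_, ?_⟩
  · rw [norm_smul, norm_of_nonneg hσ.1]
    exact (mul_le_of_le_one_left (norm_nonneg _) hσ.2).trans hd.1
  · rw [norm_smul, norm_of_nonneg hσ.1, inner_smul_right, mul_div_assoc]
    exact mul_le_mul_of_nonneg_left hd.2 hσ.1

lemma volume_cone_ge (hh : 0 < h) {ν : Plane} (hν : ‖ν‖ = 1) :
    volume (ball (0 : Plane) (h / 8)) ≤ volume (cone h ν) := by
  rw [← Measure.addHaar_ball_center volume ((h / 2) • ν) (h / 8)]
  refine measure_mono fun d hd => ?_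
  rw [mem_ball, dist_eq_norm] at hd
  have h1 : d = (h / 2) • ν + (d - (h / 2) • ν) := by abel
  have h2 : ‖d‖ ≤ h / 2 + h / 8 := by
    rw [h1]
    refine (norm_add_le _ _).trans (add_le_add ?_ hd.le)
    rw [norm_smul, hν, norm_of_nonneg (by positivity), mul_one]
  have h3 : (inner ℝ ν d : ℝ) = h / 2 + inner ℝ ν (d - (h / 2) • ν) := by
    rw [inner_sub_right, inner_smul_right, real_inner_self_eq_norm_sq, hν]; ring
  have h4 := (abs_le.1 (abs_real_inner_le_norm ν (d - (h / 2) • ν))).1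
  rw [hν, one_mul] at h4
  exact ⟨by linarith, by rw [h3]; linarith⟩

lemma enorm_le_add_lintegral_fderiv [CompleteSpace V] {v : Plane → V} {O : Set Plane}
    (hO : IsOpen O) (hv : ContDiffOn ℝ 1 v O) {d : Plane} (hd : ∀ σ ∈ Icc (0 : ℝ) 1, x + σ • d ∈ O) :
    ‖v x‖ₑ ≤ ‖v (x + d)‖ₑ + ‖d‖ₑ * ∫⁻ σ in Ioc (0 : ℝ) 1, ‖fderiv ℝ v (x + σ • d)‖ₑ := by
  have hder : ∀ σ ∈ uIcc (0 : ℝ) 1, HasDerivAt (fun σ : ℝ => v (x + σ • d))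
      (fderiv ℝ v (x + σ • d) d) σ := by
    intro σ hσ
    rw [uIcc_of_le zero_le_one] at hσ
    have h1 : HasFDerivAt v (fderiv ℝ v (x + σ • d)) (x + σ • d) :=
      ((hv.contDiffAt (hO.mem_nhds (hd σ hσ))).differentiableAt (by simp)).hasFDerivAt
    have h2 : HasDerivAt (fun σ : ℝ => x + σ • d) d σ := by
      simpa using ((hasDerivAt_id σ).smul_const d).const_add x
    exact h1.comp_hasDerivAt σ h2
  have hcont : ContinuousOn (fun σ : ℝ => fderiv ℝ v (x + σ • d) d) (uIcc 0 1) := by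
    rw [uIcc_of_le zero_le_one]
    refine ContinuousOn.clm_apply ?_ continuousOn_const
    exact (hv.continuousOn_fderiv_of_isOpen hO (by simp)).comp (by fun_prop) hd
  have h1 := intervalIntegral.integral_eq_sub_of_hasDerivAt hder hcont.intervalIntegrable
  simp only [one_smul, zero_smul, add_zero] at h1
  have h2 : v x = v (x + d) - ∫ σ in (0 : ℝ)..1, fderiv ℝ v (x + σ • d) d := by rw [h1]; abel
  rw [h2]
  refine (enorm_sub_le).trans (add_le_add le_rfl ?_)
  rw [integral_of_le zero_le_one]
  refine (enorm_integral_le_lintegral_enorm _).trans ?_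
  rw [← lintegral_const_mul' _ _ enorm_ne_top]
  refine lintegral_mono fun σ => ?_
  rw [mul_comm]
  exact le_opENorm _ _

lemma sq_lintegral_le {a : ℝ} {g : ℝ → ℝ≥0∞} (hg : Measurable g) :
    (∫⁻ σ in Ioc (0 : ℝ) 1, g σ) ^ 2 ≤ (∫⁻ σ in Ioc (0 : ℝ) 1, ofReal (σ ^ (-a))) *
      ∫⁻ σ in Ioc (0 : ℝ) 1, ofReal (σ ^ a) * g σ ^ 2 := by
  have h1 := ENNReal.lintegral_mul_norm_pow_le (μ := volume.restrict (Ioc (0 : ℝ) 1))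
    (f := fun σ => ofReal (σ ^ (-a))) (g := fun σ => ofReal (σ ^ a) * g σ ^ 2)
    (by fun_prop) (by fun_prop) (p := 1 / 2) (q := 1 / 2) (by norm_num) (by norm_num) (by norm_num)
  have h2 : ∫⁻ σ in Ioc (0 : ℝ) 1, g σ ≤ ∫⁻ σ in Ioc (0 : ℝ) 1,
      ofReal (σ ^ (-a)) ^ (1 / 2 : ℝ) * (ofReal (σ ^ a) * g σ ^ 2) ^ (1 / 2 : ℝ) := by
    refine setLIntegral_mono' measurableSet_Ioc fun σ hσ => ?_
    rw [← mul_rpow_of_nonneg _ _ (by norm_num), ← mul_assoc,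
      ← ofReal_mul (rpow_nonneg hσ.1.le _), ← Real.rpow_add hσ.1]
    simp only [neg_add_cancel, Real.rpow_zero, ENNReal.ofReal_one, one_mul]
    rw [← rpow_natCast, ← rpow_mul]; norm_num
  have h3 := pow_le_pow_left (h2.trans h1) (n := 2)
  refine h3.trans (le_of_eq ?_)
  rw [mul_pow, ← rpow_natCast, ← rpow_natCast, ← rpow_mul, ← rpow_mul]
  norm_num

lemma lintegral_Ioi_rpow {c q : ℝ} (hc : 0 < c) (hq : q < -1) :
    ∫⁻ σ in Ioi c, ofReal (σ ^ q) = ofReal (-c ^ (q + 1) / (q + 1)) := by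
  rw [← integral_Ioi_rpow_of_lt hq hc, ofReal_integral_eq_lintegral_ofReal
    (integrableOn_Ioi_rpow_of_lt hq hc)]
  exact (ae_restrict_iff' measurableSet_Ioi).2 (.of_forall fun σ hσ =>
    rpow_nonneg (hc.le.trans (le_of_lt hσ)) _)

/-- Averaging the line-integral remainder over a cone produces the singular kernel. -/
lemma lintegral_cone_le {s : ℝ} (hh : 0 < h) (ν : Plane) {G : Plane → ℝ≥0∞} (hG : Measurable G)
    (hs0 : 0 < s) : ∫⁻ d in cone h ν, ‖d‖ₑ ^ 2 *
        ∫⁻ σ in Ioc (0 : ℝ) 1, ofReal (σ ^ (1 - s)) * G (σ • d) ≤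
      ofReal (h ^ (2 + s) / (2 + s)) * ∫⁻ d in cone h ν, G d * kern h s d := by
  have hC := measurableSet_cone h ν
  obtain ⟨P, hPdef⟩ : ∃ P : Plane → ℝ≥0∞, P = (cone h ν).indicator fun d => ‖d‖ₑ ^ 2 * G d :=
    ⟨_, rfl⟩
  have hP : Measurable P := by
    rw [hPdef]
    exact (by fun_prop : Measurable fun d : Plane => ‖d‖ₑ ^ 2 * G d).indicator hC
  obtain ⟨R, hRdef⟩ : ∃ R : ℝ → Plane → ℝ≥0∞,
      R = fun σ d => {p : ℝ × Plane | ‖p.2‖ ≤ p.1 * h}.indicator 1 (σ, d) := ⟨_, rfl⟩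
  have hset : MeasurableSet {p : ℝ × Plane | ‖p.2‖ ≤ p.1 * h} :=
    (isClosed_le (by fun_prop) (by fun_prop)).measurableSet
  have hR : Measurable (uncurry R) := by
    have : Measurable ({p : ℝ × Plane | ‖p.2‖ ≤ p.1 * h}.indicator (1 : ℝ × Plane → ℝ≥0∞)) :=
      measurable_one.indicator hset
    rw [hRdef]
    exact this
  have hR1 : ∀ σ, Measurable (R σ) := fun σ => hR.comp measurable_prodMk_left
  have hR2 : ∀ d, Measurable fun σ => R σ d := fun d => hR.comp measurable_prodMk_right
  have hRP : ∀ σ a : ℝ, Measurable fun d => ofReal a * (R σ d * P d) := fun σ a =>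
    ((hR1 σ).mul hP).const_mul _
  have hR3 : ∀ d, Measurable fun σ : ℝ => ofReal (σ ^ (-3 - s)) * R σ d := fun d =>
    (by fun_prop : Measurable fun σ : ℝ => ofReal (σ ^ (-3 - s))).mul (hR2 d)
  calc ∫⁻ d in cone h ν, ‖d‖ₑ ^ 2 *
        ∫⁻ σ in Ioc (0 : ℝ) 1, ofReal (σ ^ (1 - s)) * G (σ • d)
      = ∫⁻ d in cone h ν, ∫⁻ σ in Ioc (0 : ℝ) 1, ‖d‖ₑ ^ 2 * (ofReal (σ ^ (1 - s)) * G (σ • d)) := by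
        refine lintegral_congr fun d => (lintegral_const_mul' _ _ (by simp)).symm
    _ = ∫⁻ σ in Ioc (0 : ℝ) 1, ∫⁻ d in cone h ν, ‖d‖ₑ ^ 2 * (ofReal (σ ^ (1 - s)) * G (σ • d)) := by
        refine lintegral_lintegral_swap ?_
        have : Measurable fun p : Plane × ℝ => G (p.2 • p.1) := hG.comp (by fun_prop)
        exact (by fun_prop : Measurable (uncurry fun (d : Plane) (σ : ℝ) =>
          ‖d‖ₑ ^ 2 * (ofReal (σ ^ (1 - s)) * G (σ • d)))).aemeasurable
    _ ≤ ∫⁻ σ in Ioc (0 : ℝ) 1, ∫⁻ d, ofReal (σ ^ (-3 - s)) * (R σ d * P d) := by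
        refine setLIntegral_mono' measurableSet_Ioc fun σ hσ => ?_
        have hσ0 := hσ.1
        have e1 : ∫⁻ d in cone h ν, ‖d‖ₑ ^ 2 * (ofReal (σ ^ (1 - s)) * G (σ • d)) ≤
            ∫⁻ d, ofReal (σ ^ (-1 - s)) * (R σ (σ • d) * P (σ • d)) := by
          rw [← lintegral_indicator hC]
          refine lintegral_mono fun d => ?_
          by_cases hd : d ∈ cone h ν
          · have hd' := smul_mem_cone ⟨hσ.1.le, hσ.2⟩ hd
            have hr : R σ (σ • d) = 1 := by
              rw [hRdef]
              refine indicator_of_mem ?_ _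
              rw [mem_ofPred_eq, norm_smul, norm_of_nonneg hσ0.le]
              exact mul_le_mul_of_nonneg_left hd.1 hσ0.le
            rw [indicator_of_mem hd, hr, one_mul, hPdef]
            simp only [indicator_of_mem hd', enorm_smul, mul_pow]
            rw [Real.enorm_eq_ofReal hσ0.le, ← ENNReal.ofReal_pow hσ0.le]
            have e2 : ofReal (σ ^ (1 - s)) = ofReal (σ ^ (-1 - s)) * ofReal (σ ^ 2) := by
              rw [← ofReal_mul (by positivity), ← Real.rpow_natCast, ← Real.rpow_add hσ0]
              congr 2; push_cast; ring
            rw [e2]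
            apply le_of_eq; ring
          · rw [indicator_of_notMem hd]; exact zero_le
        refine e1.trans (le_of_eq ?_)
        have e3 : ∫⁻ d, ofReal (σ ^ (-1 - s)) * (R σ (σ • d) * P (σ • d)) =
            ∫⁻ d, ofReal (σ ^ (-1 - s)) * (R σ d * P d) ∂(Measure.map (σ • ·) volume) := by
          exact (lintegral_map (hRP σ (σ ^ (-1 - s))) (measurable_const_smul σ)).symm
        rw [e3, Measure.map_addHaar_smul volume hσ0.ne', lintegral_smul_measure]
        simp only [finrank_euclideanSpace, Fintype.card_fin, smul_eq_mul]
        rw [← lintegral_const_mul _ (hRP σ (σ ^ (-1 - s)))]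
        refine lintegral_congr fun d => ?_
        rw [← mul_assoc, ← ofReal_mul (by positivity), abs_of_pos (by positivity)]
        congr 3
        rw [← Real.rpow_natCast, ← Real.rpow_neg hσ0.le, ← Real.rpow_add hσ0]
        congr 1; push_cast; ring
    _ = ∫⁻ d, ∫⁻ σ in Ioc (0 : ℝ) 1, ofReal (σ ^ (-3 - s)) * (R σ d * P d) := by
        refine lintegral_lintegral_swap ?_
        have h1 : Measurable fun p : ℝ × Plane => R p.1 p.2 := hR
        exact ((by fun_prop : Measurable fun p : ℝ × Plane =>
          ofReal (p.1 ^ (-3 - s)) * (R p.1 p.2 * P p.2))).aemeasurable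
    _ ≤ ∫⁻ d, ofReal (h ^ (2 + s) / (2 + s)) * (cone h ν).indicator
          (fun d => G d * kern h s d) d := by
        refine lintegral_mono fun d => ?_
        by_cases hd : d ∈ cone h ν
        swap
        · simp [hPdef, indicator_of_notMem hd]
        rcases eq_or_ne d 0 with rfl | hd0
        · simp [hPdef, indicator_of_mem hd]
        have hn : 0 < ‖d‖ := norm_pos_iff.2 hd0
        simp only [hPdef, indicator_of_mem hd]
        have e1 : ∫⁻ σ in Ioc (0 : ℝ) 1, ofReal (σ ^ (-3 - s)) * (R σ d * (‖d‖ₑ ^ 2 * G d)) =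
            (∫⁻ σ in Ioc (0 : ℝ) 1, ofReal (σ ^ (-3 - s)) * R σ d) * (‖d‖ₑ ^ 2 * G d) := by
          rw [← lintegral_mul_const _ (hR3 d)]
          exact lintegral_congr fun σ => (mul_assoc _ _ _).symm
        have e2 : ∫⁻ σ in Ioc (0 : ℝ) 1, ofReal (σ ^ (-3 - s)) * R σ d ≤
            ofReal (-(‖d‖ / h) ^ (-3 - s + 1) / (-3 - s + 1)) := by
          rw [← lintegral_Ioi_rpow (by positivity) (by linarith),
            ← lintegral_indicator measurableSet_Ioc, setLIntegral_congr Ioi_ae_eq_Ici,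
            ← lintegral_indicator measurableSet_Ici]
          refine lintegral_mono fun σ => ?_
          by_cases hσ : σ ∈ Ici (‖d‖ / h)
          · rw [indicator_of_mem hσ]
            refine (indicator_le_self _ _ _).trans ?_
            refine mul_le_of_le_one_right zero_le ?_
            rw [hRdef]
            exact indicator_le_self' (f := (1 : ℝ × Plane → ℝ≥0∞)) (fun _ _ => zero_le) (σ, d)
          · have : R σ d = 0 := by
              rw [hRdef]
              refine indicator_of_notMem ?_ _
              intro hcon
              exact hσ ((div_le_iff₀ hh).2 hcon)
            rw [indicator_of_notMem hσ]
            simp only [indicator, this, mul_zero, ite_self, le_refl]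
        rw [e1]
        refine (mul_le_mul_left e2 _).trans (le_of_eq ?_)
        have hk : kern h s d = ofReal (‖d‖ ^ (-s)) := indicator_of_mem (by simpa using hd.1) _
        rw [hk, ← ofReal_norm, ← ENNReal.ofReal_pow (norm_nonneg _)]
        have e4 : -(‖d‖ / h) ^ (-3 - s + 1) / (-3 - s + 1) * ‖d‖ ^ 2 =
            h ^ (2 + s) / (2 + s) * ‖d‖ ^ (-s) := by
          have e5 : (-3 - s + 1 : ℝ) = -(2 + s) := by ring
          have e6 : ‖d‖ ^ (-(2 + s)) * ‖d‖ ^ 2 = ‖d‖ ^ (-s) := by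
            rw [← Real.rpow_natCast, ← Real.rpow_add hn]; congr 1; push_cast; ring
          rw [e5, Real.div_rpow hn.le hh.le, Real.rpow_neg hh.le (2 + s), neg_div_neg_eq, ← e6]
          have : 0 < h ^ (2 + s) := by positivity
          field_simp
        rw [← mul_assoc, ← ofReal_mul (by
          rw [show (-3 - s + 1 : ℝ) = -(2 + s) by ring, neg_div_neg_eq]; positivity), e4,
          ofReal_mul (by positivity)]
        ring
    _ = _ := by
        rw [lintegral_const_mul' _ _ ofReal_ne_top, lintegral_indicator hC]

/-- Pointwise control of a `C¹` function by a singular integral over a cone. -/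
theorem exists_kernel_bound {s : ℝ} (hh : 0 < h) (hs0 : 0 < s) :
    ∃ C : ℝ≥0∞, C ≠ (⊤ : ℝ≥0∞) ∧ ∀ {V : Type} [NormedAddCommGroup V] [NormedSpace ℝ V] [CompleteSpace V]
      (v : Plane → V) (O : Set Plane) (x ν : Plane), IsOpen O → ContDiffOn ℝ 1 v O → ‖ν‖ = 1 →
      (∀ d ∈ cone h ν, x + d ∈ O) →
      ‖v x‖ₑ ^ 2 ≤ C * ∫⁻ d in cone h ν,
        (‖v (x + d)‖ₑ ^ 2 + ‖fderiv ℝ v (x + d)‖ₑ ^ 2) * kern h s d := by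
  set c₀ : ℝ≥0∞ := ∫⁻ σ in Ioc (0 : ℝ) 1, ofReal (σ ^ (-(1 - s))) with hc₀
  have hc₀t : c₀ ≠ (⊤ : ℝ≥0∞) := by
    have h1 : IntervalIntegrable (fun σ : ℝ => σ ^ (-(1 - s))) volume 0 1 :=
      intervalIntegral.intervalIntegrable_rpow' (by linarith)
    rw [intervalIntegrable_iff_integrableOn_Ioc_of_le zero_le_one] at h1
    have h2 := h1.2
    rw [hasFiniteIntegral_iff_ofReal ((ae_restrict_iff' measurableSet_Ioc).2
      (.of_forall fun σ hσ => rpow_nonneg hσ.1.le _))] at h2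
    exact h2.ne
  set V₀ := volume (ball (0 : Plane) (h / 8)) with hV₀
  have hV₀pos : V₀ ≠ 0 := (Metric.measure_ball_pos volume _ (by positivity)).ne'
  have hV₀t : V₀ ≠ (⊤ : ℝ≥0∞) := Metric.isBounded_ball.measure_lt_top.ne
  set c₁ := ofReal (h ^ (2 + s) / (2 + s))
  set c₂ := ofReal (h ^ s)
  refine ⟨V₀⁻¹ * (2 * (c₂ + c₀ * c₁)), ?_, ?_⟩
  · refine mul_ne_top (ENNReal.inv_ne_top.2 hV₀pos) (mul_ne_top (by simp) ?_)
    exact ENNReal.add_ne_top.2 ⟨ofReal_ne_top, mul_ne_top hc₀t ofReal_ne_top⟩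
  intro V _ _ _ v O x ν hO hv hν hcone
  have hC := measurableSet_cone h ν
  have hGm : Measurable fun d => ‖fderiv ℝ v (x + d)‖ₑ ^ 2 :=
    (((measurable_fderiv ℝ v).comp (measurable_const_add x)).enorm).pow_const 2
  have hgm : ∀ d : Plane, Measurable fun σ : ℝ => ‖fderiv ℝ v (x + σ • d)‖ₑ := fun d =>
    ((measurable_fderiv ℝ v).comp (by fun_prop)).enorm
  have hvm : AEMeasurable (fun d => ‖v (x + d)‖ₑ ^ 2) (volume.restrict (cone h ν)) := by
    have : ContinuousOn (fun d => ‖v (x + d)‖ₑ) (cone h ν) :=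
      continuous_enorm.comp_continuousOn (hv.continuousOn.comp (by fun_prop) hcone)
    exact (this.aemeasurable hC).pow_const 2
  have hpt : ∀ d ∈ cone h ν, ‖v x‖ₑ ^ 2 ≤ 2 * ‖v (x + d)‖ₑ ^ 2 +
      2 * (c₀ * (‖d‖ₑ ^ 2 * ∫⁻ σ in Ioc (0 : ℝ) 1, ofReal (σ ^ (1 - s)) *
        ‖fderiv ℝ v (x + σ • d)‖ₑ ^ 2)) := by
    intro d hd
    have e1 := enorm_le_add_lintegral_fderiv hO hv (x := x) (d := d)
      fun σ hσ => hcone _ (smul_mem_cone hσ hd)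
    have e2 := sq_lintegral_le (a := 1 - s) (hgm d)
    calc ‖v x‖ₑ ^ 2 ≤ (‖v (x + d)‖ₑ +
          ‖d‖ₑ * ∫⁻ σ in Ioc (0 : ℝ) 1, ‖fderiv ℝ v (x + σ • d)‖ₑ) ^ 2 :=
          pow_le_pow_left e1
      _ ≤ 2 * (‖v (x + d)‖ₑ ^ 2 +
          (‖d‖ₑ * ∫⁻ σ in Ioc (0 : ℝ) 1, ‖fderiv ℝ v (x + σ • d)‖ₑ) ^ 2) := by
          have := ENNReal.rpow_add_le_mul_rpow_add_rpow ‖v (x + d)‖ₑ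
            (‖d‖ₑ * ∫⁻ σ in Ioc (0 : ℝ) 1, ‖fderiv ℝ v (x + σ • d)‖ₑ) (p := 2) (by norm_num)
          norm_num at this
          exact this
      _ ≤ _ := by
          rw [mul_add, mul_pow]
          refine add_le_add le_rfl (mul_le_mul' le_rfl ?_)
          calc _ ≤ ‖d‖ₑ ^ 2 * (c₀ * ∫⁻ σ in Ioc (0 : ℝ) 1, ofReal (σ ^ (1 - s)) *
                ‖fderiv ℝ v (x + σ • d)‖ₑ ^ 2) := by gcongr
            _ = _ := by ring
  have hfirst : ∫⁻ d in cone h ν, ‖v (x + d)‖ₑ ^ 2 ≤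
      c₂ * ∫⁻ d in cone h ν, ‖v (x + d)‖ₑ ^ 2 * kern h s d := by
    rw [← lintegral_const_mul' _ _ ofReal_ne_top]
    refine lintegral_mono_ae ?_
    have hne : ∀ᵐ d ∂volume.restrict (cone h ν), d ≠ 0 := by
      refine ae_restrict_of_ae ?_
      exact (measure_eq_zero_iff_ae_notMem.1 (measure_singleton (0 : Plane)))
    filter_upwards [ae_restrict_mem hC, hne] with d hd hd0
    have hn : 0 < ‖d‖ := norm_pos_iff.2 hd0
    have hk : kern h s d = ofReal (‖d‖ ^ (-s)) := indicator_of_mem (by simpa using hd.1) _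
    have e1 : 1 ≤ c₂ * kern h s d := by
      rw [hk, ← ofReal_mul (by positivity), ENNReal.one_le_ofReal, Real.rpow_neg hn.le,
        ← div_eq_mul_inv, one_le_div (by positivity)]
      exact Real.rpow_le_rpow hn.le hd.1 hs0.le
    calc ‖v (x + d)‖ₑ ^ 2 = ‖v (x + d)‖ₑ ^ 2 * 1 := (mul_one _).symm
      _ ≤ ‖v (x + d)‖ₑ ^ 2 * (c₂ * kern h s d) := by gcongr
      _ = _ := by ring
  have hmain : V₀ * ‖v x‖ₑ ^ 2 ≤ 2 * (c₂ + c₀ * c₁) * ∫⁻ d in cone h ν,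
        (‖v (x + d)‖ₑ ^ 2 + ‖fderiv ℝ v (x + d)‖ₑ ^ 2) * kern h s d := by
    have hkm := measurable_kern h s
    have hGd : ∫⁻ d in cone h ν, ‖d‖ₑ ^ 2 * ∫⁻ σ in Ioc (0 : ℝ) 1, ofReal (σ ^ (1 - s)) *
        ‖fderiv ℝ v (x + σ • d)‖ₑ ^ 2 ≤
        c₁ * ∫⁻ d in cone h ν, ‖fderiv ℝ v (x + d)‖ₑ ^ 2 * kern h s d :=
      lintegral_cone_le hh ν hGm hs0
    calc V₀ * ‖v x‖ₑ ^ 2 ≤ volume (cone h ν) * ‖v x‖ₑ ^ 2 := by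
          gcongr; exact volume_cone_ge hh hν
      _ = ∫⁻ _ in cone h ν, ‖v x‖ₑ ^ 2 := by
          rw [lintegral_const, Measure.restrict_apply_univ, mul_comm]
      _ ≤ ∫⁻ d in cone h ν, (2 * ‖v (x + d)‖ₑ ^ 2 +
            2 * (c₀ * (‖d‖ₑ ^ 2 * ∫⁻ σ in Ioc (0 : ℝ) 1, ofReal (σ ^ (1 - s)) *
            ‖fderiv ℝ v (x + σ • d)‖ₑ ^ 2))) := setLIntegral_mono' hC hpt
      _ = 2 * (∫⁻ d in cone h ν, ‖v (x + d)‖ₑ ^ 2) +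
          2 * (c₀ * ∫⁻ d in cone h ν, ‖d‖ₑ ^ 2 * ∫⁻ σ in Ioc (0 : ℝ) 1,
            ofReal (σ ^ (1 - s)) * ‖fderiv ℝ v (x + σ • d)‖ₑ ^ 2) := by
          rw [lintegral_add_left' (hvm.const_mul _), lintegral_const_mul' _ _ (by simp),
            lintegral_const_mul' _ _ (by simp), lintegral_const_mul' _ _ hc₀t]
      _ ≤ 2 * (c₂ * ∫⁻ d in cone h ν, ‖v (x + d)‖ₑ ^ 2 * kern h s d) +
          2 * (c₀ * (c₁ * ∫⁻ d in cone h ν, ‖fderiv ℝ v (x + d)‖ₑ ^ 2 * kern h s d)) := by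
          gcongr
      _ ≤ 2 * (c₂ * ∫⁻ d in cone h ν, (‖v (x + d)‖ₑ ^ 2 + ‖fderiv ℝ v (x + d)‖ₑ ^ 2) * kern h s d) +
          2 * (c₀ * (c₁ * ∫⁻ d in cone h ν,
            (‖v (x + d)‖ₑ ^ 2 + ‖fderiv ℝ v (x + d)‖ₑ ^ 2) * kern h s d)) := by
          gcongr
          · exact le_self_add
          · exact le_add_self
      _ = _ := by ring
  rw [mul_assoc]
  calc ‖v x‖ₑ ^ 2 = V₀⁻¹ * (V₀ * ‖v x‖ₑ ^ 2) := by
        rw [← mul_assoc, ENNReal.inv_mul_cancel hV₀pos hV₀t, one_mul]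
    _ ≤ _ := by gcongr

end Kernel

section KernelBounds

open scoped ENNReal

lemma lintegral_kern_sub (h s r : ℝ) (x : Plane) :
    ∫⁻ y, kern h s (x - y) ^ r = ∫⁻ d, kern h s d ^ r :=
  lintegral_sub_left_eq_self (fun d => kern h s d ^ r) x

lemma measurable_kern_sub (h s : ℝ) (x : Plane) : Measurable fun y => kern h s (x - y) :=
  (measurable_kern h s).comp (by fun_prop)

lemma measurable_kern_sub_left (h s : ℝ) (y : Plane) : Measurable fun x => kern h s (x - y) :=
  (measurable_kern h s).comp (by fun_prop)

/-- Hölder's inequality for the convolution with the kernel. -/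
lemma lintegral_mul_kern_le {q q' : ℝ} (hq : q.HolderConjugate q') (h s : ℝ) (D : Set Plane)
    {b : Plane → ℝ≥0∞} (hb : AEMeasurable b (volume.restrict D)) (x : Plane) :
    ∫⁻ y in D, b y * kern h s (x - y) ≤
      (∫⁻ y in D, b y ^ q) ^ (1 / q) * (∫⁻ d, kern h s d ^ q') ^ (1 / q') := by
  refine (ENNReal.lintegral_mul_le_Lp_mul_Lq (volume.restrict D) hq hb
    (measurable_kern_sub h s x).aemeasurable).trans ?_
  refine mul_le_mul' le_rfl (rpow_le_rpow ?_ (by have := hq.symm.pos; positivity))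
  rw [← lintegral_kern_sub h s q' x]
  exact setLIntegral_le_lintegral _ _

/-- Exchange of the order of integration in `∫ g (b * k)`. -/
lemma lintegral_mul_lintegral_kern (h s : ℝ) (D : Set Plane) {g b : Plane → ℝ≥0∞}
    (hg : AEMeasurable g (volume.restrict D)) (hb : AEMeasurable b (volume.restrict D)) :
    ∫⁻ x in D, g x * ∫⁻ y in D, b y * kern h s (x - y) =
      ∫⁻ y in D, b y * ∫⁻ x in D, g x * kern h s (y - x) := by
  have hm : AEMeasurable (uncurry fun x y => g x * (b y * kern h s (x - y)))
      ((volume.restrict D).prod (volume.restrict D)) := by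
    have h1 : Measurable fun z : Plane × Plane => kern h s (z.1 - z.2) :=
      (measurable_kern h s).comp (by fun_prop)
    exact hg.comp_fst.mul (hb.comp_snd.mul h1.aemeasurable)
  calc _ = ∫⁻ x in D, ∫⁻ y in D, g x * (b y * kern h s (x - y)) :=
        lintegral_congr fun x => (lintegral_const_mul'' _
          (hb.mul (measurable_kern_sub h s x).aemeasurable)).symm
    _ = ∫⁻ y in D, ∫⁻ x in D, g x * (b y * kern h s (x - y)) := lintegral_lintegral_swap hm
    _ = ∫⁻ y in D, ∫⁻ x in D, b y * (g x * kern h s (y - x)) := by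
        refine lintegral_congr fun y => lintegral_congr fun x => ?_
        rw [kern_sub_comm h s x y]; ring
    _ = _ := lintegral_congr fun y => lintegral_const_mul'' _
          (hg.mul (measurable_kern_sub h s y).aemeasurable)

/-- `∫ g (b * k) ≤ sup (g * k) ∫ b`. -/
lemma lintegral_mul_lintegral_kern_le (h s : ℝ) (D : Set Plane) {g b : Plane → ℝ≥0∞}
    (hg : AEMeasurable g (volume.restrict D)) (hb : AEMeasurable b (volume.restrict D)) {M : ℝ≥0∞}
    (hM : ∀ y, ∫⁻ x in D, g x * kern h s (y - x) ≤ M) :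
    ∫⁻ x in D, g x * ∫⁻ y in D, b y * kern h s (x - y) ≤ M * ∫⁻ y in D, b y := by
  rw [lintegral_mul_lintegral_kern h s D hg hb, ← lintegral_const_mul'' _ hb]
  refine lintegral_mono fun y => ?_
  rw [mul_comm]
  exact mul_le_mul' (hM y) le_rfl

lemma lintegral_kern_mul_kern_le (h s : ℝ) (D : Set Plane) (x y : Plane) :
    ∫⁻ z in D, kern h s (x - z) * kern h s (y - z) ≤ ∫⁻ d, kern h s d ^ (2 : ℝ) := by
  have e := ENNReal.lintegral_mul_le_Lp_mul_Lq (volume.restrict D)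
    (Real.HolderConjugate.two_two) (measurable_kern_sub h s x).aemeasurable
    (measurable_kern_sub h s y).aemeasurable
  have h1 : ∀ x, ∫⁻ z in D, kern h s (x - z) ^ (2 : ℝ) ≤ ∫⁻ d, kern h s d ^ (2 : ℝ) := fun x => by
    rw [← lintegral_kern_sub h s 2 x]; exact setLIntegral_le_lintegral _ _
  calc _ ≤ _ := e
    _ ≤ (∫⁻ d, kern h s d ^ (2 : ℝ)) ^ (1 / 2 : ℝ) * (∫⁻ d, kern h s d ^ (2 : ℝ)) ^ (1 / 2 : ℝ) :=
        mul_le_mul' (rpow_le_rpow (h1 x) (by norm_num)) (rpow_le_rpow (h1 y) (by norm_num))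
    _ = _ := by rw [← ENNReal.rpow_add_of_nonneg _ _ (by norm_num) (by norm_num)]; norm_num

/-- A function dominated by a convolution `b * k` has a bounded convolution with `k`. -/
lemma lintegral_mul_kern_le_of_le (h s : ℝ) (D : Set Plane) {g b : Plane → ℝ≥0∞}
    (hb : AEMeasurable b (volume.restrict D)) {C : ℝ≥0∞}
    (hgb : ∀ᵐ x ∂volume.restrict D, g x ≤ C * ∫⁻ y in D, b y * kern h s (x - y)) (z : Plane) :
    ∫⁻ x in D, g x * kern h s (z - x) ≤ C * ((∫⁻ d, kern h s d ^ (2 : ℝ)) * ∫⁻ y in D, b y) := by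
  have hk := (measurable_kern_sub h s z).aemeasurable (μ := volume.restrict D)
  have hm : AEMeasurable (fun x => kern h s (z - x) * ∫⁻ y in D, b y * kern h s (x - y))
      (volume.restrict D) := by
    refine hk.mul ?_
    have h1 : Measurable fun z : Plane × Plane => kern h s (z.1 - z.2) :=
      (measurable_kern h s).comp (by fun_prop)
    exact (hb.comp_snd.mul h1.aemeasurable).lintegral_prod_right'
  calc _ ≤ ∫⁻ x in D, C * (kern h s (z - x) * ∫⁻ y in D, b y * kern h s (x - y)) := by
        refine lintegral_mono_ae ?_
        filter_upwards [hgb] with x hx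
        calc _ ≤ (C * ∫⁻ y in D, b y * kern h s (x - y)) * kern h s (z - x) := by gcongr
          _ = _ := by ring
    _ = C * ∫⁻ x in D, kern h s (z - x) * ∫⁻ y in D, b y * kern h s (x - y) :=
        lintegral_const_mul'' _ hm
    _ ≤ _ := by
        refine mul_le_mul' le_rfl (lintegral_mul_lintegral_kern_le h s D hk hb fun y => ?_)
        exact lintegral_kern_mul_kern_le h s D z y

/-- The kernel inequality in the exterior domain, with the constant `C`. -/
def BoundaryCurve.KernelBound (Γ : BoundaryCurve) (h s : ℝ) (C : ℝ≥0∞) : Prop :=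
  ∀ {V : Type} [NormedAddCommGroup V] [NormedSpace ℝ V] [CompleteSpace V] (v : Plane → V),
    ContDiffOn ℝ 1 v Γ.ext → ∀ x ∈ Γ.ext,
    ‖v x‖ₑ ^ 2 ≤ C * ∫⁻ y in Γ.ext, (‖v y‖ₑ ^ 2 + ‖fderiv ℝ v y‖ₑ ^ 2) * kern h s (x - y)

/-- The kernel inequality in the exterior domain. -/
theorem BoundaryCurve.exists_kernel_bound (Γ : BoundaryCurve) : ∃ h : ℝ, 0 < h ∧ ∀ s : ℝ, 0 < s →
    ∃ C : ℝ≥0∞, C ≠ (⊤ : ℝ≥0∞) ∧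
    Γ.KernelBound h s C ∧
    ∀ {V : Type} [NormedAddCommGroup V] [NormedSpace ℝ V] [CompleteSpace V], ∀ x ∈ Γ.ext,
      ∃ k : Set Plane, IsCompact k ∧ k ⊆ Γ.ext ∧ ∀ v : Plane → V, ContDiff ℝ 1 v →
      ‖v x‖ₑ ^ 2 ≤ C * ∫⁻ y in k, (‖v y‖ₑ ^ 2 + ‖fderiv ℝ v y‖ₑ ^ 2) * kern h s (x - y) := by
  obtain ⟨h, hh, hcone⟩ := Γ.exists_cone
  refine ⟨h, hh, fun s hs => ?_⟩
  obtain ⟨C, hC, hK⟩ := _root_.exists_kernel_bound hh hs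
  have key : ∀ (x ν : Plane) (g : Plane → ℝ≥0∞), ∫⁻ d in cone h ν, g (x + d) * kern h s d =
        ∫⁻ y in (x + ·) '' cone h ν, g y * kern h s (x - y) := by
    intro x ν g
    have e := (measurePreserving_add_left volume x).setLIntegral_comp_emb
      (measurableEmbedding_addLeft x) (fun y => g y * kern h s (x - y)) (cone h ν)
    rw [← e]
    refine lintegral_congr fun d => ?_
    rw [show x - (x + d) = -d by abel, kern_neg]
  refine ⟨C, hC, fun {V} _ _ _ v hv x hx => ?_, fun {V} _ _ _ x hx => ?_⟩
  · obtain ⟨ν, hν, hc⟩ := hcone x hx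
    refine (hK v Γ.ext x ν Γ.isOpen_ext hv hν fun d hd => hc d hd.1 hd.2).trans ?_
    refine mul_le_mul' le_rfl ?_
    rw [key x ν fun y => ‖v y‖ₑ ^ 2 + ‖fderiv ℝ v y‖ₑ ^ 2]
    refine lintegral_mono_set ?_
    rintro _ ⟨d, hd, rfl⟩
    exact hc d hd.1 hd.2
  · obtain ⟨ν, hν, hc⟩ := hcone x hx
    refine ⟨(x + ·) '' cone h ν, ?_, ?_, fun v hv => ?_⟩
    · refine IsCompact.image ?_ (by fun_prop)
      refine (isCompact_closedBall (0 : Plane) h).of_isClosed_subset (isClosed_cone h ν) ?_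
      intro d hd; simpa using hd.1
    · rintro _ ⟨d, hd, rfl⟩
      exact hc d hd.1 hd.2
    · refine (hK v univ x ν isOpen_univ hv.contDiffOn hν fun d hd => mem_univ _).trans ?_
      rw [key x ν fun y => ‖v y‖ₑ ^ 2 + ‖fderiv ℝ v y‖ₑ ^ 2]

end KernelBounds

section PartialDerivatives

lemma pd_contDiff (hu : ContDiff ℝ (k + 1 : ℕ) u) (i : Fin 3) : ContDiff ℝ k (pd i u) := by
  have h : ContDiff ℝ k (fderiv ℝ u) := hu.fderiv_right (by simp)
  exact h.clm_apply contDiff_const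

lemma pd_iterate_contDiff (i : Fin 3) (j : ℕ) (hu : ContDiff ℝ (k + j : ℕ) u) :
    ContDiff ℝ k ((pd i)^[j] u) := by
  induction j generalizing u with
  | zero => simpa using hu
  | succ j ih => rw [iterate_succ_apply]; exact ih (pd_contDiff hu i)

lemma pdIter_contDiff (β : MultiIdx) (hu : ContDiff ℝ (k + β.len : ℕ) u) :
    ContDiff ℝ k (pdIter β u) := by
  refine pd_iterate_contDiff _ _ (pd_iterate_contDiff _ _ (pd_iterate_contDiff _ _ ?_))
  have : k + β.1 + β.2.1 + β.2.2 = k + β.len := by simp only [len]; ring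
  rwa [this]

lemma pd_comm (hu : ContDiff ℝ 2 u) (i j : Fin 3) : pd i (pd j u) = pd j (pd i u) := by
  have h1 : ContDiff ℝ 1 (fderiv ℝ u) := hu.fderiv_right (by norm_num)
  have hd : Differentiable ℝ (fderiv ℝ u) := h1.differentiable one_ne_zero
  have key : ∀ a b : Fin 3, ∀ z, pd a (pd b u) z = fderiv ℝ (fderiv ℝ u) z (stDir a) (stDir b) := by
    intro a b z
    have h2 : HasFDerivAt (fun y => fderiv ℝ u y (stDir b))
        ((ContinuousLinearMap.apply ℝ V (stDir b)).comp (fderiv ℝ (fderiv ℝ u) z)) z :=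
      (ContinuousLinearMap.apply ℝ V (stDir b)).hasFDerivAt.comp z (hd z).hasFDerivAt
    unfold pd
    rw [h2.fderiv]; rfl
  funext z
  rw [key, key]
  exact (hu.contDiffAt.isSymmSndFDerivAt (by simp)).eq _ _

lemma pd_iterate_comm (i j : Fin 3) (k : ℕ) (hu : ContDiff ℝ (k + 1 : ℕ) u) :
    pd i ((pd j)^[k] u) = (pd j)^[k] (pd i u) := by
  induction k generalizing u with
  | zero => rfl
  | succ k ih =>
    rw [iterate_succ_apply, ih (pd_contDiff hu j), iterate_succ_apply,
      pd_comm (hu.of_le (by norm_cast; omega))]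

lemma unitIdx_len (i : Fin 3) : len (unitIdx i) = 1 := by
  fin_cases i <;> rfl

lemma MultiIdx.len_add (a b : MultiIdx) : len (a + b) = a.len + b.len := by
  simp only [len, Prod.fst_add, Prod.snd_add]; ring

lemma pdIter_zero (u : SpaceTime → V) : pdIter 0 u = u := rfl

lemma pdIter_unitIdx (i : Fin 3) (u : SpaceTime → V) : pdIter (unitIdx i) u = pd i u := by
  fin_cases i <;> rfl

/-- Differentiating from the outside. -/
lemma pd_pdIter (i : Fin 3) (β : MultiIdx) (hu : ContDiff ℝ (β.len + 1 : ℕ) u) :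
    pd i (pdIter β u) = pdIter (β + unitIdx i) u := by
  obtain ⟨a, b, c⟩ := β
  simp only [len] at hu
  have h2 : ContDiff ℝ (a + b + 1 : ℕ) ((pd 2)^[c] u) :=
    pd_iterate_contDiff 2 c (hu.of_le (by norm_cast; omega))
  have h1 : ContDiff ℝ (a + 1 : ℕ) ((pd 1)^[b] ((pd 2)^[c] u)) :=
    pd_iterate_contDiff 1 b (h2.of_le (by norm_cast; omega))
  fin_cases i
  · simp only [pdIter, unitIdx]
    exact (iterate_succ_apply' (pd 0) a _).symm
  · simp only [pdIter, unitIdx]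
    change pd 1 ((pd 0)^[a] ((pd 1)^[b] ((pd 2)^[c] u))) =
      (pd 0)^[a] ((pd 1)^[b + 1] ((pd 2)^[c] u))
    rw [pd_iterate_comm 1 0 a h1, ← iterate_succ_apply' (pd 1)]
  · simp only [pdIter, unitIdx]
    change pd 2 ((pd 0)^[a] ((pd 1)^[b] ((pd 2)^[c] u))) =
      (pd 0)^[a] ((pd 1)^[b] ((pd 2)^[c + 1] u))
    rw [pd_iterate_comm 2 0 a h1, pd_iterate_comm 2 1 b (h2.of_le (by norm_cast; omega)),
      ← iterate_succ_apply' (pd 2)]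

lemma pdIter_pdIter (α β : MultiIdx) (hu : ContDiff ℝ (α.len + β.len : ℕ) u) :
    pdIter α (pdIter β u) = pdIter (α + β) u := by
  have key : ∀ (i : Fin 3) (k : ℕ) (β : MultiIdx), ContDiff ℝ (k + β.len : ℕ) u →
      (pd i)^[k] (pdIter β u) = pdIter (k • unitIdx i + β) u := by
    intro i k
    induction k with
    | zero => intro β _; simp
    | succ k ih =>
      intro β hβ
      have hl : len (β + unitIdx i) = β.len + 1 := by rw [MultiIdx.len_add, unitIdx_len]
      rw [iterate_succ_apply, pd_pdIter i β (hβ.of_le (by norm_cast; omega)),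
        ih _ (by rw [hl]; exact hβ.of_le (by norm_cast; omega)), succ_nsmul, add_assoc,
        add_comm β]
  obtain ⟨a, b, c⟩ := α
  simp only [len] at hu
  change (pd 0)^[a] ((pd 1)^[b] ((pd 2)^[c] (pdIter β u))) = _
  have l2 : len (c • unitIdx 2 + β) = c + β.len := by
    simp [len, unitIdx]; ring
  have l1 : len (b • unitIdx 1 + (c • unitIdx 2 + β)) = b + c + β.len := by
    simp [len, unitIdx]; ring
  rw [key 2 c β (hu.of_le (by norm_cast; simp only [len]; omega)),
    key 1 b _ (by rw [l2]; exact hu.of_le (by norm_cast; simp only [len]; omega)),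
    key 0 a _ (by rw [l1]; exact hu.of_le (by norm_cast; simp only [len]; omega)),
    ← add_assoc, ← add_assoc]
  congr 2
  simp [unitIdx]

lemma pdIter_pd (i : Fin 3) (β : MultiIdx) (hu : ContDiff ℝ (β.len + 1 : ℕ) u) :
    pdIter β (pd i u) = pdIter (β + unitIdx i) u := by
  rw [← pdIter_unitIdx, pdIter_pdIter _ _ (by rwa [unitIdx_len])]

lemma contDiff_nat_of_top (hu : ContDiff ℝ ∞ u) (k : ℕ) : ContDiff ℝ k u :=
  hu.of_le (by exact_mod_cast le_top)

lemma pdIter_contDiff_top (hu : ContDiff ℝ ∞ u) (β : MultiIdx) : ContDiff ℝ ∞ (pdIter β u) :=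
  contDiff_infty.2 fun _ => pdIter_contDiff β (contDiff_nat_of_top hu _)

lemma tsupport_pd_subset (i : Fin 3) (u : SpaceTime → V) : tsupport (pd i u) ⊆ tsupport u :=
  closure_minimal (fun z hz => by
    refine support_fderiv_subset ℝ (fun h => hz ?_)
    simp [pd, h]) isClosed_closure

lemma tsupport_pdIter_subset (β : MultiIdx) (u : SpaceTime → V) :
    tsupport (pdIter β u) ⊆ tsupport u := by
  have key : ∀ (i : Fin 3) (k : ℕ) (v : SpaceTime → V), tsupport ((pd i)^[k] v) ⊆ tsupport v := by
    intro i k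
    induction k with
    | zero => intro v; exact subset_rfl
    | succ _ ih => intro v; rw [iterate_succ_apply]
                   exact (ih _).trans (tsupport_pd_subset i v)
  exact (key _ _ _).trans ((key _ _ _).trans (key _ _ _))

end PartialDerivatives

section WeakDerivatives

variable {Ω : Set SpaceTime} {g h k : SpaceTime → V}

instance isAddHaarMeasure_spaceTime : (volume : Measure SpaceTime).IsAddHaarMeasure :=
  inferInstanceAs ((volume : Measure ℝ).prod (volume : Measure Plane)).IsAddHaarMeasure

lemma IsWeakDeriv.trans (h1 : IsWeakDeriv Ω α g h) (h2 : IsWeakDeriv Ω β h k) :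
    IsWeakDeriv Ω (α + β) g k := by
  refine ⟨h1.1, h2.2.1, fun φ hφ hc hs => ?_⟩
  rw [← pdIter_pdIter α β (contDiff_nat_of_top hφ _), h1.2.2 _ (pdIter_contDiff_top hφ β)
    (hc.mono' ((subset_tsupport _).trans (tsupport_pdIter_subset β φ)))
    ((tsupport_pdIter_subset β φ).trans hs), h2.2.2 φ hφ hc hs, smul_smul, MultiIdx.len_add,
    pow_add]

lemma IsWeakDeriv.of_add (h1 : IsWeakDeriv Ω α g h) (h2 : IsWeakDeriv Ω (α + β) g k) :
    IsWeakDeriv Ω β h k := by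
  refine ⟨h1.2.1, h2.2.1, fun φ hφ hc hs => ?_⟩
  have e1 := h1.2.2 _ (pdIter_contDiff_top hφ β)
    (hc.mono' ((subset_tsupport _).trans (tsupport_pdIter_subset β φ)))
    ((tsupport_pdIter_subset β φ).trans hs)
  rw [pdIter_pdIter α β (contDiff_nat_of_top hφ _), h2.2.2 φ hφ hc hs, MultiIdx.len_add,
    pow_add, mul_smul] at e1
  have : ((-1 : ℝ) ^ α.len) ≠ 0 := by positivity
  exact (smul_right_injective V this e1).symm

lemma IsWeakDeriv.congr {g' h' : SpaceTime → V} (h1 : IsWeakDeriv Ω α g h)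
    (hg : g =ᵐ[volume.restrict Ω] g') (hh : h =ᵐ[volume.restrict Ω] h') :
    IsWeakDeriv Ω α g' h' := by
  have cong : ∀ {a b : SpaceTime → V}, LocallyIntegrableOn a Ω → a =ᵐ[volume.restrict Ω] b →
      LocallyIntegrableOn b Ω := by
    intro a b ha hab x hx
    obtain ⟨U, hU, hi⟩ := ha x hx
    refine ⟨U ∩ Ω, inter_mem hU self_mem_nhdsWithin, ?_⟩
    refine (hi.mono_set inter_subset_left).congr_fun_ae ?_
    exact ae_mono (Measure.restrict_mono inter_subset_right le_rfl) hab
  refine ⟨cong h1.1 hg, cong h1.2.1 hh, fun φ hφ hc hs => ?_⟩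
  have e := h1.2.2 φ hφ hc hs
  rw [integral_congr_ae (g := fun z => pdIter α φ z • g' z)
      (by filter_upwards [hg] with z hz; rw [hz]),
    integral_congr_ae (f := fun z => φ z • h z) (g := fun z => φ z • h' z)
      (by filter_upwards [hh] with z hz; rw [hz])] at e
  exact e

/-- A continuous function with compact support in `Ω` times a locally integrable function. -/
lemma integrable_smul_of_tsupport_subset (ha : LocallyIntegrableOn a Ω) {φ : SpaceTime → ℝ}
    (hφ : Continuous φ) (hc : HasCompactSupport φ) (hs : tsupport φ ⊆ Ω) :
    Integrable (fun z => φ z • a z) := by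
  have h1 : IntegrableOn a (tsupport φ) := ha.integrableOn_compact_subset hs hc
  obtain ⟨M, hM⟩ := hφ.bounded_above_of_compact_support hc
  have h2 : IntegrableOn (fun z => φ z • a z) (tsupport φ) :=
    Integrable.bdd_smul h1 M hφ.aestronglyMeasurable (.of_forall hM)
  refine (integrableOn_iff_integrable_of_support_subset fun z hz => ?_).1 h2
  by_contra hz'
  exact hz (by simp [image_eq_zero_of_notMem_tsupport hz'])

lemma setIntegral_smul_eq_integral {φ : SpaceTime → ℝ} (hs : tsupport φ ⊆ Ω) :
    ∫ z in Ω, φ z • a z = ∫ z, φ z • a z := by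
  refine setIntegral_eq_integral_of_forall_compl_eq_zero fun z hz => ?_
  rw [image_eq_zero_of_notMem_tsupport fun hz' => hz (hs hz'), zero_smul]

/-- Weak derivatives are unique. -/
lemma IsWeakDeriv.unique [CompleteSpace V] (hΩ : IsOpen Ω) (h1 : IsWeakDeriv Ω α g h)
    (h2 : IsWeakDeriv Ω α g k) : h =ᵐ[volume.restrict Ω] k := by
  have hi : ∀ {a : SpaceTime → V}, LocallyIntegrableOn a Ω → ∀ φ : SpaceTime → ℝ,
      ContDiff ℝ ∞ φ → HasCompactSupport φ → tsupport φ ⊆ Ω →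
      Integrable (fun z => φ z • a z) (volume.restrict Ω) := fun ha φ hφ hc hs =>
    (integrable_smul_of_tsupport_subset ha hφ.continuous hc hs).restrict
  have h0 : ∀ᵐ z, z ∈ Ω → (h - k) z = 0 := by
    refine hΩ.ae_eq_zero_of_integral_contDiff_smul_eq_zero (h1.2.1.sub h2.2.1) fun φ hφ hc hs => ?_
    have e : ∫ z in Ω, φ z • h z = ∫ z in Ω, φ z • k z := by
      have := (h1.2.2 φ hφ hc hs).symm.trans (h2.2.2 φ hφ hc hs)
      exact smul_right_injective V (by positivity : ((-1 : ℝ) ^ α.len) ≠ 0) this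
    have e2 : ∫ z in Ω, φ z • (h - k) z = 0 := by
      simp only [Pi.sub_apply, smul_sub]
      rw [integral_sub (hi h1.2.1 φ hφ hc hs) (hi h2.2.1 φ hφ hc hs), e, sub_self]
    rw [← e2, setIntegral_smul_eq_integral hs]
  rw [EventuallyEq, ae_restrict_iff' hΩ.measurableSet]
  filter_upwards [h0] with z hz hzΩ
  exact sub_eq_zero.1 (hz hzΩ)

lemma IsWeakDeriv.add {g' h' : SpaceTime → V} (h1 : IsWeakDeriv Ω α g h)
    (h2 : IsWeakDeriv Ω α g' h') : IsWeakDeriv Ω α (fun z => g z + g' z) (fun z => h z + h' z) := by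
  refine ⟨h1.1.add h2.1, h1.2.1.add h2.2.1, fun φ hφ hc hs => ?_⟩
  have hs' := (tsupport_pdIter_subset α φ).trans hs
  have hc' := hc.mono' ((subset_tsupport _).trans (tsupport_pdIter_subset α φ))
  have hφ' := (pdIter_contDiff_top hφ α).continuous
  simp only [smul_add]
  rw [integral_add (integrable_smul_of_tsupport_subset h1.1 hφ' hc' hs').restrict
      (integrable_smul_of_tsupport_subset h2.1 hφ' hc' hs').restrict,
    integral_add (integrable_smul_of_tsupport_subset h1.2.1 hφ.continuous hc hs).restrict
      (integrable_smul_of_tsupport_subset h2.2.1 hφ.continuous hc hs).restrict,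
    h1.2.2 φ hφ hc hs, h2.2.2 φ hφ hc hs, smul_add]

lemma IsWeakDeriv.zero : IsWeakDeriv Ω α (fun _ => (0 : V)) (fun _ => (0 : V)) :=
  ⟨locallyIntegrable_zero.locallyIntegrableOn _, locallyIntegrable_zero.locallyIntegrableOn _,
    fun φ _ _ _ => by simp⟩

lemma IsWeakDeriv.sum {ι : Type*} (s : Finset ι) {g h : ι → SpaceTime → V}
    (H : ∀ i ∈ s, IsWeakDeriv Ω α (g i) (h i)) :
    IsWeakDeriv Ω α (fun z => ∑ i ∈ s, g i z) (fun z => ∑ i ∈ s, h i z) := by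
  classical
  induction s using Finset.induction_on with
  | empty => simpa using IsWeakDeriv.zero
  | insert a s ha ih =>
    simp only [Finset.sum_insert ha]
    exact (H a (Finset.mem_insert_self a s)).add (ih fun i hi => H i (Finset.mem_insert_of_mem hi))

lemma IsWeakDeriv.clm_comp [CompleteSpace V] {W : Type*} [NormedAddCommGroup W] [NormedSpace ℝ W]
    [CompleteSpace W] (h1 : IsWeakDeriv Ω α g h) (L : V →L[ℝ] W) :
    IsWeakDeriv Ω α (fun z => L (g z)) (fun z => L (h z)) := by
  have hL : ∀ {a : SpaceTime → V}, LocallyIntegrableOn a Ω →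
      LocallyIntegrableOn (fun z => L (a z)) Ω := by
    intro a ha x hx
    obtain ⟨U, hU, hi⟩ := ha x hx
    exact ⟨U, hU, L.integrable_comp hi⟩
  refine ⟨hL h1.1, hL h1.2.1, fun φ hφ hc hs => ?_⟩
  have hs' := (tsupport_pdIter_subset α φ).trans hs
  have hc' := hc.mono' ((subset_tsupport _).trans (tsupport_pdIter_subset α φ))
  have hφ' := (pdIter_contDiff_top hφ α).continuous
  simp only [← map_smul]
  rw [L.integral_comp_comm (integrable_smul_of_tsupport_subset h1.1 hφ' hc' hs').restrict,
    L.integral_comp_comm (integrable_smul_of_tsupport_subset h1.2.1 hφ.continuous hc hs).restrict,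
    h1.2.2 φ hφ hc hs, map_smul]

lemma continuous_pd (hv : ContDiff ℝ 1 v) (i : Fin 3) : Continuous (pd i v) :=
  (hv.continuous_fderiv (by simp)).clm_apply continuous_const

lemma hasCompactSupport_pd (hc : HasCompactSupport v) (i : Fin 3) : HasCompactSupport (pd i v) :=
  hc.mono' ((subset_tsupport _).trans (tsupport_pd_subset i v))

/-- Classical derivatives are weak derivatives. -/
lemma isWeakDeriv_pd (hΩ : IsOpen Ω) (hv : ContDiffOn ℝ 1 v Ω) (i : Fin 3) :
    IsWeakDeriv Ω (unitIdx i) v (pd i v) := by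
  have h1 : ContinuousOn (pd i v) Ω :=
    (hv.continuousOn_fderiv_of_isOpen hΩ (by simp)).clm_apply continuousOn_const
  have l0 := hv.continuousOn.locallyIntegrableOn hΩ.measurableSet (μ := volume)
  have l1 := h1.locallyIntegrableOn hΩ.measurableSet (μ := volume)
  refine ⟨l0, l1, fun φ hφ hc hs => ?_⟩
  have hφ1 := contDiff_nat_of_top hφ 1
  rw [pdIter_unitIdx, unitIdx_len, pow_one, neg_one_smul,
    setIntegral_smul_eq_integral ((tsupport_pd_subset i φ).trans hs),
    setIntegral_smul_eq_integral hs, eq_neg_iff_add_eq_zero, add_comm, ← eq_neg_iff_add_eq_zero]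
  refine integral_smul_fderiv_eq_neg_fderiv_smul_of_integrable ?_ ?_ ?_ ?_ ?_
  · exact integrable_smul_of_tsupport_subset l0 (continuous_pd hφ1 i)
      (hasCompactSupport_pd hc i) ((tsupport_pd_subset i φ).trans hs)
  · exact integrable_smul_of_tsupport_subset l1 hφ.continuous hc hs
  · exact integrable_smul_of_tsupport_subset l0 hφ.continuous hc hs
  · exact fun z _ => hφ1.differentiable (by simp) z
  · exact fun z hz => (hv.contDiffAt (hΩ.mem_nhds (hs hz))).differentiableAt (by simp)

/-- A sequence of mollifiers with radius tending to `0`. -/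
noncomputable def moll (k : ℕ) : ContDiffBump (0 : SpaceTime) where
  rIn := 1 / (k + 1) / 2
  rOut := 1 / (k + 1)
  rIn_pos := by positivity
  rIn_lt_rOut := by
    have : (0 : ℝ) < 1 / (k + 1) := by positivity
    linarith

lemma tendsto_moll_rOut : Tendsto (fun k => (moll k).rOut) atTop (𝓝 0) :=
  tendsto_one_div_add_atTop_nhds_zero_nat

/-- The convolution of a mollifier with `a`. -/
noncomputable abbrev mollify (k : ℕ) (a : SpaceTime → V) : SpaceTime → V :=
  convolution ((moll k).normed volume) a (ContinuousLinearMap.lsmul ℝ ℝ) volume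

/-- First-order weak derivatives may be tested against `C¹` functions. -/
lemma IsWeakDeriv.test_contDiff_one {i : Fin 3} (hΩ : IsOpen Ω) (h1 : IsWeakDeriv Ω (unitIdx i) g h)
    {ψ : SpaceTime → ℝ} (hψ : ContDiff ℝ 1 ψ) (hc : HasCompactSupport ψ) (hs : tsupport ψ ⊆ Ω) :
    ∫ z, pd i ψ z • g z = - ∫ z, ψ z • h z := by
  obtain ⟨δ, hδ, hδΩ⟩ := IsCompact.exists_cthickening_subset_open hc hΩ hs
  have hli : LocallyIntegrable ψ := hψ.continuous.locallyIntegrable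
  set Ψ : ℕ → SpaceTime → ℝ := fun k => mollify k ψ with hΨ
  have hΨs : ∀ k, ContDiff ℝ ∞ (Ψ k) := fun k =>
    (moll k).hasCompactSupport_normed.contDiff_convolution_left (n := ⊤) (ContinuousLinearMap.lsmul ℝ ℝ)
      (moll k).contDiff_normed hli
  have hΨc : ∀ k, HasCompactSupport (Ψ k) := fun k =>
    (moll k).hasCompactSupport_normed.convolution (ContinuousLinearMap.lsmul ℝ ℝ) hc
  have hpd : ∀ k z, pd i (Ψ k) z = mollify k (pd i ψ) z := by
    intro k z
    have e := hc.hasFDerivAt_convolution_right (ContinuousLinearMap.lsmul ℝ ℝ)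
      (((moll k).continuous_normed (μ := volume)).locallyIntegrable (μ := volume)) hψ z
    rw [pd, e.fderiv]
    simp only [mollify, MeasureTheory.convolution]
    rw [integral_apply]
    · rfl
    · exact (((moll k).hasCompactSupport_normed (μ := volume)).convolutionExists_left _
        ((moll k).continuous_normed (μ := volume))
        ((hψ.continuous_fderiv (by simp)).locallyIntegrable (μ := volume)) z)
  have hlim : ∀ (a : SpaceTime → ℝ), Continuous a → ∀ z, Tendsto (fun k => mollify k a z) atTop
        (𝓝 (a z)) := fun a ha z =>
    ContDiffBump.convolution_tendsto_right_of_continuous tendsto_moll_rOut ha z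
  have hbd : ∀ (a : SpaceTime → ℝ) (M : ℝ), Continuous a → (∀ z, ‖a z‖ ≤ M) → ∀ k z,
      ‖mollify k a z‖ ≤ 3 * M := by
    intro a M ha hM k z
    have e := (moll k).dist_normed_convolution_le (μ := volume) (x₀ := z) (ε := 2 * M)
      ha.aestronglyMeasurable fun x _ => by
        rw [dist_eq_norm]
        linarith [norm_sub_le (a x) (a z), hM x, hM z]
    rw [dist_eq_norm] at e
    have e2 := norm_sub_norm_le (mollify k a z) (a z)
    linarith [hM z]
  have hsupp : ∀ᶠ k in atTop, ∀ z ∉ cthickening δ (tsupport ψ), Ψ k z = 0 := by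
    filter_upwards [tendsto_moll_rOut.eventually_lt_const hδ] with k hk z hz
    refine image_eq_zero_of_notMem_tsupport fun hz' => hz ?_
    have e1 : tsupport (Ψ k) ⊆ cthickening δ (tsupport ψ) := by
      refine closure_minimal ?_ Metric.isClosed_cthickening
      refine (support_convolution_subset (ContinuousLinearMap.lsmul ℝ ℝ)).trans ?_
      rintro _ ⟨x, hx, y, hy, rfl⟩
      rw [ContDiffBump.support_normed_eq] at hx
      refine Metric.mem_cthickening_of_dist_le _ y _ _ (subset_tsupport _ hy) ?_
      rw [dist_eq_norm, add_sub_cancel_right]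
      rw [mem_ball, dist_zero_right] at hx
      exact (hx.trans hk).le
    exact e1 hz'
  set Z := cthickening δ (tsupport ψ) with hZ
  have hZc : IsCompact Z := IsCompact.cthickening hc
  have htsupp : ∀ᶠ k in atTop, tsupport (Ψ k) ⊆ Z := by
    filter_upwards [hsupp] with k hk
    refine closure_minimal (fun z hz => ?_) hZc.isClosed
    by_contra h
    exact hz (hk z h)
  have conv : ∀ (a : SpaceTime → ℝ) (b : SpaceTime → V), Continuous a → HasCompactSupport a →
      LocallyIntegrableOn b Ω →
      (∀ᶠ k in atTop, ∀ z ∉ Z, mollify k a z = 0) →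
      Tendsto (fun k => ∫ z, mollify k a z • b z) atTop (𝓝 (∫ z, a z • b z)) := by
    intro a b ha hac hb hZ0
    have hbZ : IntegrableOn b Z := hb.integrableOn_compact_subset hδΩ hZc
    obtain ⟨M, hM⟩ := ha.bounded_above_of_compact_support hac
    have e2 : ∀ᶠ k in atTop, ∫ z, mollify k a z • b z = ∫ z in Z, mollify k a z • b z := by
      filter_upwards [hZ0] with k hk
      refine (setIntegral_eq_integral_of_forall_compl_eq_zero fun z hz => ?_).symm
      rw [hk z hz, zero_smul]
    have e3 : ∫ z, a z • b z = ∫ z in Z, a z • b z := by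
      refine (setIntegral_eq_integral_of_forall_compl_eq_zero fun z hz => ?_).symm
      have : a z = 0 := by
        refine tendsto_nhds_unique (hlim a ha z) (tendsto_const_nhds.congr' ?_)
        filter_upwards [hZ0] with k hk using (hk z hz).symm
      rw [this, zero_smul]
    rw [tendsto_congr' e2, e3]
    refine tendsto_integral_of_dominated_convergence (fun z => 3 * M * ‖b z‖) ?_
      (hbZ.norm.const_mul (3 * M)) ?_ ?_
    · intro k
      refine AEStronglyMeasurable.smul ?_ hbZ.1
      exact (((moll k).hasCompactSupport_normed.contDiff_convolution_left (n := ⊤) (ContinuousLinearMap.lsmul ℝ ℝ)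
        (moll k).contDiff_normed ha.locallyIntegrable).continuous).aestronglyMeasurable
    · intro k
      refine Eventually.of_forall fun z => ?_
      rw [norm_smul]
      exact mul_le_mul_of_nonneg_right (hbd a M ha hM k z) (norm_nonneg _)
    · exact Eventually.of_forall fun z => (hlim a ha z).smul_const _
  have L1 := conv (pd i ψ) g (continuous_pd hψ i) (hasCompactSupport_pd hc i) h1.1 (by
    filter_upwards [htsupp] with k hk z hz
    rw [← hpd]
    exact image_eq_zero_of_notMem_tsupport fun h => hz (hk (tsupport_pd_subset i _ h)))
  have L2 := conv ψ h hψ.continuous hc h1.2.1 hsupp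
  refine tendsto_nhds_unique L1 (L2.neg.congr' ?_)
  filter_upwards [htsupp] with k hk
  have e := h1.2.2 (Ψ k) (hΨs k) (hΨc k) (hk.trans hδΩ)
  rw [pdIter_unitIdx, unitIdx_len, pow_one, neg_one_smul,
    setIntegral_smul_eq_integral ((tsupport_pd_subset i _).trans (hk.trans hδΩ)),
    setIntegral_smul_eq_integral (hk.trans hδΩ)] at e
  simp only [← hpd]
  exact e.symm

/-- The product rule with a scalar `C¹` factor. -/
lemma IsWeakDeriv.smul_contDiff {i : Fin 3} (hΩ : IsOpen Ω) (h1 : IsWeakDeriv Ω (unitIdx i) g h)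
    {a : SpaceTime → ℝ} (ha : ContDiff ℝ 1 a) :
    IsWeakDeriv Ω (unitIdx i) (fun z => a z • g z) (fun z => a z • h z + pd i a z • g z) := by
  have hl : ∀ {b : SpaceTime → ℝ} {k : SpaceTime → V}, Continuous b → LocallyIntegrableOn k Ω →
      LocallyIntegrableOn (fun z => b z • k z) Ω := fun hb hk =>
    hk.continuousOn_smul hΩ.isLocallyClosed hb.continuousOn
  have ha' := continuous_pd ha i
  refine ⟨hl ha.continuous h1.1, (hl ha.continuous h1.2.1).add (hl ha' h1.1), fun φ hφ hc hs => ?_⟩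
  have hφ1 := contDiff_nat_of_top hφ 1
  have hs' := (tsupport_pd_subset i φ).trans hs
  have hψ : ContDiff ℝ 1 (fun z => φ z * a z) := hφ1.mul ha
  have hψs : tsupport (fun z => φ z * a z) ⊆ Ω := (tsupport_mul_subset_left).trans hs
  have e := h1.test_contDiff_one hΩ hψ hc.mul_right hψs
  have hpd : ∀ z, pd i (fun z => φ z * a z) z = pd i φ z * a z + φ z * pd i a z := by
    intro z
    unfold pd
    rw [fderiv_fun_mul (hφ1.differentiable (by simp) z) (ha.differentiable (by simp) z)]
    simp; ring
  rw [pdIter_unitIdx, unitIdx_len, pow_one, neg_one_smul, setIntegral_smul_eq_integral hs',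
    setIntegral_smul_eq_integral hs]
  have i1 := integrable_smul_of_tsupport_subset (hl ha.continuous h1.1) (continuous_pd hφ1 i)
    (hasCompactSupport_pd hc i) hs'
  have i2 := integrable_smul_of_tsupport_subset (hl ha' h1.1) hφ.continuous hc hs
  have i3 := integrable_smul_of_tsupport_subset (hl ha.continuous h1.2.1) hφ.continuous hc hs
  simp only [hpd, add_smul, mul_smul] at e
  rw [integral_add i1 i2] at e
  simp only [smul_add]
  rw [integral_add i3 i2, neg_add, ← e]
  abel

end WeakDerivatives

section WeakKernelBound

open scoped ENNReal
open ContinuousLinearMap (lsmul)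

/-- Jensen's inequality for the square of an average. -/
lemma enorm_integral_smul_sq_le {α : Type*} [MeasurableSpace α] {μ : Measure α} {φ : α → ℝ}
    (hφm : Measurable φ) (hφ0 : ∀ w, 0 ≤ φ w) (hφi : Integrable φ μ) (hφ1 : ∫ w, φ w ∂μ = 1)
    {a : α → V} (ha : AEStronglyMeasurable a μ) :
    ‖∫ w, φ w • a w ∂μ‖ₑ ^ 2 ≤ ∫⁻ w, ofReal (φ w) * ‖a w‖ₑ ^ 2 ∂μ := by
  have h1 : ∫⁻ w, ofReal (φ w) ∂μ = 1 := by
    rw [← ofReal_integral_eq_lintegral_ofReal hφi (.of_forall hφ0), hφ1, ENNReal.ofReal_one]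
  have h2 : ‖∫ w, φ w • a w ∂μ‖ₑ ≤ ∫⁻ w, ofReal (φ w) * ‖a w‖ₑ ∂μ := by
    refine (enorm_integral_le_lintegral_enorm _).trans (lintegral_mono fun w => ?_)
    rw [enorm_smul, Real.enorm_eq_ofReal (hφ0 w)]
  have h3 := ENNReal.lintegral_mul_norm_pow_le (μ := μ)
    (f := fun w => ofReal (φ w)) (g := fun w => ofReal (φ w) * ‖a w‖ₑ ^ 2)
    (by fun_prop) ((by fun_prop : AEMeasurable (fun w => ofReal (φ w)) μ).mul
      (ha.enorm.pow_const 2)) (p := 1 / 2) (q := 1 / 2) (by norm_num) (by norm_num) (by norm_num)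
  rw [h1, ENNReal.one_rpow, one_mul] at h3
  have h4 : ∫⁻ w, ofReal (φ w) * ‖a w‖ₑ ∂μ ≤ ∫⁻ w, ofReal (φ w) ^ (1 / 2 : ℝ) *
      (ofReal (φ w) * ‖a w‖ₑ ^ 2) ^ (1 / 2 : ℝ) ∂μ := by
    refine lintegral_mono fun w => ?_
    rw [mul_rpow_of_nonneg _ _ (by norm_num), ← mul_assoc,
      ← ENNReal.rpow_add_of_nonneg _ _ (by norm_num) (by norm_num),
      ← rpow_natCast, ← rpow_mul]
    norm_num
  refine (pow_le_pow_left (h2.trans (h4.trans h3)) (n := 2)).trans (le_of_eq ?_)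
  rw [← rpow_natCast, ← rpow_mul]
  norm_num

lemma norm_clm_plane_le (L : Plane →L[ℝ] V) : ‖L‖ ≤ ∑ j : Fin 2, ‖L (single j 1)‖ := by
  refine L.opNorm_le_bound (by positivity) fun x => ?_
  have hx : x = ∑ j : Fin 2, x j • (single j (1 : ℝ) : Plane) := by
    ext i; fin_cases i <;> simp
  conv_lhs => rw [hx]
  rw [map_sum, sum_mul]
  refine (norm_sum_le _ _).trans (sum_le_sum fun j _ => ?_)
  rw [map_smul, norm_smul, mul_comm]
  gcongr
  exact PiLp.norm_apply_le x j

lemma enorm_clm_plane_sq_le (L : Plane →L[ℝ] V) :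
    ‖L‖ₑ ^ 2 ≤ 2 * ∑ j : Fin 2, ‖L (single j 1)‖ₑ ^ 2 := by
  have h1 := norm_clm_plane_le L
  have h2 : ‖L‖ ^ 2 ≤ 2 * ∑ j : Fin 2, ‖L (single j 1)‖ ^ 2 := by
    simp only [sum_univ_two] at h1 ⊢
    nlinarith [norm_nonneg L, sq_nonneg (‖L (single 0 1)‖ - ‖L (single 1 1)‖)]
  simp only [← ofReal_norm]
  simp only [← ENNReal.ofReal_pow (norm_nonneg _)]
  rw [← ENNReal.ofReal_sum_of_nonneg fun _ _ => by positivity]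
  have h3 := ofReal_le_ofReal h2
  rwa [ofReal_mul (by norm_num), ofReal_ofNat] at h3

lemma enorm_fderiv_slice_sq_le (hv : DifferentiableAt ℝ v (t, x)) :
    ‖fderiv ℝ (fun y => v (t, y)) x‖ₑ ^ 2 ≤ 2 * ∑ j : Fin 2, ‖pd j.succ v (t, x)‖ₑ ^ 2 := by
  have h := hv.hasFDerivAt.comp x (hasFDerivAt_prodMk_right (𝕜 := ℝ) t x)
  have h' : fderiv ℝ (fun y => v (t, y)) x = (fderiv ℝ v (t, x)).comp (inr ℝ ℝ Plane) := h.fderiv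
  rw [h']
  refine (enorm_clm_plane_sq_le _).trans (le_of_eq ?_)
  simp only [pd, stDir_succ]
  rfl

lemma contDiff_mollify [CompleteSpace V] (ha : LocallyIntegrable a) (k : ℕ) :
    ContDiff ℝ 1 (mollify k a) :=
  ((moll k).hasCompactSupport_normed.contDiff_convolution_left (n := ⊤) (lsmul ℝ ℝ)
      (moll k).contDiff_normed ha).of_le (by exact_mod_cast le_top)

lemma mollify_apply (a : SpaceTime → V) (k : ℕ) (z : SpaceTime) :
    mollify k a z = ∫ w, (moll k).normed volume (z - w) • a w := by
  rw [mollify, convolution_eq_swap]; rfl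

lemma pd_mollify [CompleteSpace V] (ha : LocallyIntegrable a) (k : ℕ) (i : Fin 3) (z : SpaceTime) :
    pd i (mollify k a) z = ∫ w, pd i ((moll k).normed volume) (z - w) • a w := by
  have hs := (moll k).hasCompactSupport_normed (μ := volume)
  have hd : ContDiff ℝ 1 ((moll k).normed volume) := (moll k).contDiff_normed (n := 1)
  have e := hs.hasFDerivAt_convolution_left (lsmul ℝ ℝ (E := V)) hd ha z
  rw [pd, mollify, e.fderiv, convolution_eq_swap, integral_apply]
  · rfl
  · have := (hs.fderiv ℝ).convolutionExists_left ((lsmul ℝ ℝ (E := V)).precompL SpaceTime)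
      (hd.continuous_fderiv (by simp)) ha z
    exact (convolutionExistsAt_flip (L := (lsmul ℝ ℝ (E := V)).precompL SpaceTime)).2 this

/-- Near points of `Ω`, the mollification commutes with weak derivatives; all terms are controlled
by averages. -/
lemma mollify_sq_add_le [CompleteSpace V] {G : SpaceTime → V} {D : Fin 2 → SpaceTime → V}
    {b : SpaceTime → ℝ≥0∞} (hG : LocallyIntegrable ((Γ.cyl T).indicator G))
    (hD : ∀ j, IsWeakDeriv (Γ.cyl T) (unitIdx j.succ) G (D j))
    (hGD : ∀ᵐ z ∂volume.restrict (Γ.cyl T), ‖G z‖ₑ ^ 2 + 2 * ∑ j, ‖D j z‖ₑ ^ 2 ≤ b z) {y : Plane}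
    (hz : closedBall (t, y) (moll k).rOut ⊆ Γ.cyl T) :
    ‖mollify k ((Γ.cyl T).indicator G) (t, y)‖ₑ ^ 2 +
      ‖fderiv ℝ (fun y => mollify k ((Γ.cyl T).indicator G) (t, y)) y‖ₑ ^ 2 ≤
      ∫⁻ w, ofReal ((moll k).normed volume ((t, y) - w)) * b w := by
  have hΩ := Coeffs.isOpen_cyl Γ T
  set z : SpaceTime := (t, y) with hzdef
  set η : SpaceTime → ℝ := (moll k).normed volume with hη
  have hηs : ContDiff ℝ ∞ η := (moll k).contDiff_normed (n := ⊤)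
  set φ : SpaceTime → ℝ := fun w => η (z - w) with hφ
  have hφs : ContDiff ℝ ∞ φ := hηs.comp (contDiff_const.sub contDiff_id)
  have hsuppφ : tsupport φ ⊆ closedBall z (moll k).rOut := by
    refine closure_minimal (fun w hw => ?_) Metric.isClosed_closedBall
    have h1 : z - w ∈ Function.support η := hw
    rw [hη, ContDiffBump.support_normed_eq, mem_ball, dist_zero_right] at h1
    rw [Metric.mem_closedBall, dist_comm, dist_eq_norm]
    exact h1.le
  have hφc : HasCompactSupport φ :=
    (isCompact_closedBall z (moll k).rOut).of_isClosed_subset isClosed_closure hsuppφ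
  have hsΩ : tsupport φ ⊆ Γ.cyl T := hsuppφ.trans hz
  have hφ0 : ∀ w, 0 ≤ φ w := fun w => (moll k).nonneg_normed _
  have hφ1 : ∫ w, φ w = 1 := by
    rw [hφ, integral_sub_left_eq_self η volume z]; exact (moll k).integral_normed
  have hφi : Integrable φ := hφs.continuous.integrable_of_hasCompactSupport hφc
  have hφΩ : ∫ w in Γ.cyl T, φ w = 1 := by
    rw [← hφ1]
    exact setIntegral_eq_integral_of_forall_compl_eq_zero fun w hw =>
      image_eq_zero_of_notMem_tsupport fun h => hw (hsΩ h)
  have hind : ∀ {ψ : SpaceTime → ℝ}, tsupport ψ ⊆ Γ.cyl T →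
      ∫ w, ψ w • (Γ.cyl T).indicator G w = ∫ w in Γ.cyl T, ψ w • G w := by
    intro ψ hψ
    rw [← setIntegral_smul_eq_integral hψ]
    refine setIntegral_congr_fun hΩ.measurableSet fun w hw => ?_
    simp only [indicator_of_mem hw]
  have e0 : mollify k ((Γ.cyl T).indicator G) z = ∫ w in Γ.cyl T, φ w • G w := by
    rw [mollify_apply]; exact hind hsΩ
  have ej : ∀ j : Fin 2, pd j.succ (mollify k ((Γ.cyl T).indicator G)) z =
      ∫ w in Γ.cyl T, φ w • D j w := by
    intro j
    rw [pd_mollify hG]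
    have h1 : ∀ w, pd j.succ φ w = - pd j.succ η (z - w) := by
      intro w
      have h2 : HasFDerivAt η (fderiv ℝ η (z - w)) (z - w) :=
        (hηs.differentiable (by simp) _).hasFDerivAt
      have h3 := h2.comp w ((hasFDerivAt_id w).const_sub z)
      rw [pd, show fderiv ℝ φ w = _ from h3.fderiv]
      simp [pd]
    have h4 : ∀ w, pd j.succ η (z - w) = - pd j.succ φ w := fun w => by rw [h1, neg_neg]
    have h5 := (hD j).2.2 φ hφs hφc hsΩ
    rw [pdIter_unitIdx, unitIdx_len, pow_one, neg_one_smul] at h5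
    simp only [← hη, h4, neg_smul, integral_neg]
    rw [hind ((tsupport_pd_subset _ _).trans hsΩ), h5, neg_neg]
  have jen : ∀ {a : SpaceTime → V}, LocallyIntegrableOn a (Γ.cyl T) →
      ‖∫ w in Γ.cyl T, φ w • a w‖ₑ ^ 2 ≤ ∫⁻ w in Γ.cyl T, ofReal (φ w) * ‖a w‖ₑ ^ 2 := fun ha =>
    enorm_integral_smul_sq_le hφs.continuous.measurable hφ0 hφi.restrict hφΩ
      ha.aestronglyMeasurable
  have hmeas : ∀ {a : SpaceTime → V}, LocallyIntegrableOn a (Γ.cyl T) →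
      AEMeasurable (fun w => ofReal (φ w) * ‖a w‖ₑ ^ 2) (volume.restrict (Γ.cyl T)) :=
    fun ha => hφs.continuous.measurable.ennreal_ofReal.aemeasurable.mul
      (ha.aestronglyMeasurable.enorm.pow_const 2)
  have hGl := (hD 0).1
  have hcd : DifferentiableAt ℝ (mollify k ((Γ.cyl T).indicator G)) (t, y) :=
    (contDiff_mollify hG k).differentiable (by simp) _
  calc _ ≤ ‖mollify k ((Γ.cyl T).indicator G) z‖ₑ ^ 2 +
        2 * ∑ j : Fin 2, ‖pd j.succ (mollify k ((Γ.cyl T).indicator G)) z‖ₑ ^ 2 :=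
        add_le_add le_rfl (enorm_fderiv_slice_sq_le hcd)
    _ ≤ (∫⁻ w in Γ.cyl T, ofReal (φ w) * ‖G w‖ₑ ^ 2) +
        2 * ∑ j : Fin 2, ∫⁻ w in Γ.cyl T, ofReal (φ w) * ‖D j w‖ₑ ^ 2 := by
        rw [e0]
        refine add_le_add (jen hGl) (mul_le_mul' le_rfl (sum_le_sum fun j _ => ?_))
        rw [ej j]
        exact jen (hD j).2.1
    _ = ∫⁻ w in Γ.cyl T, ofReal (φ w) * (‖G w‖ₑ ^ 2 + 2 * ∑ j, ‖D j w‖ₑ ^ 2) := by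
        rw [← lintegral_finsetSum' _ fun j _ => hmeas (hD j).2.1,
          ← lintegral_const_mul'' _ (aemeasurable_fun_sum _ fun j _ => hmeas (hD j).2.1),
          ← lintegral_add_left' (hmeas hGl)]
        refine lintegral_congr fun w => ?_
        rw [← mul_sum]; ring
    _ ≤ ∫⁻ w in Γ.cyl T, ofReal (φ w) * b w := by
        refine lintegral_mono_ae ?_
        filter_upwards [hGD] with w hw
        exact mul_le_mul' le_rfl hw
    _ ≤ _ := setLIntegral_le_lintegral _ _

lemma lintegral_mollify_kern (h s : ℝ) {b : SpaceTime → ℝ≥0∞} (hb : Measurable b) (k : ℕ) (t : ℝ)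
    (x : Plane) :
    ∫⁻ y, (∫⁻ w, ofReal ((moll k).normed volume ((t, y) - w)) * b w) * kern h s (x - y) =
      ∫⁻ w : SpaceTime, ofReal ((moll k).normed volume w) *
        ∫⁻ y, b (t - w.1, y) * kern h s (x - w.2 - y) := by
  set η : SpaceTime → ℝ := (moll k).normed volume with hη
  have hηm : Measurable η := (moll k).continuous_normed.measurable
  have hηm' : Measurable fun w => ofReal (η w) := hηm.ennreal_ofReal
  have hkm := measurable_kern h s
  calc _ = ∫⁻ y, ∫⁻ w : SpaceTime, ofReal (η w) * (b ((t, y) - w) * kern h s (x - y)) := by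
        refine lintegral_congr fun y => ?_
        have e1 : ∫⁻ w, ofReal (η ((t, y) - w)) * b w = ∫⁻ w, ofReal (η w) * b ((t, y) - w) := by
          rw [← lintegral_sub_left_eq_self (fun w => ofReal (η w) * b ((t, y) - w)) (t, y)]
          simp
        have hm1 : Measurable fun w : SpaceTime => ofReal (η w) * b ((t, y) - w) :=
          hηm'.mul (hb.comp (measurable_const.sub measurable_id))
        rw [e1, ← lintegral_mul_const _ hm1]
        simp only [mul_assoc]
    _ = ∫⁻ w : SpaceTime, ∫⁻ y, ofReal (η w) * (b ((t, y) - w) * kern h s (x - y)) := by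
        refine lintegral_lintegral_swap (Measurable.aemeasurable ?_)
        refine (hηm'.comp measurable_snd).mul ((hb.comp ?_).mul (hkm.comp ?_))
        · exact (measurable_const.prodMk measurable_fst).sub measurable_snd
        · exact measurable_const.sub measurable_fst
    _ = _ := by
        refine lintegral_congr fun w => ?_
        have hm2 : Measurable fun y : Plane => b ((t, y) - w) * kern h s (x - y) :=
          (hb.comp ((measurable_const.prodMk measurable_id).sub measurable_const)).mul
            (hkm.comp (measurable_const.sub measurable_id))
        rw [lintegral_const_mul _ hm2]
        congr 1
        rw [← lintegral_add_right_eq_self (fun y => b ((t, y) - w) * kern h s (x - y)) w.2]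
        refine lintegral_congr fun y => ?_
        congr 2
        · ext1
          · rfl
          · change y + w.2 - w.2 = y; abel
        · abel

/-- The kernel inequality for weakly differentiable functions. -/
theorem weak_kernel_bound {s : ℝ} {C : ℝ≥0∞} [CompleteSpace V] (hC : C ≠ (⊤ : ℝ≥0∞))
    (hker : ∀ x ∈ Γ.ext, ∃ k : Set Plane, IsCompact k ∧ k ⊆ Γ.ext ∧ ∀ v : Plane → V, ContDiff ℝ 1 v
      → ‖v x‖ₑ ^ 2 ≤ C * ∫⁻ y in k, (‖v y‖ₑ ^ 2 + ‖fderiv ℝ v y‖ₑ ^ 2) * kern h s (x - y))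
    {G : SpaceTime → V} {D : Fin 2 → SpaceTime → V} {b : SpaceTime → ℝ≥0∞}
    (hG : LocallyIntegrable ((Γ.cyl T).indicator G))
    (hD : ∀ j, IsWeakDeriv (Γ.cyl T) (unitIdx j.succ) G (D j)) (hb : Measurable b)
    (hGD : ∀ᵐ z ∂volume.restrict (Γ.cyl T), ‖G z‖ₑ ^ 2 + 2 * ∑ j, ‖D j z‖ₑ ^ 2 ≤ b z)
    (hW : ∀ R : ℝ, ∫⁻ z in ball (0 : SpaceTime) R, (∫⁻ y, b (z.1, y) * kern h s (z.2 - y)) < (⊤ :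
      ℝ≥0∞)) : ∀ᵐ z ∂volume.restrict (Γ.cyl T),
      ‖G z‖ₑ ^ 2 ≤ C * ∫⁻ y, b (z.1, y) * kern h s (z.2 - y) := by
  have hΩ := Coeffs.isOpen_cyl Γ T
  obtain ⟨W, hWdef⟩ : ∃ W : SpaceTime → ℝ≥0∞,
    W = fun z => ∫⁻ y, b (z.1, y) * kern h s (z.2 - y) := ⟨_, rfl⟩
  have hWz : ∀ z : SpaceTime, ∫⁻ y, b (z.1, y) * kern h s (z.2 - y) = W z := fun z => by rw [hWdef]
  simp only [hWz] at hW ⊢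
  have hWm : Measurable W := by
    rw [hWdef]
    refine Measurable.lintegral_prod_right' (f := fun p : SpaceTime × Plane =>
      b (p.1.1, p.2) * kern h s (p.1.2 - p.2)) ?_
    exact (hb.comp (by fun_prop)).mul ((measurable_kern h s).comp (by fun_prop))
  have hWfin : ∀ᵐ z, W z < (⊤ : ℝ≥0∞) := by
    have h1 : ∀ n : ℕ, ∀ᵐ z, z ∈ ball (0 : SpaceTime) n → W z < (⊤ : ℝ≥0∞) := fun n =>
      (ae_restrict_iff' isOpen_ball.measurableSet).1 (ae_lt_top hWm (hW n).ne)
    filter_upwards [ae_all_iff.2 h1] with z hz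
    obtain ⟨n, hn⟩ := exists_nat_gt ‖z‖
    exact hz n (by simpa using hn)
  have hWl : LocallyIntegrable fun z => (W z).toReal := by
    intro z
    refine ⟨ball 0 (‖z‖ + 1), isOpen_ball.mem_nhds (by simp), ?_⟩
    exact integrable_toReal_of_lintegral_ne_top hWm.aemeasurable (hW _).ne
  have lim1 := ContDiffBump.ae_convolution_tendsto_right_of_locallyIntegrable (μ := volume)
    (K := 2) tendsto_moll_rOut (.of_forall fun k => by
      change (1 : ℝ) / (k + 1) ≤ 2 * (1 / (k + 1) / 2); linarith) hG
  have lim2 := ContDiffBump.ae_convolution_tendsto_right_of_locallyIntegrable (μ := volume)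
    (K := 2) tendsto_moll_rOut (.of_forall fun k => by
      change (1 : ℝ) / (k + 1) ≤ 2 * (1 / (k + 1) / 2); linarith) hWl
  rw [ae_restrict_iff' hΩ.measurableSet]
  filter_upwards [lim1, lim2, hWfin] with z l1 l2 hzfin hz
  obtain ⟨t, x⟩ := z
  obtain ⟨κ, hκ, hκE, hκv⟩ := hker x hz.2
  have hcomp : IsCompact (({t} : Set ℝ) ×ˢ κ) := isCompact_singleton.prod hκ
  obtain ⟨δ, hδ, hδΩ⟩ := hcomp.exists_cthickening_subset_open hΩ
    (fun w hw => ⟨by rw [hw.1]; exact hz.1, hκE hw.2⟩)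
  rw [indicator_of_mem hz] at l1
  have l1' : Tendsto (fun k => ‖mollify k ((Γ.cyl T).indicator G) (t, x)‖ₑ ^ 2) atTop
      (𝓝 (‖G (t, x)‖ₑ ^ 2)) :=
    ((ENNReal.continuous_pow 2).tendsto _).comp ((continuous_enorm.tendsto _).comp l1)
  have l2' : Tendsto (fun k => C * ofReal
      (mollify k (fun z => (W z).toReal) (t, x))) atTop (𝓝 (C * W (t, x))) := by
    have := ENNReal.Tendsto.const_mul (a := C)
      ((ENNReal.continuous_ofReal.tendsto _).comp l2) (Or.inr hC)
    rwa [ofReal_toReal hzfin.ne] at this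
  refine le_of_tendsto_of_tendsto l1' l2' ?_
  filter_upwards [tendsto_moll_rOut.eventually_lt_const hδ] with k hk
  have hcd := contDiff_mollify hG k
  have e1 := hκv (fun y => mollify k ((Γ.cyl T).indicator G) (t, y))
    (hcd.comp (by fun_prop : ContDiff ℝ 1 fun y : Plane => (t, y)))
  refine e1.trans (mul_le_mul' le_rfl ?_)
  calc _ ≤ ∫⁻ y in κ, (∫⁻ w, ofReal ((moll k).normed volume ((t, y) - w)) * b w) *
        kern h s (x - y) := by
        refine setLIntegral_mono' hκ.measurableSet fun y hy => mul_le_mul' ?_ le_rfl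
        refine mollify_sq_add_le hG hD hGD fun w hw => hδΩ ?_
        exact Metric.mem_cthickening_of_dist_le _ (t, y) _ _ ⟨rfl, hy⟩
          ((Metric.mem_closedBall.1 hw).trans hk.le)
    _ ≤ _ := setLIntegral_le_lintegral _ _
    _ = ∫⁻ w : SpaceTime, ofReal ((moll k).normed volume w) * W ((t, x) - w) := by
        rw [lintegral_mollify_kern h s hb]
        refine lintegral_congr fun w => ?_
        rw [hWdef]; rfl
    _ = ∫⁻ w : SpaceTime, ofReal ((moll k).normed volume w * (W ((t, x) - w)).toReal) := by
        have hfin' : ∀ᵐ w : SpaceTime, W ((t, x) - w) < (⊤ : ℝ≥0∞) :=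
          (quasiMeasurePreserving_sub_left volume ((t, x) : SpaceTime)).ae hWfin
        refine lintegral_congr_ae ?_
        filter_upwards [hfin'] with w hw
        rw [ofReal_mul ((moll k).nonneg_normed _), ofReal_toReal hw.ne]
    _ = _ := by
        rw [mollify, MeasureTheory.convolution, ← ofReal_integral_eq_lintegral_ofReal]
        · rfl
        · exact (moll k).hasCompactSupport_normed.convolutionExists_left (lsmul ℝ ℝ)
            (moll k).continuous_normed hWl (t, x)
        · exact Eventually.of_forall fun w => mul_nonneg ((moll k).nonneg_normed _)
            ENNReal.toReal_nonneg

end WeakKernelBound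

section SliceBounds

open scoped ENNReal

lemma le_jetNorm (D : Set Plane) (hp : 0 < p) (J : Jet V) (hβ : β.len ≤ k)
    (t : ℝ) : lpNormOn D p (fun x => J β (t, x)) ≤ jetNorm D k p J t := by
  obtain ⟨j, b⟩ := β
  simp only [len] at hβ
  have hsum : ∀ j : ℕ, 0 ≤ ∑ b ∈ pairsUpTo (k - j), lpNormOn D p (fun x => J (j, b) (t, x)) ^ p :=
    fun j => sum_nonneg fun b _ => rpow_nonneg (lpNormOn_nonneg _ _ _) _
  have h1 : lpNormOn D p (fun x => J (j, b) (t, x)) ≤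
      (∑ b ∈ pairsUpTo (k - j), lpNormOn D p (fun x => J (j, b) (t, x)) ^ p) ^ (1 / p) := by
    have hb : b ∈ pairsUpTo (k - j) := by
      simp only [pairsUpTo, mem_filter, mem_product, Finset.mem_range]; omega
    have h2 := single_le_sum (f := fun b => lpNormOn D p (fun x => J (j, b) (t, x)) ^ p)
      (fun b _ => rpow_nonneg (lpNormOn_nonneg _ _ _) _) hb
    calc _ = (lpNormOn D p (fun x => J (j, b) (t, x)) ^ p) ^ (1 / p) := by
          rw [← Real.rpow_mul (lpNormOn_nonneg _ _ _), mul_one_div_cancel hp.ne', Real.rpow_one]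
      _ ≤ _ := Real.rpow_le_rpow (rpow_nonneg (lpNormOn_nonneg _ _ _) _) h2 (by positivity)
  refine h1.trans ?_
  exact single_le_sum (f := fun j => (∑ b ∈ pairsUpTo (k - j),
    lpNormOn D p (fun x => J (j, b) (t, x)) ^ p) ^ (1 / p))
    (fun j _ => rpow_nonneg (hsum j) _) (Finset.mem_range.2 (by omega))

lemma eLpNorm_jet_le {D : Set Plane} (hp : 0 < p) {J : Jet V} (hβ : β.len ≤ k)
    (hc : ContInLp D T p (J β)) (ht : t ∈ Icc 0 T) (hM : jetNorm D k p J t ≤ M) :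
    eLpNorm (fun x => J β (t, x)) (ofReal p) (volume.restrict D) ≤ ofReal M := by
  rw [← ofReal_lpNormOn (hc t ht).1]
  exact ofReal_le_ofReal ((le_jetNorm D hp J hβ t).trans hM)

lemma lintegral_rpow_enorm_eq {α : Type*} [MeasurableSpace α] {μ : Measure α} (hp : 0 < p)
    (f : α → V) : ∫⁻ x, ‖f x‖ₑ ^ p ∂μ = eLpNorm f (ofReal p) μ ^ p := by
  rw [eLpNorm_eq_lintegral_rpow_enorm_toReal (by simpa using hp) ofReal_ne_top,
    ENNReal.toReal_ofReal hp.le, ← rpow_mul, one_div_mul_cancel hp.ne', ENNReal.rpow_one]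

lemma lintegral_sq_enorm_eq {α : Type*} [MeasurableSpace α] {μ : Measure α} (f : α → V) :
    ∫⁻ x, ‖f x‖ₑ ^ 2 ∂μ = eLpNorm f 2 μ ^ 2 := by
  have := lintegral_rpow_enorm_eq (μ := μ) (p := 2) two_pos f
  rw [ofReal_ofNat] at this
  exact_mod_cast this

lemma restrict_cyl (Γ : BoundaryCurve) (T : ℝ) : (volume : Measure SpaceTime).restrict (Γ.cyl T) =
    time[T].prod vol[Γ] := by
  rw [Measure.prod_restrict]; rfl

lemma lintegral_cyl {f : SpaceTime → ℝ≥0∞} (hf : AEMeasurable f (volume.restrict (Γ.cyl T))) :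
    ∫⁻ z in Γ.cyl T, f z = ∫⁻ t in Ioo 0 T, ∫⁻ x in Γ.ext, f (t, x) := by
  rw [restrict_cyl] at hf ⊢
  exact lintegral_prod f hf

lemma ae_cyl {P : SpaceTime → Prop} (h : ∀ᵐ z ∂volume.restrict (Γ.cyl T), P z) :
    ∀ᵐ t ∂time[T], ∀ᵐ x ∂vol[Γ], P (t, x) := by
  rw [restrict_cyl] at h
  exact Measure.ae_ae_of_ae_prod h

lemma lintegral_ball_cyl_lt_top {r : ℝ} {M : ℝ≥0∞}
    (ha : AEStronglyMeasurable a (volume.restrict (Γ.cyl T))) (hM : M ≠ (⊤ : ℝ≥0∞)) (hp : 0 < p)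
    (hr : r ∈ Icc 0 p) (haM : ∀ t ∈ Ioo 0 T, eLpNorm (fun x => a (t, x)) (ofReal p) vol[Γ] ≤ M)
    (R : ℝ) : ∫⁻ z in Γ.cyl T, (ball (0 : SpaceTime) R).indicator (fun z => ‖a z‖ₑ ^ r) z <
      (⊤ : ℝ≥0∞) := by
  have h0 : ∀ z, (ball (0 : SpaceTime) R).indicator (fun z => ‖a z‖ₑ ^ r) z ≤
      (ball (0 : SpaceTime) R).indicator (fun _ => 1) z + ‖a z‖ₑ ^ p := by
    intro z
    by_cases hz : z ∈ ball (0 : SpaceTime) R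
    · simp only [indicator_of_mem hz]
      rcases le_total ‖a z‖ₑ 1 with h | h
      · exact (ENNReal.rpow_le_one h hr.1).trans le_self_add
      · exact (ENNReal.rpow_le_rpow_of_exponent_le h hr.2).trans le_add_self
    · simp only [indicator_of_notMem hz]; exact zero_le
  refine (lintegral_mono h0).trans_lt ?_
  rw [lintegral_add_left (measurable_const.indicator isOpen_ball.measurableSet),
    lintegral_indicator isOpen_ball.measurableSet]
  refine ENNReal.add_lt_top.2 ⟨?_, ?_⟩
  · rw [lintegral_one, Measure.restrict_apply_univ]
    exact (Measure.restrict_apply_le _ _).trans_lt Metric.isBounded_ball.measure_lt_top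
  · rw [lintegral_cyl (ha.enorm.pow_const p)]
    calc _ ≤ ∫⁻ _ in Ioo 0 T, M ^ p := by
          refine setLIntegral_mono' measurableSet_Ioo fun t ht => ?_
          rw [lintegral_rpow_enorm_eq hp]
          exact rpow_le_rpow (haM t ht) hp.le
      _ < (⊤ : ℝ≥0∞) := by
          rw [lintegral_const, Measure.restrict_apply_univ]
          exact ENNReal.mul_lt_top (ENNReal.rpow_lt_top_of_nonneg hp.le hM) (by simp)

lemma locallyIntegrable_indicator_cyl {M : ℝ≥0∞}
    (ha : AEStronglyMeasurable a (volume.restrict (Γ.cyl T))) (hM : M ≠ (⊤ : ℝ≥0∞)) (hp : 1 ≤ p)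
    (haM : ∀ t ∈ Ioo 0 T, eLpNorm (fun x => a (t, x)) (ofReal p) vol[Γ] ≤ M) :
    LocallyIntegrable ((Γ.cyl T).indicator a) := by
  have hcm := (Coeffs.isOpen_cyl Γ T).measurableSet
  intro z
  refine ⟨ball 0 (‖z‖ + 1), isOpen_ball.mem_nhds (by simp), ?_⟩
  refine ⟨((aestronglyMeasurable_indicator_iff hcm).2 ha).restrict, ?_⟩
  have h1 := lintegral_ball_cyl_lt_top ha hM (by linarith) (r := 1) ⟨zero_le_one, hp⟩ haM (‖z‖ + 1)
  rw [← lintegral_indicator hcm] at h1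
  rw [hasFiniteIntegral_iff_enorm, ← lintegral_indicator isOpen_ball.measurableSet]
  refine lt_of_le_of_lt (lintegral_mono fun w => ?_) h1
  by_cases hw : w ∈ Γ.cyl T <;> by_cases hw' : w ∈ ball (0 : SpaceTime) (‖z‖ + 1) <;>
    simp [hw, hw', -mem_ball]

/-- The density `|J₀|² + 2 |∇J|²` of a jet. -/
noncomputable def jetDen (J : Jet V) (z : SpaceTime) : ℝ≥0∞ :=
  ‖J 0 z‖ₑ ^ 2 + 2 * ∑ j : Fin 2, ‖J (unitIdx j.succ) z‖ₑ ^ 2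

lemma IsWeakDeriv.refl {Ω : Set SpaceTime} {g : SpaceTime → V} (hg : LocallyIntegrableOn g Ω) :
    IsWeakDeriv Ω 0 g g :=
  ⟨hg, hg, fun φ _ _ _ => by simp [pdIter_zero, len]⟩

lemma kern_eq_zero {s : ℝ} {d : Plane} (hd : h < ‖d‖) : kern h s d = 0 := by
  rw [kern, indicator_of_notMem]
  simpa using hd

/-- The convolution with the kernel of a locally integrable density is locally integrable. -/
lemma lintegral_ball_kern_lt_top {s : ℝ} (hs : s < 2) {b : SpaceTime → ℝ≥0∞} (hb : Measurable b)
    (hbR : ∀ R, ∫⁻ z in ball (0 : SpaceTime) R, b z < (⊤ : ℝ≥0∞)) (R : ℝ) :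
    ∫⁻ z in ball (0 : SpaceTime) R, (∫⁻ y, b (z.1, y) * kern h s (z.2 - y)) < (⊤ : ℝ≥0∞) := by
  set R' := R + |h| + 1 with hR'
  set b' := (ball (0 : SpaceTime) R').indicator b with hb'
  have hb'm : Measurable b' := hb.indicator isOpen_ball.measurableSet
  have hk := measurable_kern h s
  have h1 : ∀ z ∈ ball (0 : SpaceTime) R, ∫⁻ y, b (z.1, y) * kern h s (z.2 - y) ≤
      ∫⁻ y, b' (z.1, y) * kern h s (z.2 - y) := by
    intro z hz
    refine lintegral_mono fun y => ?_
    by_cases hy : h < ‖z.2 - y‖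
    · rw [kern_eq_zero hy, mul_zero]; exact zero_le
    · refine mul_le_mul' (le_of_eq ?_) le_rfl
      rw [hb', indicator_of_mem]
      rw [mem_ball, dist_zero_right] at hz ⊢
      have h2 : ‖y‖ ≤ ‖z.2‖ + ‖z.2 - y‖ := by
        have := norm_sub_le z.2 (z.2 - y); rwa [sub_sub_cancel] at this
      have h3 := norm_snd_le z
      have h4 := norm_fst_le z
      have h5 := le_abs_self h
      rw [Prod.norm_def]
      refine max_lt ?_ ?_ <;> simp only <;> [skip; skip]
      · linarith [abs_nonneg h]
      · linarith
  have hmeas : Measurable fun p : SpaceTime × Plane => b' (p.1.1, p.2) * kern h s (p.1.2 - p.2) :=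
    (hb'm.comp (by fun_prop)).mul (hk.comp (by fun_prop))
  calc _ ≤ ∫⁻ z in ball (0 : SpaceTime) R, ∫⁻ y, b' (z.1, y) * kern h s (z.2 - y) :=
        setLIntegral_mono' isOpen_ball.measurableSet h1
    _ ≤ ∫⁻ z : SpaceTime, ∫⁻ y, b' (z.1, y) * kern h s (z.2 - y) := setLIntegral_le_lintegral _ _
    _ = ∫⁻ t : ℝ, ∫⁻ x : Plane, ∫⁻ y, b' (t, y) * kern h s (x - y) := by
        rw [Measure.volume_eq_prod, lintegral_prod _ hmeas.lintegral_prod_right'.aemeasurable]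
    _ = ∫⁻ t : ℝ, ∫⁻ y : Plane, b' (t, y) * ∫⁻ d, kern h s d := by
        refine lintegral_congr fun t => ?_
        rw [lintegral_lintegral_swap]
        · refine lintegral_congr fun y => ?_
          rw [lintegral_const_mul _ (measurable_kern_sub_left h s y)]
          congr 1
          exact lintegral_sub_right_eq_self (fun d => kern h s d) y
        · exact ((hb'm.comp (by fun_prop)).mul (hk.comp (by fun_prop))).aemeasurable
    _ = (∫⁻ z : SpaceTime, b' z) * ∫⁻ d, kern h s d := by
        rw [← lintegral_mul_const _ hb'm, Measure.volume_eq_prod, lintegral_prod]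
        exact (hb'm.mul_const _).aemeasurable
    _ < (⊤ : ℝ≥0∞) := by
        refine ENNReal.mul_lt_top ?_ ?_
        · rw [hb', lintegral_indicator isOpen_ball.measurableSet]; exact hbR _
        · have := lintegral_kern_rpow_lt_top (h := h) (s := s) (r := 1) one_pos (by linarith)
          simpa using this

/-- The kernel inequality on almost every time slice. -/
theorem BoundaryCurve.exists_slice_kernel_bound (Γ : BoundaryCurve) : ∃ h : ℝ, 0 < h ∧
    ∀ s : ℝ, 0 < s → s < 2 → ∃ C : ℝ≥0∞, C ≠ (⊤ : ℝ≥0∞) ∧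
    Γ.KernelBound h s C ∧
    ∀ {V : Type} [NormedAddCommGroup V] [NormedSpace ℝ V] [CompleteSpace V] {T p M : ℝ},
      2 ≤ p → ∀ (G : SpaceTime → V) (J : Jet V), IsWJet Γ T 1 p G J →
      (∀ t ∈ Icc 0 T, jetNorm Γ.ext 1 p J t ≤ M) →
      ∀ᵐ t ∂time[T], ∀ᵐ x ∂vol[Γ],
        ‖G (t, x)‖ₑ ^ 2 ≤ C * ∫⁻ y in Γ.ext, jetDen J (t, y) * kern h s (x - y) := by
  obtain ⟨h, hh, H⟩ := Γ.exists_kernel_bound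
  refine ⟨h, hh, fun s hs hs2 => ?_⟩
  obtain ⟨C, hC, hcl, hwk⟩ := H s hs
  refine ⟨C, hC, hcl, ?_⟩
  intro V _ _ _ T p M hp G J hJ hM
  have hΩ := Coeffs.isOpen_cyl Γ T
  have hp0 : 0 < p := by linarith
  have hlen : ∀ j : Fin 2, len (unitIdx j.succ) ≤ 1 := fun j => (unitIdx_len _).le
  have hG0 : G =ᵐ[volume.restrict (Γ.cyl T)] J 0 :=
    IsWeakDeriv.unique hΩ (IsWeakDeriv.refl (hJ 0 (by simp [len])).1.1)
      (hJ 0 (by simp [len])).1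
  have hJm : ∀ β : MultiIdx, β.len ≤ 1 →
      AEStronglyMeasurable (J β) (volume.restrict (Γ.cyl T)) := fun β hβ =>
    (hJ β hβ).1.2.1.aestronglyMeasurable
  have hJM : ∀ β : MultiIdx, β.len ≤ 1 → ∀ t ∈ Ioo 0 T, eLpNorm (fun x => J β (t, x))
      (ofReal p) vol[Γ] ≤ ofReal M := fun β hβ t ht =>
    eLpNorm_jet_le hp0 hβ (hJ β hβ).2 (Ioo_subset_Icc_self ht) (hM t (Ioo_subset_Icc_self ht))
  have hden : AEMeasurable (jetDen J) (volume.restrict (Γ.cyl T)) := by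
    refine ((hJm 0 (by simp [len])).enorm.pow_const 2).add
      (AEMeasurable.const_mul (aemeasurable_fun_sum _ fun j _ => ?_) _)
    exact (hJm _ (hlen j)).enorm.pow_const 2
  obtain ⟨b, hbm, hbe⟩ := (aemeasurable_indicator_iff hΩ.measurableSet).2 hden
  have hbden : ∀ᵐ z ∂volume.restrict (Γ.cyl T), b z = jetDen J z := by
    rw [ae_restrict_iff' hΩ.measurableSet]
    filter_upwards [hbe] with z hz hzc
    rw [← hz, indicator_of_mem hzc]
  have hbR : ∀ R, ∫⁻ z in ball (0 : SpaceTime) R, b z < (⊤ : ℝ≥0∞) := by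
    intro R
    have fin : ∀ β : MultiIdx, β.len ≤ 1 → ∫⁻ z in Γ.cyl T,
        (ball (0 : SpaceTime) R).indicator (fun z => ‖J β z‖ₑ ^ 2) z < (⊤ : ℝ≥0∞) := by
      intro β hβ
      have := lintegral_ball_cyl_lt_top (hJm β hβ) ofReal_ne_top hp0 (r := 2)
        ⟨by norm_num, hp⟩ (hJM β hβ) R
      exact_mod_cast this
    have hmi : ∀ β : MultiIdx, β.len ≤ 1 → AEMeasurable (fun z =>
        (ball (0 : SpaceTime) R).indicator (fun z => ‖J β z‖ₑ ^ 2) z)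
        (volume.restrict (Γ.cyl T)) := fun β hβ =>
      ((hJm β hβ).enorm.pow_const 2).indicator isOpen_ball.measurableSet
    calc _ = ∫⁻ z, (ball (0 : SpaceTime) R).indicator b z := by
          rw [lintegral_indicator isOpen_ball.measurableSet]
      _ = ∫⁻ z in Γ.cyl T, (ball (0 : SpaceTime) R).indicator (jetDen J) z := by
          rw [← lintegral_indicator hΩ.measurableSet]
          refine lintegral_congr_ae ?_
          filter_upwards [hbe] with z hz
          by_cases hw : z ∈ Γ.cyl T <;> by_cases hw' : z ∈ ball (0 : SpaceTime) R <;>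
            simp [hw, hw', -mem_ball, ← hz]
      _ = (∫⁻ z in Γ.cyl T, (ball (0 : SpaceTime) R).indicator (fun z => ‖J 0 z‖ₑ ^ 2) z) +
          2 * ∑ j : Fin 2, ∫⁻ z in Γ.cyl T, (ball (0 : SpaceTime) R).indicator
            (fun z => ‖J (unitIdx j.succ) z‖ₑ ^ 2) z := by
          rw [← lintegral_finsetSum' _ fun j _ => hmi _ (hlen j),
            ← lintegral_const_mul'' _ (aemeasurable_fun_sum _ fun j _ => hmi _ (hlen j)),
            ← lintegral_add_left' (hmi 0 (by simp [len]))]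
          refine lintegral_congr fun z => ?_
          by_cases hw' : z ∈ ball (0 : SpaceTime) R <;>
            simp [hw', -mem_ball, jetDen]
      _ < (⊤ : ℝ≥0∞) := by
          refine ENNReal.add_lt_top.2 ⟨fin 0 (by simp [len]), ENNReal.mul_lt_top (by simp)
            (ENNReal.sum_lt_top.2 fun j _ => fin _ (hlen j))⟩
  have key := weak_kernel_bound (Γ := Γ) hC (fun x hx => hwk (V := V) x hx) (T := T) (G := G)
    (D := fun j => J (unitIdx j.succ)) (b := b) ?_ ?_ hbm ?_
    (lintegral_ball_kern_lt_top hs2 hbm hbR)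
  · have e2 : ∀ᵐ t ∂time[T], ∀ᵐ y, b (t, y) = Γ.ext.indicator (fun y => jetDen J (t, y)) y := by
      have e3 : ∀ᵐ t : ℝ, ∀ᵐ y : Plane, (Γ.cyl T).indicator (jetDen J) (t, y) = b (t, y) :=
        Measure.ae_ae_of_ae_prod (μ := (volume : Measure ℝ)) (ν := (volume : Measure Plane)) hbe
      rw [ae_restrict_iff' measurableSet_Ioo]
      filter_upwards [e3] with t ht htI
      filter_upwards [ht] with y hy
      rw [← hy]
      by_cases hyE : y ∈ Γ.ext
      · rw [indicator_of_mem hyE, indicator_of_mem (show (t, y) ∈ Γ.cyl T from ⟨htI, hyE⟩)]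
      · rw [indicator_of_notMem hyE, indicator_of_notMem fun h => hyE h.2]
    filter_upwards [ae_cyl key, e2] with t ht1 ht2
    filter_upwards [ht1] with x hx
    refine hx.trans (mul_le_mul' le_rfl (le_of_eq ?_))
    rw [← lintegral_indicator Γ.measurableSet_ext]
    refine lintegral_congr_ae ?_
    filter_upwards [ht2] with y hy
    rw [hy]
    by_cases hyE : y ∈ Γ.ext <;> simp [hyE]
  · have h1 : (Γ.cyl T).indicator G =ᵐ[volume] (Γ.cyl T).indicator (J 0) := by
      filter_upwards [(ae_restrict_iff' hΩ.measurableSet).1 hG0] with z hz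
      by_cases hzc : z ∈ Γ.cyl T
      · rw [indicator_of_mem hzc, indicator_of_mem hzc, hz hzc]
      · rw [indicator_of_notMem hzc, indicator_of_notMem hzc]
    have h2 := locallyIntegrable_indicator_cyl (hJm 0 (by simp [len]))
      ofReal_ne_top (by linarith) (hJM 0 (by simp [len]))
    exact fun z => (h2 z).imp fun U hU => ⟨hU.1, hU.2.congr (ae_restrict_of_ae h1.symm)⟩
  · exact fun j => (hJ _ (hlen j)).1
  · filter_upwards [hbden, hG0] with z hz1 hz2
    rw [hz1, hz2, jetDen]

end SliceBounds

section SobolevProducts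

open scoped ENNReal

/-- The multi-indices of length at most `k`. -/
def idx (k : ℕ) : Finset MultiIdx :=
  (Finset.range (k + 1) ×ˢ (Finset.range (k + 1) ×ˢ Finset.range (k + 1))).filter
    (fun β => len β ≤ k)

lemma mem_idx : β ∈ idx k ↔ β.len ≤ k := by
  refine ⟨fun h => (mem_filter.1 h).2, fun h => mem_filter.2 ⟨?_, h⟩⟩
  unfold len at h
  refine mem_product.2 ⟨?_, mem_product.2 ⟨?_, ?_⟩⟩ <;>
    exact Finset.mem_range.2 (by omega)

variable {V : Type} [NormedAddCommGroup V] [NormedSpace ℝ V]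

/-- The sum of the `L²(ℰ)` norms of the members of order at most `k` of a jet. -/
noncomputable def jetSum (Γ : BoundaryCurve) (k : ℕ) (J : Jet V) (t : ℝ) : ℝ≥0∞ :=
  ∑ β ∈ idx k, eLpNorm (fun x => J β (t, x)) 2 vol[Γ]

lemma le_jetSum (Γ : BoundaryCurve) (J : Jet V) (t : ℝ) (hβ : β.len ≤ k) :
    eLpNorm (fun x => J β (t, x)) 2 vol[Γ] ≤ jetSum Γ k J t :=
  single_le_sum (f := fun β => eLpNorm (fun x => J β (t, x)) 2 vol[Γ])
    (fun _ _ => zero_le) (mem_idx.2 hβ)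

lemma jetSum_mono (Γ : BoundaryCurve) {l : ℕ} (h : k ≤ l) (J : Jet V) (t : ℝ) :
    jetSum Γ k J t ≤ jetSum Γ l J t :=
  Finset.sum_le_sum_of_subset fun β hβ => mem_idx.2 ((mem_idx.1 hβ).trans h)

lemma jetSum_pdIter_le (Γ : BoundaryCurve) {l : ℕ} {b : MultiIdx} {u : SpaceTime → V}
    (hb : k + b.len ≤ l) (hu : ContDiff ℝ l u) (t : ℝ) :
    jetSum Γ k jet[pdIter b u] t ≤ jetSum Γ l jet[u] t := by
  unfold jetSum
  calc _ = ∑ β ∈ idx k,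
        eLpNorm (fun x => pdIter (β + b) u (t, x)) 2 vol[Γ] := by
        refine sum_congr rfl fun β hβ => ?_
        have := mem_idx.1 hβ
        dsimp only
        rw [pdIter_pdIter β b (hu.of_le (by norm_cast; omega))]
    _ = ∑ β ∈ (idx k).image (· + b), eLpNorm (fun x => pdIter β u (t, x)) 2 vol[Γ] := by
        rw [Finset.sum_image fun _ _ _ _ h => add_right_cancel h]
    _ ≤ _ := by
        refine Finset.sum_le_sum_of_subset fun β hβ => ?_
        obtain ⟨a, ha, rfl⟩ := Finset.mem_image.1 hβ
        have := mem_idx.1 ha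
        exact mem_idx.2 (by rw [MultiIdx.len_add]; omega)

lemma pdIter_zero_unitIdx (u : SpaceTime → V) :
    jetDen jet[u] = fun z => ‖u z‖ₑ ^ 2 + 2 * ∑ j : Fin 2, ‖pd j.succ u z‖ₑ ^ 2 := by
  funext z
  simp only [jetDen, pdIter_zero, pdIter_unitIdx]

lemma aestronglyMeasurable_slice {w : SpaceTime → V} (hw : Continuous w) (t : ℝ) (μ : Measure Plane) :
    AEStronglyMeasurable (fun x => w (t, x)) μ :=
  (hw.comp (by fun_prop)).aestronglyMeasurable

lemma aemeasurable_jetDen {J : Jet V}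
    (hJ : ∀ β : MultiIdx, β.len ≤ 1 → AEStronglyMeasurable (fun x => J β (t, x)) vol[Γ]) :
    AEMeasurable (fun x => jetDen J (t, x)) vol[Γ] := by
  refine ((hJ 0 (by simp [len])).enorm.pow_const 2).add
    (AEMeasurable.const_mul (aemeasurable_fun_sum _ fun j _ => ?_) _)
  exact (hJ _ (unitIdx_len _).le).enorm.pow_const 2

lemma lintegral_jetDen_le {J : Jet V}
    (hJ : ∀ β : MultiIdx, β.len ≤ 1 → AEStronglyMeasurable (fun x => J β (t, x)) vol[Γ]) :
    ∫⁻ x in Γ.ext, jetDen J (t, x) ≤ 5 * jetSum Γ 1 J t ^ 2 := by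
  have h1 : ∀ j : Fin 2, AEMeasurable (fun x => ‖J (unitIdx j.succ) (t, x)‖ₑ ^ 2)
      vol[Γ] := fun j => (hJ _ (unitIdx_len _).le).enorm.pow_const 2
  have h2 : ∀ β : MultiIdx, β.len ≤ 1 →
      ∫⁻ x in Γ.ext, ‖J β (t, x)‖ₑ ^ 2 ≤ jetSum Γ 1 J t ^ 2 := fun β hβ => by
    rw [lintegral_sq_enorm_eq]
    exact pow_le_pow_left (le_jetSum Γ J t hβ)
  unfold jetDen
  rw [lintegral_add_left' ((hJ 0 (by simp [len])).enorm.pow_const 2),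
    lintegral_const_mul'' _ (aemeasurable_fun_sum _ fun j _ => h1 j),
    lintegral_finsetSum' _ fun j _ => h1 j]
  calc _ ≤ jetSum Γ 1 J t ^ 2 + 2 * ∑ _j : Fin 2, jetSum Γ 1 J t ^ 2 :=
        add_le_add (h2 0 (by simp [len]))
          (mul_le_mul' le_rfl (sum_le_sum fun j _ => h2 _ (unitIdx_len _).le))
    _ = _ := by rw [sum_univ_two]; ring

lemma add_two_mul_rpow_le {q : ℝ} (hq : 0 ≤ q) (a b c : ℝ≥0∞) :
    (a + 2 * (b + c)) ^ q ≤ 5 ^ q * (a ^ q + b ^ q + c ^ q) := by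
  obtain ⟨m, hm, hm'⟩ : ∃ m, m ∈ ({a, b, c} : Set ℝ≥0∞) ∧ a ≤ m ∧ b ≤ m ∧ c ≤ m := by
    refine ⟨max a (max b c), ?_, le_max_left _ _, (le_max_left _ _).trans (le_max_right _ _),
      (le_max_right _ _).trans (le_max_right _ _)⟩
    rcases max_choice b c with h | h <;> rw [h]
    · rcases max_choice a b with h | h <;> simp [h]
    · rcases max_choice a c with h | h <;> simp [h]
  have h1 : a + 2 * (b + c) ≤ 5 * m :=
    calc _ ≤ m + 2 * (m + m) := add_le_add hm'.1 (mul_le_mul' le_rfl (add_le_add hm'.2.1 hm'.2.2))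
      _ = 5 * m := by ring
  refine (rpow_le_rpow h1 hq).trans ?_
  rw [mul_rpow_of_nonneg _ _ hq]
  refine mul_le_mul' le_rfl ?_
  rcases hm with rfl | rfl | rfl
  · exact le_self_add.trans le_self_add
  · exact le_add_self.trans le_self_add
  · exact le_add_self

lemma lintegral_jetDen_rpow_le {J : Jet V} (hp : 2 < p) {M : ℝ≥0∞}
    (hJ : ∀ β : MultiIdx, β.len ≤ 1 → AEStronglyMeasurable (fun x => J β (t, x)) vol[Γ])
    (hM : ∀ β : MultiIdx, β.len ≤ 1 → eLpNorm (fun x => J β (t, x)) (ofReal p) vol[Γ] ≤ M) :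
    (∫⁻ x in Γ.ext, jetDen J (t, x) ^ (p / 2)) ^ (1 / (p / 2)) ≤ 15 * M ^ 2 := by
  have hp0 : 0 < p := by linarith
  have hq : 1 ≤ p / 2 := by linarith
  have hsq : ∀ a : ℝ≥0∞, (a ^ 2) ^ (p / 2) = a ^ p := fun a => by
    rw [← rpow_natCast, ← rpow_mul]; congr 1; push_cast; ring
  have hb : ∀ β : MultiIdx, β.len ≤ 1 → ∫⁻ x in Γ.ext, ‖J β (t, x)‖ₑ ^ p ≤ M ^ p := fun β hβ => by
    rw [lintegral_rpow_enorm_eq hp0]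
    exact rpow_le_rpow (hM β hβ) hp0.le
  have hmeas : ∀ β : MultiIdx, β.len ≤ 1 → AEMeasurable (fun x => ‖J β (t, x)‖ₑ ^ p)
      vol[Γ] := fun β hβ => (hJ β hβ).enorm.pow_const p
  have l0 : len 0 ≤ 1 := by simp [len]
  have l1 := fun i : Fin 3 => (unitIdx_len i).le
  have h1 : ∫⁻ x in Γ.ext, jetDen J (t, x) ^ (p / 2) ≤ 5 ^ (p / 2) * (3 * M ^ p) := by
    calc _ ≤ ∫⁻ x in Γ.ext, 5 ^ (p / 2) * (‖J 0 (t, x)‖ₑ ^ p +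
          ‖J (unitIdx (0 : Fin 2).succ) (t, x)‖ₑ ^ p +
          ‖J (unitIdx (1 : Fin 2).succ) (t, x)‖ₑ ^ p) := by
          refine lintegral_mono fun x => ?_
          have := add_two_mul_rpow_le (q := p / 2) (by linarith) (‖J 0 (t, x)‖ₑ ^ 2)
            (‖J (unitIdx (0 : Fin 2).succ) (t, x)‖ₑ ^ 2)
            (‖J (unitIdx (1 : Fin 2).succ) (t, x)‖ₑ ^ 2)
          simp only [hsq] at this
          simpa only [jetDen, sum_univ_two] using this
      _ = 5 ^ (p / 2) * ((∫⁻ x in Γ.ext, ‖J 0 (t, x)‖ₑ ^ p) +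
          (∫⁻ x in Γ.ext, ‖J (unitIdx (0 : Fin 2).succ) (t, x)‖ₑ ^ p) +
          ∫⁻ x in Γ.ext, ‖J (unitIdx (1 : Fin 2).succ) (t, x)‖ₑ ^ p) := by
          have m1 : AEMeasurable (fun x => ‖J 0 (t, x)‖ₑ ^ p +
            ‖J (unitIdx (0 : Fin 2).succ) (t, x)‖ₑ ^ p) vol[Γ] :=
            (hmeas _ l0).add (hmeas _ (l1 _))
          have m2 : AEMeasurable (fun x => ‖J 0 (t, x)‖ₑ ^ p +
            ‖J (unitIdx (0 : Fin 2).succ) (t, x)‖ₑ ^ p +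
            ‖J (unitIdx (1 : Fin 2).succ) (t, x)‖ₑ ^ p) vol[Γ] :=
            m1.add (hmeas _ (l1 _))
          rw [lintegral_const_mul'' _ m2, lintegral_add_left' m1, lintegral_add_left' (hmeas _ l0)]
      _ ≤ 5 ^ (p / 2) * (M ^ p + M ^ p + M ^ p) :=
          mul_le_mul' le_rfl (add_le_add (add_le_add (hb _ l0) (hb _ (l1 _))) (hb _ (l1 _)))
      _ = _ := by ring
  refine (rpow_le_rpow h1 (by positivity)).trans ?_
  rw [mul_rpow_of_nonneg _ _ (by positivity), mul_rpow_of_nonneg _ _ (by positivity),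
    ← rpow_mul, mul_one_div_cancel (by positivity), ENNReal.rpow_one, ← rpow_mul,
    show p * (1 / (p / 2)) = (2 : ℕ) by field_simp; norm_num, rpow_natCast, ← mul_assoc]
  refine mul_le_mul' ?_ le_rfl
  calc (5 : ℝ≥0∞) * 3 ^ (1 / (p / 2)) ≤ 5 * 3 ^ (1 : ℝ) := by
        refine mul_le_mul' le_rfl (ENNReal.rpow_le_rpow_of_exponent_le (by norm_num) ?_)
        rw [div_le_one (by linarith)]; exact hq
    _ = 15 := by rw [ENNReal.rpow_one]; norm_num

lemma mul_sq_eq_rpow_half (c m : ℝ≥0∞) : c * m ^ 2 = (c ^ (1 / 2 : ℝ) * m) ^ 2 := by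
  rw [mul_pow, ← rpow_natCast (c ^ (1 / 2 : ℝ)), ← rpow_mul]; norm_num

lemma le_of_sq_le_mul_sq {a c m : ℝ≥0∞} (h : a ^ 2 ≤ c * m ^ 2) : a ≤ c ^ (1 / 2 : ℝ) * m := by
  rw [mul_sq_eq_rpow_half] at h
  exact (ENNReal.pow_le_pow_left_iff (by norm_num)).1 h

/-- The exponent of the kernel for Morrey's inequality. -/
lemma holder_exponents (hp : 2 < p) : ∃ q' s : ℝ, (p / 2).HolderConjugate q' ∧ 0 < s ∧
    s < 2 ∧ 0 < q' ∧ s * q' < 2 := by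
  have h := Real.HolderConjugate.conjExponent (p := p / 2) (by linarith)
  have h0 := h.symm.lt
  refine ⟨_, 1 / Real.conjExponent (p / 2), h, by positivity, ?_, by positivity, ?_⟩
  · rw [div_lt_iff₀ (by positivity)]; linarith
  · rw [one_div_mul_cancel (by positivity)]; norm_num

theorem BoundaryCurve.slice_enorm_sq_le {C : ℝ≥0∞} {s : ℝ}
    (hcl : Γ.KernelBound h s C) [CompleteSpace V] {w : SpaceTime → V} (hw : ContDiff ℝ 1 w)
    (t : ℝ) (hx : x ∈ Γ.ext) : ‖w (t, x)‖ₑ ^ 2 ≤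
      C * ∫⁻ y in Γ.ext, jetDen jet[w] (t, y) * kern h s (x - y) := by
  refine (hcl (fun y => w (t, y)) (hw.comp (by fun_prop)).contDiffOn x hx).trans ?_
  refine mul_le_mul' le_rfl (lintegral_mono fun y => mul_le_mul' ?_ le_rfl)
  rw [pdIter_zero_unitIdx]
  exact add_le_add le_rfl (enorm_fderiv_slice_sq_le (hw.differentiable (by simp) _))

lemma measurable_jet_slice {w : SpaceTime → V} (hw : ContDiff ℝ 1 w) (t : ℝ) (μ : Measure Plane)
    (β : MultiIdx) (hβ : β.len ≤ 1) : AEStronglyMeasurable (fun x => pdIter β w (t, x)) μ :=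
  aestronglyMeasurable_slice
    (pdIter_contDiff (k := 0) β (hw.of_le (by norm_cast; omega))).continuous t μ

theorem BoundaryCurve.lintegral_mul_slice_le {C N : ℝ≥0∞} {s : ℝ}
    (hcl : Γ.KernelBound h s C) [CompleteSpace V] {w : SpaceTime → V} (hw : ContDiff ℝ 1 w)
    (t : ℝ) {g : Plane → ℝ≥0∞} (hg : AEMeasurable g vol[Γ])
    (hN : ∀ y, ∫⁻ x in Γ.ext, g x * kern h s (y - x) ≤ N) : ∫⁻ x in Γ.ext, g x * ‖w (t, x)‖ₑ ^ 2 ≤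
      C * (N * (5 * jetSum Γ 1 jet[w] t ^ 2)) := by
  have hwm := measurable_jet_slice hw t vol[Γ]
  have hden := aemeasurable_jetDen (J := fun β => pdIter β w) hwm
  have h1 : Measurable fun z : Plane × Plane => kern h s (z.1 - z.2) :=
    (measurable_kern h s).comp (by fun_prop)
  calc _ ≤ ∫⁻ x in Γ.ext, C * (g x *
        ∫⁻ y in Γ.ext, jetDen jet[w] (t, y) * kern h s (x - y)) := by
        refine setLIntegral_mono' Γ.measurableSet_ext fun x hx => ?_
        rw [mul_left_comm]
        exact mul_le_mul' le_rfl (Γ.slice_enorm_sq_le hcl hw t hx)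
    _ = C * ∫⁻ x in Γ.ext, (g x * ∫⁻ y in Γ.ext, jetDen jet[w] (t, y) * kern h s (x - y)) :=
        lintegral_const_mul'' _ (hg.mul (hden.comp_snd.mul h1.aemeasurable).lintegral_prod_right')
    _ ≤ _ := mul_le_mul' le_rfl ((lintegral_mul_lintegral_kern_le h s _ hg hden hN).trans
        (mul_le_mul' le_rfl (lintegral_jetDen_le hwm)))

/-- Morrey's inequality, and the product estimate `‖g v‖ ≤ C ‖g‖_{L^p} ‖v‖_{H¹}`. -/
theorem BoundaryCurve.exists_morrey (Γ : BoundaryCurve) (hp : 2 < p) : ∃ C : ℝ≥0∞, C ≠ (⊤ : ℝ≥0∞) ∧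
    (∀ {V : Type} [NormedAddCommGroup V] [NormedSpace ℝ V] [CompleteSpace V] {T M : ℝ}
      (G : SpaceTime → V) (J : Jet V), IsWJet Γ T 1 p G J →
      (∀ t ∈ Icc 0 T, jetNorm Γ.ext 1 p J t ≤ M) →
      ∀ᵐ t ∂time[T], ∀ᵐ x ∂vol[Γ], ‖G (t, x)‖ₑ ≤ C * ofReal M) ∧
    ∀ {V W : Type} [NormedAddCommGroup V] [NormedSpace ℝ V] [CompleteSpace V]
      [NormedAddCommGroup W] [NormedSpace ℝ W] (g : Plane → W) (w : SpaceTime → V) (t : ℝ),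
      AEStronglyMeasurable g vol[Γ] → ContDiff ℝ 1 w →
      ∫⁻ x in Γ.ext, ‖g x‖ₑ ^ 2 * ‖w (t, x)‖ₑ ^ 2 ≤ (C * eLpNorm g (ofReal p) vol[Γ] *
          jetSum Γ 1 jet[w] t) ^ 2 := by
  obtain ⟨h, hh, H⟩ := Γ.exists_slice_kernel_bound
  obtain ⟨q', s, hq, hs0, hs2, hq0, hsq⟩ := holder_exponents hp
  obtain ⟨C, hC, hcl, hwk⟩ := H s hs0 hs2
  have hp0 : 0 < p := by linarith
  set κ := (∫⁻ d, kern h s d ^ q') ^ (1 / q') with hκ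
  have hκt : κ ≠ (⊤ : ℝ≥0∞) :=
    (ENNReal.rpow_lt_top_of_nonneg (by positivity) (lintegral_kern_rpow_lt_top hq0 hsq).ne).ne
  refine ⟨(C * κ * 15) ^ (1 / 2 : ℝ), ?_, ?_, ?_⟩
  · exact (ENNReal.rpow_lt_top_of_nonneg (by norm_num)
      (mul_ne_top (mul_ne_top hC hκt) (by norm_num))).ne
  · intro V _ _ _ T M G J hJ hM
    filter_upwards [hwk hp.le G J hJ hM, ae_restrict_mem measurableSet_Ioo] with t ht htI
    have htI' := Ioo_subset_Icc_self htI
    have hJm : ∀ β : MultiIdx, β.len ≤ 1 →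
        AEStronglyMeasurable (fun x => J β (t, x)) vol[Γ] := fun β hβ =>
      ((hJ β hβ).2 t htI').1.1
    filter_upwards [ht] with x hx
    refine le_of_sq_le_mul_sq (hx.trans ?_)
    calc _ ≤ C * ((∫⁻ y in Γ.ext, jetDen J (t, y) ^ (p / 2)) ^ (1 / (p / 2)) * κ) :=
          mul_le_mul' le_rfl (lintegral_mul_kern_le hq h s _ (aemeasurable_jetDen hJm) x)
      _ ≤ C * ((15 * ofReal M ^ 2) * κ) :=
          mul_le_mul' le_rfl (mul_le_mul' (lintegral_jetDen_rpow_le hp hJm fun β hβ =>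
            eLpNorm_jet_le hp0 hβ (hJ β hβ).2 htI' (hM t htI')) le_rfl)
      _ = _ := by ring
  · intro V W _ _ _ _ _ g w t hg hw
    have hg2 := hg.enorm.pow_const 2
    set N := eLpNorm g (ofReal p) vol[Γ] with hN
    have e1 : ∀ y, ∫⁻ x in Γ.ext, ‖g x‖ₑ ^ 2 * kern h s (y - x) ≤ N ^ 2 * κ := by
      intro y
      refine (lintegral_mul_kern_le hq h s _ hg2 y).trans (mul_le_mul' (le_of_eq ?_) le_rfl)
      have : ∀ a : ℝ≥0∞, (a ^ 2) ^ (p / 2) = a ^ p := fun a => by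
        rw [← rpow_natCast, ← rpow_mul]; congr 1; push_cast; ring
      simp only [this]
      rw [lintegral_rpow_enorm_eq hp0, ← rpow_mul,
        show p * (1 / (p / 2)) = (2 : ℕ) by field_simp; norm_num, rpow_natCast]
    calc _ ≤ C * (N ^ 2 * κ * (5 * jetSum Γ 1 jet[w] t ^ 2)) :=
          Γ.lintegral_mul_slice_le hcl hw t hg2 e1
      _ = (C * κ * 5) * (N * jetSum Γ 1 jet[w] t) ^ 2 := by ring
      _ ≤ (C * κ * 15) * (N * jetSum Γ 1 jet[w] t) ^ 2 :=
          mul_le_mul' (mul_le_mul' le_rfl (by norm_num)) le_rfl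
      _ = _ := by rw [mul_sq_eq_rpow_half, ← mul_assoc]

/-- The product estimate `‖g v‖ ≤ C ‖g‖_{H¹} ‖v‖_{H¹}` and the embedding of `H²` in `L^∞`. -/
theorem BoundaryCurve.exists_sobolev (Γ : BoundaryCurve) : ∃ C : ℝ≥0∞, C ≠ (⊤ : ℝ≥0∞) ∧
    (∀ {V : Type} [NormedAddCommGroup V] [NormedSpace ℝ V] [CompleteSpace V] {T M : ℝ}
      (G : SpaceTime → V) (J : Jet V), IsWJet Γ T 1 2 G J →
      (∀ t ∈ Icc 0 T, jetNorm Γ.ext 1 2 J t ≤ M) →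
      ∀ᵐ t ∂time[T], ∀ {W : Type} [NormedAddCommGroup W] [NormedSpace ℝ W]
        [CompleteSpace W] (w : SpaceTime → W), ContDiff ℝ 1 w →
        ∫⁻ x in Γ.ext, ‖G (t, x)‖ₑ ^ 2 * ‖w (t, x)‖ₑ ^ 2 ≤
          (C * ofReal M * jetSum Γ 1 jet[w] t) ^ 2) ∧
    ∀ {V : Type} [NormedAddCommGroup V] [NormedSpace ℝ V] [CompleteSpace V] (w : SpaceTime → V)
      (t : ℝ), ContDiff ℝ 2 w → ∀ x ∈ Γ.ext,
      ‖w (t, x)‖ₑ ≤ C * jetSum Γ 2 jet[w] t := by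
  obtain ⟨h, hh, H⟩ := Γ.exists_slice_kernel_bound
  obtain ⟨C, hC, hcl, hwk⟩ := H (1 / 2) (by norm_num) (by norm_num)
  set κ := ∫⁻ d, kern h (1 / 2) d ^ (2 : ℝ) with hκ
  have hκt : κ ≠ (⊤ : ℝ≥0∞) := (lintegral_kern_rpow_lt_top two_pos (by norm_num)).ne
  refine ⟨(C * C * κ * 400) ^ (1 / 2 : ℝ), ?_, ?_, ?_⟩
  · exact (ENNReal.rpow_lt_top_of_nonneg (by norm_num) (mul_ne_top (mul_ne_top
      (mul_ne_top hC hC) hκt) (by norm_num))).ne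
  · intro V _ _ _ T M G J hJ hM
    have hGm : ∀ᵐ t ∂time[T], (fun x => G (t, x)) =ᵐ[vol[Γ]] fun x => J 0 (t, x) := by
      have : G =ᵐ[volume.restrict (Γ.cyl T)] J 0 := IsWeakDeriv.unique (Coeffs.isOpen_cyl Γ T)
          (IsWeakDeriv.refl (hJ 0 (by simp [len])).1.1) (hJ 0 (by simp [len])).1
      exact ae_cyl this
    filter_upwards [hwk le_rfl G J hJ hM, hGm, ae_restrict_mem measurableSet_Ioo] with t ht hG htI
    have htI' := Ioo_subset_Icc_self htI
    intro W _ _ _ w hw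
    have hJm : ∀ β : MultiIdx, β.len ≤ 1 →
        AEStronglyMeasurable (fun x => J β (t, x)) vol[Γ] := fun β hβ =>
      ((hJ β hβ).2 t htI').1.1
    have hJM : jetSum Γ 1 J t ≤ 4 * ofReal M := by
      unfold jetSum
      calc _ ≤ ∑ β ∈ idx 1, ofReal M := by
            refine sum_le_sum fun β hβ => ?_
            have := eLpNorm_jet_le two_pos (mem_idx.1 hβ) (hJ β (mem_idx.1 hβ)).2 htI' (hM t htI')
            rwa [ofReal_ofNat] at this
        _ = _ := by
            rw [Finset.sum_const, nsmul_eq_mul, show (idx 1).card = 4 by decide]; norm_num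
    have hg2 : AEMeasurable (fun x => ‖G (t, x)‖ₑ ^ 2) vol[Γ] :=
      (((hJm 0 (by simp [len])).congr hG.symm).enorm.pow_const 2)
    calc _ ≤ C * ((C * (κ * ∫⁻ y in Γ.ext, jetDen J (t, y))) *
            (5 * jetSum Γ 1 jet[w] t ^ 2)) :=
          Γ.lintegral_mul_slice_le hcl hw t hg2 fun y =>
            lintegral_mul_kern_le_of_le h _ _ (aemeasurable_jetDen hJm) ht y
      _ ≤ C * ((C * (κ * (5 * (4 * ofReal M) ^ 2))) * (5 * jetSum Γ 1 jet[w] t ^ 2)) := by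
          gcongr
          exact (lintegral_jetDen_le hJm).trans (by gcongr)
      _ = (C * C * κ * 400) * (ofReal M * jetSum Γ 1 jet[w] t) ^ 2 := by ring
      _ = _ := by rw [mul_sq_eq_rpow_half, ← mul_assoc]
  · intro V _ _ _ w t hw x hx
    have hw1 : ContDiff ℝ 1 w := hw.of_le (by norm_num)
    have hwj : ∀ j : Fin 3, ContDiff ℝ 1 (pd j w) := fun j => pd_contDiff (k := 1) hw j
    set B : Plane → ℝ≥0∞ := fun y => jetDen jet[w] (t, y) +
      2 * ∑ j : Fin 2, jetDen jet[pd j.succ w] (t, y) with hB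
    have m0 := aemeasurable_jetDen (Γ := Γ) (J := fun β => pdIter β w)
      (measurable_jet_slice hw1 t _)
    have mj : ∀ j : Fin 2, AEMeasurable (fun y => jetDen jet[pd j.succ w] (t, y)) vol[Γ] :=
      fun j => aemeasurable_jetDen (measurable_jet_slice (hwj _) t _)
    have hBm : AEMeasurable B vol[Γ] :=
      m0.add ((aemeasurable_fun_sum _ fun j _ => mj j).const_mul _)
    have hk : ∀ y, AEMeasurable (fun z => kern h (1 / 2) (y - z)) vol[Γ] :=
      fun y => (measurable_kern_sub h _ y).aemeasurable
    have e1 : ∀ y ∈ Γ.ext, jetDen jet[w] (t, y) ≤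
        C * ∫⁻ z in Γ.ext, B z * kern h (1 / 2) (y - z) := by
      intro y hy
      have e2 : ∫⁻ z in Γ.ext, B z * kern h (1 / 2) (y - z) =
          (∫⁻ z in Γ.ext, jetDen jet[w] (t, z) * kern h (1 / 2) (y - z)) +
          2 * ∑ j : Fin 2, ∫⁻ z in Γ.ext,
            jetDen jet[pd j.succ w] (t, z) * kern h (1 / 2) (y - z) := by
        have mjk : ∀ j : Fin 2, AEMeasurable (fun z =>
            jetDen jet[pd j.succ w] (t, z) * kern h (1 / 2) (y - z))
            vol[Γ] := fun j => (mj j).mul (hk y)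
        have m0k : AEMeasurable (fun z => jetDen jet[w] (t, z) * kern h (1 / 2) (y - z))
            vol[Γ] := m0.mul (hk y)
        rw [← lintegral_finsetSum' _ fun j _ => mjk j,
          ← lintegral_const_mul'' _ (aemeasurable_fun_sum _ fun j _ => mjk j),
          ← lintegral_add_left' m0k]
        refine lintegral_congr fun z => ?_
        rw [hB, ← sum_mul]; ring
      rw [e2, mul_add, ← mul_assoc, mul_comm C 2, mul_assoc, mul_sum, pdIter_zero_unitIdx]
      refine add_le_add ?_ (mul_le_mul' le_rfl (sum_le_sum fun j _ => ?_))
      · rw [← pdIter_zero_unitIdx]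
        exact Γ.slice_enorm_sq_le hcl hw1 t hy
      · exact Γ.slice_enorm_sq_le hcl (hwj _) t hy
    have e3 : ∫⁻ y in Γ.ext, B y ≤ 25 * jetSum Γ 2 jet[w] t ^ 2 := by
      rw [hB, lintegral_add_left' m0, lintegral_const_mul'' _
        (aemeasurable_fun_sum _ fun j _ => mj j), lintegral_finsetSum' _ fun j _ => mj j]
      have a1 : jetSum Γ 1 jet[w] t ≤ jetSum Γ 2 jet[w] t := jetSum_mono Γ (by norm_num) _ t
      have a2 : ∀ j : Fin 2, jetSum Γ 1 jet[pd j.succ w] t ≤ jetSum Γ 2 jet[w] t := fun j => by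
        have := jetSum_pdIter_le Γ (k := 1) (l := 2) (b := unitIdx j.succ)
          (by rw [unitIdx_len]) hw t
        simpa only [pdIter_unitIdx] using this
      calc _ ≤ 5 * jetSum Γ 2 jet[w] t ^ 2 +
            2 * ∑ _j : Fin 2, 5 * jetSum Γ 2 jet[w] t ^ 2 := by
            refine add_le_add ((lintegral_jetDen_le (measurable_jet_slice hw1 t _)).trans ?_)
              (mul_le_mul' le_rfl (sum_le_sum fun j _ =>
                (lintegral_jetDen_le (measurable_jet_slice (hwj _) t _)).trans ?_))
            · gcongr
            · gcongr; exact a2 j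
        _ = _ := by rw [sum_univ_two]; ring
    refine le_of_sq_le_mul_sq ?_
    calc _ ≤ C * ∫⁻ y in Γ.ext, jetDen jet[w] (t, y) * kern h (1 / 2) (x - y) :=
          Γ.slice_enorm_sq_le hcl hw1 t hx
      _ ≤ C * (C * (κ * ∫⁻ y in Γ.ext, B y)) :=
          mul_le_mul' le_rfl (lintegral_mul_kern_le_of_le h _ _ hBm
            ((ae_restrict_iff' Γ.measurableSet_ext).2 (.of_forall e1)) x)
      _ ≤ C * (C * (κ * (25 * jetSum Γ 2 jet[w] t ^ 2))) := by gcongr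
      _ = C * C * κ * 25 * jetSum Γ 2 jet[w] t ^ 2 := by ring
      _ ≤ _ := by gcongr; norm_num

end SobolevProducts

section Leibniz

open scoped ENNReal

variable {Ω : Set SpaceTime}

lemma clm_apply_eq_sum (M : Mat n) (x : Vec n) : M x = ∑ k, x k • M (single k 1) := by
  have hx : x = ∑ k, x k • (single k (1 : ℝ) : Vec n) := by
    ext i
    simp [Pi.single_apply]
  conv_lhs => rw [hx]
  simp only [map_sum, map_smul]

/-- The product rule for a weakly differentiable matrix and a `C¹` vector. -/
lemma IsWeakDeriv.mat_apply {i : Fin 3} (hΩ : IsOpen Ω) {H H' : SpaceTime → Mat n}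
    (h : IsWeakDeriv Ω (unitIdx i) H H') {v : SpaceTime → Vec n} (hv : ContDiff ℝ 1 v) :
    IsWeakDeriv Ω (unitIdx i) (fun z => H z (v z)) (fun z => H' z (v z) + H z (pd i v z)) := by
  have hk : ∀ k : Fin n, ContDiff ℝ 1 fun z => v z k := fun k => (proj (𝕜 := ℝ) k).contDiff.comp hv
  have hpd : ∀ (k : Fin n) z, pd i (fun z => v z k) z = pd i v z k := by
    intro k z
    have := ((proj (𝕜 := ℝ) k).hasFDerivAt (x := v z)).comp z
      (hv.differentiable (by simp) z).hasFDerivAt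
    rw [pd, show fderiv ℝ (fun z => v z k) z = _ from this.fderiv]
    rfl
  have key := IsWeakDeriv.sum (Ω := Ω) Finset.univ fun k _ =>
    (h.clm_comp (ContinuousLinearMap.apply ℝ (Vec n)
      (single k (1 : ℝ) : Vec n))).smul_contDiff hΩ (hk k)
  have e1 : (fun z => H z (v z)) = fun z => ∑ k, v z k • ContinuousLinearMap.apply ℝ (Vec n)
      (single k (1 : ℝ) : Vec n) (H z) := funext fun z => clm_apply_eq_sum _ _
  have e2 : (fun z => H' z (v z) + H z (pd i v z)) = fun z => ∑ k,
      (v z k • ContinuousLinearMap.apply ℝ (Vec n) (single k (1 : ℝ) : Vec n) (H' z) +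
      pd i (fun z => v z k) z • ContinuousLinearMap.apply ℝ (Vec n)
        (single k (1 : ℝ) : Vec n) (H z)) := by
    funext z
    rw [clm_apply_eq_sum, clm_apply_eq_sum (H z), sum_add_distrib]
    simp only [hpd]
    rfl
  rw [e1, e2]
  exact key

/-- The multi-index of a word of coordinate directions. -/
def wordIdx (w : List (Fin 3)) : MultiIdx := (w.map unitIdx).sum

lemma wordIdx_cons (k : Fin 3) (w : List (Fin 3)) : wordIdx (k :: w) = wordIdx w + unitIdx k := by
  rw [wordIdx, List.map_cons, List.sum_cons, add_comm]; rfl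

lemma wordIdx_len (w : List (Fin 3)) : (wordIdx w).len = w.length := by
  induction w with
  | nil => rfl
  | cons k w ih => rw [wordIdx_cons, MultiIdx.len_add, ih, unitIdx_len, List.length_cons]

lemma exists_word (β : MultiIdx) : ∃ w, wordIdx w = β := by
  obtain ⟨a, b, c⟩ := β
  refine ⟨List.replicate a 0 ++ List.replicate b 1 ++ List.replicate c 2, ?_⟩
  simp [wordIdx, unitIdx]

/-- The terms of the commutator of a product: `((i, β), b)` stands for `(∂^β ∂_i A) ∂^b v`. -/
def commList : List (Fin 3) → List ((Fin 3 × MultiIdx) × MultiIdx)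
  | [] => []
  | k :: w => ((k, 0), wordIdx w) :: (commList w).flatMap fun q =>
      [((q.1.1, q.1.2 + unitIdx k), q.2), (q.1, q.2 + unitIdx k)]

lemma commList_len {w : List (Fin 3)} {q : (Fin 3 × MultiIdx) × MultiIdx} (hq : q ∈ commList w) :
    q.1.2.len + 1 + q.2.len = w.length := by
  induction w generalizing q with
  | nil => simp [commList] at hq
  | cons k w ih =>
    rw [commList, List.mem_cons, List.mem_flatMap] at hq
    rcases hq with rfl | ⟨q', hq', hq⟩
    · change len 0 + 1 + (wordIdx w).len = (k :: w).length
      rw [wordIdx_len, show len 0 = 0 from rfl, List.length_cons]; omega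
    · have h1 := ih hq'
      simp only [List.mem_cons, List.not_mem_nil, or_false] at hq
      rcases hq with rfl | rfl <;>
        simp only [MultiIdx.len_add, unitIdx_len, List.length_cons] <;> omega

lemma IsWeakDeriv.list_sum {ι : Type*} (l : List ι) {g h : ι → SpaceTime → V}
    (H : ∀ i ∈ l, IsWeakDeriv Ω α (g i) (h i)) :
    IsWeakDeriv Ω α (fun z => (l.map fun i => g i z).sum) (fun z => (l.map fun i => h i z).sum) := by
  induction l with
  | nil => simpa using IsWeakDeriv.zero
  | cons a l ih =>
    simp only [List.map_cons, List.sum_cons]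
    exact (H a List.mem_cons_self).add (ih fun i hi => H i (List.mem_cons_of_mem a hi))

/-- Leibniz' formula for weak derivatives. -/
theorem weak_leibniz (hΩ : IsOpen Ω) {A : SpaceTime → Mat n}
    {J : Fin 3 → Jet (Mat n)} (hA : LocallyIntegrableOn A Ω)
    (hA1 : ∀ i, IsWeakDeriv Ω (unitIdx i) A (J i 0))
    (hJ : ∀ i (β : MultiIdx) k, β.len + 2 ≤ m → IsWeakDeriv Ω (unitIdx k) (J i β) (J i (β + unitIdx
      k))) {v : SpaceTime → Vec n} (hv : ContDiff ℝ m v) (w : List (Fin 3)) (hw : w.length ≤ m) :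
    IsWeakDeriv Ω (wordIdx w) (fun z => A z (v z)) (fun z => A z (pdIter (wordIdx w) v z) +
      ((commList w).map fun q => J q.1.1 q.1.2 z (pdIter q.2 v z)).sum) := by
  induction w with
  | nil =>
    have hloc : LocallyIntegrableOn (fun z => A z (v z)) Ω := by
      rw [show (fun z => A z (v z)) = fun z => ∑ k, v z k • A z (single k 1) from
        funext fun z => clm_apply_eq_sum _ _]
      refine (IsWeakDeriv.sum (Ω := Ω) (α := 0) Finset.univ fun k _ => IsWeakDeriv.refl ?_).1
      have h1 : LocallyIntegrableOn (fun z => A z (single k 1)) Ω := fun z hz =>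
        (hA z hz).imp fun U hU => ⟨hU.1, (ContinuousLinearMap.apply ℝ (Vec n)
          (single k (1 : ℝ) : Vec n)).integrable_comp hU.2⟩
      exact h1.continuousOn_smul hΩ.isLocallyClosed
        ((proj (𝕜 := ℝ) k).continuous.comp hv.continuous).continuousOn
    simpa [commList, wordIdx, pdIter_zero] using IsWeakDeriv.refl hloc
  | cons k w ih =>
    rw [List.length_cons] at hw
    have cd : ∀ b : MultiIdx, b.len ≤ w.length → ContDiff ℝ 1 (pdIter b v) := fun b hb =>
      pdIter_contDiff (k := 1) b (hv.of_le (by norm_cast; omega))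
    have pdp : ∀ b : MultiIdx, b.len ≤ w.length →
        pd k (pdIter b v) = pdIter (b + unitIdx k) v := fun b hb =>
      pd_pdIter k b (hv.of_le (by norm_cast; omega))
    rw [wordIdx_cons]
    refine (ih (by omega)).trans ?_
    have h1 := (hA1 k).mat_apply hΩ (cd (wordIdx w) (wordIdx_len w).le)
    have h2 := IsWeakDeriv.list_sum (commList w) (g := fun q z => J q.1.1 q.1.2 z (pdIter q.2 v z))
      (h := fun q z => J q.1.1 (q.1.2 + unitIdx k) z (pdIter q.2 v z) +
        J q.1.1 q.1.2 z (pdIter (q.2 + unitIdx k) v z)) (α := unitIdx k) (Ω := Ω) (by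
        intro q hq
        have := commList_len hq
        have h3 := (hJ q.1.1 q.1.2 k (by omega)).mat_apply hΩ (cd q.2 (by omega))
        rwa [pdp q.2 (by omega)] at h3)
    have h3 := h1.add h2
    rw [pdp _ (wordIdx_len w).le] at h3
    convert h3 using 1
    funext z
    rw [commList, List.map_cons, List.sum_cons]
    have : ∀ l : List ((Fin 3 × MultiIdx) × MultiIdx), ((l.flatMap fun q =>
        [((q.1.1, q.1.2 + unitIdx k), q.2), (q.1, q.2 + unitIdx k)]).map
          fun q => J q.1.1 q.1.2 z (pdIter q.2 v z)).sum =
        (l.map fun q => J q.1.1 (q.1.2 + unitIdx k) z (pdIter q.2 v z) +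
          J q.1.1 q.1.2 z (pdIter (q.2 + unitIdx k) v z)).sum := by
      intro l
      induction l with
      | nil => rfl
      | cons a l ihl =>
        simp only [List.flatMap_cons, List.map_append, List.sum_append, ihl, List.map_cons,
          List.sum_cons, List.map_nil, List.sum_nil, add_zero]
    rw [this]
    abel

lemma isWeakDeriv_pdIter (hΩ : IsOpen Ω) (β : MultiIdx) (hv : ContDiff ℝ β.len v) :
    IsWeakDeriv Ω β v (pdIter β v) := by
  obtain ⟨w, rfl⟩ := exists_word β
  induction w with
  | nil => exact IsWeakDeriv.refl (hv.continuous.locallyIntegrable.locallyIntegrableOn _)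
  | cons k w ih =>
    rw [wordIdx_cons, MultiIdx.len_add, unitIdx_len] at hv
    rw [wordIdx_cons, ← pd_pdIter k _ hv]
    refine (ih (hv.of_le (by norm_cast; omega))).trans (isWeakDeriv_pd hΩ ?_ k)
    exact (pdIter_contDiff (k := 1) _ (by rwa [add_comm])).contDiffOn

end Leibniz

section Commutator

open scoped ENNReal

/-- The assumption on a coefficient: its first derivatives are bounded by `K` in `𝕎^{m-1}` and
in `𝕎^{1,p}`. -/
def HasJets (Γ : BoundaryCurve) (T : ℝ) (m : ℕ) (p K : ℝ) (A : SpaceTime → Mat n) : Prop :=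
  ∀ i, ∃ G : SpaceTime → Mat n, IsWeakDeriv (Γ.cyl T) (unitIdx i) A G ∧
    (1 ≤ m → WBound Γ T (m - 1) 2 G K) ∧ WBound Γ T 1 p G K

lemma ae_eq_of_isWeakDeriv_zero [CompleteSpace V] {g h : SpaceTime → V}
    (H : IsWeakDeriv (Γ.cyl T) 0 g h) : g =ᵐ[volume.restrict (Γ.cyl T)] h :=
  IsWeakDeriv.unique (Coeffs.isOpen_cyl Γ T) (IsWeakDeriv.refl H.1) H

lemma IsWJet.congr {g g' : SpaceTime → V} {J : Jet V} (H : IsWJet Γ T k p g J)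
    (h : g =ᵐ[volume.restrict (Γ.cyl T)] g') : IsWJet Γ T k p g' J :=
  fun β hβ => ⟨(H β hβ).1.congr h (ae_eq_refl _), (H β hβ).2⟩

/-- The derivatives of a coefficient. -/
lemma HasJets.exists_jets {A : SpaceTime → Mat n} (hA : HasJets Γ T m p K A) :
    ∃ J : Fin 3 → Jet (Mat n), (∀ i, IsWeakDeriv (Γ.cyl T) (unitIdx i) A (J i 0)) ∧
      (∀ i (β : MultiIdx) k, β.len + 2 ≤ m →
        IsWeakDeriv (Γ.cyl T) (unitIdx k) (J i β) (J i (β + unitIdx k))) ∧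
      (∀ i (β : MultiIdx), β.len + 1 ≤ m → ∀ t ∈ Ioo 0 T,
        eLpNorm (fun x => J i β (t, x)) 2 vol[Γ] ≤ ofReal K) ∧
      (∀ i (β : MultiIdx), β.len + 1 ≤ m →
        AEStronglyMeasurable (J i β) (volume.restrict (Γ.cyl T))) ∧
      ∀ i, ∃ Jp, IsWJet Γ T 1 p (J i 0) Jp ∧ (∀ t ∈ Icc 0 T, jetNorm Γ.ext 1 p Jp t ≤ K) ∧
        ∀ β : MultiIdx, β.len ≤ 1 → β.len + 1 ≤ m → J i β =ᵐ[volume.restrict (Γ.cyl T)] Jp β := by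
  have hΩ := Coeffs.isOpen_cyl Γ T
  choose G hG hG1 hG2 using hA
  choose Jp hJp hJpK using hG2
  have h0 : len 0 = 0 := rfl
  rcases Nat.eq_zero_or_pos m with rfl | hm
  · refine ⟨fun i _ => G i, hG, fun i β k h => by omega, fun i β h => by omega,
      fun i β h => by omega, fun i =>
      ⟨Jp i, hJp i, hJpK i, fun β _ h => by omega⟩⟩
  · have hG1' := fun i => hG1 i hm
    choose J hJ hJK using hG1'
    have e0 : ∀ i, G i =ᵐ[volume.restrict (Γ.cyl T)] J i 0 := fun i =>
      ae_eq_of_isWeakDeriv_zero (hJ i 0 (by rw [h0]; omega)).1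
    refine ⟨J, fun i => (hG i).congr (ae_eq_refl _) (e0 i), fun i β k h => ?_,
      fun i β h t ht => ?_, fun i β h => (hJ i β (by omega)).1.2.1.aestronglyMeasurable,
      fun i => ⟨Jp i, (hJp i).congr (e0 i), hJpK i, fun β h1 h2 => ?_⟩⟩
    · exact (hJ i β (by omega)).1.of_add
        (hJ i (β + unitIdx k) (by rw [MultiIdx.len_add, unitIdx_len]; omega)).1
    · have ht' := Ioo_subset_Icc_self ht
      have := eLpNorm_jet_le two_pos (by omega : β.len ≤ m - 1) (hJ i β (by omega)).2 ht'
        (hJK i t ht')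
      rwa [ofReal_ofNat] at this
    · exact IsWeakDeriv.unique hΩ (hJ i β (by omega)).1 (hJp i β h1).1

lemma eLpNorm_clm_apply_le {μ : Measure Plane} {H : Plane → Mat n} {w : Plane → Vec n} {R : ℝ≥0∞}
    (h : ∫⁻ x, ‖H x‖ₑ ^ 2 * ‖w x‖ₑ ^ 2 ∂μ ≤ R ^ 2) : eLpNorm (fun x => H x (w x)) 2 μ ≤ R := by
  rw [← ENNReal.pow_le_pow_left_iff two_ne_zero, ← lintegral_sq_enorm_eq]
  refine (lintegral_mono fun x => ?_).trans h
  rw [← mul_pow]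
  exact pow_le_pow_left (le_opENorm _ _)

lemma eLpNorm_clm_apply_le_of_sup {μ : Measure Plane} {H : Plane → Mat n} {w : Plane → Vec n}
    {R : ℝ≥0∞} (hR : R ≠ (⊤ : ℝ≥0∞)) (h : ∀ᵐ x ∂μ, ‖H x‖ₑ ≤ R) :
    eLpNorm (fun x => H x (w x)) 2 μ ≤ R * eLpNorm w 2 μ := by
  refine eLpNorm_clm_apply_le ?_
  rw [mul_pow, ← lintegral_sq_enorm_eq, ← lintegral_const_mul' _ _ (by finiteness)]
  refine lintegral_mono_ae ?_
  filter_upwards [h] with x hx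
  gcongr

lemma eLpNorm_clm_apply_le_of_sup_right {μ : Measure Plane} {H : Plane → Mat n} {w : Plane → Vec n}
    {R : ℝ≥0∞} (hR : R ≠ (⊤ : ℝ≥0∞)) (h : ∀ᵐ x ∂μ, ‖w x‖ₑ ≤ R) :
    eLpNorm (fun x => H x (w x)) 2 μ ≤ eLpNorm H 2 μ * R := by
  refine eLpNorm_clm_apply_le ?_
  rw [mul_pow, ← lintegral_sq_enorm_eq, ← lintegral_mul_const' _ _ (by finiteness)]
  refine lintegral_mono_ae ?_
  filter_upwards [h] with x hx
  gcongr

/-- The norm of a regular function is finite. -/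
lemma jetSum_ne_top {u : SpaceTime → Vec n}
    (hu : ∀ β : MultiIdx, β.len ≤ k → ContInLp Γ.ext T 2 (pdIter β u)) (ht : t ∈ Icc 0 T) :
    jetSum Γ k jet[u] t ≠ (⊤ : ℝ≥0∞) :=
  (ENNReal.sum_lt_top.2 fun β hβ => ((hu β (mem_idx.1 hβ)).memLp_two ht).2).ne

/-- The bounds of the terms `(∂^β ∂_i A) ∂^b v` of the commutator, for a coefficient with
derivatives in `𝕎^{1,p}`, `p > 2`; here `v` is a first-order derivative of `u`. -/
theorem exists_commutator_term_bound (Γ : BoundaryCurve) (hp : 2 < p) : ∃ C : ℝ≥0∞,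
    C ≠ (⊤ : ℝ≥0∞) ∧ ∀ {n m : ℕ} {T K : ℝ} {J : Fin 3 → Jet (Mat n)}
      (u : SpaceTime → Vec n), ContDiff ℝ (m + 1 : ℕ) u →
      (∀ β : MultiIdx, β.len ≤ m + 1 → ContInLp Γ.ext T 2 (pdIter β u)) →
      (∀ i (β : MultiIdx), β.len + 1 ≤ m → ∀ t ∈ Ioo 0 T,
        eLpNorm (fun x => J i β (t, x)) 2 vol[Γ] ≤ ofReal K) →
      (∀ i, ∃ Jp, IsWJet Γ T 1 p (J i 0) Jp ∧ (∀ t ∈ Icc 0 T, jetNorm Γ.ext 1 p Jp t ≤ K) ∧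
        ∀ β : MultiIdx, β.len ≤ 1 → β.len + 1 ≤ m → J i β =ᵐ[volume.restrict (Γ.cyl T)] Jp β) →
      ∀ (i : Fin 3) (β b : MultiIdx), β.len + b.len ≤ m → 1 ≤ b.len → β.len + 1 ≤ m →
      ∀ᵐ t ∂time[T], eLpNorm (fun x => J i β (t, x) (pdIter b u (t, x))) 2 vol[Γ] ≤
          C * ofReal K * jetSum Γ m jet[u] t := by
  obtain ⟨C₁, hC₁, hmor, hprod⟩ := Γ.exists_morrey hp
  obtain ⟨C₂, hC₂, -, hsup⟩ := Γ.exists_sobolev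
  have hp0 : 0 < p := by linarith
  refine ⟨max C₁ C₂, by simp [hC₁, hC₂], ?_⟩
  intro n m T K J u hu hul hJ2 hJp i β b hβb hb hβ
  obtain ⟨Jp, hJpj, hJpK, hJpe⟩ := hJp i
  rcases Nat.lt_or_ge β.len 2 with h | h
  · rcases Nat.lt_or_ge β.len 1 with h1 | h1
    · have hβ0 : β = 0 := by
        obtain ⟨b0, b1, b2⟩ := β
        simp only [len] at h1
        have : b0 = 0 ∧ b1 = 0 ∧ b2 = 0 := by omega
        obtain ⟨rfl, rfl, rfl⟩ := this
        rfl
      subst hβ0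
      filter_upwards [hmor (J i 0) Jp hJpj hJpK] with t ht
      refine (eLpNorm_clm_apply_le_of_sup (by finiteness) ht).trans ?_
      refine mul_le_mul' (mul_le_mul' (le_max_left _ _) le_rfl) ?_
      exact le_jetSum Γ jet[u] t (by omega)
    · filter_upwards [ae_cyl (hJpe β (by omega) hβ), ae_restrict_mem measurableSet_Ioo]
        with t ht htI
      have htI' := Ioo_subset_Icc_self htI
      have hw : ContDiff ℝ 1 (pdIter b u) :=
        pdIter_contDiff (k := 1) b (hu.of_le (by norm_cast; omega))
      have hle := eLpNorm_jet_le hp0 (by omega : β.len ≤ 1) (hJpj β (by omega)).2 htI' (hJpK t htI')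
      have hjs : jetSum Γ 1 jet[pdIter b u] t ≤ jetSum Γ m jet[u] t :=
        jetSum_pdIter_le Γ (by omega) (hu.of_le (by norm_cast; omega)) t
      have e1 : (fun x => J i β (t, x) (pdIter b u (t, x))) =ᵐ[vol[Γ]]
          fun x => Jp β (t, x) (pdIter b u (t, x)) := by
        filter_upwards [ht] with x hx
        rw [hx]
      rw [eLpNorm_congr_ae e1]
      refine eLpNorm_clm_apply_le ((hprod (fun x => Jp β (t, x)) (pdIter b u) t
        ((hJpj β (by omega)).2 t htI').1.1 hw).trans ?_)
      gcongr
      exact le_max_left _ _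
  · filter_upwards [ae_restrict_mem measurableSet_Ioo] with t htI
    have htI' := Ioo_subset_Icc_self htI
    have hjs : jetSum Γ 2 jet[pdIter b u] t ≤ jetSum Γ m jet[u] t :=
      jetSum_pdIter_le Γ (by omega) (hu.of_le (by norm_cast; omega)) t
    have hfin : jetSum Γ m jet[u] t ≠ (⊤ : ℝ≥0∞) :=
      jetSum_ne_top (fun β hβ => hul β (by omega)) htI'
    have hw : ContDiff ℝ 2 (pdIter b u) :=
      pdIter_contDiff (k := 2) b (hu.of_le (by norm_cast; omega))
    refine (eLpNorm_clm_apply_le_of_sup_right (R := C₂ * jetSum Γ m jet[u] t)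
      (by finiteness) ?_).trans ?_
    · refine (ae_restrict_iff' Γ.measurableSet_ext).2 (.of_forall fun x hx => ?_)
      exact (hsup (pdIter b u) t hw x hx).trans (mul_le_mul' le_rfl hjs)
    · calc _ ≤ ofReal K * (max C₁ C₂ * jetSum Γ m jet[u] t) := by
            gcongr
            · exact hJ2 i β hβ t htI
            · exact le_max_right _ _
        _ = _ := by ring

/-- The bounds of the terms `(∂^β ∂_i B) ∂^b u` of the commutator, for a coefficient with
derivatives in `𝕎^1`. -/
theorem exists_commutator_term_bound_two (Γ : BoundaryCurve) : ∃ C : ℝ≥0∞,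
    C ≠ (⊤ : ℝ≥0∞) ∧ ∀ {n m : ℕ} {T K : ℝ} {J : Fin 3 → Jet (Mat n)}
      (u : SpaceTime → Vec n), ContDiff ℝ (m + 1 : ℕ) u →
      (∀ β : MultiIdx, β.len ≤ m + 1 → ContInLp Γ.ext T 2 (pdIter β u)) →
      (∀ i (β : MultiIdx), β.len + 1 ≤ m → ∀ t ∈ Ioo 0 T,
        eLpNorm (fun x => J i β (t, x)) 2 vol[Γ] ≤ ofReal K) →
      (∀ i, ∃ Jp, IsWJet Γ T 1 2 (J i 0) Jp ∧ ∀ t ∈ Icc 0 T, jetNorm Γ.ext 1 2 Jp t ≤ K) →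
      ∀ (i : Fin 3) (β b : MultiIdx), β.len + 1 + b.len ≤ m →
      ∀ᵐ t ∂time[T], eLpNorm (fun x => J i β (t, x) (pdIter b u (t, x))) 2 vol[Γ] ≤
          C * ofReal K * jetSum Γ m jet[u] t := by
  obtain ⟨C, hC, hprod, hsup⟩ := Γ.exists_sobolev
  refine ⟨C, hC, ?_⟩
  intro n m T K J u hu hul hJ2 hJp i β b hβb
  obtain ⟨Jp, hJpj, hJpK⟩ := hJp i
  rcases Nat.lt_or_ge β.len 1 with h1 | h1
  · have hβ0 : β = 0 := by
      obtain ⟨b0, b1, b2⟩ := β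
      simp only [len] at h1
      have : b0 = 0 ∧ b1 = 0 ∧ b2 = 0 := by omega
      obtain ⟨rfl, rfl, rfl⟩ := this
      rfl
    subst hβ0
    filter_upwards [hprod (J i 0) Jp hJpj hJpK] with t ht
    have hw : ContDiff ℝ 1 (pdIter b u) :=
      pdIter_contDiff (k := 1) b (hu.of_le (by norm_cast; omega))
    refine eLpNorm_clm_apply_le ((ht (pdIter b u) hw).trans ?_)
    gcongr
    exact jetSum_pdIter_le Γ (by omega) (hu.of_le (by norm_cast; omega)) t
  · filter_upwards [ae_restrict_mem measurableSet_Ioo] with t htI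
    have htI' := Ioo_subset_Icc_self htI
    have hjs : jetSum Γ 2 jet[pdIter b u] t ≤ jetSum Γ m jet[u] t :=
      jetSum_pdIter_le Γ (by omega) (hu.of_le (by norm_cast; omega)) t
    have hfin : jetSum Γ m jet[u] t ≠ (⊤ : ℝ≥0∞) :=
      jetSum_ne_top (fun β hβ => hul β (by omega)) htI'
    have hw : ContDiff ℝ 2 (pdIter b u) :=
      pdIter_contDiff (k := 2) b (hu.of_le (by norm_cast; omega))
    refine (eLpNorm_clm_apply_le_of_sup_right (R := C * jetSum Γ m jet[u] t)
      (by finiteness) ?_).trans ?_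
    · refine (ae_restrict_iff' Γ.measurableSet_ext).2 (.of_forall fun x hx => ?_)
      exact (hsup (pdIter b u) t hw x hx).trans (mul_le_mul' le_rfl hjs)
    · calc _ ≤ ofReal K * (C * jetSum Γ m jet[u] t) := by
            gcongr
            exact hJ2 i β (by omega) t htI
        _ = _ := by ring

end Commutator

section CommutatorBound

open scoped ENNReal

lemma commList_length (w : List (Fin 3)) : (commList w).length + 1 = 2 ^ w.length := by
  induction w with
  | nil => rfl
  | cons k w ih =>
    have : ∀ l : List ((Fin 3 × MultiIdx) × MultiIdx), (l.flatMap fun q =>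
        [((q.1.1, q.1.2 + unitIdx k), q.2), (q.1, q.2 + unitIdx k)]).length = 2 * l.length := by
      intro l
      induction l with
      | nil => rfl
      | cons a l ih => rw [List.flatMap_cons, List.length_append, ih]; simp; ring
    rw [commList, List.length_cons, this, List.length_cons, pow_succ, ← ih]; ring

lemma eLpNorm_list_sum_le {α ι : Type*} [MeasurableSpace α] {μ : Measure α} (l : List ι)
    {f : ι → α → V} {R : ℝ≥0∞} (hf : ∀ q ∈ l, AEStronglyMeasurable (f q) μ)
    (hR : ∀ q ∈ l, eLpNorm (f q) 2 μ ≤ R) :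
    AEStronglyMeasurable (fun x => (l.map fun q => f q x).sum) μ ∧
      eLpNorm (fun x => (l.map fun q => f q x).sum) 2 μ ≤ l.length * R := by
  induction l with
  | nil => exact ⟨by simpa using aestronglyMeasurable_const, by simp⟩
  | cons a l ih =>
    obtain ⟨h1, h2⟩ := ih (fun q hq => hf q (List.mem_cons_of_mem _ hq))
      fun q hq => hR q (List.mem_cons_of_mem _ hq)
    have ha := hf a List.mem_cons_self
    simp only [List.map_cons, List.sum_cons, List.length_cons]
    refine ⟨ha.add h1, ?_⟩
    refine (eLpNorm_add_le ha h1 (by norm_num)).trans ?_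
    push_cast
    rw [add_mul, one_mul, add_comm]
    exact add_le_add h2 (hR a List.mem_cons_self)

lemma ae_aestronglyMeasurable_slice {g : SpaceTime → V}
    (hg : AEStronglyMeasurable g (volume.restrict (Γ.cyl T))) : ∀ᵐ t ∂time[T],
      AEStronglyMeasurable (fun x => g (t, x)) vol[Γ] := by
  rw [restrict_cyl] at hg
  exact hg.prodMk_left

lemma aestronglyMeasurable_clm_apply {μ : Measure Plane} {H : Plane → Mat n} {w : Plane → Vec n}
    (hH : AEStronglyMeasurable H μ) (hw : AEStronglyMeasurable w μ) :
    AEStronglyMeasurable (fun x => H x (w x)) μ :=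
  (isBoundedBilinearMap_apply (𝕜 := ℝ) (E := Vec n) (F := Vec n)).continuous.comp_aestronglyMeasurable
    (hH.prodMk hw)

/-- The sum of the commutator terms is bounded when each of them is. -/
lemma ae_eLpNorm_commList_le {J : Fin 3 → Jet (Mat n)} {v : SpaceTime → Vec n}
    (w : List (Fin 3)) (hw : w.length ≤ m) (hv : ContDiff ℝ m v)
    (hJm : ∀ i (β : MultiIdx), β.len + 1 ≤ m → AEStronglyMeasurable (J i β) (volume.restrict (Γ.cyl
      T))) {R : ℝ → ℝ≥0∞}
    (hR : ∀ (i : Fin 3) (β b : MultiIdx), β.len + 1 + b.len ≤ m → ∀ᵐ t ∂time[T], eLpNorm (fun x => J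
      i β (t, x) (pdIter b v (t, x))) 2 vol[Γ] ≤ R t) : ∀ᵐ t ∂time[T],
      AEStronglyMeasurable (fun x => ((commList w).map fun q =>
        J q.1.1 q.1.2 (t, x) (pdIter q.2 v (t, x))).sum) vol[Γ] ∧
      eLpNorm (fun x => ((commList w).map fun q =>
        J q.1.1 q.1.2 (t, x) (pdIter q.2 v (t, x))).sum) 2 vol[Γ] ≤
      2 ^ m * R t := by
  have h1 : ∀ᵐ t ∂time[T], ∀ q ∈ {q | q ∈ commList w},
      AEStronglyMeasurable (fun x => J q.1.1 q.1.2 (t, x) (pdIter q.2 v (t, x)))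
        vol[Γ] ∧
      eLpNorm (fun x => J q.1.1 q.1.2 (t, x) (pdIter q.2 v (t, x))) 2 vol[Γ] ≤ R t := by
    refine (ae_ball_iff (List.finite_toSet _).countable).2 fun q hq => ?_
    have hl := commList_len hq
    filter_upwards [ae_aestronglyMeasurable_slice (hJm q.1.1 q.1.2 (by omega)),
      hR q.1.1 q.1.2 q.2 (by omega)] with t ht1 ht2
    refine ⟨aestronglyMeasurable_clm_apply ht1 (aestronglyMeasurable_slice ?_ t _), ht2⟩
    exact (pdIter_contDiff (k := 0) q.2 (hv.of_le (by norm_cast; omega))).continuous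
  filter_upwards [h1] with t ht
  obtain ⟨e1, e2⟩ := eLpNorm_list_sum_le (commList w)
    (f := fun q x => J q.1.1 q.1.2 (t, x) (pdIter q.2 v (t, x)))
    (fun q hq => (ht q hq).1) fun q hq => (ht q hq).2
  refine ⟨e1, e2.trans (mul_le_mul' ?_ le_rfl)⟩
  have h3 := commList_length w
  have h4 : (commList w).length ≤ 2 ^ m :=
    calc _ ≤ 2 ^ w.length := by omega
      _ ≤ 2 ^ m := Nat.pow_le_pow_right (by norm_num) hw
  exact_mod_cast h4

/-- The operator applied to the derivatives of a solution. -/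
theorem exists_op_bound (Γ : BoundaryCurve) (m : ℕ) (hp : 2 < p) : ∃ C : ℝ≥0∞,
    C ≠ (⊤ : ℝ≥0∞) ∧ ∀ {n : ℕ} {T K₀ K : ℝ} {c : Coeffs n} {u f : SpaceTime → Vec n}
      {F : Jet (Vec n)}, c.IsSmooth Γ T → c.IsBounded Γ T m p K₀ K →
      IsRegularUpTo Γ T m u → IsWJet Γ T m 2 f F → c.Solves Γ T u f →
      ∀ β : MultiIdx, β.len ≤ m → ∀ᵐ t ∂time[T],
        eLpNorm (fun x => c.op (pdIter β u) (t, x)) 2 vol[Γ] ≤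
          eLpNorm (fun x => F β (t, x)) 2 vol[Γ] + C * ofReal K * jetSum Γ m jet[u] t := by
  obtain ⟨C₁, hC₁, H1⟩ := exists_commutator_term_bound Γ hp
  obtain ⟨C₂, hC₂, H2⟩ := exists_commutator_term_bound_two Γ
  refine ⟨2 ^ m * (C₁ + C₁ + C₂), by finiteness, ?_⟩
  intro n T K₀ K c u f F hs hb hu hF hsol β hβ
  have hΩ := Coeffs.isOpen_cyl Γ T
  obtain ⟨w, rfl⟩ := exists_word β
  rw [wordIdx_len] at hβ
  have hum : ContDiff ℝ (m + 1 : ℕ) u := by exact_mod_cast hu.1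
  have hum' : ContDiff ℝ m u := hum.of_le (by norm_cast; omega)
  have hv : ∀ j : Fin 3, ContDiff ℝ m (pd j u) := fun j => pd_contDiff hum j
  choose JA hA1 hAJ hA2 hAm hAp using fun j => HasJets.exists_jets (A := c.A j) (hb.A_deriv j)
  obtain ⟨JB, hB1, hBJ, hB2, hBm, hBp⟩ := HasJets.exists_jets (A := c.B) hb.B_deriv
  have LA : ∀ j, LocallyIntegrableOn (c.A j) (Γ.cyl T) := fun j =>
    (hs.A_diff j).continuousOn.locallyIntegrableOn hΩ.measurableSet
  have LB : LocallyIntegrableOn c.B (Γ.cyl T) := hs.B_cont.locallyIntegrableOn hΩ.measurableSet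
  have wA := fun j : Fin 2 => weak_leibniz hΩ (LA j) (hA1 j) (hAJ j) (hv j.succ) w hβ
  have wB := weak_leibniz hΩ LB hB1 hBJ hum' w hβ
  have w0 : IsWeakDeriv (Γ.cyl T) (wordIdx w) (pd 0 u) (pdIter (wordIdx w) (pd 0 u)) :=
    isWeakDeriv_pdIter hΩ _ ((hv 0).of_le (by rw [wordIdx_len]; exact_mod_cast hβ))
  have wsum := ((w0.add (wA 0)).add (wA 1)).add wB
  have wf := (hF (wordIdx w) (by rwa [wordIdx_len])).1
  have wf' : IsWeakDeriv (Γ.cyl T) (wordIdx w) (fun z => pd 0 u z + c.A 0 z (pd (Fin.succ 0) u z) +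
      c.A 1 z (pd (Fin.succ 1) u z) + c.B z (u z)) (F (wordIdx w)) := by
    refine wf.congr ?_ (ae_eq_refl _)
    rw [EventuallyEq, ae_restrict_iff' hΩ.measurableSet]
    exact Eventually.of_forall fun z hz => (hsol z hz).symm
  have huniq := wf'.unique hΩ wsum
  have hpdc : ∀ i : Fin 3, pdIter (wordIdx w) (pd i u) = pd i (pdIter (wordIdx w) u) := by
    intro i
    have h1 : ContDiff ℝ ((wordIdx w).len + 1 : ℕ) u :=
      hum.of_le (by rw [wordIdx_len]; norm_cast; omega)
    rw [pdIter_pd i _ h1, pd_pdIter i _ h1]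
  have tA := fun j : Fin 2 => ae_eLpNorm_commList_le (J := JA j) (v := pd j.succ u) (Γ := Γ) (T := T)
    (R := fun t => C₁ * ofReal K * jetSum Γ m jet[u] t) w hβ (hv j.succ)
    (hAm j) (by
      intro i β b hβb
      have e : pdIter b (pd j.succ u) = pdIter (b + unitIdx j.succ) u :=
        pdIter_pd _ _ (hum.of_le (by norm_cast; omega))
      rw [e]
      refine H1 u hum hu.2 (hA2 j) (hAp j) i β _ ?_ ?_ ?_ <;>
        (try rw [MultiIdx.len_add, unitIdx_len]) <;> omega)
  have tB := ae_eLpNorm_commList_le (J := JB) (v := u) (Γ := Γ) (T := T)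
    (R := fun t => C₂ * ofReal K * jetSum Γ m jet[u] t) w hβ hum' hBm
    (fun i β b hβb => H2 u hum hu.2 hB2 (fun i => by
      obtain ⟨Jp, h1, h2, -⟩ := hBp i
      exact ⟨Jp, h1, h2⟩) i β b hβb)
  have hFm : ∀ᵐ t ∂time[T], AEStronglyMeasurable (fun x => F (wordIdx w) (t, x)) vol[Γ] :=
    ae_aestronglyMeasurable_slice wf.2.1.aestronglyMeasurable
  filter_upwards [ae_cyl huniq, tA 0, tA 1, tB, hFm] with t ht t0 t1 t2 tF
  set S0 := fun x => ((commList w).map fun q =>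
        JA 0 q.1.1 q.1.2 (t, x) (pdIter q.2 (pd (Fin.succ 0) u) (t, x))).sum with hS0
  set S1 := fun x => ((commList w).map fun q =>
        JA 1 q.1.1 q.1.2 (t, x) (pdIter q.2 (pd (Fin.succ 1) u) (t, x))).sum with hS1
  set S2 := fun x => ((commList w).map fun q =>
        JB q.1.1 q.1.2 (t, x) (pdIter q.2 u (t, x))).sum with hS2
  have e1 : (fun x => c.op (pdIter (wordIdx w) u) (t, x)) =ᵐ[vol[Γ]]
      fun x => F (wordIdx w) (t, x) - (S0 x + S1 x + S2 x) := by
    filter_upwards [ht] with x hx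
    rw [hx, Coeffs.op, hpdc, hpdc, hpdc, hS0, hS1, hS2]
    simp only [Fin.succ_zero_eq_one, Fin.succ_one_eq_two]
    abel
  rw [eLpNorm_congr_ae e1]
  have m01 := t0.1.add t1.1
  calc _ ≤ eLpNorm (fun x => F (wordIdx w) (t, x)) 2 vol[Γ] +
        eLpNorm (fun x => S0 x + S1 x + S2 x) 2 vol[Γ] :=
        eLpNorm_sub_le tF (m01.add t2.1) (by norm_num)
    _ ≤ eLpNorm (fun x => F (wordIdx w) (t, x)) 2 vol[Γ] +
        (eLpNorm S0 2 vol[Γ] + eLpNorm S1 2 vol[Γ] +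
        eLpNorm S2 2 vol[Γ]) := by
        refine add_le_add le_rfl ?_
        refine (eLpNorm_add_le m01 t2.1 (by norm_num)).trans (add_le_add ?_ le_rfl)
        exact eLpNorm_add_le t0.1 t1.1 (by norm_num)
    _ ≤ _ := by
        refine add_le_add le_rfl ((add_le_add (add_le_add t0.2 t1.2) t2.2).trans (le_of_eq ?_))
        ring

/-- The classical first derivatives of the coefficients are bounded. -/
theorem exists_pd_coeff_bound (Γ : BoundaryCurve) (hp : 2 < p) : ∃ C : ℝ≥0∞,
    C ≠ (⊤ : ℝ≥0∞) ∧ ∀ {n m : ℕ} {T K₀ K : ℝ} {c : Coeffs n}, c.IsSmooth Γ T →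
      c.IsBounded Γ T m p K₀ K → ∀ (j : Fin 2) (i : Fin 3),
      ∀ᵐ t ∂time[T], ∀ᵐ x ∂vol[Γ], ‖pd i (c.A j) (t, x)‖ₑ ≤ C * ofReal K := by
  obtain ⟨C, hC, hmor, -⟩ := Γ.exists_morrey hp
  refine ⟨C, hC, ?_⟩
  intro n m T K₀ K c hs hb j i
  have hΩ := Coeffs.isOpen_cyl Γ T
  obtain ⟨G, hG, -, J, hJ, hJK⟩ := hb.A_deriv j i
  have e : G =ᵐ[volume.restrict (Γ.cyl T)] pd i (c.A j) :=
    hG.unique hΩ (isWeakDeriv_pd hΩ (hs.A_diff j) i)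
  filter_upwards [ae_cyl e, hmor G J hJ hJK] with t h1 h2
  filter_upwards [h1, h2] with x hx1 hx2
  rwa [← hx1]

end CommutatorBound

section TubeOperators

/-- The normal derivative `N · ∇` (meaningful in the tubular neighborhood). -/
noncomputable def dNor (Γ : BoundaryCurve) (u : SpaceTime → V) : SpaceTime → V :=
  fun z => fderiv ℝ u z (0, Γ.normalField z.2)

/-- `∂_t^β₀ (N · ∇)^β₁ (T · ∇)^β₂`. -/
noncomputable def dFrame (Γ : BoundaryCurve) (β : MultiIdx) (u : SpaceTime → V) : SpaceTime → V :=
  (pd 0)^[β.1] ((dNor Γ)^[β.2.1] ((dTan Γ)^[β.2.2] u))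

/-- The derivations `∂_t`, `N · ∇`, `T · ∇`. -/
noncomputable def frameDir (Γ : BoundaryCurve) (i : Fin 3) (x : Plane) : SpaceTime :=
  (![((1 : ℝ), (0 : Plane)), (0, Γ.normalField x), (0, Γ.tangentField x)] : Fin 3 → SpaceTime) i

/-- Normal-tangential coordinates as a map of space-time. -/
noncomputable def flatMap (Γ : BoundaryCurve) (y : SpaceTime) : SpaceTime :=
  (y.1, thetaMap Γ.γ (y.2 0, y.2 1))

/-- The points whose coordinates are in the band. -/
def flatBand (Γ : BoundaryCurve) : Set SpaceTime := {y | y.2 0 ∈ Ioo (-Γ.r₀) Γ.r₀}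

lemma isOpen_flatBand (Γ : BoundaryCurve) : IsOpen (flatBand Γ) := isOpen_Ioo.preimage (by fun_prop)

lemma contDiff_flatMap (Γ : BoundaryCurve) : ContDiff ℝ ∞ (flatMap Γ) :=
  contDiff_fst.prodMk (Γ.contDiff_thetaMap.comp
    ((contDiff_euclidean.1 contDiff_snd 0).prodMk (contDiff_euclidean.1 contDiff_snd 1)))

lemma flatMap_mem_tube {y : SpaceTime} (hy : y ∈ flatBand Γ) :
    (flatMap Γ y).2 ∈ Γ.tube := Γ.thetaMap_mem_tube ⟨hy, mem_univ _⟩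

lemma exists_flatMap_eq (hz : z.2 ∈ Γ.tube) : ∃ y ∈ flatBand Γ, flatMap Γ y = z := by
  refine ⟨(z.1, !₂[(Γ.coords z.2).1, (Γ.coords z.2).2]), ?_, ?_⟩
  · simpa [flatBand] using (Γ.coords_mem_band hz).1
  · simp [flatMap, Γ.thetaMap_coords hz]

lemma fderiv_flatMap {y : SpaceTime} (hy : y ∈ flatBand Γ) (i : Fin 3) :
    fderiv ℝ (flatMap Γ) y (stDir i) = frameDir Γ i (flatMap Γ y).2 := by
  have h0 : HasFDerivAt (fun y : SpaceTime => (y.2 0, y.2 1))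
      (((proj (0 : Fin 2) : Plane →L[ℝ] ℝ).prod (proj 1)).comp
        (ContinuousLinearMap.snd ℝ ℝ Plane)) y :=
    (((proj (0 : Fin 2) : Plane →L[ℝ] ℝ).prod (proj 1)).comp
        (ContinuousLinearMap.snd ℝ ℝ Plane)).hasFDerivAt
  have h2 : HasFDerivAt (fun y : SpaceTime => thetaMap Γ.γ (y.2 0, y.2 1)) _ y :=
    HasFDerivAt.comp (g := thetaMap Γ.γ) y (Γ.hasFDerivAt_thetaMap (y.2 0, y.2 1)) h0
  have h1 : HasFDerivAt (flatMap Γ) _ y := hasFDerivAt_fst.prodMk h2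
  have hb : (y.2 0, y.2 1) ∈ Γ.band := ⟨hy, mem_univ _⟩
  have hN : Γ.normalField (flatMap Γ y).2 = unitNormal Γ.γ (y.2 1) := by
    have hn : unitNormal Γ.γ (toIcoMod Γ.L_pos 0 (y.2 1)) = unitNormal Γ.γ (y.2 1) :=
      Γ.periodic_unitNormal.sub_zsmul_eq _
    simp only [BoundaryCurve.normalField, flatMap, Γ.coords_thetaMap hb, hn]
  have hT : Γ.tangentField (flatMap Γ y).2 =
      (1 + y.2 0 * curvature Γ.γ (y.2 1)) • deriv Γ.γ (y.2 1) := by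
    have hk : curvature Γ.γ (toIcoMod Γ.L_pos 0 (y.2 1)) = curvature Γ.γ (y.2 1) :=
      Γ.periodic_curvature.sub_zsmul_eq _
    have hd : deriv Γ.γ (toIcoMod Γ.L_pos 0 (y.2 1)) = deriv Γ.γ (y.2 1) :=
      Γ.periodic_deriv.sub_zsmul_eq _
    simp only [BoundaryCurve.tangentField, flatMap, Γ.coords_thetaMap hb, hk, hd]
  rw [h1.fderiv]
  fin_cases i <;> simp [frameDir, stDir, BoundaryCurve.dTheta, hN, hT]

lemma pd_comp_flatMap {y : SpaceTime} (hy : y ∈ flatBand Γ) {w : SpaceTime → V}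
    (hw : DifferentiableAt ℝ w (flatMap Γ y)) (i : Fin 3) : pd i (w ∘ flatMap Γ) y =
      fderiv ℝ w (flatMap Γ y) (frameDir Γ i (flatMap Γ y).2) := by
  rw [pd, fderiv_comp y hw ((contDiff_flatMap Γ).differentiable (by simp) y), ← fderiv_flatMap hy]
  rfl

/-- Linear combinations of the operators `𝒟 β`, with coefficients smooth in the tubular
neighborhood. -/
def IsComb (Γ : BoundaryCurve) (k : ℕ) (𝒟 : MultiIdx → (SpaceTime → V) → SpaceTime → V)
    (P : (SpaceTime → V) → SpaceTime → V) : Prop :=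
  ∃ a : MultiIdx → Plane → ℝ, (∀ β, Γ.IsTubeSmooth (a β)) ∧
    ∀ u, ContDiff ℝ (k : ℕ) u → ∀ z : SpaceTime, z.2 ∈ Γ.tube →
      P u z = ∑ β ∈ idx k, a β z.2 • 𝒟 β u z

lemma BoundaryCurve.IsTubeSmooth.sum {ι : Type*} (s : Finset ι) {g : ι → Plane → ℝ}
    (h : ∀ i ∈ s, Γ.IsTubeSmooth (g i)) : Γ.IsTubeSmooth fun x => ∑ i ∈ s, g i x := by
  classical
  induction s using Finset.induction_on with
  | empty => simpa using IsTubeSmooth.const 0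
  | insert i s hi ih =>
    simp only [Finset.sum_insert hi]
    exact (h i (by simp)).add (ih fun j hj => h j (by simp [hj]))

lemma hasFDerivAt_space_smul {w : SpaceTime → V} (hg : DifferentiableAt ℝ g z.2)
    (hw : DifferentiableAt ℝ w z) (v : SpaceTime) :
    DifferentiableAt ℝ (fun z : SpaceTime => g z.2 • w z) z ∧
    fderiv ℝ (fun z : SpaceTime => g z.2 • w z) z v =
      (fderiv ℝ g z.2 v.2) • w z + g z.2 • fderiv ℝ w z v := by
  have h1 : HasFDerivAt (fun z : SpaceTime => g z.2)
      ((fderiv ℝ g z.2).comp (ContinuousLinearMap.snd ℝ ℝ Plane)) z :=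
    hg.hasFDerivAt.comp z hasFDerivAt_snd
  have h2 : HasFDerivAt (fun z : SpaceTime => g z.2 • w z) _ z := h1.smul hw.hasFDerivAt
  exact ⟨h2.differentiableAt, by rw [h2.fderiv]; simp [add_comm]⟩

lemma isOpen_tubeCyl (Γ : BoundaryCurve) : IsOpen {z : SpaceTime | z.2 ∈ Γ.tube} :=
  Γ.isOpen_tube.preimage continuous_snd

lemma fderiv_clm_decomp (M : SpaceTime →L[ℝ] V) (v : SpaceTime) :
    M v = v.1 • M (stDir 0) + v.2 0 • M (stDir 1) + v.2 1 • M (stDir 2) := by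
  rw [← map_smul, ← map_smul, ← map_smul, ← map_add, ← map_add]
  congr 1
  refine Prod.ext (by simp [stDir]) ?_
  ext i; fin_cases i <;> simp [stDir]

/-- A first-order derivation applied to a combination of `𝒟 β` is again a combination. -/
lemma IsComb.deriv {𝒟 : MultiIdx → (SpaceTime → V) → SpaceTime → V}
    {P : (SpaceTime → V) → SpaceTime → V} (hP : IsComb Γ k 𝒟 P) {X : Plane → SpaceTime}
    (hX : ∀ j, Γ.IsTubeSmooth fun x => (X x).2 j) {η : Fin 3 → Plane → ℝ}
    (hη : ∀ l, Γ.IsTubeSmooth (η l))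
    (h𝒟 : ∀ u : SpaceTime → V, ContDiff ℝ (k + 1 : ℕ) u → ∀ β ∈ idx k, ∀ z : SpaceTime, z.2 ∈ Γ.tube
      → DifferentiableAt ℝ (𝒟 β u) z ∧ fderiv ℝ (𝒟 β u) z (X z.2) = ∑ l, η l z.2 • 𝒟 (β + unitIdx l)
      u z) : IsComb Γ (k + 1) 𝒟 fun u z => fderiv ℝ (P u) z (X z.2) := by
  classical
  obtain ⟨a, ha, hP⟩ := hP
  have hda : ∀ β, Γ.IsTubeSmooth fun x => fderiv ℝ (a β) x (X x).2 := fun β => by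
    have h1 : ∀ x, fderiv ℝ (a β) x (X x).2 = (X x).2 0 * fderiv ℝ (a β) x (single 0 1) +
          (X x).2 1 * fderiv ℝ (a β) x (single 1 1) := fun x => by
      conv_lhs => rw [show (X x).2 = (X x).2 0 • (single 0 1 : Plane) +
        (X x).2 1 • (single 1 1 : Plane) by ext i; fin_cases i <;> simp]
      simp
    simp only [h1]
    exact ((hX 0).mul ((ha β).fderiv_apply _)).add ((hX 1).mul ((ha β).fderiv_apply _))
  refine ⟨fun γ x => (if γ ∈ idx k then fderiv ℝ (a γ) x (X x).2 else 0) +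
      ∑ β ∈ idx k, ∑ l, (if β + unitIdx l = γ then a β x * η l x else 0), ?_, ?_⟩
  · intro γ
    refine BoundaryCurve.IsTubeSmooth.add ?_ (BoundaryCurve.IsTubeSmooth.sum _ fun β _ =>
      BoundaryCurve.IsTubeSmooth.sum _ fun l _ => ?_)
    · split_ifs
      exacts [hda γ, .const 0]
    · split_ifs
      exacts [(ha β).mul (hη l), .const 0]
  · intro u hu z hz
    have hu' : ContDiff ℝ (k : ℕ) u := hu.of_le (by exact_mod_cast le_succ k)
    have h1 : P u =ᶠ[𝓝 z] fun z => ∑ β ∈ idx k, a β z.2 • 𝒟 β u z :=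
      eventually_of_mem ((isOpen_tubeCyl Γ).mem_nhds hz) fun y hy => hP u hu' y hy
    beta_reduce
    rw [h1.fderiv_eq, fderiv_fun_sum fun β hβ =>
      (hasFDerivAt_space_smul ((ha β).differentiableAt hz) (h𝒟 u hu β hβ z hz).1 (X z.2)).1, _root_.sum_apply]
    have h2 : ∀ β ∈ idx k, fderiv ℝ (fun z : SpaceTime => a β z.2 • 𝒟 β u z) z (X z.2) =
        fderiv ℝ (a β) z.2 (X z.2).2 • 𝒟 β u z +
          ∑ l, (a β z.2 * η l z.2) • 𝒟 (β + unitIdx l) u z := fun β hβ => by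
      rw [(hasFDerivAt_space_smul ((ha β).differentiableAt hz) (h𝒟 u hu β hβ z hz).1 (X z.2)).2,
        (h𝒟 u hu β hβ z hz).2, Finset.smul_sum]
      simp only [smul_smul]
    rw [sum_congr rfl h2, sum_add_distrib]
    simp only [add_smul, sum_add_distrib, Finset.sum_smul, ite_smul, zero_smul]
    congr 1
    · rw [← Finset.sum_filter]
      have : (idx (k + 1)).filter (fun β => β ∈ idx k) = idx k := Finset.ext fun β => by
        simp only [mem_filter, mem_idx]; omega
      rw [this]
    · symm
      rw [Finset.sum_comm]
      refine sum_congr rfl fun β hβ => ?_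
      rw [Finset.sum_comm]
      refine sum_congr rfl fun l _ => ?_
      rw [Finset.sum_ite_eq, if_pos]
      rw [mem_idx] at hβ ⊢
      rw [MultiIdx.len_add, unitIdx_len]; omega

lemma IsComb.id {𝒟 : MultiIdx → (SpaceTime → V) → SpaceTime → V} (h : ∀ u, 𝒟 0 u = u) :
    IsComb Γ 0 𝒟 fun u => u := by
  refine ⟨fun _ _ => 1, fun _ => .const 1, fun u _ z _ => ?_⟩
  have : idx 0 = {0} := by
    ext β; rw [mem_idx, Finset.mem_singleton]
    constructor
    · intro hβ; obtain ⟨a, b, c⟩ := β; simp [len] at hβ; simp [hβ, Prod.ext_iff]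
    · rintro rfl; simp [len]
  simp [this, h]

lemma isTubeSmooth_frameDir (Γ : BoundaryCurve) (i : Fin 3) :
    (Γ.IsTubeSmooth fun x => (frameDir Γ i x).1) ∧
      ∀ j, Γ.IsTubeSmooth fun x => (frameDir Γ i x).2 j := by
  fin_cases i
  · exact ⟨.const 1, fun j => by simpa [frameDir] using .const 0⟩
  · exact ⟨.const 0, fun j => Γ.isTubeSmooth_normalField j⟩
  · exact ⟨.const 0, fun j => Γ.isTubeSmooth_tangentField j⟩

lemma IsComb.frame {P : (SpaceTime → V) → SpaceTime → V} (hP : IsComb Γ k pdIter P) (i : Fin 3) :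
    IsComb Γ (k + 1) pdIter fun u z => fderiv ℝ (P u) z (frameDir Γ i z.2) := by
  have h := isTubeSmooth_frameDir Γ i
  refine hP.deriv (η := ![fun x => (frameDir Γ i x).1, fun x => (frameDir Γ i x).2 0,
    fun x => (frameDir Γ i x).2 1]) h.2 ?_ ?_
  · intro l; fin_cases l
    exacts [h.1, h.2 0, h.2 1]
  · intro u hu β hβ z hz
    rw [mem_idx] at hβ
    have hd : ContDiff ℝ (1 : ℕ) (pdIter β u) :=
      pdIter_contDiff β (hu.of_le (by exact_mod_cast (by omega : 1 + β.len ≤ k + 1)))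
    have hb : ContDiff ℝ (β.len + 1 : ℕ) u := hu.of_le (by exact_mod_cast (by omega))
    refine ⟨hd.differentiable (by simp) z, ?_⟩
    rw [fderiv_clm_decomp, Fin.sum_univ_three, ← pd_pdIter 0 β hb, ← pd_pdIter 1 β hb,
      ← pd_pdIter 2 β hb]
    rfl

/-- Induction on the leading derivative. -/
lemma leading_induction (V : Type*) [NormedAddCommGroup V] [NormedSpace ℝ V] (Γ : BoundaryCurve)
    {p : MultiIdx → Prop} (h0 : p 0)
    (hs : ∀ β β' i, β'.len = β.len + 1 → (dFrame (V := V) Γ β' = fun u z => fderiv ℝ (dFrame Γ β u)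
      z (frameDir Γ i z.2)) → (pdIter (V := V) β' = fun u => pd i (pdIter β u)) → p β → p β')
    (β : MultiIdx) : p β := by
  obtain ⟨a, b, c⟩ := β
  induction a with
  | zero =>
    induction b with
    | zero =>
      induction c with
      | zero => exact h0
      | succ c ih =>
        refine hs _ _ 2 (by simp [len]) ?_ ?_ ih <;> funext u <;>
          simp only [dFrame, pdIter, iterate_succ_apply'] <;> rfl
    | succ b ih =>
      refine hs _ _ 1 (by simp only [len]; ring) ?_ ?_ ih <;> funext u <;>
          simp only [dFrame, pdIter, iterate_succ_apply'] <;> rfl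
  | succ a ih =>
    refine hs _ _ 0 (by simp only [len]; ring) ?_ ?_ ih <;> funext u <;>
          simp only [dFrame, pdIter, iterate_succ_apply'] <;> rfl

lemma isComb_dFrame (Γ : BoundaryCurve) (β : MultiIdx) :
    IsComb Γ β.len pdIter (dFrame (V := V) Γ β) := by
  refine leading_induction V Γ (p := fun β => IsComb Γ β.len pdIter (dFrame (V := V) Γ β)) (IsComb.id fun u => pdIter_zero u) (fun β β' i hl hd _ ih => ?_) β
  rw [hl, hd]; exact ih.frame i

lemma IsComb.differentiableAt {P : (SpaceTime → V) → SpaceTime → V} (hP : IsComb Γ k pdIter P)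
    (hu : ContDiff ℝ (k + 1 : ℕ) u) (hz : z.2 ∈ Γ.tube) : DifferentiableAt ℝ (P u) z := by
  obtain ⟨a, ha, hP⟩ := hP
  have h1 : P u =ᶠ[𝓝 z] fun z => ∑ β ∈ idx k, a β z.2 • pdIter β u z :=
    eventually_of_mem ((isOpen_tubeCyl Γ).mem_nhds hz) fun y hy =>
      hP u (hu.of_le (by exact_mod_cast le_succ k)) y hy
  refine h1.differentiableAt_iff.2 (DifferentiableAt.fun_sum fun β hβ => ?_)
  rw [mem_idx] at hβ
  have hd : ContDiff ℝ (1 : ℕ) (pdIter β u) :=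
    pdIter_contDiff β (hu.of_le (by exact_mod_cast (by omega : 1 + β.len ≤ k + 1)))
  exact (hasFDerivAt_space_smul ((ha β).differentiableAt hz) (hd.differentiable (by simp) z) 0).1

lemma dFrame_flatMap (β : MultiIdx) (hu : ContDiff ℝ β.len u) {y : SpaceTime} (hy : y ∈ flatBand Γ) :
    dFrame Γ β u (flatMap Γ y) = pdIter β (u ∘ flatMap Γ) y := by
  induction β using leading_induction V Γ generalizing y with
  | h0 => rfl
  | hs β β' i hl hd hp ih =>
    rw [hl] at hu
    have hu' : ContDiff ℝ β.len u := hu.of_le (by exact_mod_cast le_succ _)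
    have : dFrame Γ β u ∘ flatMap Γ =ᶠ[𝓝 y] pdIter β (u ∘ flatMap Γ) :=
      eventually_of_mem ((isOpen_flatBand Γ).mem_nhds hy) fun y hy => ih hu' hy
    rw [hd, hp]
    beta_reduce
    rw [← pd_comp_flatMap hy ((isComb_dFrame Γ β).differentiableAt hu (flatMap_mem_tube hy)),
      pd, pd, this.fderiv_eq]

lemma fderiv_dFrame (β : MultiIdx) (i : Fin 3) (hu : ContDiff ℝ (β.len + 1 : ℕ) u)
    (hz : z.2 ∈ Γ.tube) :
    fderiv ℝ (dFrame Γ β u) z (frameDir Γ i z.2) = dFrame Γ (β + unitIdx i) u z := by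
  obtain ⟨y, hy, rfl⟩ := exists_flatMap_eq hz
  have hv : ContDiff ℝ (β.len + 1 : ℕ) (u ∘ flatMap Γ) :=
    hu.comp (contDiff_nat_of_top (contDiff_flatMap Γ) _)
  rw [dFrame_flatMap _ (by rwa [MultiIdx.len_add, unitIdx_len]) hy, ← pd_pdIter i β hv,
    ← pd_comp_flatMap hy ((isComb_dFrame Γ β).differentiableAt hu hz)]
  have : dFrame Γ β u ∘ flatMap Γ =ᶠ[𝓝 y] pdIter β (u ∘ flatMap Γ) :=
    eventually_of_mem ((isOpen_flatBand Γ).mem_nhds hy) fun y hy =>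
      dFrame_flatMap β (hu.of_le (by exact_mod_cast le_succ _)) hy
  rw [pd, pd, this.fderiv_eq]

/-- The coefficients of the coordinate directions in the frame `∂_t, N, T`. -/
noncomputable def frameCoef (Γ : BoundaryCurve) (i l : Fin 3) (x : Plane) : ℝ :=
  ![(stDir i).1, inner ℝ (Γ.normalField x) (stDir i).2, inner ℝ (Γ.tangentDual x) (stDir i).2] l

lemma isTubeSmooth_frameCoef (Γ : BoundaryCurve) (i l : Fin 3) :
    Γ.IsTubeSmooth (frameCoef Γ i l) := by
  have h : ∀ (F : Plane → Plane), (∀ j, Γ.IsTubeSmooth fun x => F x j) → ∀ e : Plane,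
      Γ.IsTubeSmooth fun x => inner ℝ (F x) e := fun F hF e => by
    simp only [PiLp.inner_apply, sum_univ_two]
    simp only [RCLike.inner_apply, conj_trivial]
    exact ((BoundaryCurve.IsTubeSmooth.const _).mul (hF 0)).add
      ((BoundaryCurve.IsTubeSmooth.const _).mul (hF 1))
  fin_cases l
  exacts [.const _, h _ Γ.isTubeSmooth_normalField _, h _ Γ.isTubeSmooth_tangentDual _]

lemma stDir_eq_frame (hx : x ∈ Γ.tube) (i : Fin 3) :
    stDir i = ∑ l, frameCoef Γ i l x • frameDir Γ l x := by
  rw [Fin.sum_univ_three]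
  have := Γ.frame_expand_tube hx (stDir i).2
  refine Prod.ext (by simp [frameCoef, frameDir]) ?_
  rw [← this]; simp [frameCoef, frameDir]

lemma isComb_pdIter (Γ : BoundaryCurve) (β : MultiIdx) :
    IsComb Γ β.len (dFrame (V := V) Γ) (pdIter β) := by
  have key : ∀ {k : ℕ} {P : (SpaceTime → V) → SpaceTime → V} (i : Fin 3),
      IsComb Γ k (dFrame Γ) P → IsComb Γ (k + 1) (dFrame Γ) fun u => pd i (P u) :=
    fun {k P} i hP => by
    refine hP.deriv (X := fun _ => stDir i) (η := frameCoef Γ i) (fun j => .const _)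
      (isTubeSmooth_frameCoef Γ i) fun u hu β hβ z hz => ?_
    rw [mem_idx] at hβ
    have hu' : ContDiff ℝ (β.len + 1 : ℕ) u := hu.of_le (by exact_mod_cast (by omega))
    refine ⟨(isComb_dFrame Γ β).differentiableAt hu' hz, ?_⟩
    rw [stDir_eq_frame hz i, map_sum]
    simp only [map_smul, fderiv_dFrame β _ hu' hz]
  refine leading_induction V Γ (p := fun β => IsComb Γ β.len (dFrame (V := V) Γ) (pdIter β)) (IsComb.id fun u => rfl) (fun β β' i hl _ hp ih => ?_) β
  rw [hl, hp]; exact key i ih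

end TubeOperators

section NormalRecovery

/-- The multi-indices of length less than `m`. -/
def idxLt (m : ℕ) : Finset MultiIdx := (idx m).filter fun β => β.len < m

lemma mem_idxLt : β ∈ idxLt m ↔ β.len < m := by
  simp only [idxLt, mem_filter, mem_idx]; omega

/-- The principal part `∂_t w + A_j ∂_j w`. -/
noncomputable def Coeffs.principal (c : Coeffs n) : (SpaceTime → Vec n) → SpaceTime → Vec n :=
  ({ c with B := fun _ => 0 } : Coeffs n).op

lemma Coeffs.principal_apply (c : Coeffs n) (w : SpaceTime → Vec n) (z : SpaceTime) :
    c.principal w z = pd 0 w z + c.A 0 z (pd 1 w z) + c.A 1 z (pd 2 w z) := by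
  simp [Coeffs.principal, Coeffs.op]

/-- The quantities which control all the derivatives near the boundary. -/
noncomputable def controlSum (Γ : BoundaryCurve) (m : ℕ) (c : Coeffs n) (u : SpaceTime → Vec n)
    (z : SpaceTime) : ℝ :=
  ∑ α ∈ pairsUpTo m, ‖dPar Γ α u z‖ + ∑ b ∈ idxLt m, (‖c.principal (pdIter b u) z‖ + ‖pdIter b u z‖)

lemma controlSum_nonneg (Γ : BoundaryCurve) (m : ℕ) (c : Coeffs n) (u : SpaceTime → Vec n)
    (z : SpaceTime) : 0 ≤ controlSum Γ m c u z :=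
  add_nonneg (sum_nonneg fun _ _ => norm_nonneg _)
    (sum_nonneg fun _ _ => add_nonneg (norm_nonneg _) (norm_nonneg _))

lemma exists_coef_bound {a : MultiIdx → Plane → ℝ} (ha : ∀ β, Γ.IsTubeSmooth (a β))
    (s : Finset MultiIdx) : ∃ M, 0 ≤ M ∧ ∀ β ∈ s, ∀ x ∈ Γ.tube,
      |a β x| ≤ M ∧ ∀ j, |fderiv ℝ (a β) x (single j 1)| ≤ M := by
  choose M0 h0 h0' using fun β => (ha β).exists_bound
  choose M1 h1 h1' using fun β (j : Fin 2) => ((ha β).fderiv_apply (single j 1)).exists_bound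
  have hn : ∀ β, 0 ≤ M0 β + ∑ j, M1 β j := fun β => add_nonneg (h0 β) (sum_nonneg fun j _ => h1 β j)
  refine ⟨∑ β ∈ s, (M0 β + ∑ j, M1 β j), sum_nonneg fun β _ => hn β, fun β hβ x hx => ?_⟩
  have h2 := single_le_sum (f := fun β => M0 β + ∑ j, M1 β j) (fun β _ => hn β) hβ
  have h3 := sum_nonneg fun j (_ : j ∈ Finset.univ) => h1 β j
  refine ⟨by linarith [h0' β x hx], fun j => ?_⟩
  have h4 := single_le_sum (f := fun j => M1 β j) (fun j _ => h1 β j) (Finset.mem_univ j)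
  linarith [h1' β j x hx, h0 β]

/-- The operator applied to a combination of derivatives. -/
lemma norm_op_comb_le {O : Set Plane} (hO : IsOpen O) {a : MultiIdx → Plane → ℝ}
    (ha : ∀ β, ∀ x ∈ O, DifferentiableAt ℝ (a β) x) (hM0 : 0 ≤ M)
    (hM : ∀ β ∈ idx k, ∀ x ∈ O, |a β x| ≤ M ∧ ∀ j, |fderiv ℝ (a β) x (single j 1)| ≤ M)
    {u : SpaceTime → Vec n} (hu : ContDiff ℝ (k + 1 : ℕ) u)
    (hw : ∀ z : SpaceTime, z.2 ∈ O → w z = ∑ β ∈ idx k, a β z.2 • pdIter β u z) (hz : z.2 ∈ O)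
    (hA : ∀ j, ‖c.A j z‖ ≤ K₀) : ‖c.op w z‖ ≤ M * (1 + 2 * K₀) *
      ∑ b ∈ idx k, (‖c.op (pdIter b u) z‖ + ‖pdIter b u z‖) := by
  have hK : 0 ≤ K₀ := (norm_nonneg _).trans (hA 0)
  have hd : ∀ β ∈ idx k, DifferentiableAt ℝ (pdIter β u) z := fun β hβ =>
    ((pdIter_contDiff (k := 1) β (hu.of_le (by
      rw [mem_idx] at hβ; exact_mod_cast (by omega)))).differentiable (by simp)) z
  have h1 : w =ᶠ[𝓝 z] fun z => ∑ β ∈ idx k, a β z.2 • pdIter β u z :=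
    eventually_of_mem ((hO.preimage continuous_snd).mem_nhds hz) hw
  have h2 : ∀ i, pd i w z = ∑ β ∈ idx k,
      (fderiv ℝ (a β) z.2 (stDir i).2 • pdIter β u z + a β z.2 • pd i (pdIter β u) z) := fun i => by
    rw [pd, h1.fderiv_eq, fderiv_fun_sum fun β hβ =>
      (hasFDerivAt_space_smul (ha β z.2 hz) (hd β hβ) 0).1, _root_.sum_apply]
    exact sum_congr rfl fun β hβ => (hasFDerivAt_space_smul (ha β z.2 hz) (hd β hβ) _).2
  have h3 : c.op w z = ∑ β ∈ idx k, (a β z.2 • c.op (pdIter β u) z +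
      (fderiv ℝ (a β) z.2 (stDir 1).2 • c.A 0 z (pdIter β u z) +
        fderiv ℝ (a β) z.2 (stDir 2).2 • c.A 1 z (pdIter β u z))) := by
    simp only [Coeffs.op, h2, hw z hz, map_sum, map_add, map_smul, ← sum_add_distrib]
    refine sum_congr rfl fun β _ => ?_
    rw [show (stDir 0).2 = 0 from rfl, map_zero]
    module
  rw [h3, mul_sum]
  refine (norm_sum_le _ _).trans (sum_le_sum fun β hβ => ?_)
  have h4 := hM β hβ z.2 hz
  have h5 : ∀ j, ‖c.A j z (pdIter β u z)‖ ≤ K₀ * ‖pdIter β u z‖ := fun j =>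
    ((c.A j z).le_opNorm _).trans (by gcongr; exact hA j)
  have h6 : ∀ (r : ℝ) (v : Vec n) (Q : ℝ), |r| ≤ M → ‖v‖ ≤ Q → ‖r • v‖ ≤ M * Q := fun r v Q hr hv => by
    rw [norm_smul, norm_eq_abs]; gcongr
  have h7 := h6 _ _ _ h4.1 (le_refl ‖c.op (pdIter β u) z‖)
  have h8 := h6 _ _ _ (h4.2 0) (h5 0)
  have h9 := h6 _ _ _ (h4.2 1) (h5 1)
  have h10 := norm_nonneg (c.op (pdIter β u) z)
  have h11 := norm_nonneg (pdIter β u z)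
  refine (norm_add_le _ _).trans (((add_le_add h7 ((norm_add_le _ _).trans (add_le_add h8 h9)))).trans ?_)
  nlinarith [mul_nonneg hM0 h11, mul_nonneg (mul_nonneg hM0 hK) h10]

lemma sum_idx_le_controlSum (Γ : BoundaryCurve) (hk : k < m) (c : Coeffs n) (u : SpaceTime → Vec n)
    (z : SpaceTime) :
    ∑ b ∈ idx k, (‖c.principal (pdIter b u) z‖ + ‖pdIter b u z‖) ≤ controlSum Γ m c u z := by
  refine (Finset.sum_le_sum_of_subset_of_nonneg (t := idxLt m) (fun b hb => ?_)
    fun _ _ _ => add_nonneg (norm_nonneg _) (norm_nonneg _)).trans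
    (le_add_of_nonneg_left (sum_nonneg fun _ _ => norm_nonneg _))
  rw [mem_idx] at hb; rw [mem_idxLt]; omega

/-- The normal derivative is recovered from the principal part and the tangential derivatives. -/
lemma norm_normal_deriv_le (hz : z.2 ∈ Γ.tube) (hA : ∀ j, ‖c.A j z‖ ≤ K₀)
    (hM : ∀ i l, ∀ x ∈ Γ.tube, |frameCoef Γ i l x| ≤ M) (hN : IsUnit (c.Anor Γ z))
    (hN' : ‖Ring.inverse (c.Anor Γ z)‖ ≤ K₀) :
    ‖fderiv ℝ w z (frameDir Γ 1 z.2)‖ ≤ K₀ * (‖c.principal w z‖ +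
      ‖fderiv ℝ w z (frameDir Γ 0 z.2)‖ + 2 * (M * K₀) * ‖fderiv ℝ w z (frameDir Γ 2 z.2)‖) := by
  have hK : 0 ≤ K₀ := (norm_nonneg _).trans hN'
  have hM0 : 0 ≤ M := (abs_nonneg _).trans (hM 0 0 _ hz)
  set W := fun l => fderiv ℝ w z (frameDir Γ l z.2) with hW
  have h1 : ∀ i, pd i w z = ∑ l, frameCoef Γ i l z.2 • W l := fun i => by
    rw [pd, stDir_eq_frame hz i, map_sum]; simp only [map_smul, hW]
  have h0 : pd 0 w z = W 0 := rfl
  have hc : ∀ j : Fin 2, frameCoef Γ j.succ 0 z.2 = 0 ∧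
      frameCoef Γ j.succ 1 z.2 = Γ.normalField z.2 j := fun j => by
    fin_cases j <;> simp [frameCoef, stDir, EuclideanSpace.inner_single_right]
  have h2 : c.Anor Γ z (W 1) = c.principal w z - W 0 -
      (frameCoef Γ 1 2 z.2 • c.A 0 z (W 2) + frameCoef Γ 2 2 z.2 • c.A 1 z (W 2)) := by
    rw [Coeffs.principal_apply, h0, h1 1, h1 2, Fin.sum_univ_three, Fin.sum_univ_three]
    have e0 := hc 0; have e1 := hc 1
    simp only [Fin.succ_zero_eq_one, Fin.succ_one_eq_two] at e0 e1
    rw [e0.1, e0.2, e1.1, e1.2, Coeffs.Anor]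
    simp only [_root_.add_apply, _root_.smul_apply, map_add, map_smul, map_zero, zero_smul]
    module
  have h3 : W 1 = Ring.inverse (c.Anor Γ z) (c.Anor Γ z (W 1)) := by
    have := congrArg (fun F : Mat n => F (W 1)) (Ring.inverse_mul_cancel _ hN)
    simpa using this.symm
  rw [show fderiv ℝ w z (frameDir Γ 1 z.2) = W 1 from rfl, h3]
  refine (le_opNorm _ _).trans (mul_le_mul hN' ?_ (norm_nonneg _) hK)
  have h5 : ∀ (i : Fin 3) j, ‖frameCoef Γ i 2 z.2 • c.A j z (W 2)‖ ≤ M * K₀ * ‖W 2‖ := fun i j => by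
    rw [norm_smul, norm_eq_abs, mul_assoc]
    exact mul_le_mul (hM _ _ _ hz) (((c.A j z).le_opNorm _).trans (by gcongr; exact hA j))
      (norm_nonneg _) hM0
  rw [h2]
  have h6 := norm_sub_le (c.principal w z - W 0)
    (frameCoef Γ 1 2 z.2 • c.A 0 z (W 2) + frameCoef Γ 2 2 z.2 • c.A 1 z (W 2))
  have h7 := norm_sub_le (c.principal w z) (W 0)
  have h8 := norm_add_le (frameCoef Γ 1 2 z.2 • c.A 0 z (W 2)) (frameCoef Γ 2 2 z.2 • c.A 1 z (W 2))
  have h9 := h5 1 0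
  have h10 := h5 2 1
  linarith

/-- Near the boundary, all the derivatives of order at most `m` are controlled by the tangential
ones and by the principal parts of the derivatives of lower order. -/
theorem exists_normal_recovery (Γ : BoundaryCurve) (n m : ℕ) (K₀ : ℝ) : ∃ C, 0 ≤ C ∧
    ∀ (c : Coeffs n) (u : SpaceTime → Vec n) (z : SpaceTime), z.2 ∈ Γ.tube →
      (∀ j, ‖c.A j z‖ ≤ K₀) → IsUnit (c.Anor Γ z) → ‖Ring.inverse (c.Anor Γ z)‖ ≤ K₀ →
      ContDiff ℝ (m + 1 : ℕ) u → ∀ β : MultiIdx, β.len ≤ m →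
      ‖pdIter β u z‖ ≤ C * controlSum Γ m c u z := by
  have hM : ∃ M, 0 ≤ M ∧ ∀ i l, ∀ x ∈ Γ.tube, |frameCoef Γ i l x| ≤ M := by
    choose M h0 h1 using fun i l => (isTubeSmooth_frameCoef Γ i l).exists_bound
    refine ⟨∑ i, ∑ l, M i l, sum_nonneg fun i _ => sum_nonneg fun l _ => h0 i l,
      fun i l x hx => (h1 i l x hx).trans ?_⟩
    exact (single_le_sum (f := M i) (fun l _ => h0 i l) (Finset.mem_univ l)).trans
      (single_le_sum (f := fun i => ∑ l, M i l)
        (fun i _ => sum_nonneg fun l _ => h0 i l) (Finset.mem_univ i))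
  obtain ⟨M, hM0, hM⟩ := hM
  have key : ∀ (j : ℕ) (β : MultiIdx), β.2.1 = j → β.len ≤ m → ∃ C, 0 ≤ C ∧
      ∀ (c : Coeffs n) (u : SpaceTime → Vec n) (z : SpaceTime), z.2 ∈ Γ.tube →
      (∀ j, ‖c.A j z‖ ≤ K₀) → IsUnit (c.Anor Γ z) → ‖Ring.inverse (c.Anor Γ z)‖ ≤ K₀ →
      ContDiff ℝ (m + 1 : ℕ) u → ‖dFrame Γ β u z‖ ≤ C * controlSum Γ m c u z := by
    intro j
    induction j with
    | zero =>
      rintro ⟨a, b, i⟩ (rfl : b = 0) hl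
      refine ⟨1, zero_le_one, fun c u z hz _ _ _ _ => ?_⟩
      rw [one_mul, show dFrame Γ (a, 0, i) u z = dPar Γ (a, i) u z from rfl]
      refine (single_le_sum (f := fun α => ‖dPar Γ α u z‖) (fun _ _ => norm_nonneg _) ?_).trans
        (le_add_of_nonneg_right (sum_nonneg fun _ _ => add_nonneg (norm_nonneg _) (norm_nonneg _)))
      simp only [len] at hl
      simp only [pairsUpTo, mem_filter, mem_product, Finset.mem_range]; omega
    | succ j ih =>
      rintro ⟨a, b, i⟩ (rfl : b = j + 1) hl
      simp only [len] at hl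
      obtain ⟨C0, hC0, h0⟩ := ih (a + 1, j, i) rfl (by simp only [len]; omega)
      obtain ⟨C2, hC2, h2⟩ := ih (a, j, i + 1) rfl (by simp only [len]; omega)
      obtain ⟨q, hq, hrep⟩ := isComb_dFrame (V := Vec n) Γ (a, j, i)
      have hk : len (a, j, i) < m := by simp only [len]; omega
      obtain ⟨Q, hQ0, hQ⟩ := exists_coef_bound hq (idx (len (a, j, i)))
      refine ⟨|K₀| * (Q * (1 + 2 * |K₀|) + C0 + 2 * (M * |K₀|) * C2), by positivity,
        fun c u z hz hA hN hN' hu => ?_⟩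
      have hu' : ContDiff ℝ (len (a, j, i) + 1 : ℕ) u := hu.of_le (by exact_mod_cast (by omega))
      have h3 := norm_op_comb_le (c := { c with B := fun _ => 0 }) Γ.isOpen_tube
        (fun β x hx => (hq β).differentiableAt hx) hQ0 hQ hu'
        (hrep u (hu'.of_le (by exact_mod_cast le_succ _))) hz hA
      have h4 := norm_normal_deriv_le (w := dFrame Γ (a, j, i) u) hz hA hM hN hN'
      have e : ∀ l, fderiv ℝ (dFrame Γ (a, j, i) u) z (frameDir Γ l z.2) =
          dFrame Γ ((a, j, i) + unitIdx l) u z := fun l => fderiv_dFrame _ l hu' hz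
      rw [e, e, e] at h4
      have hK : 0 ≤ K₀ := (norm_nonneg _).trans hN'
      have h5 := h0 c u z hz hA hN hN' hu
      have h6 := h2 c u z hz hA hN hN' hu
      have h7 := sum_idx_le_controlSum Γ hk c u z
      rw [abs_of_nonneg hK]
      refine h4.trans ?_
      rw [mul_assoc K₀]
      refine mul_le_mul_of_nonneg_left ?_ hK
      have h8 : ‖c.principal (dFrame Γ (a, j, i) u) z‖ ≤ _ := h3.trans (mul_le_mul_of_nonneg_left h7 (by positivity))
      have h9 := mul_le_mul_of_nonneg_left h6 (by positivity : 0 ≤ 2 * (M * K₀))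
      have e1 : (a, j, i) + unitIdx 0 = (a + 1, j, i) := by simp [unitIdx]
      have e2 : (a, j, i) + unitIdx 2 = (a, j, i + 1) := by simp [unitIdx]
      rw [e1, e2]
      linarith
  choose! D hD0 hD using fun β (hl : β.len ≤ m) => key β.2.1 β rfl hl
  choose q hq hrep using fun β => isComb_pdIter (V := Vec n) Γ β
  choose Q hQ0 hQ using fun β => exists_coef_bound (hq β) (idx m)
  have hDn : ∀ β ∈ idx m, 0 ≤ D β := fun β hβ => hD0 β (mem_idx.1 hβ)
  refine ⟨∑ β ∈ idx m, Q β * ∑ γ ∈ idx m, D γ, sum_nonneg fun β _ => mul_nonneg (hQ0 β)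
    (sum_nonneg hDn), fun c u z hz hA hN hN' hu β hβ => ?_⟩
  have hB := controlSum_nonneg Γ m c u z
  have h1 : ‖pdIter β u z‖ ≤ (Q β * ∑ γ ∈ idx m, D γ) * controlSum Γ m c u z := by
    rw [hrep β u (hu.of_le (by exact_mod_cast (by omega))) z hz, mul_assoc, sum_mul, mul_sum]
    refine (norm_sum_le _ _).trans ((Finset.sum_le_sum_of_subset_of_nonneg (fun γ hγ => ?_)
      fun _ _ _ => norm_nonneg _).trans (sum_le_sum fun γ hγ => ?_))
    · rw [mem_idx] at *; omega
    · rw [norm_smul, norm_eq_abs]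
      exact mul_le_mul (hQ β γ hγ z.2 hz).1 (hD γ (mem_idx.1 hγ) c u z hz hA hN hN' hu)
        (norm_nonneg _) (hQ0 β)
  refine h1.trans (mul_le_mul_of_nonneg_right ?_ hB)
  exact single_le_sum (f := fun β => Q β * ∑ γ ∈ idx m, D γ)
    (fun β _ => mul_nonneg (hQ0 β) (sum_nonneg hDn)) (mem_idx.2 hβ)

end NormalRecovery

section ContInLpAlgebra

open scoped ENNReal

variable {D : Set Plane}

lemma eLpNorm_le_mul_sum {α ι W : Type*} [MeasurableSpace α] [NormedAddCommGroup W] {μ : Measure α}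
    {s : Finset ι} {f : α → V} {g : ι → α → W} {C : ℝ} (hg : ∀ i ∈ s, AEStronglyMeasurable (g i) μ)
    (h : ∀ᵐ x ∂μ, ‖f x‖ ≤ C * ∑ i ∈ s, ‖g i x‖) :
    eLpNorm f 2 μ ≤ ofReal C * ∑ i ∈ s, eLpNorm (g i) 2 μ := by
  have h1 : ∀ᵐ x ∂μ, ‖f x‖ ≤ C * ‖(∑ i ∈ s, fun x => ‖g i x‖) x‖ := h.mono fun x hx => by
    rwa [Finset.sum_apply, norm_of_nonneg (sum_nonneg fun _ _ => norm_nonneg _)]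
  refine (eLpNorm_le_mul_eLpNorm_of_ae_le_mul h1 2).trans (mul_le_mul_right ?_ _)
  refine (eLpNorm_sum_le (fun i hi => (hg i hi).norm) one_le_two).trans (le_of_eq ?_)
  simp only [eLpNorm_norm]

lemma lpNormOn_le_mul_sum {ι W : Type*} [NormedAddCommGroup W] (hD : MeasurableSet D) {s : Finset ι}
    {f : Plane → V} {g : ι → Plane → W} {C : ℝ} (hC : 0 ≤ C)
    (hg : ∀ i ∈ s, MemLp (g i) 2 (volume.restrict D)) (h : ∀ x ∈ D, ‖f x‖ ≤ C * ∑ i ∈ s, ‖g i x‖) :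
    lpNormOn D 2 f ≤ C * ∑ i ∈ s, lpNormOn D 2 (g i) := by
  have h1 := eLpNorm_le_mul_sum (fun i hi => (hg i hi).1) ((ae_restrict_iff' hD).2 (.of_forall h))
  have h2 : ∑ i ∈ s, eLpNorm (g i) 2 (volume.restrict D) ≠ ⊤ :=
    (ENNReal.sum_lt_top.2 fun i hi => (hg i hi).2).ne
  simp only [lpNormOn, ofReal_ofNat]
  rw [← ENNReal.toReal_sum fun i hi => (hg i hi).2.ne, ← ENNReal.toReal_ofReal hC,
    ← ENNReal.toReal_mul]
  exact toReal_mono (by finiteness) h1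

lemma contInLp_two_iff {g : SpaceTime → V} : ContInLp D T 2 g ↔ ∀ t ∈ Icc 0 T,
    MemLp (fun x => g (t, x)) 2 (volume.restrict D) ∧
    Tendsto (fun τ => eLpNorm (fun x => g (τ, x) - g (t, x)) 2 (volume.restrict D))
      (𝓝[Icc 0 T] t) (𝓝 0) := by
  simp only [ContInLp, ofReal_ofNat]

lemma ContInLp.add {f g : SpaceTime → V} (hf : ContInLp D T 2 f) (hg : ContInLp D T 2 g) :
    ContInLp D T 2 fun z => f z + g z := by
  rw [contInLp_two_iff] at *
  refine fun t ht => ⟨(hf t ht).1.add (hg t ht).1, ?_⟩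
  have h1 := (hf t ht).2.add (hg t ht).2
  rw [add_zero] at h1
  refine tendsto_of_tendsto_of_tendsto_of_le_of_le' tendsto_const_nhds h1
    (.of_forall fun _ => zero_le) ?_
  filter_upwards [self_mem_nhdsWithin] with τ hτ
  refine le_trans (le_of_eq ?_) (eLpNorm_add_le ((hf τ hτ).1.sub (hf t ht).1).1
    ((hg τ hτ).1.sub (hg t ht).1).1 one_le_two)
  congr 1; funext x; simp only [Pi.add_apply]; abel

lemma ContInLp.zero : ContInLp D T 2 fun _ => (0 : V) := by
  rw [contInLp_two_iff]; intro t _; simpa using tendsto_const_nhds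

lemma ContInLp.sum {ι : Type*} {s : Finset ι} {f : ι → SpaceTime → V}
    (hf : ∀ i ∈ s, ContInLp D T 2 (f i)) : ContInLp D T 2 fun z => ∑ i ∈ s, f i z := by
  classical
  induction s using Finset.induction_on with
  | empty => simpa using ContInLp.zero
  | insert i s hi ih =>
    simp only [Finset.sum_insert hi]
    exact (hf i (by simp)).add (ih fun j hj => hf j (by simp [hj]))

lemma ContInLp.congr (hD : MeasurableSet D) {f g : SpaceTime → V} (hf : ContInLp D T 2 f)
    (h : ∀ t ∈ Icc 0 T, ∀ x ∈ D, g (t, x) = f (t, x)) : ContInLp D T 2 g := by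
  rw [contInLp_two_iff] at *
  have hae : ∀ t ∈ Icc 0 T, ∀ᵐ x ∂volume.restrict D, g (t, x) = f (t, x) := fun t ht =>
    (ae_restrict_iff' hD).2 (.of_forall (h t ht))
  refine fun t ht => ⟨(hf t ht).1.ae_eq ((hae t ht).mono fun x hx => hx.symm),
    (hf t ht).2.congr' ?_⟩
  filter_upwards [self_mem_nhdsWithin] with τ hτ
  refine eLpNorm_congr_ae ?_
  filter_upwards [hae t ht, hae τ hτ] with x h1 h2
  rw [h1, h2]

lemma ContInLp.smul_bounded (hD : MeasurableSet D) {f : SpaceTime → V} (hf : ContInLp D T 2 f)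
    (hg : AEStronglyMeasurable g (volume.restrict D)) (hM : ∀ x ∈ D, |g x| ≤ M) :
    ContInLp D T 2 fun z => g z.2 • f z := by
  rw [contInLp_two_iff] at *
  have hM' : ∀ v : Plane → V, ∀ᵐ x ∂volume.restrict D, ‖g x • v x‖ ≤ M * ‖v x‖ := fun v =>
    (ae_restrict_iff' hD).2 (.of_forall fun x hx => by
      rw [norm_smul]; exact mul_le_mul_of_nonneg_right (hM x hx) (norm_nonneg _))
  refine fun t ht => ⟨(hf t ht).1.of_le_mul (hg.smul (hf t ht).1.1) (hM' _), ?_⟩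
  have h1 := ENNReal.Tendsto.const_mul (a := ofReal M) (hf t ht).2 (Or.inr ofReal_ne_top)
  rw [mul_zero] at h1
  refine tendsto_of_tendsto_of_tendsto_of_le_of_le tendsto_const_nhds h1 (fun _ => zero_le)
    fun τ => ?_
  refine le_trans (le_of_eq ?_) (eLpNorm_le_mul_eLpNorm_of_ae_le_mul (hM' _) 2)
  simp only [smul_sub]

/-- Multiplication by bounded continuous matrices. -/
lemma ContInLp.clm_apply (hD : MeasurableSet D) (hf : ContInLp D T 2 f) {A : SpaceTime → Mat n}
    (hA : ContinuousOn A (Icc 0 T ×ˢ D)) (hM : ∀ z ∈ Icc 0 T ×ˢ D, ‖A z‖ ≤ M) :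
    ContInLp D T 2 fun z => A z (f z) := by
  rw [contInLp_two_iff] at *
  have hAm : ∀ t ∈ Icc 0 T, AEStronglyMeasurable (fun x => A (t, x)) (volume.restrict D) :=
    fun t ht => (hA.comp (f := fun x => (t, x)) (by fun_prop)
      fun x hx => ⟨ht, hx⟩).aestronglyMeasurable hD
  have hMae : ∀ t ∈ Icc 0 T, ∀ᵐ x ∂volume.restrict D, ‖A (t, x)‖ ≤ M := fun t ht =>
    (ae_restrict_iff' hD).2 (.of_forall fun x hx => hM _ ⟨ht, hx⟩)
  have hle : ∀ {B : Mat n} {M : ℝ} (v : Vec n), ‖B‖ ≤ M → ‖B v‖ ≤ M * ‖v‖ := fun v h =>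
    (le_opNorm _ _).trans (by gcongr)
  intro t ht
  refine ⟨(hf t ht).1.of_le_mul (aestronglyMeasurable_clm_apply (hAm t ht) (hf t ht).1.1)
    ((hMae t ht).mono fun x hx => hle _ hx), ?_⟩
  have h1 := ENNReal.Tendsto.const_mul (a := ofReal M) (hf t ht).2 (Or.inr ofReal_ne_top)
  rw [mul_zero] at h1
  have hdiff : ∀ τ ∈ Icc 0 T, AEStronglyMeasurable
      (fun x => (A (τ, x) - A (t, x)) (f (t, x))) (volume.restrict D) := fun τ hτ =>
    aestronglyMeasurable_clm_apply ((hAm τ hτ).sub (hAm t ht)) (hf t ht).1.1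
  have hdm : ∀ τ ∈ Icc 0 T, ∀ᵐ x ∂volume.restrict D,
      ‖(A (τ, x) - A (t, x)) (f (t, x))‖ ≤ 2 * M * ‖f (t, x)‖ := fun τ hτ => by
    filter_upwards [hMae t ht, hMae τ hτ] with x h3 h4
    exact hle _ ((norm_sub_le _ _).trans (by linarith))
  have h2 : Tendsto (fun τ => ∫ x in D, ‖(A (τ, x) - A (t, x)) (f (t, x))‖ ^ 2)
      (𝓝[Icc 0 T] t) (𝓝 (∫ _ in D, 0)) := by
    refine tendsto_integral_filter_of_dominated_convergence
      (fun x => (2 * M * ‖f (t, x)‖) ^ 2) ?_ ?_ ?_ ?_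
    · filter_upwards [self_mem_nhdsWithin] with τ hτ using (hdiff τ hτ).norm.pow 2
    · filter_upwards [self_mem_nhdsWithin] with τ hτ
      filter_upwards [hdm τ hτ] with x h3
      rw [norm_pow, norm_norm]; gcongr
    · simp only [mul_pow]
      exact ((hf t ht).1.integrable_norm_pow (by norm_num)).const_mul _
    · refine (ae_restrict_iff' hD).2 (.of_forall fun x hx => ?_)
      have h3 : ContinuousWithinAt (fun τ => A (τ, x)) (Icc 0 T) t :=
        (hA (t, x) ⟨ht, hx⟩).comp (f := fun τ => (τ, x)) (by fun_prop) fun τ hτ => ⟨hτ, hx⟩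
      have h4 := (((h3.sub (continuousWithinAt_const (b := A (t, x)))).clm_apply
        (continuousWithinAt_const (b := f (t, x)))).norm.pow 2).tendsto
      simpa [Pi.pow_def] using h4
  have h3 : Tendsto (fun τ => eLpNorm (fun x => (A (τ, x) - A (t, x)) (f (t, x))) 2
      (volume.restrict D)) (𝓝[Icc 0 T] t) (𝓝 0) := by
    rw [integral_zero] at h2
    have h4 := (ENNReal.continuous_ofReal.tendsto _).comp ((Real.continuous_sqrt.tendsto _).comp h2)
    rw [Real.sqrt_zero, ENNReal.ofReal_zero] at h4
    refine h4.congr' ?_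
    filter_upwards [self_mem_nhdsWithin] with τ hτ
    have hmem := (hf t ht).1.of_le_mul (hdiff τ hτ) (hdm τ hτ)
    simp only [Function.comp_apply]
    rw [← lpNormOn_two_sq hmem, Real.sqrt_sq (lpNormOn_nonneg _ _ _),
      ofReal_lpNormOn (memLp_two_iff.2 hmem), ofReal_ofNat]
  have h4 := h1.add h3
  rw [add_zero] at h4
  refine tendsto_of_tendsto_of_tendsto_of_le_of_le' tendsto_const_nhds h4
    (.of_forall fun _ => zero_le) ?_
  filter_upwards [self_mem_nhdsWithin] with τ hτ
  have h5 : ∀ᵐ x ∂volume.restrict D, ‖A (τ, x) (f (τ, x) - f (t, x))‖ ≤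
      M * ‖f (τ, x) - f (t, x)‖ := (hMae τ hτ).mono fun x hx => hle _ hx
  refine le_trans ?_ (add_le_add_left (eLpNorm_le_mul_eLpNorm_of_ae_le_mul h5 2) _)
  refine le_trans (le_of_eq ?_) (eLpNorm_add_le (aestronglyMeasurable_clm_apply (hAm τ hτ)
    ((hf τ hτ).1.sub (hf t ht).1).1) (hdiff τ hτ) one_le_two)
  congr 1; funext x; simp

/-- The norms `|||·|||_m` and the norms of the derivatives. -/
lemma jetNorm_le_sum (m : ℕ) (J : Jet V) (t : ℝ) :
    jetNorm D m 2 J t ≤ ∑ β ∈ idx m, lpNormOn D 2 fun x => J β (t, x) := by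
  have h1 : ∀ j ∈ Finset.range (m + 1),
      (∑ b ∈ pairsUpTo (m - j), lpNormOn D 2 (fun x => J (j, b) (t, x)) ^ (2 : ℝ)) ^ (1 / 2 : ℝ) ≤
        ∑ b ∈ pairsUpTo (m - j), lpNormOn D 2 fun x => J (j, b) (t, x) := fun j _ => by
    have h0 : ∀ b ∈ pairsUpTo (m - j), 0 ≤ lpNormOn D 2 fun x => J (j, b) (t, x) :=
      fun b _ => lpNormOn_nonneg _ _ _
    rw [← Real.sqrt_eq_rpow]
    refine Real.sqrt_le_iff.2 ⟨sum_nonneg h0, ?_⟩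
    simp only [Real.rpow_two]
    exact Finset.sum_sq_le_sq_sum_of_nonneg h0
  refine (sum_le_sum h1).trans (le_of_eq ?_)
  rw [Finset.sum_sigma']
  refine Finset.sum_bij (fun q _ => (q.1, q.2)) ?_ ?_ ?_ ?_
  · rintro ⟨j, a, b⟩ hq
    simp only [Finset.mem_sigma, Finset.mem_range, pairsUpTo, mem_filter, mem_product] at hq
    rw [mem_idx]; simp only [len]; omega
  · rintro ⟨j, a, b⟩ _ ⟨j', a', b'⟩ _ h
    simp only [Prod.mk.injEq] at h
    obtain ⟨rfl, rfl, rfl⟩ := h; rfl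
  · rintro ⟨j, a, b⟩ hq
    rw [mem_idx] at hq; simp only [len] at hq
    refine ⟨⟨j, a, b⟩, ?_, rfl⟩
    simp only [Finset.mem_sigma, Finset.mem_range, pairsUpTo, mem_filter, mem_product]; omega
  · intro q _; rfl

lemma jetNorm_nonneg (m : ℕ) (J : Jet V) (t : ℝ) : 0 ≤ jetNorm D m 2 J t :=
  sum_nonneg fun _ _ => rpow_nonneg (sum_nonneg fun _ _ => rpow_nonneg (lpNormOn_nonneg _ _ _) _) _

lemma continuousOn_jetNorm {J : Jet V}
    (hJ : ∀ β : MultiIdx, β.len ≤ m → ContInLp D T 2 (J β)) :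
    ContinuousOn (jetNorm D m 2 J) (Icc 0 T) := by
  refine continuousOn_finsetSum _ fun j hj => ContinuousOn.rpow_const
    (continuousOn_finsetSum _ fun b hb => ContinuousOn.rpow_const
      ((hJ (j, b) ?_).continuousOn_norm (by norm_num)) fun _ _ => Or.inr (by norm_num))
    fun _ _ => Or.inr (by norm_num)
  simp only [Finset.mem_range, pairsUpTo, mem_filter, mem_product] at hj hb
  simp only [len]; omega

end ContInLpAlgebra

section WeightedNorms

/-- The weighted energy `e^{-2 λ τ} φ(τ)² + λ ∫₀^τ e^{-2 λ s} φ(s)² ds`. -/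
noncomputable def energyQ (lam : ℝ) (φ : ℝ → ℝ) (τ : ℝ) : ℝ :=
  exp (-2 * lam * τ) * φ τ ^ 2 + lam * ∫ s in (0)..τ, exp (-2 * lam * s) * φ s ^ 2

variable {φ : ℝ → ℝ}

lemma integral_exp_sq_nonneg (lam : ℝ) (φ : ℝ → ℝ) (ht : 0 ≤ t) :
    0 ≤ ∫ s in (0)..t, exp (-2 * lam * s) * φ s ^ 2 :=
  intervalIntegral.integral_nonneg ht fun s _ => by positivity

lemma exp_mul_sq (lam τ x : ℝ) : (exp (-lam * τ) * |x|) ^ 2 = exp (-2 * lam * τ) * x ^ 2 := by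
  rw [mul_pow, sq_abs, ← Real.exp_nat_mul]; congr 2; push_cast; ring

lemma weightedI_sq_le {R : ℝ} (hl : 0 ≤ lam) (ht : 0 ≤ t) (hR : ∀ τ ∈ Icc 0 t, energyQ lam φ τ ≤ R) :
    weightedI lam t φ ^ 2 ≤ 4 * R := by
  have h1 : ∀ τ ∈ Icc 0 t, exp (-2 * lam * τ) * φ τ ^ 2 ≤ R := fun τ hτ => by
    have := mul_nonneg hl (integral_exp_sq_nonneg lam φ hτ.1)
    have := hR τ hτ
    unfold energyQ at this; linarith
  have hR0 : 0 ≤ R := le_trans (by positivity) (h1 0 ⟨le_rfl, ht⟩)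
  have h2 : sSup ((fun τ => exp (-lam * τ) * |φ τ|) '' Icc 0 t) ≤ √R := by
    refine csSup_le ((nonempty_Icc.2 ht).image _) ?_
    rintro _ ⟨τ, hτ, rfl⟩
    exact Real.le_sqrt_of_sq_le ((exp_mul_sq _ _ _).le.trans (h1 τ hτ))
  have h3 : √lam * √(∫ τ in (0)..t, exp (-2 * lam * τ) * φ τ ^ 2) ≤ √R := by
    rw [← Real.sqrt_mul hl]
    refine Real.sqrt_le_sqrt ?_
    have := hR t ⟨ht, le_rfl⟩
    unfold energyQ at this
    have h4 : 0 ≤ exp (-2 * lam * t) * φ t ^ 2 := by positivity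
    linarith
  have h4 : 0 ≤ sSup ((fun τ => exp (-lam * τ) * |φ τ|) '' Icc 0 t) := by
    refine Real.sSup_nonneg ?_
    rintro _ ⟨τ, _, rfl⟩; positivity
  calc weightedI lam t φ ^ 2 ≤ (√R + √R) ^ 2 := by
        unfold weightedI
        exact pow_le_pow_left₀ (by positivity) (add_le_add h2 h3) 2
    _ = 4 * R := by nlinarith [Real.sq_sqrt hR0]

lemma weightedI_nonneg (lam t : ℝ) (φ : ℝ → ℝ) : 0 ≤ weightedI lam t φ := by
  have h4 : 0 ≤ sSup ((fun τ => exp (-lam * τ) * |φ τ|) '' Icc 0 t) := by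
    refine Real.sSup_nonneg ?_
    rintro _ ⟨τ, _, rfl⟩; positivity
  unfold weightedI; positivity

lemma bddAbove_weight (hφ : ContinuousOn φ (Icc 0 t)) :
    BddAbove ((fun τ => exp (-lam * τ) * |φ τ|) '' Icc 0 t) :=
  isCompact_Icc.bddAbove_image ((by fun_prop : Continuous fun τ => exp (-lam * τ)).continuousOn.mul
    hφ.abs)

lemma continuousOn_exp_mul {g : ℝ → ℝ} (lam : ℝ) (hg : ContinuousOn g (Icc 0 t)) :
    ContinuousOn (fun s => exp (-2 * lam * s) * g s) (Icc 0 t) :=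
  (by fun_prop : Continuous fun s => exp (-2 * lam * s)).continuousOn.mul hg

lemma intervalIntegrable_exp_mul {g : ℝ → ℝ} (lam : ℝ) (hg : ContinuousOn g (Icc 0 t))
    (hτ : τ ∈ Icc 0 t) : IntervalIntegrable (fun s => exp (-2 * lam * s) * g s) volume 0 τ :=
  ((continuousOn_exp_mul lam hg).mono (by
    rw [uIcc_of_le hτ.1]; exact Icc_subset_Icc_right hτ.2)).intervalIntegrable

lemma integral_exp_mul_mono {g : ℝ → ℝ} (lam : ℝ) (hg : ContinuousOn g (Icc 0 t))
    (hg0 : ∀ s ∈ Icc 0 t, 0 ≤ g s) (hτ : τ ∈ Icc 0 t) :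
    ∫ s in (0)..τ, exp (-2 * lam * s) * g s ≤ ∫ s in (0)..t, exp (-2 * lam * s) * g s := by
  refine intervalIntegral.integral_mono_interval le_rfl hτ.1 hτ.2 ?_
    (intervalIntegrable_exp_mul lam hg ⟨hτ.1.trans hτ.2, le_rfl⟩)
  refine (ae_restrict_iff' measurableSet_Ioc).2 (.of_forall fun s hs => ?_)
  have := hg0 s (Ioc_subset_Icc_self hs)
  simp only [Pi.zero_apply]; positivity

lemma weightedI_mono (hφ : ContinuousOn φ (Icc 0 t)) (hτ : τ ∈ Icc 0 t) :
    weightedI lam τ φ ≤ weightedI lam t φ := by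
  unfold weightedI
  refine add_le_add (csSup_le_csSup (bddAbove_weight hφ) ((nonempty_Icc.2 hτ.1).image _)
    (image_mono (Icc_subset_Icc_right hτ.2))) ?_
  gcongr
  exact integral_exp_mul_mono lam (hφ.pow 2) (fun s _ => sq_nonneg _) hτ

lemma exp_mul_abs_le_weightedI (hφ : BddAbove ((fun τ => exp (-lam * τ) * |φ τ|) '' Icc 0 t))
    (hτ : τ ∈ Icc 0 t) : exp (-lam * τ) * |φ τ| ≤ weightedI lam t φ :=
  (le_csSup hφ (mem_image_of_mem _ hτ)).trans (le_add_of_nonneg_right (by positivity))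

lemma lam_mul_integral_le (hl : 0 ≤ lam) (ht : 0 ≤ t) :
    lam * ∫ s in (0)..t, exp (-2 * lam * s) * φ s ^ 2 ≤ weightedI lam t φ ^ 2 := by
  have h4 : 0 ≤ sSup ((fun τ => exp (-lam * τ) * |φ τ|) '' Icc 0 t) := by
    refine Real.sSup_nonneg ?_
    rintro _ ⟨τ, _, rfl⟩; positivity
  calc lam * ∫ s in (0)..t, exp (-2 * lam * s) * φ s ^ 2
      = (√lam * √(∫ τ in (0)..t, exp (-2 * lam * τ) * φ τ ^ 2)) ^ 2 := by
        rw [mul_pow, Real.sq_sqrt hl, Real.sq_sqrt (integral_exp_sq_nonneg lam φ ht)]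
    _ ≤ _ := pow_le_pow_left₀ (by positivity) (by unfold weightedI; linarith) 2

/-- The duality between `S*` and `I`. -/
lemma integral_le_dualS_mul {g : ℝ → ℝ} (hl : 0 ≤ lam) (ht : 0 ≤ t) (hg : ContinuousOn g (Icc 0 t))
    (hφ : ContinuousOn φ (Icc 0 t)) :
    ∫ s in (0)..t, exp (-2 * lam * s) * (g s * φ s) ≤ dualS lam t g * weightedI lam t φ := by
  set a := weightedI lam t φ with ha
  have ha0 : 0 ≤ a := weightedI_nonneg _ _ _
  rcases ha0.eq_or_lt with h0 | hpos
  · rw [← h0, mul_zero]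
    refine le_of_eq (intervalIntegral.integral_zero_ae (.of_forall fun s hs => ?_))
    rw [uIoc_of_le ht] at hs
    have h1 := exp_mul_abs_le_weightedI (lam := lam) (bddAbove_weight hφ) (Ioc_subset_Icc_self hs)
    rw [← ha, ← h0] at h1
    have h2 : |φ s| ≤ 0 := by
      by_contra hcon
      have := mul_pos (exp_pos (-lam * s)) (not_le.1 hcon)
      linarith
    rw [abs_nonpos_iff.1 h2]; ring
  set ψ : ℝ → ℝ := fun s => a⁻¹ * IccExtend ht ((Icc 0 t).domRestrict φ) s with hψ
  have hψc : Continuous ψ := continuous_const.mul (ContinuousOn.domRestrict hφ).Icc_extend'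
  have hψe : ∀ s ∈ Icc 0 t, ψ s = a⁻¹ * φ s := fun s hs => by
    simp [hψ, IccExtend_of_mem ht _ hs, domRestrict]
  have h1 : weightedI lam t ψ ≤ 1 := by
    have e1 : sSup ((fun τ => exp (-lam * τ) * |ψ τ|) '' Icc 0 t) ≤
        a⁻¹ * sSup ((fun τ => exp (-lam * τ) * |φ τ|) '' Icc 0 t) := by
      refine csSup_le ((nonempty_Icc.2 ht).image _) ?_
      rintro _ ⟨τ, hτ, rfl⟩
      have := mul_le_mul_of_nonneg_left
        (le_csSup (bddAbove_weight (lam := lam) hφ) (mem_image_of_mem _ hτ)) (inv_nonneg.2 ha0)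
      simp only [hψe τ hτ, abs_mul, abs_of_nonneg (inv_nonneg.2 ha0)]
      linarith
    have e2 : ∫ τ in (0)..t, exp (-2 * lam * τ) * ψ τ ^ 2 =
        a⁻¹ ^ 2 * ∫ τ in (0)..t, exp (-2 * lam * τ) * φ τ ^ 2 := by
      rw [← intervalIntegral.integral_const_mul]
      refine integral_congr fun s hs => ?_
      rw [uIcc_of_le ht] at hs
      simp only [hψe s hs]; ring
    rw [weightedI, e2, Real.sqrt_mul (by positivity), Real.sqrt_sq (by positivity)]
    calc _ ≤ a⁻¹ * weightedI lam t φ := by unfold weightedI; nlinarith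
      _ = 1 := by rw [← ha, inv_mul_cancel₀ hpos.ne']
  have hbdd : BddAbove {y | ∃ φ : ℝ → ℝ, Measurable φ ∧
      BddAbove ((fun τ => exp (-lam * τ) * |φ τ|) '' Icc 0 t) ∧ weightedI lam t φ ≤ 1 ∧
      y = |∫ τ in (0)..t, exp (-2 * lam * τ) * g τ * φ τ|} := by
    obtain ⟨M, hM⟩ := isCompact_Icc.exists_bound_of_continuousOn hg
    refine ⟨M * |t - 0|, ?_⟩
    rintro _ ⟨φ, -, hb, h1, rfl⟩
    rw [← norm_eq_abs]
    refine intervalIntegral.norm_integral_le_of_norm_le_const fun s hs => ?_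
    rw [uIoc_of_le ht] at hs
    have hs' := Ioc_subset_Icc_self hs
    have h2 := (exp_mul_abs_le_weightedI hb hs').trans h1
    have h3 : exp (-lam * s) ≤ 1 := Real.exp_le_one_iff.2 (by nlinarith [hs'.1])
    have h4 := hM s hs'
    rw [norm_eq_abs] at h4
    have h6 : 0 ≤ M := (abs_nonneg _).trans h4
    have h5 : exp (-2 * lam * s) = exp (-lam * s) * exp (-lam * s) := by
      rw [← Real.exp_add]; congr 1; ring
    rw [norm_eq_abs, abs_mul, abs_mul, abs_of_pos (exp_pos _), h5]
    calc exp (-lam * s) * exp (-lam * s) * |g s| * |φ s|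
        = exp (-lam * s) * |g s| * (exp (-lam * s) * |φ s|) := by ring
      _ ≤ 1 * M * 1 := by gcongr
      _ = M := by ring
  have h2 : |∫ τ in (0)..t, exp (-2 * lam * τ) * g τ * ψ τ| ≤ dualS lam t g :=
    le_csSup hbdd ⟨ψ, hψc.measurable, bddAbove_weight hψc.continuousOn, h1, rfl⟩
  have h3 : ∫ s in (0)..t, exp (-2 * lam * s) * (g s * φ s) =
      a * ∫ τ in (0)..t, exp (-2 * lam * τ) * g τ * ψ τ := by
    rw [← intervalIntegral.integral_const_mul]
    refine integral_congr fun s hs => ?_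
    rw [uIcc_of_le ht] at hs
    simp only [hψe s hs]; field_simp
  rw [h3, mul_comm]
  exact mul_le_mul_of_nonneg_right ((le_abs_self _).trans h2) ha0

lemma exists_energyQ_max (lam : ℝ) (ht : 0 ≤ t) (hφ : ContinuousOn φ (Icc 0 t)) :
    ∃ τ ∈ Icc 0 t, ∀ s ∈ Icc 0 t, energyQ lam φ s ≤ energyQ lam φ τ := by
  have h1 : ContinuousOn (energyQ lam φ) (Icc 0 t) := by
    refine (continuousOn_exp_mul lam (hφ.pow 2)).add (continuousOn_const.mul ?_)
    have := intervalIntegral.continuousOn_primitive_interval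
      (f := fun s => exp (-2 * lam * s) * φ s ^ 2) (μ := volume) (a := 0) (b := t) (by
        rw [uIcc_of_le ht]; exact (continuousOn_exp_mul lam (hφ.pow 2)).integrableOn_Icc)
    rwa [uIcc_of_le ht] at this
  obtain ⟨τ, hτ, h⟩ := isCompact_Icc.exists_isMaxOn (nonempty_Icc.2 ht) h1
  exact ⟨τ, hτ, fun s hs => h hs⟩

lemma energyQ_le_sum {ι : Type*} {s : Finset ι} {a : ι → ℝ} {ψ : ι → ℝ → ℝ} (hl : 0 ≤ lam)
    (hφ : ContinuousOn φ (Icc 0 t)) (hψ : ∀ i ∈ s, ContinuousOn (ψ i) (Icc 0 t))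
    (h : ∀ τ ∈ Icc 0 t, φ τ ^ 2 ≤ ∑ i ∈ s, a i * ψ i τ ^ 2) (hτ : τ ∈ Icc 0 t) :
    energyQ lam φ τ ≤ ∑ i ∈ s, a i * energyQ lam (ψ i) τ := by
  have h1 : ∀ σ ∈ Icc 0 t, exp (-2 * lam * σ) * φ σ ^ 2 ≤
      ∑ i ∈ s, a i * (exp (-2 * lam * σ) * ψ i σ ^ 2) := fun σ hσ => by
    have := mul_le_mul_of_nonneg_left (h σ hσ) (exp_pos (-2 * lam * σ)).le
    rw [mul_sum] at this
    refine this.trans (le_of_eq (sum_congr rfl fun i _ => by ring))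
  have hi : ∀ i ∈ s, IntervalIntegrable
      (fun σ => a i * (exp (-2 * lam * σ) * ψ i σ ^ 2)) volume 0 τ := fun i hi =>
    (intervalIntegrable_exp_mul lam ((hψ i hi).pow 2) hτ).const_mul _
  have h2 : ∫ σ in (0)..τ, exp (-2 * lam * σ) * φ σ ^ 2 ≤
      ∑ i ∈ s, a i * ∫ σ in (0)..τ, exp (-2 * lam * σ) * ψ i σ ^ 2 := by
    simp only [← intervalIntegral.integral_const_mul]
    rw [← intervalIntegral.integral_finsetSum hi]
    refine integral_mono_on hτ.1 (intervalIntegrable_exp_mul lam (hφ.pow 2) hτ) ?_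
      fun σ hσ => h1 σ ⟨hσ.1, hσ.2.trans hτ.2⟩
    have := IntervalIntegrable.sum s hi
    simpa [Finset.sum_fn] using this
  unfold energyQ
  refine (add_le_add (h1 τ hτ) (mul_le_mul_of_nonneg_left h2 hl)).trans (le_of_eq ?_)
  rw [mul_sum, ← sum_add_distrib]
  exact sum_congr rfl fun i _ => by ring

end WeightedNorms

namespace Coeffs

/-- The energy estimate in weighted form, for a source bounded by `a F + b X` and a solution
bounded by `d X`. -/
theorem weighted_energy_estimate (hT : 0 < T) (hs : c.IsSmooth Γ T)
    (hf : c.IsFriedrichs Γ T α₀ β₀ β₁) (hA : ∀ j, ∀ z ∈ Γ.cyl T, ‖c.A j z‖ ≤ K₀) (hK₀ : 0 ≤ K₀)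
    (hβ : β₁ ≤ α₀ * K) (hw : ContDiffOn ℝ 1 w (Γ.cyl T))
    (hwc : ContinuousOn w (Icc 0 T ×ˢ closure Γ.ext)) (hwL : ContInLp Γ.ext T 2 w) {F X : ℝ → ℝ}
    {a b d : ℝ} (ha : 0 ≤ a) (hb : 0 ≤ b) (hF : ContinuousOn F (Icc 0 T))
    (hX : ContinuousOn X (Icc 0 T)) (hF0 : ∀ t, 0 ≤ F t) (hX0 : ∀ t, 0 ≤ X t)
    (hop : ∀ᵐ t ∂time[T], eLpNorm (fun x => c.op w (t, x)) 2 vol[Γ] ≤ ofReal (a * F t + b * X t))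
    (hN : ∀ t ∈ Icc 0 T, lpNormOn Γ.ext 2 (fun x => w (t, x)) ≤ d * X t) (hlam : K ≤ lam)
    (hl0 : 0 ≤ lam) (ht : t ∈ Icc 0 T) (hτ : τ ∈ Icc 0 t) :
    α₀ * energyQ lam extNorm[Γ, w] τ ≤ β₀ * (d ^ 2 * X 0 ^ 2 +
        2 * d * (a * (∫ s in (0)..t, exp (-2 * lam * s) * (F s * X s)) +
          b * ∫ s in (0)..t, exp (-2 * lam * s) * X s ^ 2)) +
      ∫ s in (0)..τ, exp (-2 * lam * s) * c.bdryTerm Γ w s := by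
  have hβ0 := hf.β₀_pos
  set N : ℝ → ℝ := fun t => lpNormOn Γ.ext 2 (fun x => w (t, x)) with hNdef
  have hNc : ContinuousOn N (Icc 0 T) := hwL.continuousOn_norm (by norm_num)
  have hN0 : ∀ t, 0 ≤ N t := fun t => lpNormOn_nonneg _ _ _
  set G : ℝ → ℝ := fun t => a * F t + b * X t with hGdef
  have hG : ContinuousOn G (Icc 0 T) := (continuousOn_const.mul hF).add (continuousOn_const.mul hX)
  have hG0 : ∀ t, 0 ≤ G t := fun t => add_nonneg (mul_nonneg ha (hF0 t)) (mul_nonneg hb (hX0 t))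
  have hτT : τ ∈ Icc 0 T := ⟨hτ.1, hτ.2.trans ht.2⟩
  have hmain := energy_estimate hT hs hf hA hK₀ hβ hw hwc hwL hG hG0 hop hlam hl0 hτT
  have i1 := intervalIntegrable_exp_mul lam (continuousOn_bdryTerm hT hs hwc) hτT
  have hN2 : ContinuousOn (fun s => N s ^ 2) (Icc 0 T) := hNc.pow 2
  have hGN : ContinuousOn (fun s => G s * N s) (Icc 0 T) := hG.mul hNc
  have i2 := intervalIntegrable_exp_mul lam hN2 hτT
  have i3 := intervalIntegrable_exp_mul lam hGN hτT
  have e1 : ∫ s in (0)..τ, exp (-2 * lam * s) * (c.bdryTerm Γ w s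
        - lam * α₀ * N s ^ 2 + 2 * β₀ * (G s * N s)) =
      (∫ s in (0)..τ, exp (-2 * lam * s) * c.bdryTerm Γ w s) -
        lam * α₀ * (∫ s in (0)..τ, exp (-2 * lam * s) * N s ^ 2) +
        2 * β₀ * ∫ s in (0)..τ, exp (-2 * lam * s) * (G s * N s) := by
    rw [← intervalIntegral.integral_const_mul, ← intervalIntegral.integral_const_mul,
      ← intervalIntegral.integral_sub i1 (i2.const_mul _),
      ← intervalIntegral.integral_add (i1.sub (i2.const_mul _)) (i3.const_mul _)]
    exact integral_congr fun s _ => by ring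
  have htsub : Icc 0 t ⊆ Icc 0 T := Icc_subset_Icc_right ht.2
  have hFX : ContinuousOn (fun s => F s * X s) (Icc 0 t) := (hF.mul hX).mono htsub
  have hXX : ContinuousOn (fun s => X s ^ 2) (Icc 0 t) := (hX.pow 2).mono htsub
  have ht0 : t ∈ Icc 0 t := ⟨ht.1, le_rfl⟩
  have e2 : ∫ s in (0)..τ, exp (-2 * lam * s) * (G s * N s) ≤
      d * (a * (∫ s in (0)..t, exp (-2 * lam * s) * (F s * X s)) +
        b * ∫ s in (0)..t, exp (-2 * lam * s) * X s ^ 2) := by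
    refine (integral_exp_mul_mono lam (hGN.mono htsub)
      (fun s _ => mul_nonneg (hG0 s) (hN0 s)) hτ).trans ?_
    rw [← intervalIntegral.integral_const_mul, ← intervalIntegral.integral_const_mul,
      ← intervalIntegral.integral_add ((intervalIntegrable_exp_mul lam hFX ht0).const_mul _)
      ((intervalIntegrable_exp_mul lam hXX ht0).const_mul _), ← intervalIntegral.integral_const_mul]
    refine integral_mono_on ht.1 (intervalIntegrable_exp_mul lam (hGN.mono htsub) ht0)
      ((((intervalIntegrable_exp_mul lam hFX ht0).const_mul _).add
      ((intervalIntegrable_exp_mul lam hXX ht0).const_mul _)).const_mul _) fun s hs => ?_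
    have h1 := mul_le_mul_of_nonneg_left (hN s (htsub hs)) (hG0 s)
    have h2 := mul_le_mul_of_nonneg_left h1 (exp_pos (-2 * lam * s)).le
    simp only [hGdef] at h2 ⊢
    linarith
  have e3 : N 0 ^ 2 ≤ d ^ 2 * X 0 ^ 2 := by
    rw [← mul_pow]
    exact pow_le_pow_left₀ (hN0 0) (hN 0 ⟨le_rfl, ht.1.trans ht.2⟩) 2
  rw [e1] at hmain
  have e4 := mul_le_mul_of_nonneg_left e2 hβ0.le
  have e5 := mul_le_mul_of_nonneg_left e3 hβ0.le
  simp only [energyQ]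
  linarith

end Coeffs

section Families

open scoped ENNReal

variable {u : SpaceTime → Vec n}

/-- A regular solution of a system which satisfies the assumptions. -/
structure Coeffs.IsProblem (c : Coeffs n) (Γ : BoundaryCurve) (T : ℝ) (m : ℕ)
    (p α₀ β₀ β₁ K₀ K : ℝ) (u f : SpaceTime → Vec n) (F : Jet (Vec n)) :
    Prop where
  T_pos : 0 < T
  two_lt : 2 < p
  K₀_pos : 0 < K₀
  K₀_le : K₀ ≤ K
  smooth : c.IsSmooth Γ T
  friedrichs : c.IsFriedrichs Γ T α₀ β₀ β₁
  bounded : c.IsBounded Γ T m p K₀ K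
  nonChar : c.IsNonChar Γ T K₀
  ratio : β₀ / α₀ ≤ K₀
  ratio' : β₁ / α₀ ≤ K
  regular : IsRegularUpTo Γ T m u
  jet : IsWJet Γ T m 2 f F
  solves : c.Solves Γ T u f

/-- The bounds, with the constant `C`, on the sources of the derivatives of `u` and on the
derivatives of the coefficients. -/
structure Coeffs.JetBounds (c : Coeffs n) (Γ : BoundaryCurve) (T : ℝ) (m : ℕ) (C K : ℝ)
    (u : SpaceTime → Vec n) (F : Jet (Vec n)) : Prop where
  nonneg : 0 ≤ C
  op : ∀ β : MultiIdx, β.len ≤ m → ∀ᵐ t ∂time[T], eLpNorm (fun x => c.op (pdIter β u) (t, x)) 2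
    vol[Γ] ≤ ofReal (jetNorm Γ.ext m 2 F t + C * K * normW Γ m u t)
  pd_A : ∀ (j : Fin 2) (i : Fin 3), ∀ᵐ t ∂time[T], ∀ᵐ x ∂vol[Γ], ‖pd i (c.A j) (t, x)‖ ≤ C * K

lemma aestronglyMeasurable_slice_cyl {g : SpaceTime → V} (hg : ContinuousOn g (Γ.cyl T))
    (ht : t ∈ Ioo 0 T) : AEStronglyMeasurable (fun x => g (t, x)) vol[Γ] :=
  (hg.comp (f := fun x => (t, x)) (by fun_prop) fun _ hx => ⟨ht, hx⟩).aestronglyMeasurable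
    Γ.measurableSet_ext

namespace Coeffs.IsProblem

lemma contDiff_pdIter (h : c.IsProblem Γ T m p α₀ β₀ β₁ K₀ K u f F) (hβ : k + β.len ≤ m + 1) :
    ContDiff ℝ (k : ℕ) (pdIter β u) :=
  pdIter_contDiff β (h.regular.1.of_le (by exact_mod_cast hβ))

lemma lpNormOn_pdIter_le (hβ : β.len ≤ m) (t : ℝ) :
    lpNormOn Γ.ext 2 (fun x => pdIter β u (t, x)) ≤ normW Γ m u t := by
  have := le_jetNorm Γ.ext two_pos jet[u] hβ t
  unfold normW; exact this

lemma continuousOn_normW (h : c.IsProblem Γ T m p α₀ β₀ β₁ K₀ K u f F) :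
    ContinuousOn (normW Γ m u) (Icc 0 T) := by
  have h1 : ∀ β : MultiIdx, β.len ≤ m → ContInLp Γ.ext T 2 (pdIter β u) := fun β hβ =>
    h.regular.2 β (hβ.trans (le_succ m))
  have := continuousOn_jetNorm (J := fun β => pdIter β u) h1
  unfold normW; exact this

lemma continuousOn_source (h : c.IsProblem Γ T m p α₀ β₀ β₁ K₀ K u f F) :
    ContinuousOn (jetNorm Γ.ext m 2 F) (Icc 0 T) :=
  continuousOn_jetNorm fun β hβ => (h.jet β hβ).2

lemma eLpNorm_pdIter_le (h : c.IsProblem Γ T m p α₀ β₀ β₁ K₀ K u f F) (hβ : β.len ≤ m)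
    (ht : t ∈ Icc 0 T) : eLpNorm (fun x => pdIter β u (t, x)) 2 vol[Γ] ≤
      ofReal (normW Γ m u t) := by
  have h1 := ofReal_lpNormOn ((h.regular.2 β (by omega)) t ht).1
  rw [ofReal_ofNat] at h1
  rw [← h1]
  exact ofReal_le_ofReal (lpNormOn_pdIter_le hβ t)

lemma norm_A_le (h : c.IsProblem Γ T m p α₀ β₀ β₁ K₀ K u f F) (j : Fin 2) :
    ∀ z ∈ Icc 0 T ×ˢ closure Γ.ext, ‖c.A j z‖ ≤ K₀ := by
  have hc := (h.smooth.A_cont j).norm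
  rw [← Coeffs.closure_cyl Γ h.T_pos] at hc ⊢
  exact le_on_closure (fun z hz => h.bounded.A_bound j z hz) hc continuousOn_const

end Coeffs.IsProblem

theorem exists_jetBounds (Γ : BoundaryCurve) (n m : ℕ) (p : ℝ) : ∃ C,
    ∀ {T α₀ β₀ β₁ K₀ K : ℝ} {c : Coeffs n} {u f : SpaceTime → Vec n}
      {F : Jet (Vec n)}, c.IsProblem Γ T m p α₀ β₀ β₁ K₀ K u f F →
      c.JetBounds Γ T m C K u F := by
  by_cases hp : 2 < p
  swap
  · exact ⟨0, fun h => absurd h.two_lt hp⟩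
  obtain ⟨C, hC, h1⟩ := exists_op_bound Γ m hp
  obtain ⟨C', hC', h2⟩ := exists_pd_coeff_bound Γ hp
  refine ⟨C.toReal * (idx m).card + C'.toReal, fun {T α₀ β₀ β₁ K₀ K c u f F} h => ?_⟩
  have hK : 0 ≤ K := h.K₀_pos.le.trans h.K₀_le
  refine ⟨by positivity, fun β hβ => ?_, fun j i => ?_⟩
  · filter_upwards [h1 h.smooth h.bounded h.regular h.jet h.solves β hβ,
      ae_restrict_mem measurableSet_Ioo] with t ht ht'
    have htI := Ioo_subset_Icc_self ht'
    refine ht.trans ?_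
    have hX : 0 ≤ normW Γ m u t := jetNorm_nonneg _ _ _
    have hF := ofReal_lpNormOn ((h.jet β hβ).2 t htI).1
    rw [ofReal_ofNat] at hF
    have h3 : jetSum Γ m jet[u] t ≤ (idx m).card * ofReal (normW Γ m u t) := by
      refine (sum_le_card_nsmul _ _ _ fun β hβ =>
        h.eLpNorm_pdIter_le (mem_idx.1 hβ) htI).trans (le_of_eq (nsmul_eq_mul _ _))
    rw [ofReal_add (jetNorm_nonneg _ _ _) (by positivity), ← hF]
    refine add_le_add (ofReal_le_ofReal (le_jetNorm _ two_pos F hβ t)) ?_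
    calc C * ofReal K * jetSum Γ m jet[u] t
        ≤ ofReal C.toReal * ofReal K * ((idx m).card * ofReal (normW Γ m u t)) := by
          rw [ofReal_toReal hC]; gcongr
      _ = ofReal (C.toReal * K * ((idx m).card * normW Γ m u t)) := by
          rw [ofReal_mul (by positivity), ofReal_mul (by positivity),
            ofReal_mul (by positivity), ENNReal.ofReal_natCast]
      _ ≤ _ := ofReal_le_ofReal (by
          have : 0 ≤ C'.toReal * K * normW Γ m u t := by positivity
          linarith)
  · filter_upwards [h2 h.smooth h.bounded j i] with t ht
    filter_upwards [ht] with x hx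
    rw [← ofReal_toReal hC', ← ofReal_mul (by positivity), ← ofReal_norm] at hx
    refine ((ENNReal.ofReal_le_ofReal_iff (by positivity)).1 hx).trans ?_
    have : 0 ≤ C.toReal * (idx m).card * K := by positivity
    linarith

/-- The combination of the derivatives of `u` with coefficients `g`. -/
noncomputable def combField (m : ℕ) (g : MultiIdx → Plane → ℝ) (u : SpaceTime → Vec n)
    (z : SpaceTime) : Vec n := ∑ β ∈ idx m, g β z.2 • pdIter β u z

namespace Coeffs.IsProblem

variable {g : MultiIdx → Plane → ℝ}

lemma contDiff_combField (h : c.IsProblem Γ T m p α₀ β₀ β₁ K₀ K u f F)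
    (hg : ∀ β, ContDiff ℝ ∞ (g β)) : ContDiff ℝ 1 (combField m g u) :=
  ContDiff.sum fun β hβ => (((hg β).of_le (by simp)).comp contDiff_snd).smul
    (h.contDiff_pdIter (k := 1) (by rw [mem_idx] at hβ; omega))

lemma contInLp_combField (h : c.IsProblem Γ T m p α₀ β₀ β₁ K₀ K u f F)
    (hg : ∀ β, ContDiff ℝ ∞ (g β)) (hM : ∀ β x, |g β x| ≤ M) :
    ContInLp Γ.ext T 2 (combField m g u) :=
  ContInLp.sum fun β hβ => (h.regular.2 β (by rw [mem_idx] at hβ; omega)).smul_bounded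
    Γ.measurableSet_ext (hg β).continuous.aestronglyMeasurable fun x _ => hM β x

lemma lpNormOn_combField_le (h : c.IsProblem Γ T m p α₀ β₀ β₁ K₀ K u f F) (hM0 : 0 ≤ M)
    (hM : ∀ β x, |g β x| ≤ M) (ht : t ∈ Icc 0 T) :
    lpNormOn Γ.ext 2 (fun x => combField m g u (t, x)) ≤ M * (idx m).card * normW Γ m u t := by
  refine (lpNormOn_le_mul_sum (s := idx m) (g := fun β x => pdIter β u (t, x)) Γ.measurableSet_ext hM0
    (fun β hβ => (h.regular.2 β (by rw [mem_idx] at hβ; omega)).memLp_two ht) fun x _ => ?_).trans ?_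
  · rw [combField, mul_sum]
    refine (norm_sum_le _ _).trans (sum_le_sum fun β _ => ?_)
    rw [norm_smul, norm_eq_abs]
    exact mul_le_mul_of_nonneg_right (hM β x) (norm_nonneg _)
  · rw [mul_assoc]
    refine mul_le_mul_of_nonneg_left ?_ hM0
    exact (sum_le_card_nsmul _ _ _ fun β hβ =>
      lpNormOn_pdIter_le (mem_idx.1 hβ) t).trans (le_of_eq (nsmul_eq_mul _ _))

/-- The energy estimate for the combinations of derivatives. -/
theorem energy_combField (h : c.IsProblem Γ T m p α₀ β₀ β₁ K₀ K u f F)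
    (hg : ∀ β, ContDiff ℝ ∞ (g β)) (hM0 : 0 ≤ M) (hM : ∀ β x, |g β x| ≤ M)
    (hM' : ∀ β x j, |fderiv ℝ (g β) x (single j 1)| ≤ M) {C : ℝ}
    (B : c.JetBounds Γ T m C K u F) (hlam : K ≤ lam)
    (ht : t ∈ Icc 0 T) (hτ : τ ∈ Icc 0 t) :
    energyQ lam extNorm[Γ, combField m g u] τ ≤
      2 * K₀ * (1 + 2 * K₀) * (M * (idx m).card) ^ 2 * (normW Γ m u 0 ^ 2 +
        ∫ s in (0)..t, exp (-2 * lam * s) * (jetNorm Γ.ext m 2 F s * normW Γ m u s)) +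
      2 * K * (1 + 2 * K) * (M * (idx m).card) ^ 2 * (C * K + 1) *
        (∫ s in (0)..t, exp (-2 * lam * s) * normW Γ m u s ^ 2) +
      1 / α₀ * ∫ s in (0)..τ, exp (-2 * lam * s) * c.bdryTerm Γ (combField m g u) s := by
  have hK₀ := h.K₀_pos
  have hC := B.nonneg
  have hK : 0 < K := hK₀.trans_le h.K₀_le
  have hα := h.friedrichs.α₀_pos
  have hX0 : ∀ t, 0 ≤ normW Γ m u t := fun t => jetNorm_nonneg _ _ _
  have hF0 : ∀ t, 0 ≤ jetNorm Γ.ext m 2 F t := fun t => jetNorm_nonneg _ _ _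
  set k : ℝ := ((idx m).card : ℝ) with hk
  have hk0 : 0 ≤ k := Nat.cast_nonneg _
  have hw1 := h.contDiff_combField hg
  have hopw : ∀ᵐ t ∂time[T], eLpNorm (fun x => c.op (combField m g u) (t, x)) 2 vol[Γ] ≤
        ofReal (M * (1 + 2 * K₀) * k * jetNorm Γ.ext m 2 F t +
          M * (1 + 2 * K₀) * k * (C * K + 1) * normW Γ m u t) := by
    have hall : ∀ᵐ t ∂time[T], ∀ β ∈ idx m, eLpNorm (fun x => c.op (pdIter β u) (t, x)) 2 vol[Γ] ≤
          ofReal (jetNorm Γ.ext m 2 F t + C * K * normW Γ m u t) :=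
      (ae_ball_iff (Finset.countable_toSet _)).2 fun β hβ => B.op β (mem_idx.1 hβ)
    filter_upwards [hall, ae_restrict_mem measurableSet_Ioo] with t h1 ht
    have hsum := eLpNorm_le_mul_sum (μ := vol[Γ]) (s := idx m)
      (f := fun x => c.op (combField m g u) (t, x))
      (g := fun β x => ‖c.op (pdIter β u) (t, x)‖ + ‖pdIter β u (t, x)‖) (C := M * (1 + 2 * K₀))
      (fun β hβ => ?_) ?_
    · refine hsum.trans ?_
      have h2 : ∀ β ∈ idx m, eLpNorm (fun x => ‖c.op (pdIter β u) (t, x)‖ + ‖pdIter β u (t, x)‖) 2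
          vol[Γ] ≤ ofReal (jetNorm Γ.ext m 2 F t + (C * K + 1) * normW Γ m u t) := fun β hβ => by
        have hβ' := mem_idx.1 hβ
        have hcd : ContDiff ℝ 1 (pdIter β u) := h.contDiff_pdIter (k := 1) (by omega)
        refine (eLpNorm_add_le (aestronglyMeasurable_slice_cyl
          (Coeffs.continuousOn_op h.smooth hcd.contDiffOn) ht).norm
          (aestronglyMeasurable_slice hcd.continuous t _).norm one_le_two).trans ?_
        rw [eLpNorm_norm, eLpNorm_norm]
        refine (add_le_add (h1 β hβ) (h.eLpNorm_pdIter_le hβ' (Ioo_subset_Icc_self ht))).trans ?_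
        rw [← ofReal_add (add_nonneg (hF0 t) (mul_nonneg (by positivity) (hX0 t))) (hX0 t)]
        exact ofReal_le_ofReal (by linarith)
      refine (mul_le_mul_right ((sum_le_card_nsmul _ _ _ h2).trans
        (le_of_eq (nsmul_eq_mul _ _))) _).trans (le_of_eq ?_)
      rw [← ENNReal.ofReal_natCast, ← ofReal_mul (by positivity), ← ofReal_mul (by positivity)]
      congr 1; ring
    · have hβ' := mem_idx.1 hβ
      have hcd : ContDiff ℝ 1 (pdIter β u) := h.contDiff_pdIter (k := 1) (by omega)
      exact (aestronglyMeasurable_slice_cyl (Coeffs.continuousOn_op h.smooth hcd.contDiffOn) ht).norm.add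
        (aestronglyMeasurable_slice hcd.continuous t _).norm
    · refine (ae_restrict_iff' Γ.measurableSet_ext).2 (.of_forall fun x hx => ?_)
      have := norm_op_comb_le (c := c) (a := g) (k := m) (u := u) (w := combField m g u) isOpen_univ
        (fun β x _ => (hg β).differentiable (by simp) x) hM0
        (fun β _ x _ => ⟨hM β x, hM' β x⟩) h.regular.1 (fun z _ => rfl) (z := (t, x)) (mem_univ _)
        (fun j => h.bounded.A_bound j _ ⟨ht, hx⟩)
      refine this.trans (le_of_eq ?_)
      congr 1
      exact sum_congr rfl fun β _ => (norm_of_nonneg (by positivity)).symm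
  have hmain := Coeffs.weighted_energy_estimate h.T_pos h.smooth h.friedrichs h.bounded.A_bound hK₀.le
    ((div_le_iff₀' hα).1 h.ratio') hw1.contDiffOn hw1.continuous.continuousOn
    (h.contInLp_combField hg hM) (by positivity) (by positivity) h.continuousOn_source
    h.continuousOn_normW hF0 hX0 hopw (fun t ht => h.lpNormOn_combField_le hM0 hM ht) hlam
    (hK.le.trans hlam) ht hτ
  have htsub : Icc 0 t ⊆ Icc 0 T := Icc_subset_Icc_right ht.2
  set P := ∫ s in (0)..t, exp (-2 * lam * s) * (jetNorm Γ.ext m 2 F s * normW Γ m u s) with hP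
  set J := ∫ s in (0)..t, exp (-2 * lam * s) * normW Γ m u s ^ 2 with hJ
  have hP0 : 0 ≤ P := intervalIntegral.integral_nonneg ht.1 fun s _ =>
    mul_nonneg (exp_pos _).le (mul_nonneg (hF0 s) (hX0 s))
  have hJ0 : 0 ≤ J := integral_exp_sq_nonneg _ _ ht.1
  set E := energyQ lam extNorm[Γ, combField m g u] τ
  set b := ∫ s in (0)..τ, exp (-2 * lam * s) * c.bdryTerm Γ (combField m g u) s
  set X0 := normW Γ m u 0
  set q := (M * k) ^ 2 with hq
  have hq0 : 0 ≤ q := sq_nonneg _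
  have e1 : (M * k) ^ 2 * X0 ^ 2 + 2 * (M * k) * (M * (1 + 2 * K₀) * k * P +
      M * (1 + 2 * K₀) * k * (C * K + 1) * J) = q * (X0 ^ 2 + 2 * (1 + 2 * K₀) * (P + (C * K + 1) * J)) := by
    rw [hq]; ring
  rw [e1] at hmain
  have e2 : E ≤ β₀ / α₀ * (q * (X0 ^ 2 + 2 * (1 + 2 * K₀) * (P + (C * K + 1) * J))) + 1 / α₀ * b := by
    have : E = (α₀ * E) / α₀ := by field_simp
    rw [this, div_le_iff₀ hα]
    refine hmain.trans (le_of_eq ?_)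
    field_simp
  have e3 : 0 ≤ q * (X0 ^ 2 + 2 * (1 + 2 * K₀) * (P + (C * K + 1) * J)) := by positivity
  have e4 := mul_le_mul_of_nonneg_right h.ratio e3
  have e5 : K₀ * (1 + 2 * K₀) ≤ K * (1 + 2 * K) := by
    have := h.K₀_le
    gcongr
  have e6 := mul_le_mul_of_nonneg_right e5 (by positivity : 0 ≤ 2 * (q * ((C * K + 1) * J)))
  have e7 : 0 ≤ K₀ * (q * X0 ^ 2) := by positivity
  have e8 : 0 ≤ K₀ * K₀ * (q * X0 ^ 2) := by positivity
  linarith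

end Coeffs.IsProblem

end Families

section LowerOrder

open scoped ENNReal

variable {u : SpaceTime → Vec n}

/-- The coefficients of the operator `∂_t`. -/
noncomputable def timeCoeffs (n : ℕ) : Coeffs n where
  A := fun _ _ => 0
  B := fun _ => 0
  S := fun _ => 1

lemma timeCoeffs_isSmooth : (timeCoeffs n).IsSmooth Γ T :=
  ⟨fun _ => contDiffOn_const, fun _ => continuousOn_const, contDiffOn_const, continuousOn_const,
    continuousOn_const⟩

lemma timeCoeffs_isFriedrichs : (timeCoeffs n).IsFriedrichs Γ T 1 1 0 where
  α₀_pos := one_pos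
  β₀_pos := one_pos
  S_symm := fun _ _ => IsSelfAdjoint.one (Mat n)
  SA_symm := fun j z _ => by
    have : (timeCoeffs n).S z ∘L (timeCoeffs n).A j z = 0 := ContinuousLinearMap.comp_zero _
    rw [this]; exact IsSelfAdjoint.zero (Mat n)
  lower := fun z _ v => by simp [timeCoeffs]
  upper := fun z _ v => by simp [timeCoeffs]
  energy := fun z _ v => by simp [timeCoeffs, pd]

/-- The energy estimate for `∂_t`. -/
lemma time_energy_estimate (hT : 0 < T) (hw : ContDiffOn ℝ 1 w (Γ.cyl T))
    (hwc : ContinuousOn w (Icc 0 T ×ˢ closure Γ.ext)) (hwL : ContInLp Γ.ext T 2 w) {G X : ℝ → ℝ}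
    {a b d : ℝ} (ha : 0 ≤ a) (hb : 0 ≤ b) (hG : ContinuousOn G (Icc 0 T))
    (hX : ContinuousOn X (Icc 0 T)) (hG0 : ∀ t, 0 ≤ G t) (hX0 : ∀ t, 0 ≤ X t)
    (hop : ∀ᵐ t ∂time[T], eLpNorm (fun x => pd 0 w (t, x)) 2 vol[Γ] ≤ ofReal (a * G t + b * X t))
    (hN : ∀ t ∈ Icc 0 T, lpNormOn Γ.ext 2 (fun x => w (t, x)) ≤ d * X t) (hl0 : 0 ≤ lam)
    (ht : t ∈ Icc 0 T) (hτ : τ ∈ Icc 0 t) :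
    energyQ lam extNorm[Γ, w] τ ≤ d ^ 2 * X 0 ^ 2 +
        2 * d * (a * (∫ s in (0)..t, exp (-2 * lam * s) * (G s * X s)) +
          b * ∫ s in (0)..t, exp (-2 * lam * s) * X s ^ 2) := by
  have hop' : ∀ z, (timeCoeffs n).op w z = pd 0 w z := fun z => by simp [timeCoeffs, Coeffs.op]
  have := Coeffs.weighted_energy_estimate (K₀ := 0) (K := 0) hT timeCoeffs_isSmooth
    timeCoeffs_isFriedrichs (fun j z _ => by simp [timeCoeffs]) le_rfl (by simp) hw hwc hwL ha hb
    hG hX hG0 hX0 (by simpa only [hop'] using hop) hN hl0 hl0 ht hτ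
  have hb : ∀ s, (timeCoeffs n).bdryTerm Γ w s = 0 := fun s => by
    simp [Coeffs.bdryTerm, Coeffs.Anor, timeCoeffs]
  simpa [hb] using this

namespace Coeffs.IsProblem

variable {C : ℝ} {b : MultiIdx}

lemma energy_pdIter (h : c.IsProblem Γ T m p α₀ β₀ β₁ K₀ K u f F) (hb : b.len < m) (hl0 : 0 ≤ lam)
    (ht : t ∈ Icc 0 T) (hτ : τ ∈ Icc 0 t) :
    energyQ lam extNorm[Γ, pdIter b u] τ ≤ normW Γ m u 0 ^ 2 +
      2 * ∫ s in (0)..t, exp (-2 * lam * s) * normW Γ m u s ^ 2 := by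
  have hcd : ContDiff ℝ 1 (pdIter b u) := h.contDiff_pdIter (k := 1) (by omega)
  have hX0 : ∀ t, 0 ≤ normW Γ m u t := fun t => jetNorm_nonneg _ _ _
  have := time_energy_estimate h.T_pos hcd.contDiffOn hcd.continuous.continuousOn
    (h.regular.2 b (by omega)) (G := fun _ => 0) (a := 0) (b := 1) (d := 1) le_rfl zero_le_one
    continuousOn_const h.continuousOn_normW (fun _ => le_rfl) hX0 ?_
    (fun t _ => by rw [one_mul]; exact lpNormOn_pdIter_le hb.le t) hl0 ht hτ
  · simpa using this
  · filter_upwards [ae_restrict_mem measurableSet_Ioo] with t ht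
    rw [zero_mul, zero_add, one_mul, pd_pdIter 0 b (h.regular.1.of_le (by exact_mod_cast (by omega)))]
    exact h.eLpNorm_pdIter_le (by rw [MultiIdx.len_add, unitIdx_len]; omega) (Ioo_subset_Icc_self ht)

lemma contDiffOn_principal (h : c.IsProblem Γ T m p α₀ β₀ β₁ K₀ K u f F) (hb : b.len < m) :
    ContDiffOn ℝ 1 (c.principal (pdIter b u)) (Γ.cyl T) := by
  have hd : ∀ i, ContDiff ℝ 1 (pd i (pdIter b u)) := fun i =>
    pd_contDiff (k := 1) (h.contDiff_pdIter (k := 2) (by omega)) i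
  have := (((hd 0).contDiffOn (s := Γ.cyl T)).add ((h.smooth.A_diff 0).clm_apply (hd 1).contDiffOn)).add
    ((h.smooth.A_diff 1).clm_apply (hd 2).contDiffOn)
  exact this.congr fun z _ => c.principal_apply _ z

lemma continuousOn_principal (h : c.IsProblem Γ T m p α₀ β₀ β₁ K₀ K u f F) (hb : b.len < m) :
    ContinuousOn (c.principal (pdIter b u)) (Icc 0 T ×ˢ closure Γ.ext) := by
  have hd : ∀ i, Continuous (pd i (pdIter b u)) := fun i =>
    (pd_contDiff (k := 1) (h.contDiff_pdIter (k := 2) (by omega)) i).continuous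
  have := (((hd 0).continuousOn (s := Icc 0 T ×ˢ closure Γ.ext)).add
    ((h.smooth.A_cont 0).clm_apply (hd 1).continuousOn)).add
    ((h.smooth.A_cont 1).clm_apply (hd 2).continuousOn)
  exact this.congr fun z _ => c.principal_apply _ z

lemma contInLp_pd (h : c.IsProblem Γ T m p α₀ β₀ β₁ K₀ K u f F) (hb : b.len < m) (i : Fin 3) :
    ContInLp Γ.ext T 2 (pd i (pdIter b u)) := by
  rw [pd_pdIter i b (h.regular.1.of_le (by exact_mod_cast (by omega)))]
  exact h.regular.2 _ (by rw [MultiIdx.len_add, unitIdx_len]; omega)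

lemma contInLp_principal (h : c.IsProblem Γ T m p α₀ β₀ β₁ K₀ K u f F) (hb : b.len < m) :
    ContInLp Γ.ext T 2 (c.principal (pdIter b u)) := by
  have hsub : Icc 0 T ×ˢ Γ.ext ⊆ Icc 0 T ×ˢ closure Γ.ext := prod_mono le_rfl subset_closure
  have hA : ∀ j i, ContInLp Γ.ext T 2 fun z => c.A j z (pd i (pdIter b u) z) := fun j i =>
    (h.contInLp_pd hb i).clm_apply Γ.measurableSet_ext ((h.smooth.A_cont j).mono hsub)
      fun z hz => h.norm_A_le j z (hsub hz)
  exact (((h.contInLp_pd hb 0).add (hA 0 1)).add (hA 1 2)).congr Γ.measurableSet_ext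
    fun t _ x _ => c.principal_apply _ _

lemma lpNormOn_principal_le (h : c.IsProblem Γ T m p α₀ β₀ β₁ K₀ K u f F) (hb : b.len < m)
    (ht : t ∈ Icc 0 T) :
    lpNormOn Γ.ext 2 (fun x => c.principal (pdIter b u) (t, x)) ≤ 3 * (1 + K₀) * normW Γ m u t := by
  have hK := h.K₀_pos
  refine (lpNormOn_le_mul_sum (s := Finset.univ) (g := fun i x => pd i (pdIter b u) (t, x))
    Γ.measurableSet_ext (C := 1 + K₀) (by positivity)
    (fun i _ => (h.contInLp_pd hb i).memLp_two ht) fun x hx => ?_).trans ?_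
  · have hA : ∀ j (v : Vec n), ‖c.A j (t, x) v‖ ≤ K₀ * ‖v‖ := fun j v =>
      (le_opNorm _ _).trans (by gcongr; exact h.norm_A_le j _ ⟨ht, subset_closure hx⟩)
    rw [c.principal_apply, Fin.sum_univ_three]
    have h1 := norm_add₃_le (a := pd 0 (pdIter b u) (t, x))
      (b := c.A 0 (t, x) (pd 1 (pdIter b u) (t, x))) (c := c.A 1 (t, x) (pd 2 (pdIter b u) (t, x)))
    have h2 := hA 0 (pd 1 (pdIter b u) (t, x))
    have h3 := hA 1 (pd 2 (pdIter b u) (t, x))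
    have h4 := norm_nonneg (pd 0 (pdIter b u) (t, x))
    have h5 := norm_nonneg (pd 1 (pdIter b u) (t, x))
    have h6 := norm_nonneg (pd 2 (pdIter b u) (t, x))
    nlinarith [mul_nonneg hK.le h4]
  · have h1 : ∀ i ∈ (Finset.univ : Finset (Fin 3)),
        lpNormOn Γ.ext 2 (fun x => pd i (pdIter b u) (t, x)) ≤ normW Γ m u t := fun i _ => by
      rw [pd_pdIter i b (h.regular.1.of_le (by exact_mod_cast (by omega)))]
      exact lpNormOn_pdIter_le (by rw [MultiIdx.len_add, unitIdx_len]; omega) t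
    have h2 := mul_le_mul_of_nonneg_left (sum_le_card_nsmul _ _ _ h1) (by positivity : 0 ≤ 1 + K₀)
    rw [nsmul_eq_mul, Finset.card_univ, Fintype.card_fin] at h2
    refine h2.trans (le_of_eq ?_)
    push_cast; ring

lemma pd_zero_principal (h : c.IsProblem Γ T m p α₀ β₀ β₁ K₀ K u f F) (hb : b.len < m)
    (hz : z ∈ Γ.cyl T) : pd 0 (c.principal (pdIter b u)) z = c.op (pdIter (b + unitIdx 0) u) z -
      c.B z (pdIter (b + unitIdx 0) u z) + pd 0 (c.A 0) z (pd 1 (pdIter b u) z) +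
      pd 0 (c.A 1) z (pd 2 (pdIter b u) z) := by
  have h2 : ContDiff ℝ 2 (pdIter b u) := h.contDiff_pdIter (k := 2) (by omega)
  have hd : ∀ i, HasFDerivAt (pd i (pdIter b u)) (fderiv ℝ (pd i (pdIter b u)) z) z := fun i =>
    ((pd_contDiff (k := 1) h2 i).differentiable (by simp) z).hasFDerivAt
  have hA : ∀ j, HasFDerivAt (c.A j) (fderiv ℝ (c.A j) z) z := fun j =>
    (((h.smooth.A_diff j).contDiffAt ((Coeffs.isOpen_cyl Γ T).mem_nhds hz)).differentiableAt
      (by simp)).hasFDerivAt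
  have h1 := (((hd 0).add ((hA 0).clm_apply (hd 1))).add ((hA 1).clm_apply (hd 2))).congr_of_eventuallyEq
    (f₁ := c.principal (pdIter b u)) (.of_forall (c.principal_apply (pdIter b u)))
  have hcomm : ∀ i, fderiv ℝ (pd i (pdIter b u)) z (stDir 0) = pd i (pdIter (b + unitIdx 0) u) z :=
    fun i => by
      rw [← pd_pdIter 0 b (h.regular.1.of_le (by exact_mod_cast (by omega)))]
      exact congrFun (pd_comm h2 0 i) z
  rw [pd, h1.fderiv]
  simp only [_root_.add_apply, comp_apply, ContinuousLinearMap.flip_apply, hcomm, Coeffs.op, pd]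
  abel

lemma eLpNorm_clm_pdIter_le (h : c.IsProblem Γ T m p α₀ β₀ β₁ K₀ K u f F) {R : ℝ} (hR : 0 ≤ R)
    (H : Plane → Mat n) (hβ : β.len ≤ m) (ht : t ∈ Icc 0 T) (hH : ∀ᵐ x ∂vol[Γ], ‖H x‖ ≤ R) :
    eLpNorm (fun x => H x (pdIter β u (t, x))) 2 vol[Γ] ≤ ofReal (R * normW Γ m u t) := by
  rw [ofReal_mul hR]
  refine (eLpNorm_clm_apply_le_of_sup (R := ofReal R) ofReal_ne_top
    (hH.mono fun x hx => ?_)).trans (mul_le_mul_right (h.eLpNorm_pdIter_le hβ ht) _)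
  rw [← ofReal_norm]; exact ofReal_le_ofReal hx

/-- The energy estimate for the principal parts. -/
theorem energy_principal (h : c.IsProblem Γ T m p α₀ β₀ β₁ K₀ K u f F) (hb : b.len < m)
    (B : c.JetBounds Γ T m C K u F)
    (hl0 : 0 ≤ lam) (ht : t ∈ Icc 0 T) (hτ : τ ∈ Icc 0 t) :
    energyQ lam extNorm[Γ, c.principal (pdIter b u)] τ ≤
      (3 * (1 + K₀)) ^ 2 * normW Γ m u 0 ^ 2 + 2 * (3 * (1 + K₀)) *
        (1 * (∫ s in (0)..t, exp (-2 * lam * s) * (jetNorm Γ.ext m 2 F s * normW Γ m u s)) +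
        (3 * C + 1) * K * ∫ s in (0)..t, exp (-2 * lam * s) * normW Γ m u s ^ 2) := by
  have hC := B.nonneg
  have hK : 0 < K := h.K₀_pos.trans_le h.K₀_le
  have hX0 : ∀ t, 0 ≤ normW Γ m u t := fun t => jetNorm_nonneg _ _ _
  have hF0 : ∀ t, 0 ≤ jetNorm Γ.ext m 2 F t := fun t => jetNorm_nonneg _ _ _
  have hl : (b + unitIdx 0).len ≤ m := by rw [MultiIdx.len_add, unitIdx_len]; omega
  have key : ∀ G X : ℝ, 0 ≤ G → 0 ≤ X → ofReal (G + C * K * X) + ofReal (K * X) +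
      ofReal (C * K * X) + ofReal (C * K * X) ≤
        ofReal (1 * G + (3 * C + 1) * K * X) := fun G X hG hX => by
    rw [← ofReal_add (by positivity) (by positivity), ← ofReal_add (by positivity) (by positivity),
      ← ofReal_add (by positivity) (by positivity)]
    exact ofReal_le_ofReal (by linarith)
  refine time_energy_estimate h.T_pos (h.contDiffOn_principal hb) (h.continuousOn_principal hb)
    (h.contInLp_principal hb) zero_le_one (by positivity) h.continuousOn_source
    h.continuousOn_normW hF0 hX0 ?_ (fun t ht => h.lpNormOn_principal_le hb ht) hl0 ht hτ
  filter_upwards [B.op _ hl, B.pd_A 0 0, B.pd_A 1 0, ae_restrict_mem measurableSet_Ioo] with t h1 h2 h3 ht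
  have hae : ∀ᵐ x ∂vol[Γ], x ∈ Γ.ext := ae_restrict_mem Γ.measurableSet_ext
  have htI := Ioo_subset_Icc_self ht
  have hcd : ContDiff ℝ 1 (pdIter (b + unitIdx 0) u) := h.contDiff_pdIter (k := 1) (by omega)
  have hpd : ∀ i, Continuous (pd i (pdIter b u)) := fun i =>
    (pd_contDiff (k := 1) (h.contDiff_pdIter (k := 2) (by omega)) i).continuous
  have m1 := aestronglyMeasurable_slice_cyl (Coeffs.continuousOn_op h.smooth hcd.contDiffOn) ht
  have m2 := aestronglyMeasurable_slice_cyl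
    (h.smooth.B_cont.clm_apply (hcd.continuous.continuousOn (s := Γ.cyl T))) ht
  have m3 : ∀ j i, AEStronglyMeasurable
      (fun x => pd 0 (c.A j) (t, x) (pd i (pdIter b u) (t, x))) vol[Γ] := fun j i =>
    aestronglyMeasurable_slice_cyl ((BoundaryCurve.continuousOn_pd (h.smooth.A_diff j) 0).clm_apply
      ((hpd i).continuousOn (s := Γ.cyl T))) ht
  have hbu : ∀ i, pd i (pdIter b u) = pdIter (b + unitIdx i) u := fun i =>
    pd_pdIter i b (h.regular.1.of_le (by exact_mod_cast (by omega)))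
  have n2 := h.eLpNorm_clm_pdIter_le hK.le (fun x => c.B (t, x)) hl htI (hae.mono fun x hx => h.bounded.B_bound (t, x) ⟨ht, hx⟩)
  have n3 : ∀ j i, (∀ᵐ x ∂vol[Γ], ‖pd 0 (c.A j) (t, x)‖ ≤ C * K) →
      eLpNorm (fun x => pd 0 (c.A j) (t, x) (pd i (pdIter b u) (t, x))) 2 vol[Γ] ≤
        ofReal (C * K * normW Γ m u t) := fun j i hH => by
    rw [hbu i]
    exact h.eLpNorm_clm_pdIter_le (by positivity) (fun x => pd 0 (c.A j) (t, x))
      (by rw [MultiIdx.len_add, unitIdx_len]; omega) htI hH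
  rw [eLpNorm_congr_ae (hae.mono fun x hx => h.pd_zero_principal hb (z := (t, x)) ⟨ht, hx⟩)]
  refine (eLpNorm_add_le ((m1.sub m2).add (m3 0 1)) (m3 1 2) one_le_two).trans
    ((add_le_add ((eLpNorm_add_le (m1.sub m2) (m3 0 1) one_le_two).trans
      (add_le_add ((eLpNorm_sub_le m1 m2 one_le_two).trans (add_le_add h1 n2)) (n3 0 1 h2)))
      (n3 1 2 h3)).trans ?_)
  exact key _ _ (hF0 t) (hX0 t)

end Coeffs.IsProblem

end LowerOrder

section Cutoff

lemma exists_boundary_cutoff (Γ : BoundaryCurve) : ∃ χ : Plane → ℝ, ContDiff ℝ ∞ χ ∧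
    HasCompactSupport χ ∧ tsupport χ ⊆ Γ.tube ∧ (∀ s, χ (Γ.γ s) = 1) ∧ ∀ x, χ x ∈ Icc (0 : ℝ) 1 := by
  obtain ⟨δ, hδ, hsub⟩ := Γ.isCompact_range.exists_cthickening_subset_open Γ.isOpen_tube
    (range_subset_iff.2 Γ.curve_mem_tube)
  obtain ⟨f, h1, h0, hf⟩ := exists_contMDiffMap_one_nhds_of_subset_interior (n := ⊤)
    (modelWithCornersSelf ℝ Plane) Γ.isCompact_range.isClosed
    ((Metric.self_subset_thickening hδ _).trans (Metric.isOpen_thickening.subset_interior_iff.2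
      (Metric.thickening_subset_cthickening δ _)))
  have hts : tsupport f ⊆ cthickening δ (range Γ.γ) :=
    closure_minimal (fun x hx => by_contra fun hn => hx (h0 x hn)) Metric.isClosed_cthickening
  exact ⟨f, f.contMDiff.contDiff, Γ.isCompact_range.cthickening.of_isClosed_subset
    (isClosed_tsupport _) hts, hts.trans hsub, fun s => h1.self_of_nhdsSet _ (mem_range_self s), hf⟩

/-- Smooth functions which are bounded by `M` together with their first derivatives. -/
def IsMultiplier (M : ℝ) (g : Plane → ℝ) : Prop :=
  ContDiff ℝ ∞ g ∧ (∀ x, |g x| ≤ M) ∧ ∀ x (j : Fin 2), |fderiv ℝ g x (single j 1)| ≤ M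

lemma IsMultiplier.mono {M' : ℝ} (h : IsMultiplier M g) (hM : M ≤ M') : IsMultiplier M' g :=
  ⟨h.1, fun x => (h.2.1 x).trans hM, fun x j => (h.2.2 x j).trans hM⟩

lemma IsMultiplier.zero (hM : 0 ≤ M) : IsMultiplier M fun _ => 0 :=
  ⟨contDiff_const, fun x => by simpa using hM, fun x j => by simpa using hM⟩

lemma exists_isMultiplier (hg : ContDiff ℝ ∞ g) (hs : HasCompactSupport g) :
    ∃ M, 0 ≤ M ∧ IsMultiplier M g := by
  obtain ⟨M, hM⟩ := hs.exists_bound_of_continuous hg.continuous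
  obtain ⟨M', hM'⟩ := (hs.fderiv (𝕜 := ℝ)).exists_bound_of_continuous (hg.continuous_fderiv (by simp))
  have h0 := (norm_nonneg _).trans (hM 0)
  have h0' := (norm_nonneg _).trans (hM' 0)
  refine ⟨M + M', by positivity, hg, fun x => (hM x).trans (by linarith), fun x j => ?_⟩
  refine ((fderiv ℝ g x).le_opNorm (single j 1)).trans ?_
  rw [PiLp.norm_single, norm_one, mul_one]
  linarith [hM' x]

/-- A splitting of the derivatives of order at most `m` into fields supported in the tubular
neighborhood, and fields vanishing on the curve. -/
structure BdryLocalization (Γ : BoundaryCurve) (n m : ℕ) where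
  /-- the cutoff function -/
  χ : Plane → ℝ
  /-- the coefficients of the fields vanishing on the curve -/
  G : MultiIdx → MultiIdx → Plane → ℝ
  /-- the coefficients of the tangential fields -/
  H : ℕ × ℕ → MultiIdx → Plane → ℝ
  /-- a bound of the coefficients -/
  M : ℝ
  M_nonneg : 0 ≤ M
  χ_mem : ∀ x, χ x ∈ Icc (0 : ℝ) 1
  χ_curve : ∀ s, χ (Γ.γ s) = 1
  χ_tube : ∀ x, x ∉ Γ.tube → χ x = 0
  G_mult : ∀ b β, IsMultiplier M (G b β)
  H_mult : ∀ α β, IsMultiplier M (H α β)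
  combField_G : ∀ b ∈ idx m, ∀ (u : SpaceTime → Vec n) (z : SpaceTime),
    combField m (G b) u z = (1 - χ z.2) • pdIter b u z
  combField_H : ∀ α ∈ pairsUpTo m, ∀ u : SpaceTime → Vec n, ContDiff ℝ (m : ℕ) u →
    ∀ z : SpaceTime, combField m (H α) u z = χ z.2 • dPar Γ α u z
  norm_dPar_le : ∀ α ∈ pairsUpTo m, ∀ u : SpaceTime → Vec n, ContDiff ℝ (m : ℕ) u →
    ∀ z : SpaceTime, z.2 ∈ Γ.tube →
      ‖dPar Γ α u z‖ ≤ ‖combField m (H α) u z‖ + ∑ b ∈ idx m, M * ‖combField m (G b) u z‖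

theorem BdryLocalization.nonempty (Γ : BoundaryCurve) (n m : ℕ) :
    Nonempty (BdryLocalization Γ n m) := by
  classical
  obtain ⟨χ, hχ, hcs, hts, hχ1, hχ01⟩ := exists_boundary_cutoff Γ
  have hχ0 : ∀ x, x ∉ Γ.tube → χ x = 0 := fun x hx =>
    image_eq_zero_of_notMem_tsupport fun h => hx (hts h)
  choose a ha hrep using fun α : ℕ × ℕ => isComb_dFrame (V := Vec n) Γ (α.1, 0, α.2)
  have hlen : ∀ α ∈ pairsUpTo m, len (α.1, 0, α.2) ≤ m := fun α hα => by
    have := (mem_filter.1 hα).2; simp only [len]; omega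
  have hprod : ∀ α β, ContDiff ℝ ∞ fun x => χ x * a α β x := fun α β =>
    contDiff_iff_contDiffAt.2 fun x => by
      by_cases hx : x ∈ Γ.tube
      · exact hχ.contDiffAt.mul ((ha α β).contDiffAt hx)
      · exact (contDiffAt_const (c := (0 : ℝ))).congr_of_eventuallyEq
          ((notMem_tsupport_iff_eventuallyEq.1 fun h => hx (hts h)).mono fun y hy => by simp [hy])
  obtain ⟨M1, hM1, hm1⟩ := exists_isMultiplier hχ hcs
  choose M2 hM2 hm2 using fun α β => exists_isMultiplier (hprod α β) (hcs.mul_right (f' := a α β))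
  choose M3 hM3 hm3 using fun α => exists_coef_bound (ha α) (idx m)
  set S := ∑ α ∈ pairsUpTo m, (M3 α + ∑ β ∈ idx m, M2 α β) with hS
  have h2 : ∀ α, 0 ≤ ∑ β ∈ idx m, M2 α β := fun α => sum_nonneg fun β _ => hM2 α β
  have hS1 : ∀ α ∈ pairsUpTo m, M3 α + ∑ β ∈ idx m, M2 α β ≤ S := fun α hα =>
    single_le_sum (f := fun α => M3 α + ∑ β ∈ idx m, M2 α β)
      (fun α _ => add_nonneg (hM3 α) (h2 α)) hα
  have hS0 : 0 ≤ S := sum_nonneg fun α _ => add_nonneg (hM3 α) (h2 α)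
  have hM0 : 0 ≤ 1 + M1 + S := by positivity
  set k := fun α : ℕ × ℕ => len (α.1, 0, α.2)
  have hsub : ∀ α ∈ pairsUpTo m, idx (k α) ⊆ idx m := fun α hα β hβ =>
    mem_idx.2 ((mem_idx.1 hβ).trans (hlen α hα))
  have hpar : ∀ α ∈ pairsUpTo m, ∀ u : SpaceTime → Vec n, ContDiff ℝ (m : ℕ) u →
      ∀ z : SpaceTime, z.2 ∈ Γ.tube → dPar Γ α u z = ∑ β ∈ idx (k α), a α β z.2 • pdIter β u z :=
    fun α hα u hu z hz => hrep α u (hu.of_le (by exact_mod_cast hlen α hα)) z hz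
  have hG : ∀ b ∈ idx m, ∀ (u : SpaceTime → Vec n) (z : SpaceTime),
      combField m (fun β => if β = b then fun x => 1 - χ x else fun _ => 0) u z =
        (1 - χ z.2) • pdIter b u z := fun b hb u z => by
    rw [combField, Finset.sum_eq_single_of_mem b hb fun β _ hβ => by simp [hβ]]; simp
  have hH : ∀ α ∈ pairsUpTo m, ∀ u : SpaceTime → Vec n, ContDiff ℝ (m : ℕ) u → ∀ z : SpaceTime,
      combField m (fun β => if α ∈ pairsUpTo m ∧ β ∈ idx (k α) then fun x => χ x * a α β x
        else fun _ => 0) u z = χ z.2 • dPar Γ α u z := fun α hα u hu z => by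
    have e : combField m (fun β => if α ∈ pairsUpTo m ∧ β ∈ idx (k α) then fun x => χ x * a α β x
        else fun _ => 0) u z = χ z.2 • ∑ β ∈ idx (k α), a α β z.2 • pdIter β u z := by
      rw [combField, Finset.smul_sum, ← Finset.sum_subset (hsub α hα) fun β _ hβ => by simp [hβ]]
      exact sum_congr rfl fun β hβ => by simp [hα, hβ, mul_smul]
    rw [e]
    by_cases hz : z.2 ∈ Γ.tube
    · rw [hpar α hα u hu z hz]
    · simp [hχ0 _ hz]
  refine ⟨⟨χ, fun b β => if β = b then fun x => 1 - χ x else fun _ => 0,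
    fun α β => if α ∈ pairsUpTo m ∧ β ∈ idx (k α) then fun x => χ x * a α β x else fun _ => 0,
    1 + M1 + S, hM0, hχ01, hχ1, hχ0, fun b β => ?_, fun α β => ?_, hG, hH, fun α hα u hu z hz => ?_⟩⟩
  · by_cases h : β = b
    · simp only [h, if_true]
      refine ⟨contDiff_const.sub hχ, fun x => ?_, fun x j => ?_⟩
      · rw [abs_le]; constructor <;> linarith [(hχ01 x).1, (hχ01 x).2]
      · rw [fderiv_const_sub, _root_.neg_apply, abs_neg]
        exact (hm1.2.2 x j).trans (by linarith)
    · simp only [h, if_false]; exact IsMultiplier.zero hM0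
  · by_cases h : α ∈ pairsUpTo m ∧ β ∈ idx (k α)
    · simp only [h, and_self, if_true]
      have h3 := single_le_sum (f := M2 α) (fun β _ => hM2 α β) (hsub α h.1 h.2)
      exact (hm2 α β).mono (by linarith [hS1 α h.1, hM3 α])
    · simp only [h, if_false]; exact IsMultiplier.zero hM0
  · rw [hH α hα u hu]
    have e : dPar Γ α u z = χ z.2 • dPar Γ α u z +
        ∑ β ∈ idx (k α), a α β z.2 • ((1 - χ z.2) • pdIter β u z) := by
      rw [hpar α hα u hu z hz, Finset.smul_sum, ← sum_add_distrib]
      refine sum_congr rfl fun β _ => ?_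
      module
    refine (congrArg norm e).le.trans ((norm_add_le _ _).trans (add_le_add_right ?_ _))
    refine (norm_sum_le _ _).trans ((sum_le_sum fun β hβ => ?_).trans
      (Finset.sum_le_sum_of_subset_of_nonneg (hsub α hα) fun _ _ _ => by positivity))
    rw [hG β (hsub α hα hβ), norm_smul]
    refine mul_le_mul_of_nonneg_right (((hm3 α β (hsub α hα hβ) _ hz).1).trans ?_) (norm_nonneg _)
    linarith [hS1 α hα, h2 α]

end Cutoff

section Recovery

variable {u : SpaceTime → Vec n}

/-- The fields which control the derivatives of order at most `m`. -/
noncomputable def BdryLocalization.field (D : BdryLocalization Γ n m) (c : Coeffs n)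
    (u : SpaceTime → Vec n) : (MultiIdx ⊕ ℕ × ℕ) ⊕ (MultiIdx ⊕ MultiIdx) → SpaceTime → Vec n :=
  Sum.elim (Sum.elim (fun b => combField m (D.G b) u) fun α => combField m (D.H α) u)
    (Sum.elim (fun b => c.principal (pdIter b u)) fun b => pdIter b u)

/-- The indices of the controlling fields. -/
noncomputable def fieldIdx (m : ℕ) : Finset ((MultiIdx ⊕ ℕ × ℕ) ⊕ (MultiIdx ⊕ MultiIdx)) :=
  ((idx m).disjSum (pairsUpTo m)).disjSum ((idxLt m).disjSum (idxLt m))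

lemma sum_fieldIdx (m : ℕ) (g : (MultiIdx ⊕ ℕ × ℕ) ⊕ (MultiIdx ⊕ MultiIdx) → ℝ) :
    ∑ i ∈ fieldIdx m, g i = (∑ b ∈ idx m, g (.inl (.inl b)) + ∑ α ∈ pairsUpTo m, g (.inl (.inr α))) +
      ∑ b ∈ idxLt m, (g (.inr (.inl b)) + g (.inr (.inr b))) := by
  simp only [fieldIdx, Finset.sum_disjSum, sum_add_distrib]

namespace Coeffs.IsProblem

lemma contInLp_field (h : c.IsProblem Γ T m p α₀ β₀ β₁ K₀ K u f F) (D : BdryLocalization Γ n m)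
    {i : (MultiIdx ⊕ ℕ × ℕ) ⊕ (MultiIdx ⊕ MultiIdx)} (hi : i ∈ fieldIdx m) :
    ContInLp Γ.ext T 2 (D.field c u i) := by
  rcases i with (b | α) | (b | b)
  · exact h.contInLp_combField (fun β => (D.G_mult b β).1) fun β => (D.G_mult b β).2.1
  · exact h.contInLp_combField (fun β => (D.H_mult α β).1) fun β => (D.H_mult α β).2.1
  all_goals
    simp only [fieldIdx, Finset.inr_mem_disjSum, Finset.inl_mem_disjSum, mem_idxLt] at hi
  · exact h.contInLp_principal hi
  · exact h.regular.2 b (by omega)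

lemma continuousOn_field_norm (h : c.IsProblem Γ T m p α₀ β₀ β₁ K₀ K u f F)
    (D : BdryLocalization Γ n m) {i : (MultiIdx ⊕ ℕ × ℕ) ⊕ (MultiIdx ⊕ MultiIdx)}
    (hi : i ∈ fieldIdx m) :
    ContinuousOn extNorm[Γ, D.field c u i] (Icc 0 T) :=
  (h.contInLp_field D hi).continuousOn_norm (by norm_num)

end Coeffs.IsProblem

theorem exists_normW_le_fields (D : BdryLocalization Γ n m) : ∃ R : ℝ → ℝ, Monotone R ∧
    (∀ r, 0 ≤ R r) ∧ ∀ {T p α₀ β₀ β₁ K₀ K : ℝ} {c : Coeffs n} {u f : SpaceTime → Vec n}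
      {F : Jet (Vec n)}, c.IsProblem Γ T m p α₀ β₀ β₁ K₀ K u f F →
      ∀ τ ∈ Icc 0 T, normW Γ m u τ ≤
        R K₀ * ∑ i ∈ fieldIdx m, lpNormOn Γ.ext 2 fun x => D.field c u i (τ, x) := by
  choose C hC hrec using fun k : ℕ => exists_normal_recovery Γ n m k
  have hR0 : ∀ r : ℝ, 0 ≤ 1 + ∑ j ∈ Finset.range (⌈r⌉₊ + 1), C j := fun r =>
    add_nonneg zero_le_one (sum_nonneg fun j _ => hC j)
  refine ⟨fun r => (idx m).card * (1 + ∑ j ∈ Finset.range (⌈r⌉₊ + 1), C j), fun r s hrs => ?_,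
    fun r => mul_nonneg (Nat.cast_nonneg _) (hR0 r), fun {T p α₀ β₀ β₁ K₀ K c u f F} h => ?_⟩
  · refine mul_le_mul_of_nonneg_left (add_le_add_right (Finset.sum_le_sum_of_subset_of_nonneg
      (Finset.range_mono ?_) fun j _ _ => hC j) _) (Nat.cast_nonneg _)
    have := Nat.ceil_mono hrs
    omega
  set R := 1 + ∑ j ∈ Finset.range (⌈K₀⌉₊ + 1), C j
  have hCR : 1 + C ⌈K₀⌉₊ ≤ R := add_le_add_right (single_le_sum (fun j _ => hC j)
    (Finset.mem_range.2 (Nat.lt_succ_self _))) _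
  have hcu : ContDiff ℝ (m : ℕ) u := h.regular.1.of_le (by exact_mod_cast le_succ m)
  have hpt : ∀ β ∈ idx m, ∀ t ∈ Ioo 0 T, ∀ x ∈ Γ.ext,
      ‖pdIter β u (t, x)‖ ≤ R * ∑ i ∈ fieldIdx m, ‖D.field c u i (t, x)‖ := by
    intro β hβ t ht x hx
    rw [sum_fieldIdx]
    simp only [BdryLocalization.field, Sum.elim_inl, Sum.elim_inr]
    have hχ := D.χ_mem x
    set g1 := ∑ b ∈ idx m, ‖combField m (D.G b) u (t, x)‖
    set g2 := ∑ α ∈ pairsUpTo m, ‖combField m (D.H α) u (t, x)‖ with hg2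
    set g3 := ∑ b ∈ idxLt m, (‖c.principal (pdIter b u) (t, x)‖ + ‖pdIter b u (t, x)‖) with hg3
    have h1 : (1 - D.χ x) * ‖pdIter β u (t, x)‖ ≤ g1 := by
      have := single_le_sum (f := fun b => ‖combField m (D.G b) u (t, x)‖)
        (fun _ _ => norm_nonneg _) hβ
      simp only [D.combField_G β hβ, norm_smul, norm_of_nonneg (sub_nonneg.2 hχ.2)] at this
      exact this
    have h2 : 0 ≤ g2 := sum_nonneg fun _ _ => norm_nonneg _
    have h3 : 0 ≤ g3 := sum_nonneg fun _ _ => by positivity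
    have h4 : D.χ x * ‖pdIter β u (t, x)‖ ≤ C ⌈K₀⌉₊ * (g2 + g3) := by
      by_cases hxt : x ∈ Γ.tube
      · obtain ⟨n1, n2⟩ := h.nonChar (t, x) ⟨ht, hx, hxt⟩
        have := hrec ⌈K₀⌉₊ c u (t, x) hxt
          (fun j => (h.bounded.A_bound j _ ⟨ht, hx⟩).trans (Nat.le_ceil _)) n1
          (n2.trans (Nat.le_ceil _)) h.regular.1 β (mem_idx.1 hβ)
        refine (mul_le_mul_of_nonneg_left this hχ.1).trans ?_
        have e : g2 = D.χ x * ∑ α ∈ pairsUpTo m, ‖dPar Γ α u (t, x)‖ := by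
          rw [hg2, mul_sum]
          refine sum_congr rfl fun α hα => ?_
          rw [D.combField_H α hα u hcu, norm_smul, norm_of_nonneg hχ.1]
        rw [e, controlSum, ← hg3]
        have := mul_le_mul_of_nonneg_left (mul_le_of_le_one_left h3 hχ.2) (hC ⌈K₀⌉₊)
        linarith
      · rw [D.χ_tube x hxt, zero_mul]; exact mul_nonneg (hC _) (add_nonneg h2 h3)
    have h5 : 0 ≤ g1 := sum_nonneg fun _ _ => norm_nonneg _
    have h6 := mul_le_mul_of_nonneg_right hCR (add_nonneg (add_nonneg h5 h2) h3)
    have h7 := mul_nonneg (hC ⌈K₀⌉₊) h5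
    linarith
  have hmain : ∀ τ ∈ Ioo 0 T, normW Γ m u τ ≤ (idx m).card * R *
      ∑ i ∈ fieldIdx m, lpNormOn Γ.ext 2 fun x => D.field c u i (τ, x) := fun τ hτ => by
    refine (jetNorm_le_sum m jet[u] τ).trans ((sum_le_card_nsmul _ _ _
      fun β hβ => lpNormOn_le_mul_sum Γ.measurableSet_ext (hR0 K₀)
        (fun i hi => (h.contInLp_field D hi).memLp_two (Ioo_subset_Icc_self hτ))
        (hpt β hβ τ hτ)).trans (le_of_eq ?_))
    rw [nsmul_eq_mul, mul_assoc]
  have hcl := closure_Ioo h.T_pos.ne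
  have hc1 := h.continuousOn_normW
  have hc2 : ContinuousOn (fun τ => (idx m).card * R *
      ∑ i ∈ fieldIdx m, lpNormOn Γ.ext 2 fun x => D.field c u i (τ, x)) (Icc 0 T) :=
    continuousOn_const.mul (continuousOn_finsetSum _ fun i hi => h.continuousOn_field_norm D hi)
  rw [← hcl] at hc1 hc2 ⊢
  exact fun τ hτ => le_on_closure hmain hc1 hc2 hτ

end Recovery

section Energies

variable {u : SpaceTime → Vec n}

lemma energyQ_nonneg {φ : ℝ → ℝ} (hl : 0 ≤ lam) (hτ : 0 ≤ τ) : 0 ≤ energyQ lam φ τ :=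
  add_nonneg (by positivity) (mul_nonneg hl (integral_exp_sq_nonneg _ _ hτ))

lemma weightedI_le_weightedI {φ ψ : ℝ → ℝ} (ht : 0 ≤ t) (hψ : ContinuousOn ψ (Icc 0 t))
    (h : ∀ τ ∈ Icc 0 t, |φ τ| ≤ ψ τ) : weightedI lam t φ ≤ weightedI lam t ψ := by
  have hsq : ∀ τ ∈ Icc 0 t, φ τ ^ 2 ≤ ψ τ ^ 2 := fun τ hτ =>
    sq_le_sq.2 ((h τ hτ).trans (le_abs_self _))
  unfold weightedI
  refine add_le_add (csSup_le ((nonempty_Icc.2 ht).image _) ?_)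
    (mul_le_mul_of_nonneg_left (Real.sqrt_le_sqrt ?_) (Real.sqrt_nonneg _))
  · rintro _ ⟨τ, hτ, rfl⟩
    refine le_trans ?_ (le_csSup (bddAbove_weight hψ) (mem_image_of_mem _ hτ))
    exact mul_le_mul_of_nonneg_left ((h τ hτ).trans (le_abs_self _)) (exp_pos _).le
  · rw [integral_of_le ht, integral_of_le ht]
    refine integral_mono_of_nonneg (.of_forall fun s => by positivity)
      (intervalIntegrable_exp_mul lam (hψ.pow 2) ⟨ht, le_rfl⟩).1 ?_
    refine (ae_restrict_iff' measurableSet_Ioc).2 (.of_forall fun s hs => ?_)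
    exact mul_le_mul_of_nonneg_left (hsq s (Ioc_subset_Icc_self hs)) (exp_pos _).le

/-- The constant of the energy estimates which depends on `K₀`. -/
def energyConst (a K₀ : ℝ) : ℝ :=
  2 * K₀ * (1 + 2 * K₀) * a ^ 2 + (3 * (1 + K₀)) ^ 2 + 2 * (3 * (1 + K₀))

/-- The constant of the energy estimates which depends on `p` and `K`. -/
def lowerConst (a C K : ℝ) : ℝ :=
  2 * K * (1 + 2 * K) * a ^ 2 * (C * K + 1) + 2 * (3 * (1 + K)) * ((3 * C + 1) * K) + 2

/-- The data and lower order terms of the energy estimates. -/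
noncomputable def energyData (Γ : BoundaryCurve) (m : ℕ) (a b : ℝ) (u : SpaceTime → Vec n)
    (F : Jet (Vec n)) (lam t : ℝ) : ℝ :=
  a * (normW Γ m u 0 ^ 2 +
    ∫ s in (0)..t, exp (-2 * lam * s) * (jetNorm Γ.ext m 2 F s * normW Γ m u s)) +
  b * ∫ s in (0)..t, exp (-2 * lam * s) * normW Γ m u s ^ 2

lemma le_energyData {a b a' b' P J X E : ℝ} (ha : a ≤ a') (hb : b ≤ b') (hP : 0 ≤ P) (hJ : 0 ≤ J)
    (h : E ≤ a * (X ^ 2 + P) + b * J) : E ≤ a' * (X ^ 2 + P) + b' * J :=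
  h.trans (add_le_add (mul_le_mul_of_nonneg_right ha (by positivity))
    (mul_le_mul_of_nonneg_right hb hJ))

namespace Coeffs.IsProblem

/-- The energy estimates for all the controlling fields. -/
theorem energy_field (h : c.IsProblem Γ T m p α₀ β₀ β₁ K₀ K u f F) (D : BdryLocalization Γ n m)
    {C : ℝ} (B : c.JetBounds Γ T m C K u F)
    (hlam : K ≤ lam) (ht : t ∈ Icc 0 T) (hτ : τ ∈ Icc 0 t) :
    let E := energyData Γ m (energyConst (D.M * (idx m).card) K₀)
      (lowerConst (D.M * (idx m).card) C K) u F lam t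
    0 ≤ E ∧ (∀ i ∈ fieldIdx m, (∀ α, i ≠ .inl (.inr α)) →
      energyQ lam extNorm[Γ, D.field c u i] τ ≤ E) ∧
    ∀ α ∈ pairsUpTo m, energyQ lam extNorm[Γ, D.field c u (.inl (.inr α))] τ ≤
        E + 1 / α₀ * ∫ s in (0)..τ, exp (-2 * lam * s) * c.bdryTerm Γ (dPar Γ α u) s := by
  intro E
  have hC := B.nonneg
  have hK₀ := h.K₀_pos
  have hKle := h.K₀_le
  have hK : 0 < K := hK₀.trans_le hKle
  have hl0 := hK.le.trans hlam
  set a := D.M * (idx m).card with ha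
  have hcu : ContDiff ℝ (m : ℕ) u := h.regular.1.of_le (by exact_mod_cast le_succ m)
  have hP : 0 ≤ ∫ s in (0)..t, exp (-2 * lam * s) * (jetNorm Γ.ext m 2 F s * normW Γ m u s) :=
    intervalIntegral.integral_nonneg ht.1 fun s _ => mul_nonneg (exp_pos _).le
      (mul_nonneg (jetNorm_nonneg _ _ _) (jetNorm_nonneg _ _ _))
  have hJ := integral_exp_sq_nonneg lam (normW Γ m u) ht.1
  have hB1 : 2 * K * (1 + 2 * K) * a ^ 2 * (C * K + 1) ≤ lowerConst a C K := by
    have : 0 ≤ 2 * (3 * (1 + K)) * ((3 * C + 1) * K) + 2 := by positivity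
    unfold lowerConst; linarith
  have hB2 : 2 * (3 * (1 + K)) * ((3 * C + 1) * K) + 2 ≤ lowerConst a C K := by
    have : 0 ≤ 2 * K * (1 + 2 * K) * a ^ 2 * (C * K + 1) := by positivity
    unfold lowerConst; linarith
  have hA1 : 2 * K₀ * (1 + 2 * K₀) * a ^ 2 ≤ energyConst a K₀ := by
    have : 0 ≤ (3 * (1 + K₀)) ^ 2 + 2 * (3 * (1 + K₀)) := by positivity
    unfold energyConst; linarith
  have hA2 : (3 * (1 + K₀)) ^ 2 + 2 * (3 * (1 + K₀)) ≤ energyConst a K₀ := by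
    have : 0 ≤ 2 * K₀ * (1 + 2 * K₀) * a ^ 2 := by positivity
    unfold energyConst; linarith
  have hE0 : ∀ {x y z : ℝ}, x ≤ y + z → z ≤ 0 → x ≤ y := fun h1 h2 => by linarith
  have hG : ∀ b ∈ idx m, energyQ lam
      extNorm[Γ, combField m (D.G b) u] τ ≤ E := fun b hb => by
    have hb0 : ∀ s, c.bdryTerm Γ (combField m (D.G b) u) s = 0 := fun s => by
      simp [Coeffs.bdryTerm, D.combField_G b hb, D.χ_curve]
    have := h.energy_combField (fun β => (D.G_mult b β).1) D.M_nonneg (fun β => (D.G_mult b β).2.1)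
      (fun β => (D.G_mult b β).2.2) B hlam ht hτ
    simp only [hb0, mul_zero, intervalIntegral.integral_zero, add_zero] at this
    exact le_energyData hA1 hB1 hP hJ this
  refine ⟨?_, fun i hi hne => ?_, fun α hα => ?_⟩
  · have : 0 ≤ energyConst a K₀ := by unfold energyConst; positivity
    have : 0 ≤ lowerConst a C K := by unfold lowerConst; positivity
    exact add_nonneg (mul_nonneg (by assumption) (add_nonneg (sq_nonneg _) hP)) (mul_nonneg this hJ)
  · rcases i with (b | α) | (b | b) <;> simp only [fieldIdx, Finset.inr_mem_disjSum,
      Finset.inl_mem_disjSum, mem_idxLt] at hi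
    · exact hG b hi
    · exact absurd rfl (hne α)
    · have := h.energy_principal hi B hl0 ht hτ
      refine le_energyData (a := (3 * (1 + K₀)) ^ 2 + 2 * (3 * (1 + K₀)))
        (b := 2 * (3 * (1 + K₀)) * ((3 * C + 1) * K)) hA2 (le_trans ?_ hB2) hP hJ (this.trans ?_)
      · have : 2 * (3 * (1 + K₀)) * ((3 * C + 1) * K) ≤ 2 * (3 * (1 + K)) * ((3 * C + 1) * K) := by
          gcongr
        linarith
      · have h1 := mul_nonneg (sq_nonneg (3 * (1 + K₀))) hP
        have h2 := mul_nonneg (by positivity : 0 ≤ 2 * (3 * (1 + K₀))) (sq_nonneg (normW Γ m u 0))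
        linarith
    · have := h.energy_pdIter hi hl0 ht hτ
      refine le_energyData (a := 1) (b := 2) (le_trans ?_ hA2) (le_trans ?_ hB2) hP hJ
        (this.trans (by linarith))
      · nlinarith
      · have : 0 ≤ 2 * (3 * (1 + K)) * ((3 * C + 1) * K) := by positivity
        linarith
  · have hb0 : ∀ s, c.bdryTerm Γ (combField m (D.H α) u) s = c.bdryTerm Γ (dPar Γ α u) s := fun s => by
      simp [Coeffs.bdryTerm, D.combField_H α hα u hcu, D.χ_curve]
    have := h.energy_combField (fun β => (D.H_mult α β).1) D.M_nonneg (fun β => (D.H_mult α β).2.1)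
      (fun β => (D.H_mult α β).2.2) B hlam ht hτ
    simp only [hb0] at this
    refine this.trans (add_le_add_left (le_energyData hA1 hB1 hP hJ le_rfl) _)

end Coeffs.IsProblem

end Energies

section Absorption

variable {u : SpaceTime → Vec n}

lemma sq_add_sum_le {s : Finset MultiIdx} (M x : ℝ) (y : MultiIdx → ℝ) :
    (x + ∑ b ∈ s, M * y b) ^ 2 ≤
      ∑ i ∈ Finset.insertNone s, (i.elim (3 / 2) fun _ => 3 * M ^ 2 * s.card) *
        (i.elim x y) ^ 2 := by
  rw [Finset.sum_insertNone]
  simp only [Option.elim]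
  have h1 := sq_sum_le_card_mul_sum_sq (s := s) (f := y)
  rw [← mul_sum, ← mul_sum]
  nlinarith [sq_nonneg (x - 2 * (M * ∑ b ∈ s, y b)),
    mul_le_mul_of_nonneg_left h1 (by positivity : 0 ≤ 3 * M ^ 2)]

lemma Coeffs.IsProblem.lpNormOn_tube_le (h : c.IsProblem Γ T m p α₀ β₀ β₁ K₀ K u f F)
    (D : BdryLocalization Γ n m) {α : ℕ × ℕ} (hα : α ∈ pairsUpTo m) (hτ : τ ∈ Icc 0 T) :
    lpNormOn (Γ.ext ∩ Γ.tube) 2 (fun x => dPar Γ α u (τ, x)) ≤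
      lpNormOn Γ.ext 2 (fun x => combField m (D.H α) u (τ, x)) +
        ∑ b ∈ idx m, D.M * lpNormOn Γ.ext 2 fun x => combField m (D.G b) u (τ, x) := by
  have hcu : ContDiff ℝ (m : ℕ) u := h.regular.1.of_le (by exact_mod_cast le_succ m)
  have hH : MemLp (fun x => combField m (D.H α) u (τ, x)) 2 vol[Γ] :=
    (h.contInLp_combField (fun β => (D.H_mult α β).1) fun β => (D.H_mult α β).2.1).memLp_two hτ
  have hG : ∀ b, MemLp (fun x => combField m (D.G b) u (τ, x)) 2 vol[Γ] := fun b =>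
    (h.contInLp_combField (fun β => (D.G_mult b β).1) fun β => (D.G_mult b β).2.1).memLp_two hτ
  have hsub := Measure.restrict_mono_set volume (inter_subset_left : Γ.ext ∩ Γ.tube ⊆ Γ.ext)
  have hmono : ∀ {g : Plane → Vec n}, MemLp g 2 vol[Γ] →
      lpNormOn (Γ.ext ∩ Γ.tube) 2 g ≤ lpNormOn Γ.ext 2 g := fun {g} hg =>
    toReal_mono (memLp_two_iff.2 hg).2.ne (eLpNorm_mono_measure _ hsub)
  let g : Option MultiIdx → Plane → Vec n := fun i x =>
    i.elim (combField m (D.H α) u (τ, x)) fun b => D.M • combField m (D.G b) u (τ, x)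
  have hg : ∀ i, MemLp (g i) 2 vol[Γ] := fun i => by
    rcases i with _ | b
    exacts [hH, (hG b).const_smul D.M]
  have h1 := lpNormOn_le_mul_sum (D := Γ.ext ∩ Γ.tube) (s := Finset.insertNone (idx m))
    (f := fun x => dPar Γ α u (τ, x)) (g := g) (C := 1)
    (Γ.measurableSet_ext.inter Γ.isOpen_tube.measurableSet) zero_le_one
    (fun i _ => (hg i).mono_measure hsub) fun x hx => by
      rw [one_mul, Finset.sum_insertNone]
      simp only [g, Option.elim, norm_smul, norm_of_nonneg D.M_nonneg]
      exact D.norm_dPar_le α hα u hcu (τ, x) hx.2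
  rw [one_mul, Finset.sum_insertNone] at h1
  refine h1.trans (add_le_add (hmono hH) (sum_le_sum fun b _ => (hmono (hg (some b))).trans ?_))
  have := lpNormOn_le_mul_sum (D := Γ.ext) (s := {b}) (f := g (some b))
    (g := fun b x => combField m (D.G b) u (τ, x)) (C := D.M) Γ.measurableSet_ext D.M_nonneg
    (fun b _ => hG b) fun x _ => by
      rw [Finset.sum_singleton]
      exact (norm_smul _ _).le.trans (by rw [norm_of_nonneg D.M_nonneg])
  rwa [Finset.sum_singleton] at this

/-- The energies of the tangential derivatives, when the boundary term is weakly dissipative. -/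
theorem Coeffs.IsProblem.energy_tangential (h : c.IsProblem Γ T m p α₀ β₀ β₁ K₀ K u f F)
    (D : BdryLocalization Γ n m) {lamd : ℝ} {Eb Sd : ℕ × ℕ → ℝ → ℝ → ℝ} {ν : ℕ × ℕ → ℝ → ℝ}
    (W : c.IsWeaklyDissipative Γ T m α₀ lamd Eb Sd ν u) (hlam : lamd ≤ lam) {α : ℕ × ℕ}
    (hα : α ∈ pairsUpTo m) (ht : t ∈ Icc 0 T) {E : ℝ}
    (hG : ∀ b ∈ idx m, ∀ τ ∈ Icc 0 t, energyQ lam extNorm[Γ, combField m (D.G b) u] τ ≤ E)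
    (hH : ∀ τ ∈ Icc 0 t, energyQ lam extNorm[Γ, combField m (D.H α) u] τ ≤
      E + 1 / α₀ * ∫ s in (0)..τ, exp (-2 * lam * s) * c.bdryTerm Γ (dPar Γ α u) s) :
    let S := (1 + 3 / 2 * D.M ^ 2 * (idx m).card ^ 2) * E + 1 / α₀ * Sd α lam t +
      ν α lam⁻¹ * weightedI lam t (normW Γ m u) ^ 2
    (∀ τ ∈ Icc 0 t, energyQ lam extNorm[Γ, combField m (D.H α) u] τ ≤ 4 * S) ∧
    1 / α₀ * Eb α lam t ≤ 4 * S := by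
  intro S
  have hα₀ := h.friedrichs.α₀_pos
  have hlpos := W.lamd_pos.trans_le hlam
  have hsubT : Icc 0 t ⊆ Icc 0 T := Icc_subset_Icc_right ht.2
  set k : ℝ := ((idx m).card : ℝ) with hk
  set φ := fun τ => lpNormOn Γ.ext 2 fun x => combField m (D.H α) u (τ, x) with hφdef
  set ψ := fun b τ => lpNormOn Γ.ext 2 fun x => combField m (D.G b) u (τ, x) with hψdef
  have hφ : ContinuousOn φ (Icc 0 t) := ((h.contInLp_combField (fun β => (D.H_mult α β).1)
    fun β => (D.H_mult α β).2.1).continuousOn_norm (by norm_num)).mono hsubT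
  have hψ : ∀ b, ContinuousOn (ψ b) (Icc 0 t) := fun b => ((h.contInLp_combField
    (fun β => (D.G_mult b β).1) fun β => (D.G_mult b β).2.1).continuousOn_norm (by norm_num)).mono hsubT
  obtain ⟨τ₀, hτ₀, hmax⟩ := exists_energyQ_max lam ht.1 hφ
  set q := energyQ lam φ τ₀ with hq
  have hy : ContinuousOn (fun τ => φ τ + ∑ b ∈ idx m, D.M * ψ b τ) (Icc 0 t) :=
    hφ.add (continuousOn_finsetSum _ fun b _ => continuousOn_const.mul (hψ b))
  have htube : ∀ τ ∈ Icc 0 t, weightedI lam τ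
      (fun τ => lpNormOn (Γ.ext ∩ Γ.tube) 2 fun x => dPar Γ α u (τ, x)) ^ 2 ≤
        4 * (3 / 2 * q + 3 * D.M ^ 2 * k ^ 2 * E) := fun τ hτ => by
    have hsub : Icc 0 τ ⊆ Icc 0 t := Icc_subset_Icc_right hτ.2
    have h1 := weightedI_le_weightedI (lam := lam) (φ := fun τ =>
        lpNormOn (Γ.ext ∩ Γ.tube) 2 fun x => dPar Γ α u (τ, x)) hτ.1 (hy.mono hsub) fun σ hσ => by
      rw [abs_of_nonneg (lpNormOn_nonneg _ _ _)]
      exact h.lpNormOn_tube_le D hα (hsubT (hsub hσ))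
    refine (pow_le_pow_left₀ (weightedI_nonneg _ _ _) h1 2).trans
      (weightedI_sq_le hlpos.le hτ.1 fun σ hσ => ?_)
    have h2 := energyQ_le_sum (s := Finset.insertNone (idx m)) (ψ := fun i => i.elim φ ψ)
      (a := fun i => i.elim (3 / 2) fun _ => 3 * D.M ^ 2 * k) hlpos.le hy
      (fun i _ => by rcases i with _ | b; exacts [hφ, hψ b])
      (fun σ _ => (sq_add_sum_le D.M (φ σ) fun b => ψ b σ).trans (le_of_eq
        (sum_congr rfl fun i _ => by cases i <;> rfl))) (hsub hσ)
    rw [Finset.sum_insertNone] at h2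
    simp only [Option.elim] at h2
    have h3 := sum_le_card_nsmul (idx m) (fun b => 3 * D.M ^ 2 * k * energyQ lam (ψ b) σ)
      (3 * D.M ^ 2 * k * E) fun b hb => mul_le_mul_of_nonneg_left (hG b hb σ (hsub hσ)) (by positivity)
    rw [nsmul_eq_mul, ← hk] at h3
    have h4 := hmax σ (hsub hσ)
    linarith
  have hstep : ∀ τ ∈ Icc 0 t, energyQ lam φ τ + 1 / α₀ * Eb α lam τ ≤ S + 3 / 4 * q := fun τ hτ => by
    have h1 := W.dissip α hα lam hlam τ (hsubT hτ)
    have h2 := W.Sd_mono α hα lam hlam (hsubT hτ) ht hτ.2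
    have h3 := pow_le_pow_left₀ (weightedI_nonneg lam τ (normW Γ m u))
      (weightedI_mono (h.continuousOn_normW.mono hsubT) hτ) 2
    have h4 := mul_le_mul_of_nonneg_left h3
      (mul_nonneg hα₀.le (W.ν_nonneg α hα _ (inv_nonneg.2 hlpos.le)))
    have h5 := mul_le_mul_of_nonneg_left (htube τ hτ) (by positivity : 0 ≤ α₀ / 8)
    have h6 := mul_le_mul_of_nonneg_left ((h1.trans (add_le_add (add_le_add_right h5 _) h4)).trans
      (add_le_add_left (add_le_add_left (add_le_add_right h2 _) _) _)) (by positivity : 0 ≤ 1 / α₀)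
    have h7 := hH τ hτ
    have e : 1 / α₀ * (-Eb α lam τ + Sd α lam t + α₀ / 8 * (4 * (3 / 2 * q + 3 * D.M ^ 2 * k ^ 2 * E)) +
        α₀ * ν α lam⁻¹ * weightedI lam t (normW Γ m u) ^ 2) =
        S - E + 3 / 4 * q - 1 / α₀ * Eb α lam τ := by
      simp only [S]; field_simp; ring
    rw [e] at h6
    linarith
  have hEb : ∀ τ ∈ Icc 0 t, 0 ≤ 1 / α₀ * Eb α lam τ := fun τ hτ =>
    mul_nonneg (by positivity) (W.Eb_nonneg α hα lam hlam τ (hsubT hτ))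
  have hq4 : q ≤ 4 * S := by linarith [hstep τ₀ hτ₀, hEb τ₀ hτ₀]
  have htt : t ∈ Icc 0 t := ⟨ht.1, le_rfl⟩
  refine ⟨fun τ hτ => (hmax τ hτ).trans hq4, ?_⟩
  linarith [hstep t htt, energyQ_nonneg (φ := φ) hlpos.le ht.1]

end Absorption

section Conclusion

variable {u : SpaceTime → Vec n}

/-- The factor by which the data control the sum of the energies of the controlling fields. -/
noncomputable def BdryLocalization.factor (D : BdryLocalization Γ n m) : ℝ :=
  (idx m).card + 2 * (idxLt m).card +
    4 * (1 + 3 / 2 * D.M ^ 2 * (idx m).card ^ 2) * (pairsUpTo m).card + 4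

lemma Coeffs.IsProblem.weightedI_normW_le (h : c.IsProblem Γ T m p α₀ β₀ β₁ K₀ K u f F)
    (D : BdryLocalization Γ n m) {lamd : ℝ} {Eb Sd : ℕ × ℕ → ℝ → ℝ → ℝ} {ν : ℕ × ℕ → ℝ → ℝ}
    (W : c.IsWeaklyDissipative Γ T m α₀ lamd Eb Sd ν u) (hlamd : lamd ≤ lam) {C : ℝ}
    (B : c.JetBounds Γ T m C K u F)
    (hlam : K ≤ lam) (ht : t ∈ Icc 0 T) {R : ℝ}
    (hR : ∀ τ ∈ Icc 0 T, normW Γ m u τ ≤ R * ∑ i ∈ fieldIdx m, lpNormOn Γ.ext 2 fun x => D.field c u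
      i (τ, x)) :
    let Y := energyData Γ m (energyConst (D.M * (idx m).card) K₀)
        (lowerConst (D.M * (idx m).card) C K) u F lam t +
      1 / α₀ * ∑ α ∈ pairsUpTo m, Sd α lam t +
      (∑ α ∈ pairsUpTo m, ν α lam⁻¹) * weightedI lam t (normW Γ m u) ^ 2
    weightedI lam t (normW Γ m u) ^ 2 ≤ (4 * (R ^ 2 * (fieldIdx m).card) + 1) * D.factor * Y ∧
      1 / α₀ * ∑ α ∈ pairsUpTo m, Eb α lam t ≤
        (4 * (R ^ 2 * (fieldIdx m).card) + 1) * D.factor * Y := by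
  intro Y
  have hα₀ := h.friedrichs.α₀_pos
  have hlpos := W.lamd_pos.trans_le hlamd
  have hsubT : Icc 0 t ⊆ Icc 0 T := Icc_subset_Icc_right ht.2
  set E := energyData Γ m (energyConst (D.M * (idx m).card) K₀)
    (lowerConst (D.M * (idx m).card) C K) u F lam t
  set Z := weightedI lam t (normW Γ m u) ^ 2 with hZ
  set s := 1 / α₀ * ∑ α ∈ pairsUpTo m, Sd α lam t with hs
  set r := ∑ α ∈ pairsUpTo m, ν α lam⁻¹ with hr
  have hEn := fun τ (hτ : τ ∈ Icc 0 t) => h.energy_field D B hlam ht hτ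
  have hE0 : 0 ≤ E := (hEn t ⟨ht.1, le_rfl⟩).1
  have hG : ∀ b ∈ idx m, ∀ τ ∈ Icc 0 t, energyQ lam extNorm[Γ, combField m (D.G b) u] τ ≤ E :=
    fun b hb τ hτ => (hEn τ hτ).2.1 (.inl (.inl b)) (by simpa [fieldIdx] using hb) (by simp)
  have htan := fun α hα => h.energy_tangential D W hlamd (α := α) hα ht hG
    fun τ hτ => (hEn τ hτ).2.2 α hα
  have hs0 : 0 ≤ s := mul_nonneg (by positivity)
    (sum_nonneg fun α hα => W.Sd_nonneg α hα lam hlamd t ht)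
  have hr0 : 0 ≤ r := sum_nonneg fun α hα => W.ν_nonneg α hα _ (inv_nonneg.2 hlpos.le)
  have hZ0 : 0 ≤ Z := sq_nonneg _
  have hY0 : 0 ≤ Y := add_nonneg (add_nonneg hE0 hs0) (mul_nonneg hr0 hZ0)
  set q := 1 + 3 / 2 * D.M ^ 2 * ((idx m).card : ℝ) ^ 2 with hq
  have hq0 : 0 ≤ q := by positivity
  have hsum : ∑ α ∈ pairsUpTo m, 4 * (q * E + 1 / α₀ * Sd α lam t + ν α lam⁻¹ * Z) =
      4 * q * (pairsUpTo m).card * E + 4 * s + 4 * (r * Z) := by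
    rw [← mul_sum, sum_add_distrib, sum_add_distrib, Finset.sum_const,
      nsmul_eq_mul, ← mul_sum, ← sum_mul]
    ring
  have hk : (0 : ℝ) ≤ (idx m).card := Nat.cast_nonneg _
  have hl : (0 : ℝ) ≤ (idxLt m).card := Nat.cast_nonneg _
  have hp : 0 ≤ 4 * q * ((pairsUpTo m).card : ℝ) := by positivity
  have hfac : (((idx m).card : ℝ) + 2 * (idxLt m).card + 4 * q * (pairsUpTo m).card) * E +
      4 * s + 4 * (r * Z) ≤ D.factor * Y := by
    have e : D.factor * Y = (((idx m).card : ℝ) + 2 * (idxLt m).card + 4 * q * (pairsUpTo m).card) * E +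
      4 * s + 4 * (r * Z) + (4 * E + (((idx m).card : ℝ) + 2 * (idxLt m).card +
        4 * q * (pairsUpTo m).card) * (s + r * Z)) := by
      simp only [BdryLocalization.factor, Y]; ring
    rw [e]
    have := mul_nonneg hr0 hZ0
    exact le_add_of_nonneg_right (by positivity)
  have htot : ∀ τ ∈ Icc 0 t, ∑ i ∈ fieldIdx m,
      energyQ lam extNorm[Γ, D.field c u i] τ ≤ D.factor * Y := by
    intro τ hτ
    rw [sum_fieldIdx]
    have h1 := sum_le_card_nsmul (idx m) _ E fun b hb => hG b hb τ hτ
    have h2 := (sum_le_sum fun α hα => (htan α hα).1 τ hτ).trans hsum.le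
    have h3 := sum_le_card_nsmul (idxLt m) _ (E + E) fun b hb => add_le_add
      ((hEn τ hτ).2.1 (.inr (.inl b)) (by simpa [fieldIdx] using hb) (by simp))
      ((hEn τ hτ).2.1 (.inr (.inr b)) (by simpa [fieldIdx] using hb) (by simp))
    rw [nsmul_eq_mul] at h1 h3
    refine le_trans (add_le_add (add_le_add h1 h2) h3) (le_trans (le_of_eq ?_) hfac)
    ring
  have hDY : 0 ≤ D.factor * Y := mul_nonneg (by unfold BdryLocalization.factor; positivity) hY0
  refine ⟨(weightedI_sq_le (R := R ^ 2 * (fieldIdx m).card * (D.factor * Y)) hlpos.le ht.1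
    fun τ hτ => ?_).trans (by linarith), ?_⟩
  · refine (energyQ_le_sum (s := fieldIdx m) (a := fun _ => R ^ 2 * (fieldIdx m).card) hlpos.le
      (h.continuousOn_normW.mono hsubT) (fun i hi => (h.continuousOn_field_norm D hi).mono hsubT)
      (fun σ hσ => ?_) hτ).trans ?_
    · refine (pow_le_pow_left₀ (jetNorm_nonneg _ _ _) (hR σ (hsubT hσ)) 2).trans ?_
      rw [mul_pow, ← mul_sum, mul_assoc]
      exact mul_le_mul_of_nonneg_left sq_sum_le_card_mul_sum_sq (sq_nonneg R)
    · rw [← mul_sum]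
      exact mul_le_mul_of_nonneg_left (htot τ hτ) (by positivity)
  · rw [mul_sum]
    refine ((sum_le_sum fun α hα => (htan α hα).2).trans hsum.le).trans
      (le_trans ?_ (hfac.trans ?_))
    · have := mul_nonneg (add_nonneg hk (mul_nonneg zero_le_two hl)) hE0
      linarith
    · have := mul_nonneg (by positivity : 0 ≤ 4 * (R ^ 2 * ((fieldIdx m).card : ℝ))) hDY
      linarith

lemma absorb {Z e x s r σ S I P J A B c : ℝ} (hc : 0 ≤ c) (hx : 0 ≤ x) (hs : 0 ≤ s) (hA : 0 ≤ A)
    (hB : 8 * (c * B) ≤ lam) (hr : c * r ≤ 1 / 8) (hZI : Z = I ^ 2) (hP : P ≤ S * I)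
    (hJ : lam * J ≤ Z) (hJ0 : 0 ≤ J) (hσ : σ = A * (x + P) + B * J) (hZ : Z ≤ c * (σ + s + r * Z))
    (he : e ≤ c * (σ + s + r * Z)) : Z + e ≤ 4 * (c * A + (c * A) ^ 2 + c) * (x + S ^ 2 + s) := by
  have hZ0 : 0 ≤ Z := hZI ▸ sq_nonneg I
  have h1 := mul_le_mul_of_nonneg_right hr hZ0
  have h2 := mul_le_mul_of_nonneg_right hB hJ0
  have h3 := mul_le_mul_of_nonneg_left hP (mul_nonneg hc hA)
  have h4 : c * A * (S * I) ≤ (c * A) ^ 2 * S ^ 2 + Z / 4 := by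
    rw [hZI]; nlinarith [sq_nonneg (c * A * S - I / 2)]
  have h5 : c * (σ + s + r * Z) ≤ c * A * x + (c * A) ^ 2 * S ^ 2 + c * s + Z / 2 := by
    rw [hσ]; linarith
  have h6 : c * A * x + (c * A) ^ 2 * S ^ 2 + c * s ≤
      (c * A + (c * A) ^ 2 + c) * (x + S ^ 2 + s) := by
    have := mul_nonneg (mul_nonneg hc hA) (add_nonneg (sq_nonneg S) hs)
    have := mul_nonneg (sq_nonneg (c * A)) (add_nonneg hx hs)
    have := mul_nonneg hc (add_nonneg hx (sq_nonneg S))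
    linarith
  linarith

lemma exists_forall_mul_inv_le {C : ℝ} {ν : ℝ → ℝ} (hν : ContinuousOn ν (Ici 0)) (h0 : ν 0 = 0) :
    ∃ r, ∀ lam, r ≤ lam → C * ν lam⁻¹ ≤ 1 / 8 := by
  have h1 : Tendsto (fun x => C * ν x) (𝓝[Ici 0] 0) (𝓝 0) := by
    have := ((hν 0 self_mem_Ici).const_mul C).tendsto
    rwa [h0, mul_zero] at this
  have h2 : Tendsto (fun x : ℝ => x⁻¹) atTop (𝓝[Ici 0] 0) :=
    tendsto_nhdsWithin_iff.2 ⟨tendsto_inv_atTop_zero,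
      (eventually_ge_atTop 0).mono fun x hx => inv_nonneg.2 hx⟩
  obtain ⟨r, hr⟩ := eventually_atTop.1 ((h1.comp h2).eventually_le_const
    (by norm_num : (0 : ℝ) < 1 / 8))
  exact ⟨r, hr⟩

end Conclusion

theorem mainTheorem4 (Γ : BoundaryCurve) (n m : ℕ) : ∃ (C : ℝ → ℝ) (lam0 : ℝ → ℝ → (ℝ → ℝ) → ℝ),
      ∀ (p K₀ K T : ℝ), 2 < p → 0 < K₀ → K₀ ≤ K → 0 < T →
      ∀ (c : Coeffs n) (α₀ β₀ β₁ : ℝ), c.IsSmooth Γ T → c.IsFriedrichs Γ T α₀ β₀ β₁ →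
        c.IsBounded Γ T m p K₀ K →
        c.IsNonChar Γ T K₀ →
        β₀ / α₀ ≤ K₀ → β₁ / α₀ ≤ K →
      ∀ (u f : SpaceTime → Vec n) (F : MultiIdx → SpaceTime → Vec n), IsRegularUpTo Γ T m u →
        IsWJet Γ T m 2 f F →
        c.Solves Γ T u f →
      ∀ (lamd : ℝ) (Eb Sd : ℕ × ℕ → ℝ → ℝ → ℝ) (ν : ℕ × ℕ → ℝ → ℝ),
        c.IsWeaklyDissipative Γ T m α₀ lamd Eb Sd ν u →
      ∀ lam : ℝ, lamd ≤ lam → lam0 p K (fun r => ∑ α ∈ pairsUpTo m, ν α r) ≤ lam →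
      ∀ t ∈ Set.Icc 0 T,
        weightedI lam t (normW Γ m u) ^ 2 + 1 / α₀ * ∑ α ∈ pairsUpTo m, Eb α lam t ≤
          C K₀ * (normW Γ m u 0 ^ 2 + dualS lam t (jetNorm Γ.ext m 2 F) ^ 2
            + 1 / α₀ * ∑ α ∈ pairsUpTo m, Sd α lam t) := by
  obtain ⟨D⟩ := BdryLocalization.nonempty Γ n m
  obtain ⟨R, hRm, hR0, hR⟩ := exists_normW_le_fields D
  choose Cp hCp using exists_jetBounds Γ n m
  set a := D.M * (idx m).card
  set C₁ : ℝ → ℝ := fun r => (4 * (R r ^ 2 * (fieldIdx m).card) + 1) * D.factor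
  have hf0 : 0 ≤ D.factor := by unfold BdryLocalization.factor; positivity
  have hC₁0 : ∀ r, 0 ≤ C₁ r := fun r => mul_nonneg (by positivity) hf0
  refine ⟨fun r => 4 * (C₁ r * energyConst a r + (C₁ r * energyConst a r) ^ 2 + C₁ r),
    fun p K ν => max K (max (8 * (C₁ K * lowerConst a (Cp p) K))
      (Classical.epsilon fun r => ∀ lam, r ≤ lam → C₁ K * ν lam⁻¹ ≤ 1 / 8)), ?_⟩
  intro p K₀ K T hp hK₀ hKle hT c α₀ β₀ β₁ hsm hfr hbd hnc hr1 hr2 u f F hreg hjet hsol lamd Eb Sd ν W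
    lam hlamd hlam t ht
  have h : c.IsProblem Γ T m p α₀ β₀ β₁ K₀ K u f F :=
    ⟨hT, hp, hK₀, hKle, hsm, hfr, hbd, hnc, hr1, hr2, hreg, hjet, hsol⟩
  have hK : 0 < K := hK₀.trans_le hKle
  have hlpos := W.lamd_pos.trans_le hlamd
  have hsubT : Icc 0 t ⊆ Icc 0 T := Icc_subset_Icc_right ht.2
  have hl1 := (le_max_left _ _).trans hlam
  have hl2 := ((le_max_left _ _).trans (le_max_right _ _)).trans hlam
  have hl3 := ((le_max_right _ _).trans (le_max_right _ _)).trans hlam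
  have hν := Classical.epsilon_spec (exists_forall_mul_inv_le (C := C₁ K)
    (ν := fun r => ∑ α ∈ pairsUpTo m, ν α r) (continuousOn_finsetSum _ fun α hα => W.ν_cont α hα)
    (Finset.sum_eq_zero fun α hα => W.ν_zero α hα)) lam hl3
  have hC₁m : C₁ K₀ ≤ C₁ K := by
    refine mul_le_mul_of_nonneg_right ?_ hf0
    have := pow_le_pow_left₀ (hR0 K₀) (hRm hKle) 2
    gcongr
  have B := hCp p h
  obtain ⟨hZ, hE⟩ := h.weightedI_normW_le D W hlamd B hl1 ht (hR h)
  have hα₀ := hfr.α₀_pos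
  have hr0 : 0 ≤ ∑ α ∈ pairsUpTo m, ν α lam⁻¹ :=
    sum_nonneg fun α hα => W.ν_nonneg α hα _ (inv_nonneg.2 hlpos.le)
  have hlow : 0 ≤ lowerConst a (Cp p) K := by
    have := B.nonneg
    unfold lowerConst; positivity
  refine absorb (hC₁0 K₀) (sq_nonneg _) (mul_nonneg (by positivity)
    (sum_nonneg fun α hα => W.Sd_nonneg α hα lam hlamd t ht))
    (by unfold energyConst; positivity) ((mul_le_mul_of_nonneg_left
      (mul_le_mul_of_nonneg_right hC₁m hlow) (by norm_num)).trans hl2)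
    ((mul_le_mul_of_nonneg_right hC₁m hr0).trans hν) rfl
    (integral_le_dualS_mul hlpos.le ht.1 (h.continuousOn_source.mono hsubT)
      (h.continuousOn_normW.mono hsubT)) (lam_mul_integral_le hlpos.le ht.1)
    (integral_exp_sq_nonneg lam (normW Γ m u) ht.1) rfl hZ hE
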